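/- Let $-1<q^{1/2}<0$, so $0<q<1$, put $q^{m/2}=(q^{1/2})^m$, $[n]=\frac{q^n-q^{-n}}{q-q^{-1}}$, $c_m=[2m]-(-1)^m[m]$, $(z;p)_\infty=\prod_{m\ge 0}(1-p^mz)$, $i=\sqrt{-1}$. **Fock space.** Let $a_m$ ($m\in\mathbb Z\setminus\{0\}$), $P,Q$ satisfy $[a_m,a_n]=\delta_{m+n,0}\frac{[m]}{m}c_m$, $[P,Q]=1$, $[a_m,P]=[a_m,Q]=0$, and let $V=\bigoplus_{n\in\mathbb Z}\mathbb C[a_{-1},a_{-2},\dots]\,e^{nQ}|\Lambda_1\rangle$, $|\Lambda_1\rangle=e^{Q/2}|0\rangle$, where $a_m|0\rangle=0$ ($m>0$) and $P|0\rangle=0$. Let $\langle\Lambda_1|=\langle0|e^{-Q/2}\in V^*$, where $\langle0|a_{-m}=0$ ($m>0$), $\langle 0|P=0$, $\langle0|0\rangle=1$. **Vertex operators.** Fix $\epsilon(q)$ with $\epsilon(q)^2=q^{1/2}+q^{-1/2}$ and put $$x^-(w)=\epsilon(q)\,e^{-\sum_{m>0}\frac{a_{-m}}{[m]}q^{m/2}w^m}\,e^{\sum_{m>0}\frac{a_m}{[m]}q^{m/2}w^{-m}}\,e^{-Q}w^{-P+1/2},\qquad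 x_0^-=\oint\frac{dw}{2\pi i\,w}x^-(w),$$ $$\Phi_-(z)=\epsilon(q)^{-1}e^{\sum_{m>0}\frac{a_{-m}}{c_m}q^{9m/2}z^m}\,e^{-\sum_{m>0}\frac{a_m}{c_m}q^{-7m/2}z^{-m}}\,e^{Q}(-zq^4)^{P+1/2},$$ $$\Phi_0(z)=\Phi_-(z)x_0^--q\,x_0^-\Phi_-(z),\quad \Phi_+(z)=q^{1/2}\bigl(\Phi_0(z)x_0^--x_0^-\Phi_0(z)\bigr),\quad \Phi_j^*(z)=(-1)^jq^{j/2}\,\Phi_{-j}(-q^{-3}z)$$ for $j\in\{+,0,-\}=\{1,0,-1\}$. These are formal Laurent series in $z$ whose coefficients are operators on $V$. **Transfer matrix.** For $\varepsilon\in\{+,0,-\}=\{1,0,-1\}$ let $$\varphi_\varepsilon(z)=\frac{(q^8z^2;q^{12})_\infty(-q^9z^2;q^{12})_\infty}{(q^{12}z^2;q^{12})_\infty(-q^5z^2;q^{12})_\infty}\cdot\frac{(\varepsilon iq^{9/2}z;q^6)_\infty(-\varepsilon iq^{7/2}z;q^6)_\infty}{(\varepsilon iq^{1/2}z;q^6)_\infty(-\varepsilon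 iq^{3/2}z;q^6)_\infty},$$ $$K_0(z)=\frac{\varphi_0(z)}{\varphi_0(z^{-1})}\,\mathrm{id},\qquad K_\pm(z)=\frac{\varphi_\pm(z)}{\varphi_\pm(z^{-1})}\,\mathrm{diag}\Bigl(z^2,\frac{\pm iq^{3/2}+z}{\pm iq^{3/2}+z^{-1}},1\Bigr)$$ (indices ordered $+,0,-$), and let $$T_\varepsilon(z)=g\sum_{j=\pm,0}\Phi_j^*(z^{-1})K_\varepsilon(z)_j^j\Phi_j(z),\qquad g=\frac1{1+q}\frac{(q^2;q^6)_\infty(-q^3;q^6)_\infty}{(q^6;q^6)_\infty(-q^5;q^6)_\infty}.$$ **Theorem.** For $\varepsilon=+,0,-$ put ${}_\varepsilon\langle B|=\langle\Lambda_1|e^{G(\varepsilon)}\in V^*$, where $$G(\varepsilon)=-\frac12\sum_{m>0}\frac{m\,q^{-2m}}{[m]\,c_m}a_m^2+\sum_{m>0}\Bigl\{-\theta_m\frac{(q^{m/2}-q^{-m/2}-i^m)q^{-m}}{c_m}+\frac{(-\varepsilon i)^mq^{-2m}}{c_m}\Bigr\}a_m-\varepsilon^2Q,$$ with $\theta_m=1$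 for even $m$ and $\theta_m=0$ for odd $m$. Then ${}_\varepsilon\langle B|$ is a well-defined linear functional on $V$ and $${}_\varepsilon\langle B|\,T_\varepsilon(z)={}_\varepsilon\langle B|\qquad(|q^2|<|z|<|q^{-2}|)$$ in the following sense. For every $v\in V$ and $j$, the double series ${}_\varepsilon\langle B|\Phi_j^*(z^{-1})\Phi_j(z)|v\rangle$ over the modes of the two vertex operators converges absolutely for $|q^2|<|z|<|q^{-2}|$ if $\varepsilon=0$, and for $|q^{1/2}|<|z|<|q^{-2}|$ if $\varepsilon=\pm$. Its sum continues to a meromorphic function $M_j$ on $|q^2|<|z|<|q^{-2}|$. Call $z$ regular if neither $z$ nor $z^{-1}$ is a zero of the denominator of $\varphi_\varepsilon$ or, for $\varepsilon=\pm$, of $\varepsilon iq^{3/2}+z$. Then each $M_j$ is holomorphic at every regular point of $|q^2|<|z|<|q^{-2}|$, and at all these points $$g\sum_{j}K_\varepsilon(z)_j^j\,M_j(z)={}_\varepsilon\langle B|v\rangle .$$ -/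

import Mathlib

/-!
Bosonic Fock space, vertex operators and transfer matrix of the half-infinite
Izergin-Korepin model for `U_q(A_2^{(2)})`.  Throughout, `h` stands for `q^{1/2}`,
so that `q = h ^ 2` and `q^{m/2} = h ^ m`.  The three labels `+, 0, -` are the elements
`1, 0, -1` of `SignType`.
-/

noncomputable section

namespace IzerginKorepin

open PowerSeries

/-- The `q`-integer `[n]_q` for `q = h ^ 2`. -/
def qInt (h : ℂ) (n : ℤ) : ℂ :=
  ((h ^ 2) ^ n - (h ^ 2) ^ (-n)) / (h ^ 2 - (h ^ 2)⁻¹)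

/-- `[2m]_q - (-1)^m [m]_q`. -/
def cInt (h : ℂ) (m : ℤ) : ℂ := qInt h (2 * m) - (-1) ^ m * qInt h m

/-- `ε(q) = ([2]_{q^{1/2}})^{1/2}`. -/
def epsQ (h : ℂ) : ℂ := (h + h⁻¹) ^ (1 / 2 : ℂ)

/-- `(z; p)_∞`. -/
def qPoch (z p : ℂ) : ℂ := ∏' m : ℕ, (1 - p ^ m * z)

/-! ### The boundary `K`-matrix -/

def phiDen (h : ℂ) (ε : SignType) (z : ℂ) : ℂ :=
  qPoch ((h ^ 2) ^ 12 * z ^ 2) ((h ^ 2) ^ 12) * qPoch (-(h ^ 2) ^ 5 * z ^ 2) ((h ^ 2) ^ 12) *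
    if ε = 0 then 1 else
      qPoch ((ε : ℂ) * Complex.I * h * z) ((h ^ 2) ^ 6) *
        qPoch (-(ε : ℂ) * Complex.I * h ^ 3 * z) ((h ^ 2) ^ 6)

def phiNum (h : ℂ) (ε : SignType) (z : ℂ) : ℂ :=
  qPoch ((h ^ 2) ^ 8 * z ^ 2) ((h ^ 2) ^ 12) * qPoch (-(h ^ 2) ^ 9 * z ^ 2) ((h ^ 2) ^ 12) *
    if ε = 0 then 1 else
      qPoch ((ε : ℂ) * Complex.I * h ^ 9 * z) ((h ^ 2) ^ 6) *
        qPoch (-(ε : ℂ) * Complex.I * h ^ 7 * z) ((h ^ 2) ^ 6)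

/-- The normalizing function `φ_ε(z)`. -/
def phi (h : ℂ) (ε : SignType) (z : ℂ) : ℂ := phiNum h ε z / phiDen h ε z

/-- The diagonal `K`-matrix `K_ε(z)`. -/
def kMatrix (h : ℂ) (ε : SignType) (z : ℂ) : Matrix SignType SignType ℂ :=
  (phi h ε z / phi h ε z⁻¹) • Matrix.diagonal fun j =>
    if ε = 0 then 1 else
      match j with
      | .pos => z ^ 2
      | .zero => ((ε : ℂ) * Complex.I * h ^ 3 + z) / ((ε : ℂ) * Complex.I * h ^ 3 + z⁻¹)
      | .neg => 1

/-- Neither `z` nor `z⁻¹` is a pole of one of the factors of `K_ε`. -/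
def IsRegularPoint (h : ℂ) (ε : SignType) (z : ℂ) : Prop :=
  z ≠ 0 ∧ phiDen h ε z ≠ 0 ∧ phiDen h ε z⁻¹ ≠ 0 ∧
    (ε ≠ 0 → (ε : ℂ) * Complex.I * h ^ 3 + z ≠ 0 ∧ (ε : ℂ) * Complex.I * h ^ 3 + z⁻¹ ≠ 0)

/-- The constant `g`. -/
def gConst (h : ℂ) : ℂ :=
  1 / (1 + h ^ 2) *
    ((qPoch ((h ^ 2) ^ 2) ((h ^ 2) ^ 6) * qPoch (-(h ^ 2) ^ 3) ((h ^ 2) ^ 6)) /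
      (qPoch ((h ^ 2) ^ 6) ((h ^ 2) ^ 6) * qPoch (-(h ^ 2) ^ 5) ((h ^ 2) ^ 6)))

/-! ### Fock space and bosons -/

/-- The Fock space `V(Λ_1) = ⊕_n ℂ[a_{-1}, a_{-2}, …] e^{nQ} |Λ_1⟩`.  The variable `X m` is
`a_{-m}`, and the summand of index `n` is the eigenspace of `P` for the eigenvalue `n + 1/2`. -/
abbrev FockSpace : Type := ℤ →₀ MvPolynomial ℕ+ ℂ

/-- The boson `a_m` (`m ≠ 0`) on one summand: `a_{-m}` is multiplication by `X m` and `a_m` is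
`([m]_q / m) ([2m]_q - (-1)^m [m]_q) ∂/∂X_m`, for `m > 0`.  By convention `a_0` is zero. -/
def bosonAux (h : ℂ) (m : ℤ) : Module.End ℂ (MvPolynomial ℕ+ ℂ) :=
  if hm : 0 < m then
    (qInt h m / m * cInt h m) •
      (MvPolynomial.pderiv (R := ℂ) (⟨m.toNat, by omega⟩ : ℕ+)).toLinearMap
  else if hm' : m < 0 then
    LinearMap.mulLeft ℂ (MvPolynomial.X (⟨(-m).toNat, by omega⟩ : ℕ+))
  else 0

/-- The boson `a_m` on the Fock space. -/
def boson (h : ℂ) (m : ℤ) : Module.End ℂ FockSpace :=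
  Finsupp.mapRange.linearMap (bosonAux h m)

/-- The operator `e^{nQ}`. -/
def expQ (n : ℤ) : Module.End ℂ FockSpace :=
  Finsupp.lmapDomain (MvPolynomial ℕ+ ℂ) ℂ (fun k => k + n)

/-- The exponential `∑_n f^n / n!` of a formal power series `f` without constant term. -/
def formalExp (f : (Module.End ℂ FockSpace)⟦X⟧) : (Module.End ℂ FockSpace)⟦X⟧ :=
  PowerSeries.mk fun k =>
    ∑ n ∈ Finset.range (k + 1), ((n.factorial : ℂ)⁻¹) • PowerSeries.coeff k (f ^ n)

/-- The coefficient of `z^k` in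
`exp (∑_{m>0} r_m a_{-m} z^m) exp (∑_{m>0} t_m a_m z^{-m})`, applied to `v`
(all but finitely many summands vanish). -/
def normalMode (h : ℂ) (r t : ℕ → ℂ) (k : ℤ) (v : FockSpace) : FockSpace :=
  ∑ᶠ (p : ℕ × ℕ) (_ : (p.1 : ℤ) - p.2 = k),
    PowerSeries.coeff p.1 (formalExp (PowerSeries.mk fun m => r m • boson h (-(m : ℤ))))
      (PowerSeries.coeff p.2 (formalExp (PowerSeries.mk fun m => t m • boson h (m : ℤ))) v)

/-! ### Currents and vertex operators

An operator `A(z)` is given through its modes: the coefficients of the powers of `z`. -/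

/-- The coefficient `x_m^-` of `w^{-m}` in
`x^-(w) = ε(q) e^{R^-(w)} e^{S^-(w)} e^{-Q} w^{-P+1/2}`;
on the summand of index `n` the factor `w^{-P+1/2}` is `w^{-n}`. -/
def xMinus (h : ℂ) (m : ℤ) (v : FockSpace) : FockSpace :=
  v.sum fun n f => epsQ h •
    normalMode h (fun i => -(h ^ i / qInt h i)) (fun i => h ^ i / qInt h i) (-m + n)
      (expQ (-1) (Finsupp.single n f))

/-- The coefficient of `z^k` in
`Φ_-(z) = ε(q)^{-1} e^{P(z)} e^{Q(z)} e^Q (-z q^4)^{P+1/2}`;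
on the summand of index `n` the last factor is `(-z q^4)^{n+1}`. -/
def vertexMinus (h : ℂ) (k : ℤ) (v : FockSpace) : FockSpace :=
  v.sum fun n f => ((epsQ h)⁻¹ * (-(h ^ 2) ^ 4) ^ (n + 1)) •
    normalMode h (fun i => h ^ (9 * i) / cInt h i) (fun i => -((h ^ (7 * i))⁻¹ / cInt h i))
      (k - (n + 1)) (expQ 1 (Finsupp.single n f))

def vertexZero (h : ℂ) (k : ℤ) (v : FockSpace) : FockSpace :=
  vertexMinus h k (xMinus h 0 v) - (h ^ 2) • xMinus h 0 (vertexMinus h k v)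

def vertexPlus (h : ℂ) (k : ℤ) (v : FockSpace) : FockSpace :=
  h • (vertexZero h k (xMinus h 0 v) - xMinus h 0 (vertexZero h k v))

/-- The coefficient of `z^k` in the vertex operator `Φ_j(z)`. -/
def vertex (h : ℂ) (j : SignType) (k : ℤ) (v : FockSpace) : FockSpace :=
  match j with
  | .pos => vertexPlus h k v
  | .zero => vertexZero h k v
  | .neg => vertexMinus h k v

/-- The coefficient of `z^k` in the dual vertex operator
`Φ_j^*(z) = (-1)^j q^{j/2} Φ_{-j}(-q^{-3} z)`. -/
def vertexDual (h : ℂ) (j : SignType) (k : ℤ) (v : FockSpace) : FockSpace :=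
  ((-h) ^ (j : ℤ) * (-((h ^ 2) ^ 3)⁻¹) ^ k) • vertex h (-j) k v

/-! ### The dual ground state -/

/-- The dual highest weight vector `⟨Λ_1|`. -/
def dualHighestWeight (v : FockSpace) : ℂ := MvPolynomial.constantCoeff (v 0)

/-- The coefficient of `a_m` in `G(ε)`. -/
def gLinear (h : ℂ) (ε : SignType) (m : ℕ+) : ℂ :=
  -(if Even (m : ℕ) then
      (h ^ (m : ℕ) - (h ^ (m : ℕ))⁻¹ - Complex.I ^ (m : ℕ)) * ((h ^ 2) ^ (m : ℕ))⁻¹ /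
        cInt h (m : ℕ)
    else 0) +
    (-(ε : ℂ) * Complex.I) ^ (m : ℕ) * ((h ^ 2) ^ (2 * (m : ℕ)))⁻¹ / cInt h (m : ℕ)

/-- The bosonic part `G(ε) + ε² Q` of `G(ε)` (finitely many `m` contribute on each vector). -/
def gBosonic (h : ℂ) (ε : SignType) (v : FockSpace) : FockSpace :=
  ∑ᶠ m : ℕ+,
    ((-(1 / 2) * ((m : ℕ) * ((h ^ 2) ^ (2 * (m : ℕ)))⁻¹ /
        (qInt h (m : ℕ) * cInt h (m : ℕ)))) •
        boson h (m : ℕ) (boson h (m : ℕ) v) +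
      gLinear h ε m • boson h (m : ℕ) v)

/-- `e^{G(ε)}`; the bosonic part is locally nilpotent and commutes with `Q`. -/
def expG (h : ℂ) (ε : SignType) (v : FockSpace) : FockSpace :=
  ∑ᶠ n : ℕ, ((n.factorial : ℂ)⁻¹) • (gBosonic h ε)^[n] (expQ (-(ε : ℤ) ^ 2) v)

/-- The dual ground state `⟨Λ_1| e^{G(ε)}`. -/
def dualGroundState (h : ℂ) (ε : SignType) (v : FockSpace) : ℂ :=
  dualHighestWeight (expG h ε v)

/-! ### Domains of the spectral parameter -/

/-- The annulus `|q^2| < |z| < |q^{-2}|`. -/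
def annulus (h : ℂ) : Set ℂ := {z | ‖(h ^ 2) ^ 2‖ < ‖z‖ ∧ ‖z‖ < ‖((h ^ 2) ^ 2)⁻¹‖}

/-- The part of the annulus on which the mode expansions converge: all of it if `ε = 0`,
and its part `|q^{1/2}| < |z|` if `ε = ±`. -/
def convergenceAnnulus (h : ℂ) (ε : SignType) : Set ℂ :=
  {z ∈ annulus h | ε ≠ 0 → ‖h‖ < ‖z‖}

end IzerginKorepin

end

open IzerginKorepin

/-! Next to the dual ground state every operator is Gaussian. By `dualGroundState_eq` the functional
is the constant term of the exponential of a second order differential operator, applied to the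
component `ε²`; such a functional `gauss a b`, with variances `a` and means `b`, obeys integration
by parts (`gauss_X_mul`). So an exponential of creation operators multiplies it by a scalar
generating function and shifts its mean, while an exponential of annihilation operators only shifts
the mean (`hasSum_gauss_creMode`, `hasSum_gauss_annMode`). In the variables `Z = q³z` for `Φ_-` and
`W = w/q` for `x^-` the shifts have the form `D_m (Z^m + Z⁻ᵐ)`: the quadratic part of `G(ε)` turns
annihilation at `Z` into creation at `1/Z`, and all remaining `v`-dependence is invariant under
inversion of each variable.

The linear part of `G(ε)` makes the contraction of `Φ_-` with the boundary equal to `φ_ε(-Z)` and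
that of `x^-` a polynomial (`gaussGen_phi`, `gaussGen_x`). Each coefficient of the product of the
two vertex operators thus becomes a fourfold contour integral over `Z₁`, `Z₂`, `W₁`, `W₂`
(`dualGroundState_vertex`), and the mode expansion at `Z₁ = -1/z`, `Z₂ = q³z` sums to a double
integral over `W₁`, `W₂` (`hasSum_twoPoint`).

Reflection: for `|Z₁| = 1` the contours in `W` can be moved to the unit circle where needed, and the
integrand symmetrized under `W → 1/W` and, for the component `-` with `ε ≠ 0`, under exchange of the
two variables. Rational identities then show that the two-point function, divided by an explicit
factor `poleFactor` in `Z₁`, is multiplied by a monomial when `Z₁` is replaced by `1/Z₁`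
(`coreFun_inv`). On Laurent coefficients this is the symmetry `c (s - k) l = c k l`, so the quotient
converges on the whole annulus, and all singularities of the matrix element come from `poleFactor`
(`exists_quotient`). The diagonal entries of `K_ε(z)` are exactly what undoes this reflection
(`kMatrix_mul_poleFactor`): they replace `Φ_j^*(1/z)` by `Φ_j^*(z)` next to the ground state.

Inversion: what remains is `g ∑ Φ_j^*(z) Φ_j(z) = 1` in matrix elements with the ground state, that
is the case `Z₂ = -q³ Z₁` with `|Z₁| = 1` (`sum_twoPoint`). Moving all `W`-contours to the unit
circle, the torus integrals cancel after symmetrization (`pKer_mul_xKer_symm`), the single residues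
at `W = -q² Z₁` cancel (`residue_cancel`), and one double residue at `W₁ = -q² Z₁`, `W₂ = q Z₁`
survives. There the four mean shifts add up to zero (`shifted_residue`), so the residue is a
multiple of the ground state's value at `v`; the multiple is `1` by two infinite product identities
(`kappa_one_mul_kappa`, `phi_mul_phi`). The identity theorem extends this from the unit circle to
the annulus (`sum_poleFactor_mul`). -/

noncomputable section
set_option linter.unusedSectionVars false

namespace IzerginKorepin
open PowerSeries

/-! ### Formal exponentials -/

section FormalExponential

variable {A B : Type*} [Ring A] [Algebra ℂ A] [Ring B] [Algebra ℂ B]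

/-- The exponential of a power series without constant term. -/
def pexp (f : A⟦X⟧) : A⟦X⟧ :=
  PowerSeries.mk fun k =>
    ∑ n ∈ Finset.range (k + 1), ((n.factorial : ℂ)⁻¹) • PowerSeries.coeff k (f ^ n)

theorem coeff_pow_eq_zero_of_lt {A : Type*} [Ring A] {f : A⟦X⟧} (hf : coeff 0 f = 0) :
    ∀ {n k : ℕ}, k < n → coeff k (f ^ n) = 0 := by
  intro n
  induction n with
  | zero => intro k hk; omega
  | succ n ih =>
    intro k hk
    rw [pow_succ, coeff_mul]
    refine Finset.sum_eq_zero fun p hp => ?_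
    rw [Finset.HasAntidiagonal.mem_antidiagonal] at hp
    rcases Nat.eq_zero_or_pos p.2 with h | h
    · rw [h, hf, mul_zero]
    · rw [ih (by omega), zero_mul]

/-- Powers above the degree do not contribute, so the sum may be truncated at any larger index; this
freedom is what lets two coefficients of different degree be compared term by term. -/
theorem coeff_pexp {f : A⟦X⟧} (hf : coeff 0 f = 0) {k N : ℕ} (hN : k < N) :
    coeff k (pexp f) = ∑ n ∈ Finset.range N, ((n.factorial : ℂ)⁻¹) • coeff k (f ^ n) := by
  rw [pexp, coeff_mk]
  refine Finset.sum_subset (fun x hx => ?_) fun x _ hx => ?_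
  · rw [Finset.mem_range] at *; omega
  · rw [coeff_pow_eq_zero_of_lt hf (by simp at hx; omega), smul_zero]

theorem pexp_map (φ : A →ₐ[ℂ] B) (f : A⟦X⟧) :
    pexp (PowerSeries.map (φ : A →+* B) f) = PowerSeries.map (φ : A →+* B) (pexp f) := by
  ext k
  simp [pexp, ← map_pow]

/-- The map `[y, ·]` is a derivation, and its value `τ` at `f` commutes with `f`. -/
theorem mul_pow_of_mul_eq {R : Type*} [Ring R] {y f τ : R} (h : y * f = f * y + τ)
    (hτ : τ * f = f * τ) (n : ℕ) : y * f ^ n = f ^ n * y + n * (τ * f ^ (n - 1)) := by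
  induction n with
  | zero => simp
  | succ n ih =>
    have hc : τ * f ^ n = f ^ n * τ := (Commute.pow_right hτ n).eq
    rw [pow_succ, ← mul_assoc, ih, add_mul, mul_assoc, h, Nat.add_sub_cancel]
    rcases n with _ | n
    · simp [mul_add]
    · rw [Nat.add_sub_cancel, mul_assoc ((n + 1 : ℕ) : R), mul_assoc τ, ← pow_succ, mul_add, hc,
        Nat.cast_succ (n + 1), add_mul ((n + 1 : ℕ) : R), one_mul, mul_assoc]
      abel

/-- If `[y, f] = c X^m` is central then `[y, exp f] = c X^m exp f`. With `c = 0` the same lemma says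
that commuting operators stay commuting. -/
theorem mul_coeff_pexp {f : A⟦X⟧} (hf : coeff 0 f = 0) {y : A} {m : ℕ} (hm : 0 < m) {c : ℂ}
    (h : ∀ j, y * coeff j f = coeff j f * y + if j = m then algebraMap ℂ A c else 0) (p : ℕ) :
    y * coeff p (pexp f) =
      coeff p (pexp f) * y + if m ≤ p then c • coeff (p - m) (pexp f) else 0 := by
  have h1 : C y * f = f * C y + C (algebraMap ℂ A c) * X ^ m := by
    ext j
    rw [map_add, coeff_C_mul, coeff_mul_C, coeff_C_mul, coeff_X_pow, h j]
    simp
  have h2 : C (algebraMap ℂ A c) * X ^ m * f = f * (C (algebraMap ℂ A c) * X ^ m) := by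
    have e1 : C (algebraMap ℂ A c) * f = f * C (algebraMap ℂ A c) := by
      ext j; rw [coeff_C_mul, coeff_mul_C, Algebra.commutes]
    rw [mul_assoc, X_pow_mul, ← mul_assoc, e1, mul_assoc]
  have h3 : ∀ n : ℕ, y * coeff p (f ^ n) = coeff p (f ^ n) * y +
      (n : ℂ) • if m ≤ p then c • coeff (p - m) (f ^ (n - 1)) else 0 := by
    intro n
    have := congrArg (coeff p) (mul_pow_of_mul_eq h1 h2 n)
    rw [coeff_C_mul, map_add, coeff_mul_C] at this
    rw [this]
    congr 1
    have e : (n : A⟦X⟧) = C (n : A) := by simp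
    rw [e, coeff_C_mul, mul_assoc, coeff_C_mul, coeff_X_pow_mul']
    split_ifs
    · rw [← Algebra.smul_def, ← nsmul_eq_mul, Nat.cast_smul_eq_nsmul]
    · simp
  rw [coeff_pexp hf (Nat.lt_add_one p), Finset.mul_sum, Finset.sum_mul]
  simp_rw [mul_smul_comm, smul_mul_assoc, h3, smul_add]
  rw [Finset.sum_add_distrib]
  congr 1
  rw [Finset.sum_range_succ']
  simp only [Nat.cast_zero, zero_smul, smul_zero, add_zero, Nat.add_sub_cancel]
  split_ifs with hmp
  · rw [coeff_pexp hf (show p - m < p by omega), Finset.smul_sum]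
    refine Finset.sum_congr rfl fun n _ => ?_
    rw [smul_smul, smul_smul, smul_smul, Nat.factorial_succ]
    congr 1
    push_cast
    have : (n.factorial : ℂ) ≠ 0 := by exact_mod_cast n.factorial_ne_zero
    have : (n : ℂ) + 1 ≠ 0 := by exact_mod_cast n.succ_ne_zero
    field_simp
  · simp

theorem coeff_zero_pexp (f : A⟦X⟧) : coeff 0 (pexp f) = 1 := by simp [pexp]

/-- The differential equation `(exp f)' = f' exp f`, read coefficient by coefficient. -/
theorem succ_mul_coeff_pexp {R : Type*} [CommRing R] [Algebra ℂ R] {f : R⟦X⟧}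
    (hf : coeff 0 f = 0) (p : ℕ) :
    ((p : R) + 1) * coeff (p + 1) (pexp f) =
      ∑ x ∈ Finset.HasAntidiagonal.antidiagonal p, ((x.1 : R) + 1) * coeff (x.1 + 1) f * coeff x.2 (pexp f) := by
  have key : ∀ n : ℕ, ((p : R) + 1) * coeff (p + 1) (f ^ n) =
      (n : ℂ) • coeff p (PowerSeries.derivative R f * f ^ (n - 1)) := by
    intro n
    have h := Derivation.leibniz_pow (PowerSeries.derivative R) f n
    have := congrArg (coeff p) h
    rw [PowerSeries.coeff_derivative] at this
    rw [mul_comm, this, smul_eq_mul, mul_comm (f ^ (n - 1)), map_nsmul, Nat.cast_smul_eq_nsmul]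
  rw [coeff_pexp hf (Nat.lt_add_one (p + 1)), Finset.mul_sum]
  simp_rw [mul_smul_comm, key]
  rw [Finset.sum_range_succ']
  simp only [Nat.cast_zero, zero_smul, smul_zero, add_zero, Nat.add_sub_cancel]
  have : ∀ x ∈ Finset.HasAntidiagonal.antidiagonal p,
      ((x.1 : R) + 1) * coeff (x.1 + 1) f * coeff x.2 (pexp f) =
      ∑ n ∈ Finset.range (p + 1), ((n.factorial : ℂ)⁻¹) •
        (coeff x.1 (PowerSeries.derivative R f) * coeff x.2 (f ^ n)) := by
    intro x hx
    rw [Finset.HasAntidiagonal.mem_antidiagonal] at hx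
    rw [coeff_pexp hf (show x.2 < p + 1 by omega), Finset.mul_sum]
    refine Finset.sum_congr rfl fun n _ => ?_
    rw [mul_smul_comm, PowerSeries.coeff_derivative, mul_comm (coeff (x.1 + 1) f)]
  rw [Finset.sum_congr rfl this, Finset.sum_comm]
  refine Finset.sum_congr rfl fun n _ => ?_
  rw [coeff_mul, ← Finset.smul_sum, smul_smul, Nat.factorial_succ]
  congr 1
  push_cast
  have : (n.factorial : ℂ) ≠ 0 := by exact_mod_cast n.factorial_ne_zero
  have : (n : ℂ) + 1 ≠ 0 := by exact_mod_cast n.succ_ne_zero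
  field_simp

/-- The recursion determines the exponential. -/
theorem eq_coeff_pexp_of_succ_mul {f : ℂ⟦X⟧} (hf : coeff 0 f = 0) {u : ℕ → ℂ} (h0 : u 0 = 1)
    (h : ∀ p : ℕ, ((p : ℂ) + 1) * u (p + 1) =
      ∑ x ∈ Finset.HasAntidiagonal.antidiagonal p, ((x.1 : ℂ) + 1) * coeff (x.1 + 1) f * u x.2) (p : ℕ) :
    u p = coeff p (pexp f) := by
  induction p using Nat.strong_induction_on with
  | _ p ih =>
    rcases p with _ | p
    · rw [h0, coeff_zero_pexp]
    · have hp : (p : ℂ) + 1 ≠ 0 := by exact_mod_cast p.succ_ne_zero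
      apply mul_left_cancel₀ hp
      rw [h p, succ_mul_coeff_pexp hf]
      refine Finset.sum_congr rfl fun x hx => ?_
      rw [Finset.HasAntidiagonal.mem_antidiagonal] at hx
      rw [ih x.2 (by omega)]

end FormalExponential

/-! ### Convergence of the exponential of a scalar power series. -/

theorem summable_norm_coeff_pow {f : ℂ⟦X⟧} {ζ : ℂ} (hs : Summable fun j => ‖coeff j f * ζ ^ j‖)
    (n : ℕ) : Summable (fun p => ‖coeff p (f ^ n) * ζ ^ p‖) ∧
      ∑' p, ‖coeff p (f ^ n) * ζ ^ p‖ ≤ (∑' j, ‖coeff j f * ζ ^ j‖) ^ n ∧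
      ∑' p, coeff p (f ^ n) * ζ ^ p = (∑' j, coeff j f * ζ ^ j) ^ n := by
  induction n with
  | zero =>
    have : ∀ p, coeff p ((f ^ 0 : ℂ⟦X⟧)) * ζ ^ p = if p = 0 then 1 else 0 := by
      intro p; rw [pow_zero, coeff_one]; split_ifs with h <;> simp [h]
    simp only [this]
    refine ⟨summable_of_ne_finset_zero (s := {0}) fun b hb => by simp_all, ?_, by simp⟩
    rw [tsum_eq_single 0 (by simp_all)]; simp
  | succ n ih =>
    obtain ⟨h1, h2, h3⟩ := ih
    have e : ∀ p, coeff p (f ^ (n + 1)) * ζ ^ p =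
        ∑ x ∈ Finset.HasAntidiagonal.antidiagonal p, (coeff x.1 (f ^ n) * ζ ^ x.1) * (coeff x.2 f * ζ ^ x.2) := by
      intro p
      rw [pow_succ, coeff_mul, Finset.sum_mul]
      refine Finset.sum_congr rfl fun x hx => ?_
      rw [Finset.HasAntidiagonal.mem_antidiagonal] at hx
      rw [← hx, pow_add]; ring
    simp only [e]
    have hsum := summable_norm_sum_mul_antidiagonal_of_summable_norm h1 hs
    refine ⟨hsum, ?_, ?_⟩
    · have h1' : Summable fun p => ‖‖coeff p (f ^ n) * ζ ^ p‖‖ := by simpa using h1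
      have hs' : Summable fun j => ‖‖coeff j f * ζ ^ j‖‖ := by simpa using hs
      have := tsum_mul_tsum_eq_tsum_sum_antidiagonal_of_summable_norm h1' hs'
      rw [pow_succ]
      refine le_trans ?_ (mul_le_mul_of_nonneg_right h2 (tsum_nonneg fun _ => norm_nonneg _))
      rw [this]
      refine hsum.tsum_le_tsum (fun p => ?_) ?_
      · refine (norm_sum_le _ _).trans (Finset.sum_le_sum fun x _ => (norm_mul_le _ _))
      · exact (summable_norm_sum_mul_antidiagonal_of_summable_norm h1' hs').of_norm
    · rw [pow_succ, ← h3, tsum_mul_tsum_eq_tsum_sum_antidiagonal_of_summable_norm h1 hs]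

/-- The double series of `coeff p (f ^ n) ζ^p / n!` is dominated by the exponential series of `∑
‖f_j ζ^j‖`, so it may be summed over `p` first, giving the analytic exponential, or over `n` first,
giving the formal one. -/
theorem hasSum_coeff_pexp {f : ℂ⟦X⟧} (hf : coeff 0 f = 0) {ζ : ℂ}
    (hs : Summable fun j => ‖coeff j f * ζ ^ j‖) :
    HasSum (fun p => coeff p (pexp f) * ζ ^ p) (Complex.exp (∑' j, coeff j f * ζ ^ j)) := by
  set G := ∑' j, ‖coeff j f * ζ ^ j‖
  set c : ℕ × ℕ → ℂ := fun x => (x.1.factorial : ℂ)⁻¹ * (coeff x.2 (f ^ x.1) * ζ ^ x.2) with hc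
  have hsum : Summable c := by
    apply Summable.of_norm
    rw [summable_prod_of_nonneg (fun _ => norm_nonneg _)]
    constructor
    · intro n
      exact ((summable_norm_coeff_pow hs n).1.mul_left ‖((n.factorial : ℂ)⁻¹)‖).congr
        fun p => (norm_mul _ _).symm
    · refine Summable.of_nonneg_of_le (fun n => tsum_nonneg fun _ => norm_nonneg _) (fun n => ?_)
        (Real.summable_pow_div_factorial G)
      have e : (fun p => ‖c (n, p)‖) =
          fun p => ‖((n.factorial : ℂ)⁻¹)‖ * ‖coeff p (f ^ n) * ζ ^ p‖ :=
        funext fun p => norm_mul _ _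
      rw [e, tsum_mul_left, norm_inv, Complex.norm_natCast, mul_comm, div_eq_mul_inv]
      exact mul_le_mul_of_nonneg_right (summable_norm_coeff_pow hs n).2.1 (by positivity)
  have hn : ∀ n, HasSum (fun p => c (n, p)) ((n.factorial : ℂ)⁻¹ * (∑' j, coeff j f * ζ ^ j) ^ n) := by
    intro n
    obtain ⟨h1, -, h3⟩ := summable_norm_coeff_pow hs n
    have h4 : HasSum (fun p => coeff p (f ^ n) * ζ ^ p) ((∑' j, coeff j f * ζ ^ j) ^ n) := by
      rw [← h3]; exact h1.of_norm.hasSum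
    exact h4.mul_left ((n.factorial : ℂ)⁻¹)
  have htot : HasSum c (Complex.exp (∑' j, coeff j f * ζ ^ j)) := by
    have h1 := hsum.hasSum
    have h2 := h1.prod_fiberwise hn
    have h3 := NormedSpace.expSeries_div_hasSum_exp (∑' j, coeff j f * ζ ^ j)
    rw [← Complex.exp_eq_exp_ℂ] at h3
    have h4 := h3.unique (h2.congr_fun fun n => div_eq_inv_mul _ _)
    rw [h4]; exact h1
  have hswap := (Equiv.prodComm ℕ ℕ).hasSum_iff.mpr htot
  refine hswap.prod_fiberwise fun p => ?_
  have : coeff p (pexp f) * ζ ^ p = ∑ n ∈ Finset.range (p + 1), c (n, p) := by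
    rw [coeff_pexp hf (Nat.lt_add_one p), Finset.sum_mul]
    refine Finset.sum_congr rfl fun n _ => ?_
    simp only [hc, smul_eq_mul]; ring
  rw [this]
  refine hasSum_sum_of_ne_finset_zero fun n hn => ?_
  simp only [Function.comp, Equiv.prodComm_apply, Prod.swap, hc]
  rw [coeff_pow_eq_zero_of_lt hf (by simp at hn; omega)]; simp

end IzerginKorepin

namespace IzerginKorepin
open PowerSeries

/-! ### Gaussian functionals on the polynomial ring -/

abbrev Poly : Type := MvPolynomial ℕ+ ℂ

/-- The second order operator `∑_m (a_m ∂_m² / 2 + b_m ∂_m)`. -/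
def gaussOp (a b : ℕ → ℂ) : Poly →ₗ[ℂ] Poly where
  toFun f := ∑ᶠ m : ℕ+, ((1 / 2 * a m) • MvPolynomial.pderiv m (MvPolynomial.pderiv m f) +
    b m • MvPolynomial.pderiv m f)
  map_add' f g := by
    have hfin : ∀ f : Poly, (Function.support fun m : ℕ+ =>
        ((1 / 2 * a m) • MvPolynomial.pderiv m (MvPolynomial.pderiv m f) +
          b m • MvPolynomial.pderiv m f)).Finite := fun f =>
      f.vars.finite_toSet.subset fun m hm => by
        by_contra h
        apply hm
        simp only [Finset.mem_coe] at h
        simp [MvPolynomial.pderiv_eq_zero_of_notMem_vars h]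
    rw [← finsum_add_distrib (hfin f) (hfin g)]
    refine finsum_congr fun m => ?_
    simp only [map_add, smul_add]; abel
  map_smul' c f := by
    rw [RingHom.id_apply, smul_finsum]
    refine finsum_congr fun m => ?_
    simp only [Derivation.map_smul, smul_add, smul_comm c]

theorem gaussOp_apply (a b : ℕ → ℂ) (f : Poly) : gaussOp a b f =
    ∑ᶠ m : ℕ+, ((1 / 2 * a m) • MvPolynomial.pderiv m (MvPolynomial.pderiv m f) +
      b m • MvPolynomial.pderiv m f) := rfl

theorem finite_support_gaussOp (a b : ℕ → ℂ) (f : Poly) : (Function.support fun m : ℕ+ =>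
    ((1 / 2 * a m) • MvPolynomial.pderiv m (MvPolynomial.pderiv m f) +
      b m • MvPolynomial.pderiv m f)).Finite :=
  f.vars.finite_toSet.subset fun m hm => by
    by_contra h
    apply hm
    simp only [Finset.mem_coe] at h
    simp [MvPolynomial.pderiv_eq_zero_of_notMem_vars h]

theorem gaussOp_C (a b : ℕ → ℂ) (c : ℂ) : gaussOp a b (MvPolynomial.C c) = 0 := by
  simp [gaussOp_apply]

theorem pderiv_X_mul (m j : ℕ+) (f : Poly) :
    MvPolynomial.pderiv m (MvPolynomial.X j * f) =
      MvPolynomial.X j * MvPolynomial.pderiv m f + if m = j then f else 0 := by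
  rw [Derivation.leibniz, smul_eq_mul, smul_eq_mul, MvPolynomial.pderiv_X]
  congr 1
  by_cases h : m = j
  · subst h; simp
  · rw [Pi.single_eq_of_ne (Ne.symm h)]; simp [h]

/-- Only the summand with index `j` fails to commute with `X_j`; the factor `1/2` disappears because
`∂_j²` produces the cross term twice. -/
theorem gaussOp_X_mul (a b : ℕ → ℂ) (j : ℕ+) (f : Poly) :
    gaussOp a b (MvPolynomial.X j * f) = MvPolynomial.X j * gaussOp a b f +
      (a j • MvPolynomial.pderiv j f + b j • f) := by
  rw [gaussOp_apply, gaussOp_apply, mul_finsum' _ _ (finite_support_gaussOp a b f)]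
  have h2 : (a j • MvPolynomial.pderiv j f + b j • f) =
      ∑ᶠ m : ℕ+, if m = j then (a m • MvPolynomial.pderiv m f + b m • f) else 0 := by
    rw [finsum_eq_single _ j]
    · simp
    · intro x hx; simp [hx]
  rw [h2, ← finsum_add_distrib]
  · refine finsum_congr fun m => ?_
    rw [pderiv_X_mul, map_add, pderiv_X_mul]
    by_cases h : m = j
    · subst h
      simp only [if_true, smul_add, mul_add, mul_smul_comm]
      have : a m • MvPolynomial.pderiv m f = (1 / 2 * a m) • MvPolynomial.pderiv m f +
          (1 / 2 * a m) • MvPolynomial.pderiv m f := by rw [← add_smul]; congr 1; ring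
      rw [this]; abel
    · simp [h, mul_add]
  · refine (finite_support_gaussOp a b f).subset fun m hm => ?_
    intro h
    apply hm
    simp only at h ⊢
    rw [h, mul_zero]
  · refine (Set.finite_singleton j).subset fun m hm => ?_
    by_contra h
    apply hm
    simp only [Set.mem_singleton_iff] at h
    simp [h]

theorem poly_induction {P : Poly → Prop} (h1 : P 1) (hadd : ∀ f g, P f → P g → P (f + g))
    (hsmul : ∀ (c : ℂ) f, P f → P (c • f)) (hX : ∀ (m : ℕ+) f, P f → P (MvPolynomial.X m * f))
    (f : Poly) : P f := by
  induction f using MvPolynomial.induction_on with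
  | C c => rw [← mul_one (MvPolynomial.C c), ← MvPolynomial.smul_eq_C_mul]; exact hsmul c 1 h1
  | add f g hf hg => exact hadd f g hf hg
  | mul_X f m hf => rw [mul_comm]; exact hX m f hf

theorem pderiv_comm (m j : ℕ+) (f : Poly) : MvPolynomial.pderiv m (MvPolynomial.pderiv j f) =
    MvPolynomial.pderiv j (MvPolynomial.pderiv m f) := by
  induction f using poly_induction with
  | h1 => simp
  | hadd f g hf hg => simp [hf, hg]
  | hsmul c f hf => simp [hf]
  | hX i f hf =>
    simp only [pderiv_X_mul, map_add, hf]
    by_cases h1 : m = i <;> by_cases h2 : j = i <;> simp [h1, h2, add_comm]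

theorem gaussOp_pderiv (a b : ℕ → ℂ) (j : ℕ+) (f : Poly) :
    gaussOp a b (MvPolynomial.pderiv j f) = MvPolynomial.pderiv j (gaussOp a b f) := by
  induction f using poly_induction with
  | h1 => rw [show (1 : Poly) = MvPolynomial.C 1 from rfl, gaussOp_C]; simp
  | hadd f g hf hg => simp [hf, hg]
  | hsmul c f hf => simp [hf]
  | hX i f hf =>
    rw [pderiv_X_mul, map_add, gaussOp_X_mul, gaussOp_X_mul, map_add, pderiv_X_mul, hf,
      map_add, Derivation.map_smul, Derivation.map_smul, pderiv_comm j i]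
    split_ifs
    · abel
    · simp

/-- `[g, X_j] = a_j ∂_j + b_j`. -/
def gaussComm (a b : ℕ → ℂ) (j : ℕ+) : Poly →ₗ[ℂ] Poly :=
  a j • (MvPolynomial.pderiv j).toLinearMap + b j • LinearMap.id

/-- The commutator `a_j ∂_j + b_j` commutes with the operator itself, so the `n`-th power
contributes `n` equal terms. -/
theorem iterate_gaussOp_X_mul (a b : ℕ → ℂ) (j : ℕ+) (f : Poly) (n : ℕ) :
    (gaussOp a b)^[n] (MvPolynomial.X j * f) = MvPolynomial.X j * (gaussOp a b)^[n] f +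
      (n : ℂ) • gaussComm a b j ((gaussOp a b)^[n - 1] f) := by
  induction n with
  | zero => simp
  | succ n ih =>
    rw [Function.iterate_succ_apply', ih, map_add, gaussOp_X_mul, map_smul,
      Function.iterate_succ_apply' _ n f, Nat.add_sub_cancel]
    have hc : ∀ f, gaussOp a b (gaussComm a b j f) = gaussComm a b j (gaussOp a b f) := fun f => by
      simp [gaussComm, gaussOp_pderiv]
    rw [hc]
    rcases n with _ | n
    · simp [gaussComm]
    · rw [Nat.add_sub_cancel, ← Function.iterate_succ_apply' (gaussOp a b) n f, add_assoc]
      congr 1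
      change gaussComm a b j ((gaussOp a b)^[n + 1] f) +
        ((n + 1 : ℕ) : ℂ) • gaussComm a b j ((gaussOp a b)^[n + 1] f) = _
      push_cast
      module

/-- Local nilpotency makes the exponential series a finite sum on each polynomial; multiplication by
a variable raises the nilpotency index by at most one. -/
theorem exists_iterate_gaussOp_eq_zero (a b : ℕ → ℂ) (f : Poly) :
    ∃ N, ∀ n, N ≤ n → (gaussOp a b)^[n] f = 0 := by
  have hlin : ∀ n f g, (gaussOp a b)^[n] (f + g) = (gaussOp a b)^[n] f + (gaussOp a b)^[n] g :=
    fun n f g => by simp [← Module.End.pow_apply]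
  have hsm : ∀ n (c : ℂ) f, (gaussOp a b)^[n] (c • f) = c • (gaussOp a b)^[n] f :=
    fun n f g => by simp [← Module.End.pow_apply]
  induction f using poly_induction with
  | h1 =>
    refine ⟨1, fun n hn => ?_⟩
    obtain ⟨n, rfl⟩ := Nat.exists_eq_add_of_le' hn
    rw [Function.iterate_succ_apply, show (1 : Poly) = MvPolynomial.C 1 from rfl, gaussOp_C,
      ← Module.End.pow_apply, map_zero]
  | hadd f g hf hg =>
    obtain ⟨N, hN⟩ := hf
    obtain ⟨M, hM⟩ := hg
    exact ⟨max N M, fun n hn => by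
      rw [hlin, hN n (le_of_max_le_left hn), hM n (le_of_max_le_right hn), add_zero]⟩
  | hsmul c f hf =>
    obtain ⟨N, hN⟩ := hf
    exact ⟨N, fun n hn => by rw [hsm, hN n hn, smul_zero]⟩
  | hX j f hf =>
    obtain ⟨N, hN⟩ := hf
    refine ⟨N + 1, fun n hn => ?_⟩
    rw [iterate_gaussOp_X_mul, hN n (by omega), hN (n - 1) (by omega)]
    simp

theorem finite_support_exp_gaussOp (a b : ℕ → ℂ) (f : Poly) :
    (Function.support fun n : ℕ => ((n.factorial : ℂ)⁻¹) • (gaussOp a b)^[n] f).Finite := by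
  obtain ⟨N, hN⟩ := exists_iterate_gaussOp_eq_zero a b f
  refine (Set.finite_lt_nat N).subset fun n hn => ?_
  by_contra h
  apply hn
  simp only [Set.mem_ofPred_eq, not_lt] at h
  simp [hN n h]

/-- The Gaussian functional with variances `a` and means `b`: the constant term of
`exp (∑_m (a_m ∂_m² / 2 + b_m ∂_m))`. -/
def gauss (a b : ℕ → ℂ) : Poly →ₗ[ℂ] ℂ where
  toFun f := MvPolynomial.constantCoeff (∑ᶠ n : ℕ, ((n.factorial : ℂ)⁻¹) • (gaussOp a b)^[n] f)
  map_add' f g := by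
    rw [← map_add, ← finsum_add_distrib (finite_support_exp_gaussOp a b f)
      (finite_support_exp_gaussOp a b g)]
    congr 1
    refine finsum_congr fun n => ?_
    simp [← Module.End.pow_apply]
  map_smul' c f := by
    rw [RingHom.id_apply, ← MvPolynomial.constantCoeff_smul, smul_finsum]
    congr 1
    refine finsum_congr fun n => ?_
    rw [← Module.End.pow_apply, map_smul, Module.End.pow_apply, smul_comm]

theorem gauss_apply (a b : ℕ → ℂ) (f : Poly) : gauss a b f = MvPolynomial.constantCoeff
    (∑ᶠ n : ℕ, ((n.factorial : ℂ)⁻¹) • (gaussOp a b)^[n] f) := rfl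

theorem gauss_one (a b : ℕ → ℂ) : gauss a b 1 = 1 := by
  rw [gauss_apply, finsum_eq_single _ 0]
  · simp
  · intro n hn
    obtain ⟨n, rfl⟩ := Nat.exists_eq_succ_of_ne_zero hn
    rw [Function.iterate_succ_apply, show (1 : Poly) = MvPolynomial.C 1 from rfl, gaussOp_C,
      ← Module.End.pow_apply, map_zero, smul_zero]

/-- Gaussian integration by parts: `exp(g) X_j = (X_j + a_j ∂_j + b_j) exp(g)`, and the constant
term kills `X_j`. All later computations with the functional use only this rule and the value at
`1`. -/
theorem gauss_X_mul (a b : ℕ → ℂ) (j : ℕ+) (f : Poly) :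
    gauss a b (MvPolynomial.X j * f) = a j * gauss a b (MvPolynomial.pderiv j f) +
      b j * gauss a b f := by
  have hR : a j * gauss a b (MvPolynomial.pderiv j f) + b j * gauss a b f =
      gauss a b (gaussComm a b j f) := by simp [gaussComm]
  rw [hR]
  obtain ⟨N, hN⟩ := exists_iterate_gaussOp_eq_zero a b f
  have hc : ∀ n, (gaussOp a b)^[n] (gaussComm a b j f) = gaussComm a b j ((gaussOp a b)^[n] f) := by
    intro n
    induction n with
    | zero => rfl
    | succ n ih =>
      rw [Function.iterate_succ_apply', ih, Function.iterate_succ_apply']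
      simp [gaussComm, gaussOp_pderiv]
  rw [gauss_apply, gauss_apply, finsum_eq_sum_of_support_subset (s := Finset.range (N + 1)),
    finsum_eq_sum_of_support_subset (s := Finset.range N)]
  · simp only [iterate_gaussOp_X_mul, smul_add, Finset.sum_add_distrib, map_add, map_sum]
    rw [Finset.sum_eq_zero, zero_add, Finset.sum_range_succ']
    · simp only [Nat.cast_zero, zero_smul, smul_zero, map_zero, add_zero, Nat.add_sub_cancel]
      refine Finset.sum_congr rfl fun n _ => ?_
      rw [hc, smul_smul, Nat.factorial_succ]
      congr 2
      push_cast
      have : (n.factorial : ℂ) ≠ 0 := by exact_mod_cast n.factorial_ne_zero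
      have : (n : ℂ) + 1 ≠ 0 := by exact_mod_cast n.succ_ne_zero
      field_simp
    · intro n _; simp [MvPolynomial.constantCoeff_smul]
  · intro n hn
    by_contra h
    apply hn
    simp only [Finset.coe_range, Set.mem_Iio, not_lt] at h
    simp [hc, hN n h]
  · intro n hn
    by_contra h
    apply hn
    simp only [Finset.coe_range, Set.mem_Iio, not_lt] at h
    simp [iterate_gaussOp_X_mul, hN n (by omega), hN (n - 1) (by omega)]

end IzerginKorepin

namespace IzerginKorepin
open PowerSeries

/-! ### Exponentials of creation and annihilation operators -/

/-- Multiplication by `X_m`. -/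
def cre (m : ℕ) : Module.End ℂ Poly :=
  if m = 0 then 0 else LinearMap.mulLeft ℂ (MvPolynomial.X m.toPNat')

/-- Differentiation with respect to `X_m`. -/
def ann (m : ℕ) : Module.End ℂ Poly :=
  if m = 0 then 0 else (MvPolynomial.pderiv (R := ℂ) m.toPNat').toLinearMap

theorem cre_coe (m : ℕ+) : cre m = LinearMap.mulLeft ℂ (MvPolynomial.X m) := by
  rw [cre, if_neg m.ne_zero, PNat.coe_toPNat']

theorem ann_coe (m : ℕ+) : ann m = (MvPolynomial.pderiv (R := ℂ) m).toLinearMap := by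
  rw [ann, if_neg m.ne_zero, PNat.coe_toPNat']

/-- The coefficient of `ζ^p` in `exp (∑ r_m X_m ζ^m)`. -/
def creMode (r : ℕ → ℂ) (p : ℕ) : Module.End ℂ Poly :=
  coeff p (pexp (PowerSeries.mk fun m => r m • cre m))

/-- The coefficient of `ζ^p` in `exp (∑ t_m ∂_m ζ^m)`. -/
def annMode (t : ℕ → ℂ) (p : ℕ) : Module.End ℂ Poly :=
  coeff p (pexp (PowerSeries.mk fun m => t m • ann m))

theorem coeff_zero_cre (r : ℕ → ℂ) :
    coeff 0 (PowerSeries.mk fun m => r m • cre m : (Module.End ℂ Poly)⟦X⟧) = 0 := by simp [cre]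

theorem coeff_zero_ann (r : ℕ → ℂ) :
    coeff 0 (PowerSeries.mk fun m => r m • ann m : (Module.End ℂ Poly)⟦X⟧) = 0 := by simp [ann]

theorem ann_mul_cre (i : ℕ) (j : ℕ+) : ann i * cre j = cre j * ann i + if i = j then 1 else 0 := by
  rcases Nat.eq_zero_or_pos i with rfl | hi
  · simp [ann, j.ne_zero.symm]
  · lift i to ℕ+ using hi
    refine LinearMap.ext fun f => ?_
    simp only [cre_coe, ann_coe, Module.End.mul_apply, LinearMap.add_apply,
      LinearMap.mulLeft_apply, Derivation.coeFn_coe, pderiv_X_mul]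
    by_cases h : i = j
    · simp [h]
    · simp [h]

theorem ann_mul_cre' (i : ℕ+) (j : ℕ) : ann i * cre j = cre j * ann i + if j = i then 1 else 0 := by
  rcases Nat.eq_zero_or_pos j with rfl | hj
  · simp [cre, i.ne_zero.symm]
  · lift j to ℕ+ using hj
    rw [ann_mul_cre]
    simp [eq_comm]

theorem cre_mul_cre (i j : ℕ) : cre i * cre j = cre j * cre i := by
  rcases Nat.eq_zero_or_pos i with rfl | hi
  · simp [cre]
  rcases Nat.eq_zero_or_pos j with rfl | hj
  · simp [cre]
  lift i to ℕ+ using hi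
  lift j to ℕ+ using hj
  refine LinearMap.ext fun f => ?_
  simp [cre_coe, mul_left_comm]

theorem ann_mul_ann (i j : ℕ) : ann i * ann j = ann j * ann i := by
  rcases Nat.eq_zero_or_pos i with rfl | hi
  · simp [ann]
  rcases Nat.eq_zero_or_pos j with rfl | hj
  · simp [ann]
  lift i to ℕ+ using hi
  lift j to ℕ+ using hj
  refine LinearMap.ext fun f => ?_
  simp only [ann_coe, Module.End.mul_apply, Derivation.coeFn_coe]
  exact pderiv_comm _ _ f

theorem creMode_X_mul (r : ℕ → ℂ) (p : ℕ) (j : ℕ+) (f : Poly) :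
    creMode r p (MvPolynomial.X j * f) = MvPolynomial.X j * creMode r p f := by
  have := mul_coeff_pexp (coeff_zero_cre r) (y := cre j) (m := 1) one_pos (c := 0)
    (fun i => by simp [cre_mul_cre]) p
  have := LinearMap.congr_fun this f
  simpa [cre_coe, creMode, Module.End.mul_apply] using this.symm

/-- Differentiating `exp (∑ r_m X_m ζ^m)` brings down `r_j ζ^j`, and the power `ζ^j` lowers the mode
index by `j`. -/
theorem pderiv_creMode (r : ℕ → ℂ) (p : ℕ) (j : ℕ+) (f : Poly) :
    MvPolynomial.pderiv j (creMode r p f) = creMode r p (MvPolynomial.pderiv j f) +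
      if (j : ℕ) ≤ p then r j • creMode r (p - j) f else 0 := by
  have := mul_coeff_pexp (coeff_zero_cre r) (y := ann j) (m := j) j.pos (c := r j)
    (fun i => by
      rw [coeff_mk, mul_smul_comm, ann_mul_cre', smul_add, smul_mul_assoc]
      by_cases h : i = j
      · simp [h, Algebra.algebraMap_eq_smul_one]
      · simp [h]) p
  have := LinearMap.congr_fun this f
  simp only [ann_coe, Module.End.mul_apply, LinearMap.add_apply] at this
  rw [Derivation.coeFn_coe] at this
  rw [creMode, this]
  split_ifs <;> rfl

theorem annMode_X_mul (t : ℕ → ℂ) (p : ℕ) (j : ℕ+) (f : Poly) :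
    annMode t p (MvPolynomial.X j * f) = MvPolynomial.X j * annMode t p f +
      if (j : ℕ) ≤ p then t j • annMode t (p - j) f else 0 := by
  have := mul_coeff_pexp (coeff_zero_ann t) (y := cre j) (m := j) j.pos (c := -t j)
    (fun i => by
      rw [coeff_mk, smul_mul_assoc, ann_mul_cre, smul_add, mul_smul_comm]
      by_cases h : i = j
      · simp [h, Algebra.algebraMap_eq_smul_one]
      · simp [h]) p
  have := LinearMap.congr_fun this f
  simp only [cre_coe, Module.End.mul_apply, LinearMap.add_apply, LinearMap.mulLeft_apply] at this
  rw [annMode, this]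
  split_ifs <;> simp [annMode]

theorem pderiv_annMode (t : ℕ → ℂ) (p : ℕ) (j : ℕ+) (f : Poly) :
    MvPolynomial.pderiv j (annMode t p f) = annMode t p (MvPolynomial.pderiv j f) := by
  have := mul_coeff_pexp (coeff_zero_ann t) (y := ann j) (m := 1) one_pos (c := 0)
    (fun i => by simp [ann_mul_ann]) p
  have := LinearMap.congr_fun this f
  simpa [ann_coe, annMode, Module.End.mul_apply] using this

theorem annMode_one (t : ℕ → ℂ) (p : ℕ) : annMode t p 1 = if p = 0 then 1 else 0 := by
  rcases Nat.eq_zero_or_pos p with rfl | hp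
  · simp [annMode, coeff_zero_pexp]
  · rw [if_neg hp.ne', annMode, coeff_pexp (coeff_zero_ann t) (Nat.lt_add_one p),
      LinearMap.sum_apply]
    refine Finset.sum_eq_zero fun n _ => ?_
    rcases n with _ | n
    · simp [coeff_one, hp.ne']
    · rw [pow_succ, coeff_mul, LinearMap.smul_apply, LinearMap.sum_apply, Finset.sum_eq_zero,
        smul_zero]
      intro x _
      rw [Module.End.mul_apply, coeff_mk, LinearMap.smul_apply]
      have : ann x.2 1 = 0 := by
        unfold ann
        split_ifs
        · rfl
        · exact (MvPolynomial.pderiv (R := ℂ) x.2.toPNat').map_one_eq_zero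
      rw [this, smul_zero, map_zero]

/-- Annihilation modes vanish on a fixed polynomial from some index on, so normally ordered modes
are finite sums and only the creation direction raises convergence questions. -/
theorem exists_annMode_eq_zero (t : ℕ → ℂ) (f : Poly) : ∃ N, ∀ p, N ≤ p → annMode t p f = 0 := by
  induction f using poly_induction with
  | h1 => exact ⟨1, fun p hp => by rw [annMode_one, if_neg (by omega)]⟩
  | hadd f g hf hg =>
    obtain ⟨N, hN⟩ := hf
    obtain ⟨M, hM⟩ := hg
    exact ⟨max N M, fun n hn => by
      rw [map_add, hN n (le_of_max_le_left hn), hM n (le_of_max_le_right hn), add_zero]⟩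
  | hsmul c f hf =>
    obtain ⟨N, hN⟩ := hf
    exact ⟨N, fun n hn => by rw [map_smul, hN n hn, smul_zero]⟩
  | hX j f hf =>
    obtain ⟨N, hN⟩ := hf
    refine ⟨N + j, fun n hn => ?_⟩
    rw [annMode_X_mul, hN n (by omega), hN (n - j) (by omega)]
    simp

theorem creMode_apply_one (r : ℕ → ℂ) (p : ℕ) : creMode r p 1 =
    coeff p (pexp (PowerSeries.mk fun m => r m • cre m 1 : Poly⟦X⟧)) := by
  have h : (PowerSeries.mk fun m => r m • cre m : (Module.End ℂ Poly)⟦X⟧) =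
      PowerSeries.map ((Algebra.lmul ℂ Poly : Poly →ₐ[ℂ] Module.End ℂ Poly) :
        Poly →+* Module.End ℂ Poly) (PowerSeries.mk fun m => r m • cre m 1) := by
    ext1 m
    simp only [coeff_mk, PowerSeries.coeff_map, RingHom.coe_coe, map_smul]
    congr 1
    unfold cre
    split_ifs
    · simp
    · refine LinearMap.ext fun f => ?_
      simp
  rw [creMode, h, pexp_map, PowerSeries.coeff_map]
  simp

/-! ### Generating functions of Gaussian values. -/

theorem succ_smul_creMode_one (r : ℕ → ℂ) (p : ℕ) :
    ((p : ℂ) + 1) • creMode r (p + 1) 1 = ∑ x ∈ Finset.HasAntidiagonal.antidiagonal p,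
      (((x.1 : ℂ) + 1) * r (x.1 + 1)) • (MvPolynomial.X x.1.succPNat * creMode r x.2 1) := by
  have h := succ_mul_coeff_pexp (R := Poly) (f := PowerSeries.mk fun m => r m • cre m 1)
    (by simp [cre]) p
  rw [← creMode_apply_one] at h
  simp only [← creMode_apply_one, coeff_mk] at h
  have e : ∀ n : ℕ, ((n : Poly) + 1) = MvPolynomial.C ((n : ℂ) + 1) := by simp
  rw [MvPolynomial.smul_eq_C_mul, ← e, h]
  refine Finset.sum_congr rfl fun x _ => ?_
  rw [e, show x.1 + 1 = ((x.1.succPNat : ℕ+) : ℕ) from rfl, cre_coe, LinearMap.mulLeft_apply,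
    mul_one, MvPolynomial.smul_eq_C_mul, MvPolynomial.smul_eq_C_mul, MvPolynomial.C_mul]
  ring

/-- The exponent of the generating function of `gauss a b (creMode r p 1)`. -/
def gaussExponent (a b r : ℕ → ℂ) : ℂ⟦X⟧ :=
  PowerSeries.mk fun j => r j * b j + if Even j then 1 / 2 * a (j / 2) * r (j / 2) ^ 2 else 0

/-- The second order term of the recursion shifts the index by `m` twice and therefore belongs to
degree `2m` of the exponent; the weight `m` on the left becomes `2m · 1/2` on the right. -/
theorem sum_antidiagonal_double (A u : ℕ → ℂ) (p : ℕ) :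
    ∑ x ∈ Finset.HasAntidiagonal.antidiagonal p,
      ((x.1 : ℂ) + 1) * (if x.1 + 1 ≤ x.2 then A (x.1 + 1) * u (x.2 - (x.1 + 1)) else 0) =
    ∑ x ∈ Finset.HasAntidiagonal.antidiagonal p,
      ((x.1 : ℂ) + 1) * (if Even (x.1 + 1) then 1 / 2 * A ((x.1 + 1) / 2) else 0) * u x.2 := by
  have e1 := Finset.Nat.sum_antidiagonal_eq_sum_range_succ
    (fun i j => ((i : ℂ) + 1) * (if i + 1 ≤ j then A (i + 1) * u (j - (i + 1)) else 0)) p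
  have e2 := Finset.Nat.sum_antidiagonal_eq_sum_range_succ
    (fun i j => ((i : ℂ) + 1) * (if Even (i + 1) then 1 / 2 * A ((i + 1) / 2) else 0) * u j) p
  rw [e1, e2]
  simp only [mul_ite, ite_mul, mul_zero, zero_mul]
  rw [← Finset.sum_filter, ← Finset.sum_filter]
  -- Both indices are shifted by one: `i` stands for `m = i + 1`, and `2m` is the index `2i + 1`.
  refine Finset.sum_nbij' (fun i => 2 * i + 1) (fun i => i / 2) ?_ ?_ ?_ ?_ ?_
  · intro i hi
    simp only [Finset.mem_filter, Finset.mem_range] at hi ⊢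
    exact ⟨by omega, ⟨i + 1, by ring⟩⟩
  · intro i hi
    simp only [Finset.mem_filter, Finset.mem_range] at hi ⊢
    obtain ⟨h, k, hk⟩ := hi
    omega
  · intro i _; omega
  · intro i hi
    simp only [Finset.mem_filter, Finset.mem_range] at hi ⊢
    obtain ⟨h, k, hk⟩ := hi
    omega
  · intro i hi
    rw [show (2 * i + 1 + 1) / 2 = i + 1 by omega, show p - i - (i + 1) = p - (2 * i + 1) by omega]
    push_cast
    ring

/-- This is `E exp(∑ r_m X_m ζ^m) = exp(∑ r_m b_m ζ^m + ½ ∑ a_m r_m² ζ^{2m})` at the level of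
coefficients. Integration by parts shows that the left side satisfies the recursion of the
exponential on the right. -/
theorem gauss_creMode_one (a b r : ℕ → ℂ) (hr : r 0 = 0) (p : ℕ) :
    gauss a b (creMode r p 1) = coeff p (pexp (gaussExponent a b r)) := by
  refine eq_coeff_pexp_of_succ_mul (u := fun p => gauss a b (creMode r p 1))
    (by simp [gaussExponent, hr]) ?_ ?_ p
  · simp [creMode, coeff_zero_pexp, gauss_one]
  · intro p
    have h := congrArg (gauss a b) (succ_smul_creMode_one r p)
    rw [map_smul, smul_eq_mul, map_sum] at h
    rw [h]
    have h2 := sum_antidiagonal_double (fun m => a m * r m ^ 2)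
      (fun p => gauss a b (creMode r p 1)) p
    have h3 : ∀ x : ℕ × ℕ, ((x.1 : ℂ) + 1) * coeff (x.1 + 1) (gaussExponent a b r) *
        gauss a b (creMode r x.2 1) =
        ((x.1 : ℂ) + 1) * (r (x.1 + 1) * b (x.1 + 1)) * gauss a b (creMode r x.2 1) +
        ((x.1 : ℂ) + 1) * (if Even (x.1 + 1) then
          1 / 2 * (a ((x.1 + 1) / 2) * r ((x.1 + 1) / 2) ^ 2) else 0) *
          gauss a b (creMode r x.2 1) := fun x => by
      rw [gaussExponent, coeff_mk]
      split_ifs <;> ring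
    simp only [h3]
    rw [Finset.sum_add_distrib, ← h2, ← Finset.sum_add_distrib]
    refine Finset.sum_congr rfl fun x _ => ?_
    rw [map_smul, gauss_X_mul, pderiv_creMode,
      show (MvPolynomial.pderiv x.1.succPNat) (1 : Poly) = 0 by simp, map_zero, zero_add, smul_eq_mul,
      Nat.succPNat_coe]
    by_cases hx : x.1 + 1 ≤ x.2
    · rw [if_pos hx, if_pos hx, map_smul, smul_eq_mul]; ring
    · rw [if_neg hx, if_neg hx, map_zero]; ring

theorem hasSum_gaussExponent {a b r : ℕ → ℂ} {ζ : ℂ}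
    (h1 : Summable fun m => ‖a m * r m ^ 2 * ζ ^ (2 * m)‖)
    (h2 : Summable fun m => ‖r m * b m * ζ ^ m‖) :
    (Summable fun j => ‖coeff j (gaussExponent a b r) * ζ ^ j‖) ∧
    HasSum (fun j => coeff j (gaussExponent a b r) * ζ ^ j)
      (∑' m, r m * b m * ζ ^ m + 1 / 2 * ∑' m, a m * r m ^ 2 * ζ ^ (2 * m)) := by
  set E : ℕ → ℂ := fun j => (if Even j then 1 / 2 * a (j / 2) * r (j / 2) ^ 2 else 0) * ζ ^ j
    with hE
  have hinj : Function.Injective (fun m : ℕ => 2 * m) := fun x y h => by simpa using h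
  have hE2 : ∀ m, E (2 * m) = 1 / 2 * (a m * r m ^ 2 * ζ ^ (2 * m)) := fun m => by
    simp [hE]; ring
  have hE0 : ∀ j, j ∉ Set.range (fun m : ℕ => 2 * m) → E j = 0 := fun j hj => by
    simp only [hE]
    rw [if_neg, zero_mul]
    rintro ⟨k, hk⟩
    exact hj ⟨k, by simp only; omega⟩
  have e : ∀ j, coeff j (gaussExponent a b r) * ζ ^ j = r j * b j * ζ ^ j + E j := fun j => by
    rw [gaussExponent, coeff_mk, add_mul]
  have hEs : Summable fun j => ‖E j‖ := by
    rw [← hinj.summable_iff (fun j hj => by rw [hE0 j hj, norm_zero])]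
    refine (h1.mul_left ‖(1 / 2 : ℂ)‖).congr fun m => ?_
    rw [Function.comp, hE2, norm_mul (1 / 2 : ℂ)]
  have hEh : HasSum E (1 / 2 * ∑' m, a m * r m ^ 2 * ζ ^ (2 * m)) := by
    rw [← hinj.hasSum_iff hE0]
    exact (h1.of_norm.hasSum.mul_left (1 / 2 : ℂ)).congr_fun fun m => hE2 m
  simp only [e]
  exact ⟨Summable.of_nonneg_of_le (fun _ => norm_nonneg _) (fun _ => norm_add_le _ _)
    (h2.add hEs), h2.of_norm.hasSum.add hEh⟩

/-- The generating function of `gauss a b (creMode r p 1)`. -/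
def gaussGen (a b r : ℕ → ℂ) (ζ : ℂ) : ℂ :=
  Complex.exp (∑' m, r m * b m * ζ ^ m + 1 / 2 * ∑' m, a m * r m ^ 2 * ζ ^ (2 * m))

theorem hasSum_ite_sub {g : ℕ → ℂ} {c ζ : ℂ} (j : ℕ) (h : HasSum (fun p => g p * ζ ^ p) c) :
    HasSum (fun p => (if j ≤ p then g (p - j) else 0) * ζ ^ p) (c * ζ ^ j) := by
  have hinj : Function.Injective (fun p : ℕ => p + j) := add_left_injective j
  rw [← hinj.hasSum_iff]
  · refine (h.mul_right (ζ ^ j)).congr_fun fun p => ?_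
    simp [pow_add, mul_assoc]
  · intro p hp
    rw [if_neg, zero_mul]
    intro hjp
    exact hp ⟨p - j, by simp only; omega⟩

/-- Integration by parts reduces `X_m f` to both `f` and `∂_m f`, so an induction hypothesis for the
derivative is needed as well; induction on the degree of monomials supplies it. -/
theorem poly_induction_pderiv {P : Poly → Prop} (h1 : P 1)
    (hadd : ∀ f g, P f → P g → P (f + g)) (hsmul : ∀ (c : ℂ) f, P f → P (c • f))
    (hX : ∀ (m : ℕ+) f, P f → P (MvPolynomial.pderiv m f) → P (MvPolynomial.X m * f))
    (f : Poly) : P f := by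
  have hmon : ∀ (n : ℕ) (s : ℕ+ →₀ ℕ), s.degree = n → P (MvPolynomial.monomial s 1) := by
    intro n
    induction n using Nat.strong_induction_on with
    | _ n ih =>
      intro s hs
      by_cases h0 : s = 0
      · subst h0; exact h1
      · obtain ⟨j, hj⟩ := Finsupp.ne_iff.mp h0
        have hle : Finsupp.single j 1 ≤ s := by
          rw [Finsupp.single_le_iff]; exact Nat.one_le_iff_ne_zero.mpr hj
        obtain ⟨s', rfl⟩ := exists_add_of_le hle
        have hd : s'.degree + 1 = n := by
          rw [← hs, map_add, Finsupp.degree_single, add_comm]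
        rw [show MvPolynomial.monomial (Finsupp.single j 1 + s') (1 : ℂ) =
          MvPolynomial.X j * MvPolynomial.monomial s' 1 by
            rw [MvPolynomial.X, MvPolynomial.monomial_mul, one_mul]]
        refine hX j _ (ih _ (by omega) s' rfl) ?_
        rw [MvPolynomial.pderiv_monomial, ← mul_one (1 * ((s' j : ℕ) : ℂ)), ← smul_eq_mul,
          ← MvPolynomial.smul_monomial]
        -- If `s' j = 0` the truncated subtraction leaves `s'` unchanged and the scalar is zero, so
        -- the bound `≤` on the degree is all that is needed.
        refine hsmul _ _ (ih _ ?_ (s' - Finsupp.single j 1) rfl)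
        have : (s' - Finsupp.single j 1).degree ≤ s'.degree := Finsupp.degree_mono tsub_le_self
        omega
  induction f using MvPolynomial.induction_on' with
  | monomial s c =>
    rw [← mul_one c, ← smul_eq_mul, ← MvPolynomial.smul_monomial]
    exact hsmul _ _ (hmon _ s rfl)
  | add f g hf hg => exact hadd f g hf hg

/-- Completing the square: a creation exponential to the left of `f` acts on a Gaussian functional
as a scalar times a shift of the mean by `a_m r_m ζ^m`. The summability hypotheses are those of the
exponent of the scalar. -/
theorem hasSum_gauss_creMode {a b r : ℕ → ℂ} (hr : r 0 = 0) {ζ : ℂ}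
    (h1 : Summable fun m => ‖a m * r m ^ 2 * ζ ^ (2 * m)‖)
    (h2 : Summable fun m => ‖r m * b m * ζ ^ m‖) (f : Poly) :
    HasSum (fun p => gauss a b (creMode r p f) * ζ ^ p)
      (gaussGen a b r ζ * gauss a (fun m => b m + a m * r m * ζ ^ m) f) := by
  induction f using poly_induction_pderiv with
  | h1 =>
    rw [gauss_one, mul_one]
    simp only [gauss_creMode_one a b r hr]
    obtain ⟨hs, hh⟩ := hasSum_gaussExponent h1 h2
    rw [gaussGen, ← hh.tsum_eq]
    exact hasSum_coeff_pexp (by simp [gaussExponent, hr]) hs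
  | hadd f g hf hg => simpa [map_add, add_mul, mul_add] using hf.add hg
  | hsmul c f hf => simpa [mul_assoc, mul_left_comm] using hf.mul_left c
  | hX j f hf hd =>
    have hs := hasSum_ite_sub (g := fun p => gauss a b (creMode r p f)) j hf
    have := ((hd.mul_left (a j)).add (hs.mul_left (a j * r j))).add (hf.mul_left (b j))
    rw [gauss_X_mul, show gaussGen a b r ζ *
      (a j * gauss a (fun m => b m + a m * r m * ζ ^ m) (MvPolynomial.pderiv j f) +
        (b j + a j * r j * ζ ^ (j : ℕ)) * gauss a (fun m => b m + a m * r m * ζ ^ m) f) =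
      a j * (gaussGen a b r ζ *
        gauss a (fun m => b m + a m * r m * ζ ^ m) (MvPolynomial.pderiv j f)) +
      a j * r j * (gaussGen a b r ζ * gauss a (fun m => b m + a m * r m * ζ ^ m) f *
        ζ ^ (j : ℕ)) +
      b j * (gaussGen a b r ζ * gauss a (fun m => b m + a m * r m * ζ ^ m) f) by ring]
    refine this.congr_fun fun p => ?_
    rw [creMode_X_mul, gauss_X_mul, pderiv_creMode, map_add]
    split_ifs
    · rw [map_smul, smul_eq_mul]; ring
    · simp only [map_zero]; ring

/-- `exp (∑ t_m η^m ∂_m)` is a translation of the variables, hence a shift of the mean with no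
scalar factor. -/
theorem hasSum_gauss_annMode (a b t : ℕ → ℂ) (η : ℂ) (f : Poly) :
    HasSum (fun p => gauss a b (annMode t p f) * η ^ p)
      (gauss a (fun m => b m + t m * η ^ m) f) := by
  induction f using poly_induction_pderiv with
  | h1 =>
    rw [gauss_one]
    refine (hasSum_ite_eq 0 (1 : ℂ)).congr_fun fun p => ?_
    rw [annMode_one]
    split_ifs with h
    · simp [h, gauss_one]
    · simp
  | hadd f g hf hg => simpa [map_add, add_mul, mul_add] using hf.add hg
  | hsmul c f hf => simpa [mul_assoc, mul_left_comm] using hf.mul_left c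
  | hX j f hf hd =>
    have hs := hasSum_ite_sub (g := fun p => gauss a b (annMode t p f)) j hf
    have := ((hd.mul_left (a j)).add (hs.mul_left (t j))).add (hf.mul_left (b j))
    rw [gauss_X_mul, show
      a j * gauss a (fun m => b m + t m * η ^ m) (MvPolynomial.pderiv j f) +
        (b j + t j * η ^ (j : ℕ)) * gauss a (fun m => b m + t m * η ^ m) f =
      a j * gauss a (fun m => b m + t m * η ^ m) (MvPolynomial.pderiv j f) +
      t j * (gauss a (fun m => b m + t m * η ^ m) f * η ^ (j : ℕ)) +
      b j * gauss a (fun m => b m + t m * η ^ m) f by ring]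
    refine this.congr_fun fun p => ?_
    rw [annMode_X_mul, map_add, gauss_X_mul, pderiv_annMode]
    split_ifs
    · rw [map_smul, smul_eq_mul]; ring
    · simp only [map_zero]; ring

end IzerginKorepin

namespace IzerginKorepin
open MeasureTheory AddCircle Metric Set Topology

/-! ### Averages over circles -/

instance fact_two_pi_pos : Fact (0 < 2 * Real.pi) := ⟨Real.two_pi_pos⟩

/-- The point of the unit circle with a given angle. -/
def cis (θ : AddCircle (2 * Real.pi)) : ℂ := toCircle θ

theorem norm_cis (θ) : ‖cis θ‖ = 1 := Circle.norm_coe _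

theorem cis_ne_zero (θ) : cis θ ≠ 0 := Circle.coe_ne_zero _

@[fun_prop]
theorem continuous_cis : Continuous cis :=
  continuous_subtype_val.comp AddCircle.continuous_toCircle

theorem cis_zpow (θ) (n : ℤ) : cis θ ^ n = fourier n θ := by
  rw [fourier_apply, toCircle_zsmul, cis, Circle.coe_zpow]

theorem norm_mul_cis {ρ : ℝ} (hρ : 0 ≤ ρ) (θ) : ‖(ρ : ℂ) * cis θ‖ = ρ := by
  rw [norm_mul, norm_cis, mul_one, Complex.norm_of_nonneg hρ]

theorem mul_cis_mem_sphere {ρ : ℝ} (hρ : 0 ≤ ρ) (θ) : (ρ : ℂ) * cis θ ∈ sphere (0 : ℂ) ρ := by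
  rw [mem_sphere_zero_iff_norm, norm_mul_cis hρ]

theorem exists_eq_mul_cis {ρ : ℝ} (hρ : 0 < ρ) {w : ℂ} (hw : ‖w‖ = ρ) : ∃ θ, w = ρ * cis θ := by
  have h1 : ‖w / ρ‖ = 1 := by rw [norm_div, Complex.norm_of_nonneg hρ.le, hw, div_self hρ.ne']
  obtain ⟨θ, hθ⟩ := (AddCircle.homeomorphCircle Real.two_pi_pos.ne').surjective
    ⟨w / ρ, mem_sphere_zero_iff_norm.mpr h1⟩
  refine ⟨θ, ?_⟩
  have h2 : cis θ = w / ρ := by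
    rw [cis, ← AddCircle.homeomorphCircle_apply Real.two_pi_pos.ne', hθ]
  have : (ρ : ℂ) ≠ 0 := by exact_mod_cast hρ.ne'
  rw [h2]; field_simp

/-- The average of `f` over the circle of radius `ρ` around `0`. -/
def avg (ρ : ℝ) (f : ℂ → ℂ) : ℂ := ∫ θ, f (ρ * cis θ) ∂haarAddCircle

theorem avg_congr {ρ : ℝ} (hρ : 0 ≤ ρ) {f g : ℂ → ℂ} (h : ∀ w, ‖w‖ = ρ → f w = g w) :
    avg ρ f = avg ρ g :=
  integral_congr_ae (Filter.Eventually.of_forall fun θ => h _ (norm_mul_cis hρ θ))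

theorem continuous_comp_cis {ρ : ℝ} (hρ : 0 ≤ ρ) {f : ℂ → ℂ} (hf : ContinuousOn f (sphere 0 ρ)) :
    Continuous fun θ => f (ρ * cis θ) :=
  hf.comp_continuous (by fun_prop) (mul_cis_mem_sphere hρ)

theorem integrable_of_continuous_torus {X : Type*} [TopologicalSpace X] [CompactSpace X]
    [T2Space X] [MeasurableSpace X] [OpensMeasurableSpace X] {μ : Measure X}
    [IsFiniteMeasure μ] {f : X → ℂ} (hf : Continuous f) : Integrable f μ := by
  rw [← integrableOn_univ]
  exact hf.continuousOn.integrableOn_compact isCompact_univ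

theorem avg_add {ρ : ℝ} (hρ : 0 ≤ ρ) {f g : ℂ → ℂ} (hf : ContinuousOn f (sphere 0 ρ))
    (hg : ContinuousOn g (sphere 0 ρ)) : avg ρ (fun w => f w + g w) = avg ρ f + avg ρ g :=
  integral_add (integrable_of_continuous_torus (continuous_comp_cis hρ hf))
    (integrable_of_continuous_torus (continuous_comp_cis hρ hg))

theorem avg_sub {ρ : ℝ} (hρ : 0 ≤ ρ) {f g : ℂ → ℂ} (hf : ContinuousOn f (sphere 0 ρ))
    (hg : ContinuousOn g (sphere 0 ρ)) : avg ρ (fun w => f w - g w) = avg ρ f - avg ρ g :=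
  integral_sub (integrable_of_continuous_torus (continuous_comp_cis hρ hf))
    (integrable_of_continuous_torus (continuous_comp_cis hρ hg))

theorem avg_const_mul (ρ : ℝ) (c : ℂ) (f : ℂ → ℂ) : avg ρ (fun w => c * f w) = c * avg ρ f :=
  integral_const_mul _ _

theorem avg_const (ρ : ℝ) (c : ℂ) : avg ρ (fun _ => c) = c := by simp [avg]

theorem norm_avg_le {ρ : ℝ} (hρ : 0 ≤ ρ) {f : ℂ → ℂ} {C : ℝ} (h : ∀ w, ‖w‖ = ρ → ‖f w‖ ≤ C) :
    ‖avg ρ f‖ ≤ C := by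
  have := norm_integral_le_of_norm_le_const (μ := haarAddCircle)
    (f := fun θ => f (ρ * cis θ)) (C := C)
    (Filter.Eventually.of_forall fun θ => h _ (norm_mul_cis hρ θ))
  simpa [avg] using this

theorem avg_eq_circleAverage (ρ : ℝ) (f : ℂ → ℂ) : avg ρ f = Real.circleAverage f 0 ρ := by
  rw [avg, integral_haarAddCircle, ← AddCircle.intervalIntegral_preimage (2 * Real.pi) 0, zero_add,
    Real.circleAverage]
  congr 1
  refine intervalIntegral.integral_congr fun θ _ => ?_
  simp only [cis, circleMap, toCircle_apply_mk, Circle.coe_exp, zero_add]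
  congr 3
  have : Real.pi ≠ 0 := Real.pi_ne_zero
  push_cast
  field_simp

theorem avg_inv (f : ℂ → ℂ) : avg 1 (fun w => f w⁻¹) = avg 1 f := by
  rw [avg_eq_circleAverage, avg_eq_circleAverage]
  exact Real.circleAverage_zero_one_congr_inv

theorem avg_zpow {ρ : ℝ} (n : ℤ) : avg ρ (fun w => w ^ n) = if n = 0 then 1 else 0 := by
  by_cases h : n = 0
  · simp [h, avg_const]
  · rw [if_neg h, avg]
    simp_rw [mul_zpow, cis_zpow]
    rw [integral_const_mul]
    have := fourierCoeff_fourier (T := 2 * Real.pi) n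
    have h0 := congrFun this 0
    rw [Pi.single_eq_of_ne (Ne.symm h)] at h0
    rw [fourierCoeff] at h0
    simp only [neg_zero, fourier_zero, one_smul] at h0
    rw [h0, mul_zero]

theorem avg_swap {ρ σ : ℝ} (hρ : 0 ≤ ρ) (hσ : 0 ≤ σ) {f : ℂ → ℂ → ℂ}
    (hf : ContinuousOn (Function.uncurry f) (sphere 0 ρ ×ˢ sphere 0 σ)) :
    avg ρ (fun a => avg σ fun b => f a b) = avg σ fun b => avg ρ fun a => f a b := by
  refine integral_integral_swap (f := fun x y => f (ρ * cis x) (σ * cis y)) ?_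
  refine integrable_of_continuous_torus ?_
  refine hf.comp_continuous (f := fun x : AddCircle (2 * Real.pi) × AddCircle (2 * Real.pi) =>
    ((ρ : ℂ) * cis x.1, (σ : ℂ) * cis x.2)) (by fun_prop) fun x =>
      ⟨mul_cis_mem_sphere hρ _, mul_cis_mem_sphere hσ _⟩

theorem continuousOn_avg {X : Type*} [TopologicalSpace X] [T2Space X] [FirstCountableTopology X]
    {S : Set X} (hS : IsCompact S) {ρ : ℝ} (hρ : 0 ≤ ρ) {f : X → ℂ → ℂ}
    (hf : ContinuousOn (Function.uncurry f) (S ×ˢ sphere 0 ρ)) :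
    ContinuousOn (fun x => avg ρ (f x)) S := by
  rw [continuousOn_iff_continuous_domRestrict]
  have : CompactSpace S := isCompact_iff_compactSpace.mp hS
  have h := continuous_parametric_integral_of_continuous (X := S) (μ := haarAddCircle)
    (f := fun (x : S) (θ : AddCircle (2 * Real.pi)) => f x (ρ * cis θ)) (s := univ) ?_
    isCompact_univ
  · simpa [avg, Set.domRestrict_def] using h
  · refine hf.comp_continuous (f := fun x : S × AddCircle (2 * Real.pi) =>
      ((x.1 : X), (ρ : ℂ) * cis x.2)) (by fun_prop) fun x => ⟨x.1.2, mul_cis_mem_sphere hρ _⟩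

/-- Termwise integration of an absolutely convergent sum of monomials with arbitrary, possibly
repeated, exponents: only the exponent zero survives. -/
theorem hasSum_avg {ι : Type*} [Countable ι] {ρ : ℝ} (hρ : 0 < ρ) {c : ι → ℂ} {e : ι → ℤ}
    {g : ℂ → ℂ} (hc : Summable fun i => ‖c i‖ * ρ ^ e i)
    (h : ∀ w, ‖w‖ = ρ → HasSum (fun i => c i * w ^ e i) (g w)) :
    HasSum (fun i => c i * if e i = 0 then 1 else 0) (avg ρ g) := by
  have hcont : ∀ i, Continuous fun θ => c i * ((ρ : ℂ) * cis θ) ^ e i := fun i => by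
    refine continuous_const.mul (Continuous.zpow₀ (by fun_prop) _ fun θ => Or.inl ?_)
    exact mul_ne_zero (by exact_mod_cast hρ.ne') (cis_ne_zero θ)
  have hn : ∀ i θ, ‖c i * ((ρ : ℂ) * cis θ) ^ e i‖ = ‖c i‖ * ρ ^ e i := fun i θ => by
    rw [norm_mul, norm_zpow, norm_mul_cis hρ.le]
  have := hasSum_integral_of_summable_integral_norm (μ := haarAddCircle)
    (F := fun i θ => c i * ((ρ : ℂ) * cis θ) ^ e i)
    (fun i => integrable_of_continuous_torus (hcont i)) (by
      simp only [hn, integral_const, probReal_univ, one_smul]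
      exact hc)
  have e1 : ∀ θ, ∑' i, c i * ((ρ : ℂ) * cis θ) ^ e i = g (ρ * cis θ) :=
    fun θ => (h _ (norm_mul_cis hρ.le θ)).tsum_eq
  simp only [e1] at this
  refine this.congr_fun fun i => ?_
  rw [← avg_zpow (ρ := ρ), ← avg_const_mul]
  rfl

/-! ### Moving circular contours. -/

theorem avg_radius_eq {r R : ℝ} (h0 : 0 < r) (hle : r ≤ R) {f : ℂ → ℂ}
    (hd : ∀ w, r ≤ ‖w‖ → ‖w‖ ≤ R → DifferentiableAt ℂ f w) : avg R f = avg r f := by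
  rw [avg_eq_circleAverage, avg_eq_circleAverage,
    Real.circleAverage_eq_circleIntegral (h0.trans_le hle).ne',
    Real.circleAverage_eq_circleIntegral h0.ne']
  congr 1
  refine Complex.circleIntegral_sub_center_inv_smul_eq_of_differentiable_on_annulus_off_countable
    h0 hle countable_empty (fun w hw => ?_) fun w hw => ?_
  · simp only [Set.mem_sdiff, mem_closedBall, mem_ball, dist_zero_right, not_lt] at hw
    exact (hd w hw.2 hw.1).continuousAt.continuousWithinAt
  · simp only [Set.mem_sdiff, mem_closedBall, mem_ball, dist_zero_right, not_le] at hw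
    exact hd w hw.1.2.le hw.1.1.le

theorem avg_inv_sub_of_lt {ρ : ℝ} (hρ : 0 < ρ) {a : ℂ} (ha : ρ < ‖a‖) :
    avg ρ (fun w => (w - a)⁻¹) = -a⁻¹ := by
  have ha0 : a ≠ 0 := by rintro rfl; simp at ha; linarith
  have hlt : ∀ w : ℂ, ‖w‖ = ρ → ‖w / a‖ < 1 := fun w hw => by
    rw [norm_div, hw, div_lt_one (hρ.trans ha)]; exact ha
  have h := hasSum_avg (ι := ℕ) hρ (c := fun p => -(a⁻¹ ^ (p + 1))) (e := fun p => (p : ℤ))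
    (g := fun w => (w - a)⁻¹) ?_ ?_
  · rw [← h.tsum_eq, tsum_eq_single 0]
    · simp
    · intro p hp
      simp [hp]
  · have : ∀ p : ℕ, ‖-(a⁻¹ ^ (p + 1))‖ * ρ ^ (p : ℤ) = ‖a‖⁻¹ * (ρ / ‖a‖) ^ p := fun p => by
      rw [norm_neg, norm_pow, norm_inv, zpow_natCast, div_pow, pow_succ, inv_pow]; ring
    simp only [this]
    exact (summable_geometric_of_lt_one (by positivity)
      (by rwa [div_lt_one (hρ.trans ha)])).mul_left _
  · intro w hw
    have h1 := (hasSum_geometric_of_norm_lt_one (hlt w hw)).mul_left (-a⁻¹)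
    have hne : w - a ≠ 0 := by
      intro h; rw [sub_eq_zero] at h; rw [h] at hw; linarith
    have hne' : a - w ≠ 0 := by rw [← neg_sub]; exact neg_ne_zero.mpr hne
    have e : -a⁻¹ * (1 - w / a)⁻¹ = (w - a)⁻¹ := by
      rw [one_sub_div ha0, inv_div]
      field_simp
      ring
    rw [← e]
    refine h1.congr_fun fun p => ?_
    simp only [zpow_natCast]
    rw [div_pow, pow_succ, inv_pow]; field_simp

theorem avg_inv_sub_of_gt {ρ : ℝ} {a : ℂ} (ha : ‖a‖ < ρ) :
    avg ρ (fun w => (w - a)⁻¹) = 0 := by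
  have hρ : 0 < ρ := (norm_nonneg a).trans_lt ha
  have hlt : ∀ w : ℂ, ‖w‖ = ρ → ‖a / w‖ < 1 := fun w hw => by
    rw [norm_div, hw, div_lt_one hρ]; exact ha
  have h := hasSum_avg (ι := ℕ) hρ (c := fun p => a ^ p) (e := fun p => -((p : ℤ) + 1))
    (g := fun w => (w - a)⁻¹) ?_ ?_
  · rw [← h.tsum_eq]
    have : ∀ p : ℕ, (-((p : ℤ) + 1) = 0) = False := fun p => by
      rw [eq_iff_iff, iff_false]; omega
    simp only [this, if_false, mul_zero, tsum_zero]
  · have : ∀ p : ℕ, ‖a ^ p‖ * ρ ^ (-((p : ℤ) + 1)) = ρ⁻¹ * (‖a‖ / ρ) ^ p := fun p => by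
      rw [norm_pow, zpow_neg, zpow_add_one₀ hρ.ne', zpow_natCast, div_pow]; field_simp
    simp only [this]
    exact (summable_geometric_of_lt_one (by positivity)
      (by rwa [div_lt_one hρ])).mul_left _
  · intro w hw
    have hw0 : w ≠ 0 := by rintro rfl; simp at hw; linarith
    have h1 := (hasSum_geometric_of_norm_lt_one (hlt w hw)).mul_left (w⁻¹)
    have e : w⁻¹ * (1 - a / w)⁻¹ = (w - a)⁻¹ := by
      rw [one_sub_div hw0, inv_div]
      field_simp
    rw [← e]
    refine h1.congr_fun fun p => ?_
    rw [zpow_neg, zpow_add_one₀ hw0, zpow_natCast, div_pow]; field_simp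

/-- Moving the contour across a simple pole. -/
theorem avg_residue {r R : ℝ} (h0 : 0 < r) {g : ℂ → ℂ} {a : ℂ} (hra : r < ‖a‖) (haR : ‖a‖ < R)
    (hd : ∀ w, r ≤ ‖w‖ → ‖w‖ ≤ R → DifferentiableAt ℂ g w) :
    avg r (fun w => g w / (w - a)) = avg R (fun w => g w / (w - a)) - g a / a := by
  have hU : {w : ℂ | r < ‖w‖ ∧ ‖w‖ < R} ∈ 𝓝 a :=
    ((isOpen_lt continuous_const continuous_norm).inter
      (isOpen_lt continuous_norm continuous_const)).mem_nhds ⟨hra, haR⟩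
  -- Splitting `g(w)/(w - a)` into `dslope g a w` and `g(a)/(w - a)` leaves a holomorphic part,
  -- whose average does not depend on the radius, and an explicit one, whose average is `-1/a`
  -- inside the pole and `0` outside. The extra `1/a` comes from the measure `dw/w`.
  have hds : ∀ w, r ≤ ‖w‖ → ‖w‖ ≤ R → DifferentiableAt ℂ (dslope g a) w := by
    intro w h1 h2
    by_cases hwa : w = a
    · subst hwa
      have : DifferentiableOn ℂ (dslope g w) {w : ℂ | r < ‖w‖ ∧ ‖w‖ < R} :=
        (Complex.differentiableOn_dslope hU).mpr fun x hx =>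
          (hd x hx.1.le hx.2.le).differentiableWithinAt
      exact this.differentiableAt hU
    · exact (differentiableAt_dslope_of_ne hwa).mpr (hd w h1 h2)
  have key : ∀ ρ, 0 < ρ → r ≤ ρ → ρ ≤ R → ρ ≠ ‖a‖ → avg ρ (fun w => g w / (w - a)) =
      avg ρ (dslope g a) + g a * avg ρ fun w => (w - a)⁻¹ := by
    intro ρ hρ h1 h2 h3
    have hne : ∀ w ∈ sphere (0 : ℂ) ρ, w - a ≠ 0 := fun w hw h => by
      rw [sub_eq_zero] at h; rw [mem_sphere_zero_iff_norm] at hw; exact h3 (by rw [← hw, h])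
    rw [← avg_const_mul, ← avg_add hρ.le]
    · refine avg_congr hρ.le fun w hw => ?_
      have hwa := hne w (mem_sphere_zero_iff_norm.mpr hw)
      rw [dslope_of_ne _ (sub_ne_zero.mp hwa), slope_def_field]
      field_simp
      ring
    · intro w hw
      rw [mem_sphere_zero_iff_norm] at hw
      exact (hds w (by linarith) (by linarith)).continuousAt.continuousWithinAt
    · exact continuousOn_const.mul ((continuousOn_id.sub continuousOn_const).inv₀ hne)
  have hrR : r < R := hra.trans haR
  rw [key r h0 le_rfl hrR.le hra.ne, key R (h0.trans hrR) hrR.le le_rfl haR.ne',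
    avg_radius_eq h0 hrR.le hds, avg_inv_sub_of_lt h0 hra, avg_inv_sub_of_gt haR]
  ring

/-! ### Laurent expansions on circles and tori, from Fourier series. -/

theorem hasSum_laurent {ρ : ℝ} (hρ : 0 < ρ) {f : ℂ → ℂ} (hf : ContinuousOn f (sphere 0 ρ))
    (hs : Summable fun k : ℤ => ‖avg ρ (fun w => w ^ (-k) * f w)‖ * ρ ^ k) {w : ℂ} (hw : ‖w‖ = ρ) :
    HasSum (fun k : ℤ => avg ρ (fun w => w ^ (-k) * f w) * w ^ k) (f w) := by
  obtain ⟨θ, rfl⟩ := exists_eq_mul_cis hρ hw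
  have hρ' : (ρ : ℂ) ≠ 0 := by exact_mod_cast hρ.ne'
  set F : C(AddCircle (2 * Real.pi), ℂ) := ⟨fun θ => f (ρ * cis θ), continuous_comp_cis hρ.le hf⟩
  have e : ∀ k, fourierCoeff F k = avg ρ (fun w => w ^ (-k) * f w) * (ρ : ℂ) ^ k := fun k => by
    rw [fourierCoeff, avg, ← integral_mul_const]
    refine integral_congr_ae (Filter.Eventually.of_forall fun x => ?_)
    simp only [smul_eq_mul, ← cis_zpow, mul_zpow]
    have : (ρ : ℂ) ^ (-k) * (ρ : ℂ) ^ k = 1 := by rw [← zpow_add₀ hρ', neg_add_cancel, zpow_zero]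
    change cis x ^ (-k) * f (ρ * cis x) = _
    linear_combination (-(cis x ^ (-k) * f (ρ * cis x))) * this
  have hs' : Summable (fourierCoeff F) := by
    apply Summable.of_norm
    refine hs.congr fun k => ?_
    rw [e, norm_mul, norm_zpow, Complex.norm_of_nonneg hρ.le]
  refine (has_pointwise_sum_fourier_series_of_summable hs' θ).congr_fun fun k => ?_
  rw [e, smul_eq_mul, ← cis_zpow, mul_zpow, mul_assoc]

/-- Only continuity and absolute summability of the coefficients are required: the one-variable
expansion is applied first in `b`, to each coefficient function of `a^k`, and then in `a`. -/
theorem hasSum_laurent_two {ρ σ : ℝ} (hρ : 0 < ρ) (hσ : 0 < σ) {f : ℂ → ℂ → ℂ}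
    (hf : ContinuousOn (Function.uncurry f) (sphere 0 ρ ×ˢ sphere 0 σ))
    {c : ℤ → ℤ → ℂ}
    (hc : ∀ k l, c k l = avg ρ fun a => avg σ fun b => a ^ (-k) * b ^ (-l) * f a b)
    (hs : Summable fun p : ℤ × ℤ => ‖c p.1 p.2‖ * (ρ ^ p.1 * σ ^ p.2))
    {a b : ℂ} (ha : ‖a‖ = ρ) (hb : ‖b‖ = σ) :
    HasSum (fun p : ℤ × ℤ => c p.1 p.2 * (a ^ p.1 * b ^ p.2)) (f a b) := by
  have hsa : ∀ k : ℤ, ContinuousOn (fun w : ℂ => w ^ (-k)) (sphere 0 ρ) := fun k w hw =>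
    (continuousAt_zpow₀ w _ (Or.inl (by
      rintro rfl; simp at hw; linarith))).continuousWithinAt
  have hsb : ∀ k : ℤ, ContinuousOn (fun w : ℂ => w ^ (-k)) (sphere 0 σ) := fun k w hw =>
    (continuousAt_zpow₀ w _ (Or.inl (by
      rintro rfl; simp at hw; linarith))).continuousWithinAt
  -- the coefficients of `a^k`
  set g : ℤ → ℂ → ℂ := fun k b => avg ρ fun a => a ^ (-k) * f a b
  have hg : ∀ k, ContinuousOn (g k) (sphere 0 σ) := fun k => by
    refine continuousOn_avg (isCompact_sphere _ _) hρ.le (f := fun b a => a ^ (-k) * f a b) ?_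
    exact ((hsa k).comp continuousOn_snd fun x hx => hx.2).mul
      (hf.comp (f := fun x : ℂ × ℂ => (x.2, x.1)) (by fun_prop) fun x hx => ⟨hx.2, hx.1⟩)
  have hc' : ∀ k l, c k l = avg σ fun b => b ^ (-l) * g k b := fun k l => by
    rw [hc, avg_swap hρ.le hσ.le]
    · refine congrArg _ (funext fun b => ?_)
      rw [← avg_const_mul]
      refine congrArg _ (funext fun a => ?_)
      ring
    · exact (((hsa k).comp continuousOn_fst fun x hx => hx.1).mul
        ((hsb l).comp continuousOn_snd fun x hx => hx.2)).mul hf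
  have hs0 : Summable fun p : ℤ × ℤ => c p.1 p.2 * (a ^ p.1 * b ^ p.2) := by
    apply Summable.of_norm
    refine hs.congr fun p => ?_
    rw [norm_mul, norm_mul, norm_zpow, norm_zpow, ha, hb]
  have hsl : ∀ k, Summable fun l => ‖c k l‖ * σ ^ l := fun k => by
    have h1 := hs.prod_factor k
    have h2 := h1.mul_left ((ρ ^ k)⁻¹)
    refine h2.congr fun l => ?_
    have : ρ ^ k ≠ 0 := zpow_ne_zero _ hρ.ne'
    field_simp
  have hfib : ∀ k, HasSum (fun l => c k l * (a ^ k * b ^ l)) (g k b * a ^ k) := fun k => by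
    have h1 := hasSum_laurent hσ (hg k) (by simpa only [← hc'] using hsl k) hb
    simp only [← hc'] at h1
    refine (h1.mul_right (a ^ k)).congr_fun fun l => by ring
  have htot := hs0.hasSum.prod_fiberwise hfib
  have hfa : ContinuousOn (fun a => f a b) (sphere 0 ρ) :=
    hf.comp (f := fun a => (a, b)) (by fun_prop) fun x hx =>
      ⟨hx, mem_sphere_zero_iff_norm.mpr hb⟩
  have hgs : Summable fun k => ‖g k b‖ * ρ ^ k := by
    refine htot.summable.norm.congr fun k => ?_
    rw [norm_mul, norm_zpow, ha]
  have h2 := hasSum_laurent hρ hfa hgs ha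
  rw [h2.unique htot]
  exact hs0.hasSum

end IzerginKorepin

namespace IzerginKorepin
open PowerSeries

/-! ### Normal ordered modes -/

theorem finsum_of_holds {M : Type*} [AddCommMonoid M] {p : Prop} (hp : p) (x : M) :
    ∑ᶠ _ : p, x = x := by
  classical
  rw [finsum_eq_if, if_pos hp]

theorem finsum_of_fails {M : Type*} [AddCommMonoid M] {p : Prop} (hp : ¬p) (x : M) :
    ∑ᶠ _ : p, x = 0 := by
  classical
  rw [finsum_eq_if, if_neg hp]

/-- The coefficient of `ζ^k` in `exp (∑ r_m X_m ζ^m) exp (∑ t_m ∂_m ζ^{-m})`. -/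
def polyMode (r t : ℕ → ℂ) (k : ℤ) (f : Poly) : Poly :=
  ∑ᶠ (p : ℕ × ℕ) (_ : (p.1 : ℤ) - p.2 = k), creMode r p.1 (annMode t p.2 f)

theorem finite_support_polyMode (r t : ℕ → ℂ) (k : ℤ) (f : Poly) :
    (Function.support fun p : ℕ × ℕ => ∑ᶠ (_ : (p.1 : ℤ) - p.2 = k),
      creMode r p.1 (annMode t p.2 f)).Finite := by
  obtain ⟨N, hN⟩ := exists_annMode_eq_zero t f
  refine ((Finset.range (N + k.natAbs + 1) ×ˢ Finset.range N).finite_toSet).subset fun p hp => ?_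
  rw [Function.mem_support] at hp
  have h1 : (p.1 : ℤ) - p.2 = k := by
    by_contra h
    exact hp (by rw [finsum_of_fails h])
  have h2 : p.2 < N := by
    by_contra h
    apply hp
    rw [hN _ (not_lt.mp h)]
    simp
  simp only [Finset.coe_product, Finset.coe_range, Set.mem_prod, Set.mem_Iio]
  omega

/-- A mode of a normally ordered exponential is a circle average of its generating function: the
creation part gives the scalar and one half of the shift, the annihilation part the other half. The
double series over both mode indices converges absolutely because the annihilation index is bounded
by `N`. -/
theorem gauss_polyMode {a b r t : ℕ → ℂ} (hr : r 0 = 0) {ρ : ℝ} (hρ : 0 < ρ)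
    (h1 : Summable fun m => ‖a m * r m ^ 2 * (ρ : ℂ) ^ (2 * m)‖)
    (h2 : Summable fun m => ‖r m * b m * (ρ : ℂ) ^ m‖) (k : ℤ) (f : Poly) :
    gauss a b (polyMode r t k f) = avg ρ fun ζ => ζ ^ (-k) *
      (gaussGen a b r ζ * gauss a (fun m => b m + (a m * r m * ζ ^ m + t m * ζ⁻¹ ^ m)) f) := by
  obtain ⟨N, hN⟩ := exists_annMode_eq_zero t f
  set c : ℕ × ℕ → ℂ := fun p => gauss a b (creMode r p.1 (annMode t p.2 f)) with hc
  have hc0 : ∀ p : ℕ × ℕ, N ≤ p.2 → c p = 0 := fun p hp => by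
    simp only [hc]; rw [hN _ hp, map_zero, map_zero]
  have n1 : ∀ ζ : ℂ, ‖ζ‖ = ρ → Summable fun m => ‖a m * r m ^ 2 * ζ ^ (2 * m)‖ := fun ζ hζ => by
    refine h1.congr fun m => ?_
    simp only [norm_mul, norm_pow, hζ, Complex.norm_of_nonneg hρ.le]
  have n2 : ∀ ζ : ℂ, ‖ζ‖ = ρ → Summable fun m => ‖r m * b m * ζ ^ m‖ := fun ζ hζ => by
    refine h2.congr fun m => ?_
    simp only [norm_mul, norm_pow, hζ, Complex.norm_of_nonneg hρ.le]
  have hcs : ∀ p2, Summable fun p1 => ‖c (p1, p2)‖ * ρ ^ p1 := fun p2 => by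
    have hρ' : ‖(ρ : ℂ)‖ = ρ := Complex.norm_of_nonneg hρ.le
    have := (hasSum_gauss_creMode (a := a) (b := b) hr (n1 _ hρ') (n2 _ hρ')
      (annMode t p2 f)).summable.norm
    refine this.congr fun p => ?_
    rw [norm_mul, norm_pow, hρ']
  have hpow : ∀ p : ℕ × ℕ, ρ ^ ((p.1 : ℤ) - p.2 - k) = ρ ^ p.1 * ρ ^ (-(p.2 : ℤ) - k) := fun p => by
    rw [← zpow_natCast, ← zpow_add₀ hρ.ne']; congr 1; ring
  have hs : Summable fun p : ℕ × ℕ => ‖c p‖ * ρ ^ ((p.1 : ℤ) - p.2 - k) := by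
    rw [← (Equiv.prodComm ℕ ℕ).summable_iff, summable_prod_of_nonneg (fun p => by
      simp only [Pi.zero_apply, Function.comp_apply]; positivity)]
    constructor
    · intro p2
      refine ((hcs p2).mul_right (ρ ^ (-(p2 : ℤ) - k))).congr fun p1 => ?_
      simp only [Function.comp_apply, Equiv.prodComm_apply, Prod.swap_prod_mk, hpow, mul_assoc]
    · refine summable_of_ne_finset_zero (s := Finset.range N) fun p2 hp => ?_
      rw [Finset.mem_range, not_lt] at hp
      have : ∀ p1, c (p1, p2) = 0 := fun p1 => hc0 _ hp
      simp [this]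
  have hsum : ∀ ζ : ℂ, ‖ζ‖ = ρ → HasSum (fun p : ℕ × ℕ => c p * ζ ^ ((p.1 : ℤ) - p.2 - k))
      (ζ ^ (-k) * (gaussGen a b r ζ *
        gauss a (fun m => b m + (a m * r m * ζ ^ m + t m * ζ⁻¹ ^ m)) f)) := by
    intro ζ hζ
    have hζ0 : ζ ≠ 0 := by rintro rfl; simp at hζ; linarith
    have hzp : ∀ p1 p2 : ℕ, ζ ^ ((p1 : ℤ) - p2 - k) = ζ ^ (-k) * ζ⁻¹ ^ p2 * ζ ^ p1 := by
      intro p1 p2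
      rw [inv_pow, ← zpow_natCast ζ p1, ← zpow_natCast ζ p2, ← zpow_neg, ← zpow_add₀ hζ0,
        ← zpow_add₀ hζ0]
      congr 1; ring
    have hS : Summable fun p : ℕ × ℕ => c p * ζ ^ ((p.1 : ℤ) - p.2 - k) := by
      apply Summable.of_norm
      refine hs.congr fun p => ?_
      rw [norm_mul, norm_zpow, hζ]
    have hS' := (Equiv.prodComm ℕ ℕ).hasSum_iff.mpr hS.hasSum
    have hf1 := hS'.prod_fiberwise (g := fun p2 => ζ ^ (-k) * (gaussGen a b r ζ *
        (gauss a (fun m => b m + a m * r m * ζ ^ m) (annMode t p2 f) * ζ⁻¹ ^ p2))) fun p2 => by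
      have := (hasSum_gauss_creMode (a := a) (b := b) hr (n1 _ hζ) (n2 _ hζ)
        (annMode t p2 f)).mul_left (ζ ^ (-k) * ζ⁻¹ ^ p2)
      rw [show ζ ^ (-k) * (gaussGen a b r ζ *
        (gauss a (fun m => b m + a m * r m * ζ ^ m) (annMode t p2 f) * ζ⁻¹ ^ p2)) =
        ζ ^ (-k) * ζ⁻¹ ^ p2 * (gaussGen a b r ζ *
          gauss a (fun m => b m + a m * r m * ζ ^ m) (annMode t p2 f)) by ring]
      refine this.congr_fun fun p1 => ?_
      simp only [Function.comp_apply, Equiv.prodComm_apply, Prod.swap_prod_mk, hzp, hc]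
      ring
    have hf2 := ((hasSum_gauss_annMode a (fun m => b m + a m * r m * ζ ^ m) t ζ⁻¹ f).mul_left
      (gaussGen a b r ζ)).mul_left (ζ ^ (-k))
    simp only [add_assoc] at hf1 hf2 ⊢
    rw [hf2.unique hf1]
    exact hS.hasSum
  have hfin := hasSum_avg hρ hs hsum
  rw [← hfin.tsum_eq]
  have e1 : gauss a b (polyMode r t k f) =
      ∑ᶠ p : ℕ × ℕ, c p * if (p.1 : ℤ) - p.2 - k = 0 then 1 else 0 := by
    rw [polyMode, ← LinearMap.toAddMonoidHom_coe,
      AddMonoidHom.map_finsum _ (finite_support_polyMode r t k f)]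
    refine finsum_congr fun p => ?_
    by_cases h : (p.1 : ℤ) - p.2 = k
    · rw [finsum_of_holds h, if_pos (by omega), mul_one]; rfl
    · rw [finsum_of_fails h, map_zero, if_neg (by omega), mul_zero]
  rw [e1, tsum_eq_finsum]
  refine (finite_support_polyMode r t k f).subset fun p hp => ?_
  intro h0
  apply hp
  by_cases h : (p.1 : ℤ) - p.2 = k
  · replace h0 := (finsum_of_holds h _).symm.trans h0
    simp only [hc, h0, map_zero, zero_mul]
  · simp only; rw [if_neg (by omega), mul_zero]

theorem polyMode_zero (r t : ℕ → ℂ) (k : ℤ) : polyMode r t k 0 = 0 := by simp [polyMode]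

/-! ### Components of the operators on the Fock space -/

/-- The action of an endomorphism of the polynomial ring on all components. -/
def onComponents : Module.End ℂ Poly →ₐ[ℂ] Module.End ℂ FockSpace where
  toFun A := Finsupp.mapRange.linearMap A
  map_one' := by
    refine LinearMap.ext fun v => Finsupp.ext fun n => ?_
    simp
  map_mul' A B := by
    refine LinearMap.ext fun v => Finsupp.ext fun n => ?_
    simp
  map_zero' := by
    refine LinearMap.ext fun v => Finsupp.ext fun n => ?_
    simp
  map_add' A B := by
    refine LinearMap.ext fun v => Finsupp.ext fun n => ?_
    simp
  commutes' c := by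
    refine LinearMap.ext fun v => Finsupp.ext fun n => ?_
    simp [Algebra.algebraMap_eq_smul_one]

theorem onComponents_apply (A : Module.End ℂ Poly) (v : FockSpace) (n : ℤ) :
    onComponents A v n = A (v n) := rfl

/-- `[a_m, a_{-m}]`. -/
def bosonNorm (h : ℂ) (m : ℕ) : ℂ := qInt h m / m * cInt h m

theorem boson_neg (h : ℂ) (m : ℕ) : boson h (-(m : ℤ)) = onComponents (cre m) := by
  suffices H : bosonAux h (-(m : ℤ)) = cre m by rw [boson, H]; rfl
  rcases Nat.eq_zero_or_pos m with rfl | hm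
  · simp [bosonAux, cre]
  · have h1 : ¬ (0 : ℤ) < -(m : ℤ) := by omega
    have h2 : -(m : ℤ) < 0 := by omega
    refine (dif_neg h1).trans ((dif_pos h2).trans ?_)
    lift m to ℕ+ using hm
    rw [cre_coe]
    have : (⟨(- -((m : ℕ) : ℤ)).toNat, by omega⟩ : ℕ+) = m := PNat.eq (by simp)
    rw [this]

theorem boson_pos (h : ℂ) (m : ℕ) : boson h (m : ℤ) = onComponents (bosonNorm h m • ann m) := by
  suffices H : bosonAux h (m : ℤ) = bosonNorm h m • ann m by rw [boson, H]; rfl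
  rcases Nat.eq_zero_or_pos m with rfl | hm
  · simp [bosonAux, ann]
  · have h1 : (0 : ℤ) < (m : ℤ) := by omega
    refine (dif_pos h1).trans ?_
    lift m to ℕ+ using hm
    rw [ann_coe]
    have : (⟨((m : ℕ) : ℤ).toNat, by omega⟩ : ℕ+) = m := PNat.eq (by simp)
    rw [this]
    simp only [bosonNorm, Int.cast_natCast]
    rfl

/-- The bosons act on all components by the same endomorphism of the polynomial ring, and
`onComponents` is an algebra map, so it commutes with formal exponentials. The factor `bosonNorm`
turns `a_m` into a plain derivative. -/
theorem normalMode_apply (h : ℂ) (r t : ℕ → ℂ) (k : ℤ) (v : FockSpace) (n : ℤ) :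
    normalMode h r t k v n = polyMode r (fun m => t m * bosonNorm h m) k (v n) := by
  have e1 : (PowerSeries.mk fun m => r m • boson h (-(m : ℤ))) =
      PowerSeries.map (onComponents : Module.End ℂ Poly →+* Module.End ℂ FockSpace)
        (PowerSeries.mk fun m => r m • cre m) := by
    ext1 m
    simp only [coeff_mk, PowerSeries.coeff_map, RingHom.coe_coe, map_smul, boson_neg]
  have e2 : (PowerSeries.mk fun m => t m • boson h (m : ℤ)) =
      PowerSeries.map (onComponents : Module.End ℂ Poly →+* Module.End ℂ FockSpace)
        (PowerSeries.mk fun m => (t m * bosonNorm h m) • ann m) := by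
    ext1 m
    simp only [coeff_mk, PowerSeries.coeff_map, RingHom.coe_coe, map_smul, boson_pos, mul_smul]
  have e3 : ∀ f, formalExp f = pexp f := fun f => rfl
  rw [normalMode, e1, e2, e3, e3, pexp_map, pexp_map]
  simp only [PowerSeries.coeff_map, RingHom.coe_coe]
  obtain ⟨N, hN⟩ : ∃ N, ∀ p, N ≤ p →
      onComponents (annMode (fun m => t m * bosonNorm h m) p) v = 0 := by
    choose N hN using fun n => exists_annMode_eq_zero (fun m => t m * bosonNorm h m) (v n)
    refine ⟨v.support.sup N, fun p hp => Finsupp.ext fun n => ?_⟩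
    rw [onComponents_apply]
    by_cases hn : n ∈ v.support
    · rw [hN n p ((Finset.le_sup hn).trans hp)]; rfl
    · rw [Finsupp.notMem_support_iff.mp hn, map_zero]; rfl
  have hfin : (Function.support fun p : ℕ × ℕ => ∑ᶠ (_ : (p.1 : ℤ) - p.2 = k),
      onComponents (creMode r p.1)
        (onComponents (annMode (fun m => t m * bosonNorm h m) p.2) v)).Finite := by
    refine ((Finset.range (N + k.natAbs + 1) ×ˢ Finset.range N).finite_toSet).subset
      fun p hp => ?_
    rw [Function.mem_support] at hp
    have h1 : (p.1 : ℤ) - p.2 = k := by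
      by_contra h
      exact hp (by rw [finsum_of_fails h])
    have h2 : p.2 < N := by
      by_contra h
      apply hp
      rw [hN _ (not_lt.mp h)]
      simp
    simp only [Finset.coe_product, Finset.coe_range, Set.mem_prod, Set.mem_Iio]
    omega
  change (Finsupp.applyAddHom n) (∑ᶠ (p : ℕ × ℕ) (_ : (p.1 : ℤ) - p.2 = k),
    onComponents (creMode r p.1)
      (onComponents (annMode (fun m => t m * bosonNorm h m) p.2) v)) = _
  rw [AddMonoidHom.map_finsum _ hfin, polyMode]
  refine finsum_congr fun p => ?_
  by_cases hp : (p.1 : ℤ) - p.2 = k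
  · rw [finsum_of_holds hp, finsum_of_holds hp]
    simp only [Finsupp.applyAddHom_apply, onComponents_apply]
  · rw [finsum_of_fails hp, finsum_of_fails hp, map_zero]

theorem expQ_apply (j : ℤ) (v : FockSpace) (n : ℤ) : expQ j v n = v (n - j) := by
  have := Finsupp.mapDomain_apply (f := fun k : ℤ => k + j) (add_left_injective j) v (n - j)
  simpa [expQ] using this

/-- The creation and annihilation coefficients of `x^-`. -/
def xCre (h : ℂ) (i : ℕ) : ℂ := -(h ^ i / qInt h i)

def xAnn (h : ℂ) (i : ℕ) : ℂ := h ^ i / qInt h i * bosonNorm h i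

/-- The creation and annihilation coefficients of `Φ_-`. -/
def phiCre (h : ℂ) (i : ℕ) : ℂ := h ^ (9 * i) / cInt h i

def phiAnn (h : ℂ) (i : ℕ) : ℂ := -((h ^ (7 * i))⁻¹ / cInt h i) * bosonNorm h i

theorem sum_apply_single {v : FockSpace} {G : ℤ → Poly → FockSpace} {n n' : ℤ}
    (h0 : ∀ m, G m 0 = 0) (h : ∀ m, m ≠ n' → G m (v m) n = 0) :
    (v.sum G) n = G n' (v n') n := by
  rw [Finsupp.sum, Finsupp.finsetSum_apply]
  rw [Finset.sum_eq_single n']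
  · intro m _ hm; exact h m hm
  · intro hn; rw [Finsupp.notMem_support_iff.mp hn, h0]; rfl

theorem normalMode_zero (h : ℂ) (r t : ℕ → ℂ) (k : ℤ) : normalMode h r t k 0 = 0 := by
  simp [normalMode]

/-- The component `n` is fed by the component `n + 1`, on which `w^{-P+1/2}` is `w^{-(n+1)}`;
extracting the coefficient of `w^0` therefore needs the mode `n + 1`. -/
theorem xMinus_apply (h : ℂ) (v : FockSpace) (n : ℤ) :
    xMinus h 0 v n = epsQ h • polyMode (xCre h) (xAnn h) (n + 1) (v (n + 1)) := by
  rw [xMinus, sum_apply_single (n' := n + 1)]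
  · rw [Finsupp.smul_apply, normalMode_apply, expQ_apply, sub_neg_eq_add, Finsupp.single_eq_same]
    simp only [neg_zero, zero_add]
    rfl
  · intro m; rw [Finsupp.single_zero, map_zero, normalMode_zero, smul_zero]
  · intro m hm
    rw [Finsupp.smul_apply, normalMode_apply, expQ_apply, sub_neg_eq_add,
      Finsupp.single_eq_of_ne (Ne.symm hm), polyMode_zero, smul_zero]

theorem vertexMinus_apply (h : ℂ) (k : ℤ) (v : FockSpace) (n : ℤ) :
    vertexMinus h k v n = ((epsQ h)⁻¹ * (-(h ^ 2) ^ 4) ^ n) •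
      polyMode (phiCre h) (phiAnn h) (k - n) (v (n - 1)) := by
  rw [vertexMinus, sum_apply_single (n' := n - 1)]
  · rw [Finsupp.smul_apply, normalMode_apply, expQ_apply, Finsupp.single_eq_same, sub_add_cancel]
    rfl
  · intro m; rw [Finsupp.single_zero, map_zero, normalMode_zero, smul_zero]
  · intro m hm
    rw [Finsupp.smul_apply, normalMode_apply, expQ_apply,
      Finsupp.single_eq_of_ne (Ne.symm hm), polyMode_zero, smul_zero]

/-! ### The dual ground state -/

/-- The variances of the dual ground state. -/
def bdVar (h : ℂ) (m : ℕ) : ℂ :=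
  -((m : ℂ) * ((h ^ 2) ^ (2 * m))⁻¹ / (qInt h m * cInt h m)) * (bosonNorm h m * bosonNorm h m)

/-- The means of the dual ground state. -/
def bdMean (h : ℂ) (ε : SignType) (m : ℕ) : ℂ := gLinear h ε m.toPNat' * bosonNorm h m

theorem gBosonic_apply (h : ℂ) (ε : SignType) (v : FockSpace) (n : ℤ) :
    gBosonic h ε v n = gaussOp (bdVar h) (bdMean h ε) (v n) := by
  have hterm : ∀ m : ℕ+, ∀ n, (((-(1 / 2) * ((m : ℕ) * ((h ^ 2) ^ (2 * (m : ℕ)))⁻¹ /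
        (qInt h (m : ℕ) * cInt h (m : ℕ)))) •
        boson h (m : ℕ) (boson h (m : ℕ) v) +
      gLinear h ε m • boson h (m : ℕ) v) : FockSpace) n =
      ((1 / 2 * bdVar h m) • MvPolynomial.pderiv m (MvPolynomial.pderiv m (v n)) +
        bdMean h ε m • MvPolynomial.pderiv m (v n)) := fun m n => by
    rw [boson_pos, Finsupp.add_apply, Finsupp.smul_apply, Finsupp.smul_apply, onComponents_apply,
      onComponents_apply, ann_coe]
    simp only [LinearMap.smul_apply, Derivation.coeFn_coe, Derivation.map_smul, smul_smul, bdVar,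
      bdMean, PNat.coe_toPNat']
    congr 2
    ring
  rw [gBosonic]
  change (Finsupp.applyAddHom n) (∑ᶠ m : ℕ+, _) = _
  rw [AddMonoidHom.map_finsum]
  · rw [gaussOp_apply]
    exact finsum_congr fun m => hterm m n
  · refine ((v.support.biUnion fun n => (v n).vars).finite_toSet).subset fun m hm => ?_
    by_contra hmem
    apply hm
    refine Finsupp.ext fun n => ?_
    rw [hterm]
    by_cases hn : n ∈ v.support
    · have : m ∉ (v n).vars := fun h' => hmem (by
        rw [Finset.mem_coe, Finset.mem_biUnion]; exact ⟨n, hn, h'⟩)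
      simp [MvPolynomial.pderiv_eq_zero_of_notMem_vars this]
    · rw [Finsupp.notMem_support_iff.mp hn]; simp

theorem iterate_gBosonic_apply (h : ℂ) (ε : SignType) (v : FockSpace) (n : ℤ) (k : ℕ) :
    (gBosonic h ε)^[k] v n = (gaussOp (bdVar h) (bdMean h ε))^[k] (v n) := by
  induction k with
  | zero => rfl
  | succ k ih => rw [Function.iterate_succ_apply', gBosonic_apply, ih, Function.iterate_succ_apply']

/-- The factor `e^{-ε²Q}` moves the component `ε²` to the component `0`, which is the one that
`⟨Λ_1|` reads. -/
theorem dualGroundState_eq (h : ℂ) (ε : SignType) (v : FockSpace) :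
    dualGroundState h ε v = gauss (bdVar h) (bdMean h ε) (v ((ε : ℤ) ^ 2)) := by
  rw [dualGroundState, dualHighestWeight, gauss_apply]
  congr 1
  rw [expG]
  change (Finsupp.applyAddHom (0 : ℤ)) (∑ᶠ k : ℕ, _) = _
  rw [AddMonoidHom.map_finsum]
  · refine finsum_congr fun k => ?_
    rw [Finsupp.applyAddHom_apply, Finsupp.smul_apply, iterate_gBosonic_apply, expQ_apply, zero_sub,
      neg_neg]
  · choose N hN using fun n => exists_iterate_gaussOp_eq_zero (bdVar h) (bdMean h ε)
      ((expQ (-(ε : ℤ) ^ 2) v) n)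
    refine (Set.finite_lt_nat ((expQ (-(ε : ℤ) ^ 2) v).support.sup N)).subset fun k hk => ?_
    by_contra hlt
    apply hk
    refine Finsupp.ext fun n => ?_
    simp only [Set.mem_ofPred_eq, not_lt] at hlt
    rw [Finsupp.smul_apply, iterate_gBosonic_apply]
    by_cases hn : n ∈ (expQ (-(ε : ℤ) ^ 2) v).support
    · rw [hN n k ((Finset.le_sup hn).trans hlt), smul_zero]; rfl
    · rw [Finsupp.notMem_support_iff.mp hn, ← Module.End.pow_apply, map_zero, smul_zero]; rfl

theorem isLinearMap_dualGroundState (h : ℂ) (ε : SignType) :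
    IsLinearMap ℂ (dualGroundState h ε) where
  map_add v w := by simp [dualGroundState_eq]
  map_smul c v := by simp [dualGroundState_eq]

end IzerginKorepin

namespace IzerginKorepin

/-! ### Exponentials of power series -/

/-- `E` is the exponential of `∑ c_m z^m`. -/
def ExpSum (c : ℕ → ℂ) (z E : ℂ) : Prop :=
  ∃ S, HasSum (fun m => c m * z ^ m) S ∧ Complex.exp S = E

theorem ExpSum.congr {c d : ℕ → ℂ} {z E : ℂ} (h : ExpSum c z E) (hcd : ∀ m, c m = d m) :
    ExpSum d z E := by rwa [← funext hcd]

theorem ExpSum.mul {c d : ℕ → ℂ} {z E E' : ℂ} (h : ExpSum c z E) (h' : ExpSum d z E') :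
    ExpSum (fun m => c m + d m) z (E * E') := by
  obtain ⟨S, hS, rfl⟩ := h
  obtain ⟨T, hT, rfl⟩ := h'
  exact ⟨S + T, by simpa only [add_mul] using hS.add hT, Complex.exp_add S T⟩

theorem ExpSum.inv {c : ℕ → ℂ} {z E : ℂ} (h : ExpSum c z E) :
    ExpSum (fun m => -c m) z E⁻¹ := by
  obtain ⟨S, hS, rfl⟩ := h
  exact ⟨-S, by simpa only [neg_mul] using hS.neg, Complex.exp_neg S⟩

theorem ExpSum.div {c d : ℕ → ℂ} {z E E' : ℂ} (h : ExpSum c z E) (h' : ExpSum d z E') :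
    ExpSum (fun m => c m - d m) z (E / E') := by
  simpa only [sub_eq_add_neg, div_eq_mul_inv] using h.mul h'.inv

/-- The tool for identities between infinite products: write both sides as exponentials of power
series and compare logarithmic coefficients, which are rational in `h ^ m`. No branch of the
logarithm has to be chosen. -/
theorem ExpSum.unique {c : ℕ → ℂ} {z E E' : ℂ} (h : ExpSum c z E) (h' : ExpSum c z E') :
    E = E' := by
  obtain ⟨S, hS, rfl⟩ := h
  obtain ⟨T, hT, rfl⟩ := h'
  rw [hS.unique hT]

theorem ExpSum.ne_zero {c : ℕ → ℂ} {z E : ℂ} (h : ExpSum c z E) : E ≠ 0 := by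
  obtain ⟨S, -, rfl⟩ := h
  exact Complex.exp_ne_zero S

theorem ExpSum.eq_exp {c : ℕ → ℂ} {z E : ℂ} (h : ExpSum c z E) :
    E = Complex.exp (∑' m, c m * z ^ m) := by
  obtain ⟨S, hS, rfl⟩ := h
  rw [hS.tsum_eq]

theorem ExpSum.summable {c : ℕ → ℂ} {z E : ℂ} (h : ExpSum c z E) :
    Summable fun m => ‖c m * z ^ m‖ := by
  obtain ⟨S, hS, -⟩ := h
  exact hS.summable.norm

theorem expSum_of_summable {c : ℕ → ℂ} {z : ℂ} (h : Summable fun m => c m * z ^ m) :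
    ExpSum c z (Complex.exp (∑' m, c m * z ^ m)) := ⟨_, h.hasSum, rfl⟩

/-- Factors in `z²` and factors in `z` must share one series in `z`; this is why parity splittings
appear in the coefficient comparisons. -/
theorem ExpSum.even {c : ℕ → ℂ} {z E : ℂ} (h : ExpSum c (z ^ 2) E) :
    ExpSum (fun m => if Even m then c (m / 2) else 0) z E := by
  obtain ⟨S, hS, rfl⟩ := h
  refine ⟨S, ?_, rfl⟩
  have hinj : Function.Injective fun j : ℕ => 2 * j := mul_right_injective₀ two_ne_zero
  rw [← hinj.hasSum_iff]
  · refine hS.congr_fun fun j => ?_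
    simp [pow_mul]
  · intro m hm
    dsimp only
    rw [if_neg, zero_mul]
    rintro ⟨j, rfl⟩
    exact hm ⟨j, by simp only; ring⟩

theorem ExpSum.scale {c : ℕ → ℂ} {a z E : ℂ} (h : ExpSum c (a * z) E) :
    ExpSum (fun m => c m * a ^ m) z E := by
  simpa only [ExpSum, mul_pow, mul_assoc] using h

theorem expSum_one_sub {a z : ℂ} (h : ‖a * z‖ < 1) :
    ExpSum (fun m => -(a ^ m / m)) z (1 - a * z) := by
  refine ⟨Complex.log (1 - a * z), ?_, Complex.exp_log ?_⟩
  · have := (Complex.hasSum_taylorSeries_neg_log h).neg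
    rw [neg_neg] at this
    refine this.congr_fun fun m => ?_
    rw [mul_pow]; ring
  · intro h0
    rw [sub_eq_zero] at h0
    rw [← h0] at h
    simp at h

theorem expSum_one_add {a z : ℂ} (h : ‖a * z‖ < 1) :
    ExpSum (fun m => -((-a) ^ m / m)) z (1 + a * z) := by
  simpa using expSum_one_sub (a := -a) (z := z) (by simpa using h)

/-! ### The infinite product `(z; p)_∞` -/

/-- The double series of `-(pⁿ a z)^m / m`: summation over `n` is geometric and gives the
coefficients, summation over `m` gives the logarithms of the factors. -/
theorem expSum_qPoch {p a z : ℂ} (hp : ‖p‖ < 1) (h : ‖a * z‖ < 1) :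
    ExpSum (fun m => -(a ^ m / (m * (1 - p ^ m)))) z (qPoch (a * z) p) := by
  set w := a * z with hw
  have hn : ∀ n : ℕ, ‖p ^ n * w‖ < 1 := fun n => by
    rw [norm_mul, norm_pow]
    exact (mul_le_of_le_one_left (norm_nonneg _) (pow_le_one₀ (norm_nonneg _) hp.le)).trans_lt h
  set f : ℕ × ℕ → ℂ := fun x => -((p ^ x.2 * w) ^ x.1 / x.1)
  have hb : ∀ x, ‖f x‖ ≤ if x.1 = 0 then 0 else ‖w‖ ^ x.1 * ‖p‖ ^ x.2 := by
    rintro ⟨m, n⟩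
    split_ifs with hm
    · simp only at hm
      simp [f, hm]
    · simp only at hm ⊢
      simp only [f, norm_neg, norm_div, norm_pow, norm_mul, Complex.norm_natCast]
      have h1 : (1 : ℝ) ≤ m := by exact_mod_cast Nat.one_le_iff_ne_zero.mpr hm
      refine (div_le_self (by positivity) h1).trans ?_
      rw [mul_pow, mul_comm]
      gcongr
      rw [← pow_mul]
      exact pow_le_pow_of_le_one (norm_nonneg _) hp.le
        (Nat.le_mul_of_pos_right n (Nat.pos_of_ne_zero hm))
  have hs : Summable f := by
    refine Summable.of_norm_bounded (g := fun x : ℕ × ℕ => ‖w‖ ^ x.1 * ‖p‖ ^ x.2) ?_ fun x => ?_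
    · exact (summable_geometric_of_lt_one (norm_nonneg _) h).mul_of_nonneg
        (summable_geometric_of_lt_one (norm_nonneg _) hp) (fun _ => by positivity)
        (fun _ => by positivity)
    · refine (hb x).trans ?_
      split_ifs
      · positivity
      · exact le_rfl
  have h1 := hs.hasSum.prod_fiberwise (g := fun m : ℕ => -(a ^ m / (m * (1 - p ^ m))) * z ^ m)
    fun m => by
      rcases Nat.eq_zero_or_pos m with rfl | hm
      · simp [f]
      · have hpm : ‖p ^ m‖ < 1 := by
          rw [norm_pow]; exact pow_lt_one₀ (norm_nonneg _) hp hm.ne'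
        have hg := (hasSum_geometric_of_norm_lt_one hpm).mul_left (-(w ^ m / m))
        have hne : 1 - p ^ m ≠ 0 := by
          intro h0
          rw [sub_eq_zero] at h0
          rw [← h0] at hpm
          simp at hpm
        have hm' : (m : ℂ) ≠ 0 := by exact_mod_cast hm.ne'
        rw [show -(a ^ m / (m * (1 - p ^ m))) * z ^ m = -(w ^ m / m) * (1 - p ^ m)⁻¹ by
          rw [hw, mul_pow]; field_simp]
        refine hg.congr_fun fun n => ?_
        simp only [f]
        rw [mul_pow, ← pow_mul, ← pow_mul, mul_comm n m]; ring
  have h2 := ((Equiv.prodComm ℕ ℕ).hasSum_iff.mpr hs.hasSum).prod_fiberwise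
    (g := fun n => Complex.log (1 - p ^ n * w)) fun n => by
      have := (Complex.hasSum_taylorSeries_neg_log (hn n)).neg
      rw [neg_neg] at this
      exact this.congr_fun fun m => by simp [f]
  refine ⟨_, h1, ?_⟩
  have h3 := h2.cexp.tprod_eq
  rw [← h3, qPoch]
  refine tprod_congr fun n => ?_
  rw [Function.comp_apply, Complex.exp_log]
  intro h0
  have := hn n
  rw [sub_eq_zero] at h0
  rw [← h0] at this
  simp at this

theorem qPoch_zero (p : ℂ) : qPoch 0 p = 1 := by simp [qPoch]

theorem differentiable_qPoch {p : ℂ} (hp : ‖p‖ < 1) : Differentiable ℂ fun z => qPoch z p := by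
  have hm : MultipliableLocallyUniformlyOn (fun (n : ℕ) (z : ℂ) => 1 - p ^ n * z) Set.univ := by
    refine ⟨fun z => ∏' n, (1 - p ^ n * z), ?_⟩
    simp_rw [sub_eq_add_neg]
    apply hasProdLocallyUniformlyOn_of_forall_compact isOpen_univ
    intro K _ hcK
    obtain ⟨C, hC⟩ := hcK.isBounded.exists_norm_le
    refine Summable.hasProdUniformlyOn_nat_one_add (u := fun n => ‖p‖ ^ n * C) hcK
      ((summable_geometric_of_lt_one (norm_nonneg _) hp).mul_right C)
      (Filter.Eventually.of_forall fun n z hz => ?_) fun n => by fun_prop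
    rw [norm_neg, norm_mul, norm_pow]
    gcongr
    exact hC z hz
  rw [← differentiableOn_univ]
  exact hm.hasProdLocallyUniformlyOn.differentiableOn (.of_forall fun _ => by
    simpa [Finset.prod_fn] using DifferentiableOn.finsetProd (fun _ _ => by fun_prop)) isOpen_univ

end IzerginKorepin

namespace IzerginKorepin

/-! ### Coefficients of the vertex operators -/

/-- `[2m] / [m] - (-1)^m`. -/
def cRatio (h : ℂ) (m : ℕ) : ℂ := (h ^ 2) ^ m + ((h ^ 2) ^ m)⁻¹ - (-1) ^ m

theorem one_sub_pow_ne_zero {x : ℂ} (hx : ‖x‖ < 1) {m : ℕ} (hm : m ≠ 0) : 1 - x ^ m ≠ 0 := by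
  intro h0
  have : ‖x ^ m‖ < 1 := by rw [norm_pow]; exact pow_lt_one₀ (norm_nonneg _) hx hm
  rw [sub_eq_zero] at h0
  rw [← h0] at this
  simp at this

section
variable {h : ℂ} (h0 : h ≠ 0) (h1 : ‖h‖ < 1)
include h0 h1

theorem qInt_ne_zero {m : ℕ} (hm : m ≠ 0) : qInt h m ≠ 0 := by
  have key : ∀ k : ℕ, k ≠ 0 → (h ^ 2) ^ k - ((h ^ 2) ^ k)⁻¹ ≠ 0 := fun k hk h2 => by
    have h3 : (h ^ 2) ^ k ≠ 0 := pow_ne_zero _ (pow_ne_zero _ h0)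
    have h4 : 1 - h ^ (4 * k) = 0 := by
      field_simp at h2
      linear_combination -h2
    exact one_sub_pow_ne_zero h1 (by omega : 4 * k ≠ 0) h4
  have k1 := key 1 one_ne_zero
  rw [pow_one] at k1
  rw [qInt, zpow_neg, zpow_natCast]
  exact div_ne_zero (key m hm) k1

/-- With `x = (-1)^m q^m` the factor is `1 - x + x²`, and `(1 - x + x²)(1 + x) = 1 + x³` stays away
from zero uniformly in `m`. -/
theorem norm_cRatio_factor {m : ℕ} (hm : m ≠ 0) :
    (1 - ‖h‖) / 2 ≤ ‖1 + (h ^ 2) ^ (2 * m) - (-1) ^ m * (h ^ 2) ^ m‖ := by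
  set x := (-1) ^ m * (h ^ 2) ^ m with hx
  have hsq : ((-1 : ℂ) ^ m) ^ 2 = 1 := by rw [← pow_mul, mul_comm, pow_mul]; norm_num
  have hxn : ‖x‖ = ‖h‖ ^ (2 * m) := by simp [hx, pow_mul]
  have hx2 : (h ^ 2) ^ (2 * m) = x ^ 2 := by rw [hx, mul_pow, hsq]; ring
  have hle : ‖x‖ ≤ ‖h‖ := by
    rw [hxn]
    exact pow_le_of_le_one (norm_nonneg _) h1.le (by omega)
  have e : (1 + x ^ 2 - x) * (1 + x) = 1 + x ^ 3 := by ring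
  have b1 : ‖1 + x‖ ≤ 2 := (norm_add_le _ _).trans (by rw [norm_one]; linarith)
  have b2 : 1 - ‖h‖ ≤ ‖1 + x ^ 3‖ := by
    have h3 := norm_sub_norm_le (1 : ℂ) (-x ^ 3)
    rw [sub_neg_eq_add, norm_neg, norm_one, norm_pow] at h3
    have : ‖x‖ ^ 3 ≤ ‖x‖ := pow_le_of_le_one (norm_nonneg _) (hle.trans h1.le) (by norm_num)
    linarith
  rw [hx2]
  rw [← e, norm_mul] at b2
  nlinarith [norm_nonneg (1 + x ^ 2 - x), norm_nonneg (1 + x)]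

theorem cRatio_eq (m : ℕ) : cRatio h m =
    ((h ^ 2) ^ m)⁻¹ * (1 + (h ^ 2) ^ (2 * m) - (-1) ^ m * (h ^ 2) ^ m) := by
  have h3 : (h ^ 2) ^ m ≠ 0 := pow_ne_zero _ (pow_ne_zero _ h0)
  rw [cRatio, mul_comm 2 m, pow_mul (h ^ 2) m 2]
  field_simp
  ring

theorem cRatio_ne_zero {m : ℕ} (hm : m ≠ 0) : cRatio h m ≠ 0 := by
  rw [cRatio_eq h0 h1]
  refine mul_ne_zero (inv_ne_zero (pow_ne_zero _ (pow_ne_zero _ h0))) ?_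
  rw [← norm_pos_iff]
  exact (by linarith : 0 < (1 - ‖h‖) / 2).trans_le (norm_cRatio_factor h0 h1 hm)

theorem norm_inv_cRatio_le {m : ℕ} (hm : m ≠ 0) :
    ‖(cRatio h m)⁻¹‖ ≤ 2 / (1 - ‖h‖) * ‖h‖ ^ (2 * m) := by
  have hb := norm_cRatio_factor h0 h1 hm
  have hpos : 0 < (1 - ‖h‖) / 2 := by linarith
  rw [cRatio_eq h0 h1, mul_inv, inv_inv, norm_mul, norm_inv, norm_pow, norm_pow, ← pow_mul,
    mul_comm, ← inv_div]
  gcongr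

/-- The factorization `1 + x³ = (1 + x)(1 - x + x²)` with `x = (-1)^m q^m`, extended to the
denominator `1 - q^{6m}`. This is the origin of the base `q⁶` in `κ` and `φ`. -/
theorem inv_cRatio_eq {m : ℕ} (hm : m ≠ 0) : (cRatio h m)⁻¹ =
    ((h ^ 2) ^ m + (h ^ 2) ^ (3 * m) + (-1) ^ m * (h ^ 2) ^ (2 * m)) * (1 - (h ^ 2) ^ (2 * m)) /
      (1 - (h ^ 2) ^ (6 * m)) := by
  have h6 : 1 - (h ^ 2) ^ (6 * m) ≠ 0 := by
    rw [← pow_mul]; exact one_sub_pow_ne_zero h1 (by omega)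
  have h3 : (h ^ 2) ^ m ≠ 0 := pow_ne_zero _ (pow_ne_zero _ h0)
  rw [inv_eq_one_div, div_eq_div_iff (cRatio_ne_zero h0 h1 hm) h6, cRatio]
  have hsq : ((-1 : ℂ) ^ m) ^ 2 = 1 := by rw [← pow_mul, mul_comm, pow_mul]; norm_num
  rw [mul_comm 6 m, mul_comm 3 m, mul_comm 2 m, pow_mul _ m 6, pow_mul _ m 3, pow_mul _ m 2]
  generalize (h ^ 2) ^ m = x at *
  generalize (-1 : ℂ) ^ m = e at *
  field_simp
  linear_combination (x ^ 2 * (1 - x ^ 2)) * hsq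

theorem cInt_eq (m : ℕ) : cInt h m = qInt h m * cRatio h m := by
  have h3 : (h ^ 2) ^ m ≠ 0 := pow_ne_zero _ (pow_ne_zero _ h0)
  rw [cInt, cRatio, qInt, qInt]
  rw [show (2 * (m : ℤ)) = ((2 * m : ℕ) : ℤ) by push_cast; ring]
  simp only [zpow_neg, zpow_natCast]
  rw [mul_comm 2 m, pow_mul _ m 2]
  generalize (h ^ 2) ^ m = x at *
  generalize (h ^ 2 - (h ^ 2)⁻¹) = d
  rw [div_mul_eq_mul_div, mul_div_assoc', ← sub_div]
  congr 1
  field_simp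
  ring

theorem cInt_ne_zero {m : ℕ} (hm : m ≠ 0) : cInt h m ≠ 0 := by
  rw [cInt_eq h0 h1]
  exact mul_ne_zero (qInt_ne_zero h0 h1 hm) (cRatio_ne_zero h0 h1 hm)

end

theorem qInt_zero (h : ℂ) : qInt h (0 : ℕ) = 0 := by simp [qInt]

theorem cInt_zero (h : ℂ) : cInt h (0 : ℕ) = 0 := by simp [cInt, qInt]

/-- Creation coefficients of `Φ_-` and `x^-` in the variables `Z = q^3 z` and `W = w / q`. -/
def phiR (h : ℂ) (m : ℕ) : ℂ := h ^ (3 * m) / cInt h m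

def xR (h : ℂ) (m : ℕ) : ℂ := -(h ^ (3 * m) / qInt h m)

/-- The shifts of the mean caused by `Φ_-` and `x^-` are `phiD m * (Z^m + Z^{-m})` and
`xD m * (W^m + W^{-m})`. -/
def phiD (h : ℂ) (m : ℕ) : ℂ := -((h ^ m)⁻¹ * qInt h m / m)

def xD (h : ℂ) (m : ℕ) : ℂ := (h ^ m)⁻¹ * cInt h m / m

theorem phiR_zero (h : ℂ) : phiR h 0 = 0 := by rw [phiR, cInt_zero, div_zero]

theorem xR_zero (h : ℂ) : xR h 0 = 0 := by rw [xR, qInt_zero, div_zero, neg_zero]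

section
variable {h : ℂ} (h0 : h ≠ 0) (h1 : ‖h‖ < 1)
include h0 h1

theorem bdVar_eq (m : ℕ) : bdVar h m = -(((h ^ 2) ^ (2 * m))⁻¹ * bosonNorm h m) := by
  rcases Nat.eq_zero_or_pos m with rfl | hm
  · simp [bdVar, bosonNorm]
  · have a1 := qInt_ne_zero h0 h1 hm.ne'
    have a2 := cInt_ne_zero h0 h1 hm.ne'
    have a3 : (m : ℂ) ≠ 0 := by exact_mod_cast hm.ne'
    rw [bdVar, bosonNorm]
    field_simp

/-- Together with `phiAnn_eq` this is the boundary mechanism: the shift caused by creation at `Z`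
has the same coefficient as the shift caused by annihilation, with `Z` in place of `1/Z`.
`bdVar_mul_xR` and `xAnn_eq` do the same for `x^-`. -/
theorem bdVar_mul_phiR (m : ℕ) : bdVar h m * phiR h m = phiD h m := by
  rw [bdVar_eq h0 h1]
  rcases Nat.eq_zero_or_pos m with rfl | hm
  · simp [bosonNorm, phiD]
  · have a2 := cInt_ne_zero h0 h1 hm.ne'
    have a3 : (m : ℂ) ≠ 0 := by exact_mod_cast hm.ne'
    rw [phiR, phiD, bosonNorm, ← pow_mul, show 2 * (2 * m) = m + 3 * m by ring, pow_add h]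
    have : h ^ (3 * m) ≠ 0 := pow_ne_zero _ h0
    have : h ^ m ≠ 0 := pow_ne_zero _ h0
    field_simp

theorem bdVar_mul_xR (m : ℕ) : bdVar h m * xR h m = xD h m := by
  rw [bdVar_eq h0 h1]
  rcases Nat.eq_zero_or_pos m with rfl | hm
  · simp [bosonNorm, xD]
  · have a2 := qInt_ne_zero h0 h1 hm.ne'
    have a3 : (m : ℂ) ≠ 0 := by exact_mod_cast hm.ne'
    rw [xR, xD, bosonNorm, ← pow_mul, show 2 * (2 * m) = m + 3 * m by ring, pow_add h]
    have : h ^ (3 * m) ≠ 0 := pow_ne_zero _ h0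
    have : h ^ m ≠ 0 := pow_ne_zero _ h0
    field_simp

theorem phiCre_eq (m : ℕ) : phiCre h m = phiR h m * (h ^ 6) ^ m := by
  rw [phiCre, phiR, ← pow_mul, show 9 * m = 3 * m + 6 * m by ring, pow_add]; ring

theorem xCre_eq (m : ℕ) : xCre h m = xR h m * ((h ^ 2)⁻¹) ^ m := by
  have : h ^ (2 * m) ≠ 0 := pow_ne_zero _ h0
  rw [xCre, xR, inv_pow, ← pow_mul, show 3 * m = m + 2 * m by ring, pow_add]; field_simp

theorem phiAnn_eq (m : ℕ) : phiAnn h m = phiD h m * ((h ^ 6)⁻¹) ^ m := by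
  rcases Nat.eq_zero_or_pos m with rfl | hm
  · simp [phiAnn, phiD, bosonNorm]
  have a2 := cInt_ne_zero h0 h1 hm.ne'
  have : h ^ (6 * m) ≠ 0 := pow_ne_zero _ h0
  have : h ^ m ≠ 0 := pow_ne_zero _ h0
  rw [phiAnn, phiD, bosonNorm, inv_pow, ← pow_mul, show 7 * m = m + 6 * m by ring, pow_add]
  field_simp

theorem xAnn_eq (m : ℕ) : xAnn h m = xD h m * (h ^ 2) ^ m := by
  rcases Nat.eq_zero_or_pos m with rfl | hm
  · simp [xAnn, xD, bosonNorm]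
  have a2 := qInt_ne_zero h0 h1 hm.ne'
  have : h ^ m ≠ 0 := pow_ne_zero _ h0
  rw [xAnn, xD, bosonNorm, ← pow_mul, show 2 * m = m + m by ring, pow_add]
  field_simp

/-! ### Contractions of two vertex operators -/

theorem phiR_mul_phiD {m : ℕ} (hm : m ≠ 0) :
    phiR h m * phiD h m = -((h ^ 2) ^ m / m * (cRatio h m)⁻¹) := by
  have a1 := qInt_ne_zero h0 h1 hm
  have a2 := cRatio_ne_zero h0 h1 hm
  have a3 : (m : ℂ) ≠ 0 := by exact_mod_cast hm
  have : h ^ m ≠ 0 := pow_ne_zero _ h0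
  rw [phiR, phiD, cInt_eq h0 h1, ← pow_mul, show 3 * m = 2 * m + m by ring, pow_add]
  field_simp

theorem xR_mul_phiD {m : ℕ} (hm : m ≠ 0) : xR h m * phiD h m = (h ^ 2) ^ m / m := by
  have a1 := qInt_ne_zero h0 h1 hm
  have a3 : (m : ℂ) ≠ 0 := by exact_mod_cast hm
  have : h ^ m ≠ 0 := pow_ne_zero _ h0
  rw [xR, phiD, ← pow_mul, show 3 * m = 2 * m + m by ring, pow_add]
  field_simp

theorem phiR_mul_xD {m : ℕ} (hm : m ≠ 0) : phiR h m * xD h m = (h ^ 2) ^ m / m := by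
  have a1 := cInt_ne_zero h0 h1 hm
  have a3 : (m : ℂ) ≠ 0 := by exact_mod_cast hm
  have : h ^ m ≠ 0 := pow_ne_zero _ h0
  rw [phiR, xD, ← pow_mul, show 3 * m = 2 * m + m by ring, pow_add]
  field_simp

/-- Each power over `m` is the logarithm of one linear factor, so the contraction of two currents is
rational; the products of `x` with `Φ` coefficients above are single such terms. -/
theorem xR_mul_xD {m : ℕ} (hm : m ≠ 0) :
    xR h m * xD h m = -(((h ^ 4) ^ m + 1 - (-h ^ 2) ^ m) / m) := by
  have a1 := qInt_ne_zero h0 h1 hm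
  have a3 : (m : ℂ) ≠ 0 := by exact_mod_cast hm
  have : h ^ m ≠ 0 := pow_ne_zero _ h0
  have e : (h ^ 2) ^ m * cRatio h m = (h ^ 4) ^ m + 1 - (-h ^ 2) ^ m := by
    have : (h ^ 2) ^ m ≠ 0 := pow_ne_zero _ (pow_ne_zero _ h0)
    rw [cRatio_eq h0 h1, neg_pow (h ^ 2), pow_mul (h ^ 2), show (h ^ 2) ^ 2 = h ^ 4 by ring]
    field_simp
    ring
  rw [← e, xR, xD, cInt_eq h0 h1, ← pow_mul, show 3 * m = 2 * m + m by ring, pow_add]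
  field_simp

end

/-- The contraction of two operators `Φ_-`. -/
def kappa (h u : ℂ) : ℂ :=
  (qPoch (h ^ 4 * u) ((h ^ 2) ^ 6) * qPoch (-h ^ 6 * u) ((h ^ 2) ^ 6)) /
    (qPoch (h ^ 12 * u) ((h ^ 2) ^ 6) * qPoch (-h ^ 10 * u) ((h ^ 2) ^ 6))

theorem norm_pow_mul_lt {h u : ℂ} (h1 : ‖h‖ < 1) {k l : ℕ} (hkl : k ≤ l) (hu : ‖h ^ k * u‖ < 1) :
    ‖h ^ l * u‖ < 1 := by
  rw [norm_mul, norm_pow] at *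
  exact (mul_le_mul_of_nonneg_right (pow_le_pow_of_le_one (norm_nonneg _) h1.le hkl)
    (norm_nonneg _)).trans_lt hu

section
variable {h : ℂ} (h0 : h ≠ 0) (h1 : ‖h‖ < 1)
include h0 h1

/-- The product `phiR · phiD` is `-(q^m / m)` divided by `cRatio`; expanded over `1 - q^{6m}` its
four terms are the four infinite products of `κ`. -/
theorem expSum_phi_phi {u : ℂ} (hu : ‖h ^ 4 * u‖ < 1) :
    ExpSum (fun m => phiR h m * phiD h m) u (kappa h u) := by
  have hp : ‖(h ^ 2) ^ 6‖ < 1 := by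
    rw [← pow_mul, norm_pow]; exact pow_lt_one₀ (norm_nonneg _) h1 (by norm_num)
  have n6 : ‖-h ^ 6 * u‖ < 1 := by
    rw [neg_mul, norm_neg]; exact norm_pow_mul_lt h1 (by norm_num) hu
  have n10 : ‖-h ^ 10 * u‖ < 1 := by
    rw [neg_mul, norm_neg]; exact norm_pow_mul_lt h1 (by norm_num) hu
  have n12 : ‖h ^ 12 * u‖ < 1 := norm_pow_mul_lt h1 (by norm_num) hu
  refine (((expSum_qPoch hp hu).mul (expSum_qPoch hp n6)).div
    ((expSum_qPoch hp n12).mul (expSum_qPoch hp n10))).congr fun m => ?_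
  rcases Nat.eq_zero_or_pos m with rfl | hm
  · simp [phiR_zero]
  · have h6 : 1 - (h ^ 2) ^ (6 * m) ≠ 0 := by
      rw [← pow_mul]; exact one_sub_pow_ne_zero h1 (by omega)
    have a3 : (m : ℂ) ≠ 0 := by exact_mod_cast hm.ne'
    have hsq : ((-1 : ℂ) ^ m) ^ 2 = 1 := by rw [← pow_mul, mul_comm, pow_mul]; norm_num
    rw [phiR_mul_phiD h0 h1 hm.ne', inv_cRatio_eq h0 h1 hm.ne', neg_pow (h ^ 6), neg_pow (h ^ 10)]
    simp only [← pow_mul] at *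
    rw [show 2 * (6 * m) = m * 12 by ring] at *
    rw [show 2 * 6 * m = m * 12 by ring, show 4 * m = m * 4 by ring, show 6 * m = m * 6 by ring,
      show 10 * m = m * 10 by ring, show 2 * m = m * 2 by ring,
      show 2 * (3 * m) = m * 6 by ring, show 2 * (m * 2) = m * 4 by ring]
    simp only [pow_mul] at *
    generalize h ^ m = x at *
    generalize (-1 : ℂ) ^ m = e at *
    field_simp
    ring

theorem expSum_x_phi {u : ℂ} (hu : ‖h ^ 2 * u‖ < 1) :
    ExpSum (fun m => xR h m * phiD h m) u (1 - h ^ 2 * u)⁻¹ := by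
  refine (expSum_one_sub hu).inv.congr fun m => ?_
  rcases Nat.eq_zero_or_pos m with rfl | hm
  · simp [xR_zero]
  · rw [xR_mul_phiD h0 h1 hm.ne', neg_neg]

theorem expSum_phi_x {u : ℂ} (hu : ‖h ^ 2 * u‖ < 1) :
    ExpSum (fun m => phiR h m * xD h m) u (1 - h ^ 2 * u)⁻¹ := by
  refine (expSum_one_sub hu).inv.congr fun m => ?_
  rcases Nat.eq_zero_or_pos m with rfl | hm
  · simp [phiR_zero]
  · rw [phiR_mul_xD h0 h1 hm.ne', neg_neg]

theorem expSum_x_x {u : ℂ} (hu : ‖u‖ < 1) : ExpSum (fun m => xR h m * xD h m) u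
    ((1 - u) * (1 - h ^ 4 * u) / (1 + h ^ 2 * u)) := by
  have n1 : ‖1 * u‖ < 1 := by rwa [one_mul]
  have n0 : ‖h ^ 0 * u‖ < 1 := by simpa using hu
  refine (((expSum_one_sub n1).mul (expSum_one_sub (norm_pow_mul_lt h1 (Nat.zero_le _) n0 (l := 4)))).div
    (expSum_one_add (norm_pow_mul_lt h1 (Nat.zero_le _) n0 (l := 2)))).congr (d := fun m =>
      xR h m * xD h m) (fun m => ?_) |>.congr (fun m => rfl) |> fun H => by
        simpa only [one_mul] using H
  rcases Nat.eq_zero_or_pos m with rfl | hm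
  · simp [xR_zero]
  · rw [xR_mul_xD h0 h1 hm.ne', one_pow]
    ring

end

theorem gConst_eq (h : ℂ) : gConst h = kappa h 1 / (1 + h ^ 2) := by
  rw [gConst, kappa]
  rw [show (h ^ 2) ^ 2 = h ^ 4 * 1 by ring, show -(h ^ 2) ^ 3 = -h ^ 6 * 1 by ring,
    show -(h ^ 2) ^ 5 = -h ^ 10 * 1 by ring]
  nth_rw 3 [show (h ^ 2) ^ 6 = h ^ 12 * 1 by ring]
  ring

end IzerginKorepin

namespace IzerginKorepin

/-! ### Contractions with the boundary. -/

theorem summable_of_norm_le_geometric {c : ℕ → ℂ} {C r : ℝ} (hc : ∀ m, ‖c m‖ ≤ C * r ^ m)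
    {ζ : ℂ} (hr : 0 ≤ r) (h : r * ‖ζ‖ < 1) : Summable fun m => ‖c m * ζ ^ m‖ := by
  refine Summable.of_nonneg_of_le (fun _ => norm_nonneg _) (fun m => ?_)
    ((summable_geometric_of_lt_one (by positivity) h).mul_left C)
  rw [norm_mul, norm_pow, mul_pow, ← mul_assoc]
  exact mul_le_mul_of_nonneg_right (hc m) (by positivity)

/-- Reduces a boundary contraction to one comparison of logarithmic coefficients: the linear term `R
b` and, in even degree, half of the self-contraction `R D` at `ζ²`. -/
theorem gaussGen_eq {a b R D : ℕ → ℂ} (haR : ∀ m, a m * R m = D m) {ζ E : ℂ}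
    (s1 : Summable fun m => ‖R m * b m * ζ ^ m‖) (s2 : Summable fun m => ‖R m * D m * (ζ ^ 2) ^ m‖)
    (hE : ExpSum (fun m => R m * b m + if Even m then 1 / 2 * (R (m / 2) * D (m / 2)) else 0) ζ E) :
    gaussGen a b R ζ = E := by
  have e2 : ExpSum (fun m => 1 / 2 * (R m * D m)) (ζ ^ 2) _ := expSum_of_summable (by
    refine (s2.of_norm.mul_left (1 / 2)).congr fun m => ?_
    ring)
  have e1 := (expSum_of_summable (c := fun m => R m * b m) s1.of_norm).mul e2.even
  rw [gaussGen, Complex.exp_add, hE.unique e1]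
  congr 2
  rw [← tsum_mul_left]
  refine tsum_congr fun m => ?_
  rw [← haR, ← pow_mul]; ring

section
variable {h : ℂ} (h0 : h ≠ 0) (h1 : ‖h‖ < 1) (ε : SignType)
include h0 h1

theorem norm_signType_mul_I_pow_le (m : ℕ) : ‖((ε : ℂ) * Complex.I) ^ m‖ ≤ 1 := by
  rw [norm_pow, norm_mul, Complex.norm_I, mul_one]
  refine pow_le_one₀ (norm_nonneg _) ?_
  cases ε <;> simp

theorem bdMean_eq {m : ℕ} (hm : m ≠ 0) : bdMean h ε m = qInt h m / m *
    ((-(ε : ℂ) * Complex.I) ^ m * ((h ^ 4) ^ m)⁻¹ -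
      if Even m then (h ^ m - (h ^ m)⁻¹ - Complex.I ^ m) * ((h ^ 2) ^ m)⁻¹ else 0) := by
  have hc := cInt_ne_zero h0 h1 hm
  have hm' : ((m.toPNat' : ℕ+) : ℕ) = m := by
    rw [Nat.toPNat'_coe, if_pos (Nat.pos_of_ne_zero hm)]
  have e4 : (h ^ 2) ^ (2 * m) = (h ^ 4) ^ m := by rw [← pow_mul, ← pow_mul]; congr 1; ring
  rw [bdMean, gLinear, bosonNorm, hm', e4]
  generalize qInt h m / m = y
  generalize ((h ^ 4) ^ m)⁻¹ = z4
  generalize ((h ^ 2) ^ m)⁻¹ = z2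
  split_ifs <;> field_simp <;> ring

theorem xR_mul_bdMean {m : ℕ} (hm : m ≠ 0) : xR h m * bdMean h ε m =
    (if Even m then ((h ^ 2) ^ m - 1 - (Complex.I * h) ^ m) / m else 0) -
      (-((ε : ℂ) * Complex.I * h⁻¹)) ^ m / m := by
  have hq := qInt_ne_zero h0 h1 hm
  have hx : h ^ m ≠ 0 := pow_ne_zero _ h0
  have a3 : (m : ℂ) ≠ 0 := by exact_mod_cast hm
  rw [bdMean_eq h0 h1 ε hm, xR, show -((ε : ℂ) * Complex.I * h⁻¹) =
    -(ε : ℂ) * Complex.I * h⁻¹ by ring, mul_pow _ h⁻¹, mul_pow Complex.I h, inv_pow]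
  rw [show 3 * m = m * 3 by ring, pow_mul, ← pow_mul h 2, ← pow_mul h 4, mul_comm 2 m,
    mul_comm 4 m, pow_mul h m 2, pow_mul h m 4]
  generalize h ^ m = x at *
  split_ifs <;> field_simp <;> ring

theorem phiR_mul_bdMean {m : ℕ} (hm : m ≠ 0) : phiR h m * bdMean h ε m =
    h ^ (3 * m) / m * (cRatio h m)⁻¹ * ((-(ε : ℂ) * Complex.I) ^ m * ((h ^ 4) ^ m)⁻¹ -
      if Even m then (h ^ m - (h ^ m)⁻¹ - Complex.I ^ m) * ((h ^ 2) ^ m)⁻¹ else 0) := by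
  have hq := qInt_ne_zero h0 h1 hm
  have hc := cRatio_ne_zero h0 h1 hm
  rw [bdMean_eq h0 h1 ε hm, phiR, cInt_eq h0 h1]
  field_simp

/-- The radius `|h|` comes from the term `(-εi)^m q^{-2m}` of the mean. It restricts only the
initial contours of the currents: the sum of the series turns out to be a polynomial, so the
contours may later leave this disc. -/
theorem summable_xR_mul_bdMean {W : ℂ} (hW : ‖W‖ < ‖h‖) :
    Summable fun m => ‖xR h m * bdMean h ε m * W ^ m‖ := by
  have hp : 0 < ‖h‖ := norm_pos_iff.mpr h0
  refine summable_of_norm_le_geometric (C := 4) (r := ‖h‖⁻¹) (fun m => ?_) (by positivity) ?_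
  · rcases Nat.eq_zero_or_pos m with rfl | hm
    · simp [xR_zero]
    rw [xR_mul_bdMean h0 h1 ε hm.ne']
    have hm1 : (1 : ℝ) ≤ m := by exact_mod_cast hm
    have hge : (1 : ℝ) ≤ ‖h‖⁻¹ ^ m := one_le_pow₀ ((one_le_inv₀ hp).mpr h1.le)
    have hle : ∀ k, ‖h‖ ^ k ≤ 1 := fun k => pow_le_one₀ hp.le h1.le
    have b1 : ‖(if Even m then ((h ^ 2) ^ m - 1 - (Complex.I * h) ^ m) / m else 0)‖ ≤ 3 := by
      split_ifs
      · rw [norm_div, Complex.norm_natCast]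
        refine (div_le_self (norm_nonneg _) hm1).trans ?_
        refine (norm_sub_le _ _).trans ?_
        have e1 := norm_sub_le ((h ^ 2) ^ m) 1
        have e2 : ‖(h ^ 2) ^ m‖ ≤ 1 := by rw [← pow_mul, norm_pow]; exact hle _
        have e3 : ‖(Complex.I * h) ^ m‖ ≤ 1 := by
          rw [norm_pow, norm_mul, Complex.norm_I, one_mul]; exact hle _
        rw [norm_one] at e1
        linarith
      · simp
    have b2 : ‖(-((ε : ℂ) * Complex.I * h⁻¹)) ^ m / m‖ ≤ ‖h‖⁻¹ ^ m := by
      rw [norm_div, Complex.norm_natCast]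
      refine (div_le_self (norm_nonneg _) hm1).trans ?_
      rw [norm_pow, norm_neg, ← norm_pow, mul_pow, norm_mul, norm_pow h⁻¹, norm_inv]
      exact mul_le_of_le_one_left (by positivity) (norm_signType_mul_I_pow_le h0 h1 ε m)
    refine (norm_sub_le _ _).trans ?_
    linarith
  · rw [inv_mul_lt_one₀ hp]; exact hW

/-- The worst term is `h^{3m} · h^{2m} · h^{-4m} = h^m`: creation coefficient, `cRatio⁻¹`, and mean.
-/
theorem summable_phiR_mul_bdMean {Z : ℂ} (hZ : ‖h * Z‖ < 1) :
    Summable fun m => ‖phiR h m * bdMean h ε m * Z ^ m‖ := by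
  have hp : 0 < ‖h‖ := norm_pos_iff.mpr h0
  refine summable_of_norm_le_geometric (C := 2 / (1 - ‖h‖) * 4) (r := ‖h‖) (fun m => ?_)
    hp.le (by rwa [norm_mul] at hZ)
  have hC : 0 ≤ 2 / (1 - ‖h‖) := div_nonneg (by norm_num) (by linarith)
  rcases Nat.eq_zero_or_pos m with rfl | hm
  · simp [phiR_zero]; linarith
  rw [phiR_mul_bdMean h0 h1 ε hm.ne']
  have hm1 : (1 : ℝ) ≤ m := by exact_mod_cast hm
  set x := ‖h‖ ^ m with hx
  have hx0 : 0 < x := by positivity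
  have hx1 : x ≤ 1 := pow_le_one₀ hp.le h1.le
  have b0 : ‖h ^ (3 * m) / m‖ ≤ x ^ 3 := by
    rw [norm_div, Complex.norm_natCast, norm_pow, mul_comm 3 m, pow_mul]
    exact div_le_self (by positivity) hm1
  have b1 := norm_inv_cRatio_le h0 h1 hm.ne'
  rw [mul_comm 2 m, pow_mul, ← hx] at b1
  have b2 : ‖(-(ε : ℂ) * Complex.I) ^ m * ((h ^ 4) ^ m)⁻¹‖ ≤ (x ^ 4)⁻¹ := by
    rw [neg_mul, norm_mul, norm_pow, norm_neg, ← norm_pow, norm_inv, ← pow_mul, norm_pow h,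
      mul_comm 4 m, pow_mul, ← hx]
    exact mul_le_of_le_one_left (by positivity) (norm_signType_mul_I_pow_le h0 h1 ε m)
  have b3 : ‖(if Even m then (h ^ m - (h ^ m)⁻¹ - Complex.I ^ m) * ((h ^ 2) ^ m)⁻¹ else 0)‖ ≤
      3 * (x ^ 4)⁻¹ := by
    split_ifs
    · rw [norm_mul, norm_inv ((h ^ 2) ^ m), ← pow_mul, norm_pow, mul_comm 2 m, pow_mul, ← hx]
      have e1 := norm_sub_le (h ^ m - (h ^ m)⁻¹) (Complex.I ^ m)
      have e2 := norm_sub_le (h ^ m) (h ^ m)⁻¹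
      rw [norm_inv, norm_pow, ← hx] at e2
      rw [norm_pow Complex.I, Complex.norm_I, one_pow] at e1
      have e3 : 1 ≤ x⁻¹ := (one_le_inv₀ hx0).mpr hx1
      have e4 : ‖h ^ m - (h ^ m)⁻¹ - Complex.I ^ m‖ ≤ 3 * (x⁻¹) ^ 2 := by nlinarith
      calc _ ≤ 3 * (x⁻¹) ^ 2 * (x ^ 2)⁻¹ := by gcongr
        _ = _ := by rw [inv_pow]; field_simp
    · simp only [norm_zero]; positivity
  have b4 := norm_sub_le ((-(ε : ℂ) * Complex.I) ^ m * ((h ^ 4) ^ m)⁻¹)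
    (if Even m then (h ^ m - (h ^ m)⁻¹ - Complex.I ^ m) * ((h ^ 2) ^ m)⁻¹ else 0)
  rw [norm_mul, norm_mul]
  calc _ ≤ x ^ 3 * (2 / (1 - ‖h‖) * x ^ 2) * (4 * (x ^ 4)⁻¹) := by
        gcongr
        linarith
    _ = _ := by field_simp

/-- The contraction of `x^-` with the boundary. -/
theorem gaussGen_x {W : ℂ} (hW : ‖W‖ < ‖h‖) :
    gaussGen (bdVar h) (bdMean h ε) (xR h) W =
      (1 - W ^ 2) * (1 + (ε : ℂ) * Complex.I * h⁻¹ * W) := by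
  have hp : 0 < ‖h‖ := norm_pos_iff.mpr h0
  have hW2 : ‖W ^ 2‖ < 1 := by
    rw [norm_pow]; exact pow_lt_one₀ (norm_nonneg _) (hW.trans h1) (by norm_num)
  refine gaussGen_eq (D := xD h) (bdVar_mul_xR h0 h1) (summable_xR_mul_bdMean h0 h1 ε hW)
    (expSum_x_x h0 h1 hW2).summable ?_
  have n1 : ‖(1 : ℂ) * W ^ 2‖ < 1 := by rwa [one_mul]
  have n2 : ‖(ε : ℂ) * Complex.I * h⁻¹ * W‖ < 1 := by
    have := norm_signType_mul_I_pow_le h0 h1 ε 1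
    rw [pow_one] at this
    rw [mul_assoc, norm_mul]
    refine (mul_le_of_le_one_left (norm_nonneg _) this).trans_lt ?_
    rw [norm_mul, norm_inv, inv_mul_lt_one₀ hp]; exact hW
  -- In even degree the `θ_m`-part of the mean cancels the self-contraction except for `log (1 -
  -- W²)`; the `ε`-part of the mean is the remaining linear factor.
  have := (expSum_one_sub n1).even.mul (expSum_one_add n2)
  rw [one_mul] at this
  refine this.congr fun m => ?_
  rcases Nat.eq_zero_or_pos m with rfl | hm
  · simp [xR_zero]
  rw [xR_mul_bdMean h0 h1 ε hm.ne']
  split_ifs with he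
  · obtain ⟨j, rfl⟩ := he
    have hj : j ≠ 0 := by omega
    have a3 : (j : ℂ) ≠ 0 := by exact_mod_cast hj
    have e1 : (Complex.I * h) ^ (2 * j) = (-h ^ 2) ^ j := by
      rw [pow_mul, mul_pow, Complex.I_sq, neg_one_mul]
    have e2 : (h ^ 2) ^ (2 * j) = (h ^ 4) ^ j := by rw [pow_mul, ← pow_mul h]
    rw [show (j + j) / 2 = j by omega, xR_mul_xD h0 h1 hj, ← two_mul, e1, e2]
    generalize (-((ε : ℂ) * Complex.I * h⁻¹)) ^ (2 * j) = t
    push_cast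
    field_simp
    ring
  · ring

end

/-! ### The functions `φ_ε` -/

/-- For `ε = 0` the extra products are `(0; p)_∞ = 1`, so the case distinction in the definition is
redundant and all `ε` can be treated at once. -/
theorem phiNum_eq (h : ℂ) (ε : SignType) (z : ℂ) : phiNum h ε z =
    qPoch ((h ^ 2) ^ 8 * z ^ 2) ((h ^ 2) ^ 12) * qPoch (-(h ^ 2) ^ 9 * z ^ 2) ((h ^ 2) ^ 12) *
      (qPoch ((ε : ℂ) * Complex.I * h ^ 9 * z) ((h ^ 2) ^ 6) *
        qPoch (-(ε : ℂ) * Complex.I * h ^ 7 * z) ((h ^ 2) ^ 6)) := by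
  rw [phiNum]
  split_ifs with hε
  · subst hε; simp [qPoch_zero]
  · rfl

theorem phiDen_eq (h : ℂ) (ε : SignType) (z : ℂ) : phiDen h ε z =
    qPoch ((h ^ 2) ^ 12 * z ^ 2) ((h ^ 2) ^ 12) * qPoch (-(h ^ 2) ^ 5 * z ^ 2) ((h ^ 2) ^ 12) *
      (qPoch ((ε : ℂ) * Complex.I * h * z) ((h ^ 2) ^ 6) *
        qPoch (-(ε : ℂ) * Complex.I * h ^ 3 * z) ((h ^ 2) ^ 6)) := by
  rw [phiDen]
  split_ifs with hε
  · subst hε; simp [qPoch_zero]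
  · rfl

/-- The Taylor coefficients of the logarithm of `phiNum`. -/
def phiNumLog (h : ℂ) (ε : SignType) (m : ℕ) : ℂ :=
  (if Even m then -((((h ^ 2) ^ 8) ^ (m / 2)) / ((m / 2 : ℕ) * (1 - ((h ^ 2) ^ 12) ^ (m / 2)))) +
      -(((-(h ^ 2) ^ 9) ^ (m / 2)) / ((m / 2 : ℕ) * (1 - ((h ^ 2) ^ 12) ^ (m / 2)))) else 0) +
    (-(((ε : ℂ) * Complex.I * h ^ 9) ^ m / (m * (1 - ((h ^ 2) ^ 6) ^ m))) +
      -((-(ε : ℂ) * Complex.I * h ^ 7) ^ m / (m * (1 - ((h ^ 2) ^ 6) ^ m))))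

/-- The Taylor coefficients of the logarithm of `phiDen`. -/
def phiDenLog (h : ℂ) (ε : SignType) (m : ℕ) : ℂ :=
  (if Even m then -((((h ^ 2) ^ 12) ^ (m / 2)) / ((m / 2 : ℕ) * (1 - ((h ^ 2) ^ 12) ^ (m / 2)))) +
      -(((-(h ^ 2) ^ 5) ^ (m / 2)) / ((m / 2 : ℕ) * (1 - ((h ^ 2) ^ 12) ^ (m / 2)))) else 0) +
    (-(((ε : ℂ) * Complex.I * h) ^ m / (m * (1 - ((h ^ 2) ^ 6) ^ m))) +
      -((-(ε : ℂ) * Complex.I * h ^ 3) ^ m / (m * (1 - ((h ^ 2) ^ 6) ^ m))))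

section
variable {h : ℂ} (h0 : h ≠ 0) (h1 : ‖h‖ < 1) (ε : SignType)
include h0 h1

theorem norm_signType_mul_pow_lt {z : ℂ} {k : ℕ} (hz : ‖h ^ k * z‖ < 1) :
    ‖(ε : ℂ) * Complex.I * h ^ k * z‖ < 1 ∧ ‖-(ε : ℂ) * Complex.I * h ^ k * z‖ < 1 := by
  have := norm_signType_mul_I_pow_le h0 h1 ε 1
  rw [pow_one] at this
  have e : ‖(ε : ℂ) * Complex.I * h ^ k * z‖ < 1 := by
    rw [mul_assoc, norm_mul]
    exact (mul_le_of_le_one_left (norm_nonneg _) this).trans_lt hz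
  refine ⟨e, ?_⟩
  rwa [show -(ε : ℂ) * Complex.I * h ^ k * z = -((ε : ℂ) * Complex.I * h ^ k * z) by ring, norm_neg]

theorem norm_pow_pow_lt {k : ℕ} (hk : k ≠ 0) : ‖(h ^ 2) ^ k‖ < 1 := by
  rw [← pow_mul, norm_pow]; exact pow_lt_one₀ (norm_nonneg _) h1 (by omega)

theorem norm_pow_mul_sq_lt {z : ℂ} {k l : ℕ} (hz : ‖h ^ k * z‖ < 1) (hkl : k ≤ l) :
    ‖(h ^ 2) ^ l * z ^ 2‖ < 1 ∧ ‖-(h ^ 2) ^ l * z ^ 2‖ < 1 := by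
  have e : ‖(h ^ 2) ^ l * z ^ 2‖ < 1 := by
    rw [show (h ^ 2) ^ l * z ^ 2 = (h ^ l * z) ^ 2 by ring, norm_pow]
    exact pow_lt_one₀ (norm_nonneg _) (norm_pow_mul_lt h1 hkl hz) (by norm_num)
  exact ⟨e, by rwa [neg_mul, norm_neg]⟩

theorem expSum_phiNum {z : ℂ} (hz : ‖h ^ 7 * z‖ < 1) :
    ExpSum (phiNumLog h ε) z (phiNum h ε z) := by
  have p12 := norm_pow_pow_lt h0 h1 (k := 12) (by norm_num)
  have p6 := norm_pow_pow_lt h0 h1 (k := 6) (by norm_num)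
  rw [phiNum_eq]
  exact ((expSum_qPoch p12 (norm_pow_mul_sq_lt h0 h1 hz (by norm_num)).1).mul
    (expSum_qPoch p12 (norm_pow_mul_sq_lt h0 h1 hz (by norm_num)).2)).even.mul
    ((expSum_qPoch p6 (norm_signType_mul_pow_lt h0 h1 ε
      (norm_pow_mul_lt h1 (by norm_num) hz)).1).mul
    (expSum_qPoch p6 (norm_signType_mul_pow_lt h0 h1 ε hz).2))

theorem expSum_phiDen {z : ℂ} (hz : ‖h * z‖ < 1) :
    ExpSum (phiDenLog h ε) z (phiDen h ε z) := by
  have p12 := norm_pow_pow_lt h0 h1 (k := 12) (by norm_num)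
  have p6 := norm_pow_pow_lt h0 h1 (k := 6) (by norm_num)
  have hz1 : ‖h ^ 1 * z‖ < 1 := by rwa [pow_one]
  have n1 := (norm_signType_mul_pow_lt h0 h1 ε hz1).1
  rw [pow_one] at n1
  rw [phiDen_eq]
  exact ((expSum_qPoch p12 (norm_pow_mul_sq_lt h0 h1 hz1 (by norm_num)).1).mul
    (expSum_qPoch p12 (norm_pow_mul_sq_lt h0 h1 hz1 (by norm_num)).2)).even.mul
    ((expSum_qPoch p6 n1).mul
    (expSum_qPoch p6 (norm_signType_mul_pow_lt h0 h1 ε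
      (norm_pow_mul_lt h1 (by norm_num) hz1)).2))

theorem expSum_phi {z : ℂ} (hz : ‖h * z‖ < 1) :
    ExpSum (fun m => phiNumLog h ε m - phiDenLog h ε m) z (phi h ε z) :=
  (expSum_phiNum h0 h1 ε (norm_pow_mul_lt h1 (k := 1) (by norm_num) (by rwa [pow_one]))).div
    (expSum_phiDen h0 h1 ε hz)

/-- The contraction of `Φ_-` with the boundary. -/
theorem gaussGen_phi {Z : ℂ} (hZ : ‖h * Z‖ < 1) :
    gaussGen (bdVar h) (bdMean h ε) (phiR h) Z = phi h ε (-Z) := by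
  have hZ2 : ‖h ^ 4 * Z ^ 2‖ < 1 := by
    rw [show h ^ 4 * Z ^ 2 = (h ^ 2 * Z) ^ 2 by ring, norm_pow]
    exact pow_lt_one₀ (norm_nonneg _) (norm_pow_mul_lt h1 (k := 1) (by norm_num)
      (by rwa [pow_one])) (by norm_num)
  refine gaussGen_eq (D := phiD h) (bdVar_mul_phiR h0 h1) (summable_phiR_mul_bdMean h0 h1 ε hZ)
    (expSum_phi_phi h0 h1 hZ2).summable ?_
  have hZ' : ‖h * (-1 * Z)‖ < 1 := by simpa using hZ
  have := (expSum_phi h0 h1 ε hZ').scale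
  rw [neg_one_mul] at this
  refine this.congr fun m => ?_
  rcases Nat.eq_zero_or_pos m with rfl | hm
  · simp [phiR_zero, phiNumLog, phiDenLog]
  have a3 : (m : ℂ) ≠ 0 := by exact_mod_cast hm.ne'
  have hx : h ^ m ≠ 0 := pow_ne_zero _ h0
  have hpw : ∀ k : ℕ, (h ^ k) ^ m = (h ^ m) ^ k := fun k => by rw [← pow_mul, mul_comm, pow_mul]
  have hpk : ∀ k : ℕ, h ^ (k * m) = (h ^ m) ^ k := fun k => by rw [mul_comm, pow_mul]
  have h12 : 1 - (h ^ m) ^ 12 ≠ 0 := by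
    rw [← pow_mul]; exact one_sub_pow_ne_zero h1 (by omega)
  have hneg : -(ε : ℂ) * Complex.I = -1 * (ε * Complex.I) := by ring
  rw [phiR_mul_bdMean h0 h1 ε hm.ne', phiNumLog, phiDenLog, inv_cRatio_eq h0 h1 hm.ne', hneg]
  have hp2 : ∀ k : ℕ, (h ^ 2) ^ (k * m) = (h ^ m) ^ (2 * k) := fun k => by
    rw [← pow_mul, ← pow_mul]; congr 1; ring
  have hp1 : (h ^ 2) ^ m = (h ^ m) ^ 2 := hpw 2
  simp only [mul_pow, ← pow_mul h 2, hpw, hpk] at *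
  simp only [hp2]
  -- In even degree `m = 2j` the products of base `q^{12}` and the self-contraction enter;
  -- everything is rewritten in `y = h ^ j`, and the two kinds of denominators are related by `1 -
  -- y^{24} = (1 - y^{12})(1 + y^{12})`. In odd degree only the products of base `q⁶` remain.
  by_cases he : Even m
  · obtain ⟨j, rfl⟩ := he
    have hj : j ≠ 0 := by omega
    have b3 : (j : ℂ) ≠ 0 := by exact_mod_cast hj
    have hy : h ^ j ≠ 0 := pow_ne_zero _ h0
    have h12' : 1 - (h ^ j) ^ 12 ≠ 0 := by
      rw [← pow_mul]; exact one_sub_pow_ne_zero h1 (by omega)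
    have hIp : Complex.I ^ (j + j) = (-1) ^ j := by
      rw [← two_mul, pow_mul, Complex.I_sq]
    have hsq : ((-1 : ℂ) ^ j) ^ 2 = 1 := by rw [← pow_mul, mul_comm, pow_mul]; norm_num
    have hpj : ∀ k : ℕ, (h ^ k) ^ j = (h ^ j) ^ k := fun k => by rw [← pow_mul, mul_comm, pow_mul]
    have hp2j : ∀ k : ℕ, (h ^ 2) ^ (k * j) = (h ^ j) ^ (2 * k) := fun k => by
      rw [← pow_mul, ← pow_mul]; congr 1; ring
    have hIj : ((Complex.I ^ (j + j) : ℂ)) = (-1) ^ j := hIp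
    rw [show (h : ℂ) ^ (j + j) = (h ^ j) ^ 2 by rw [← pow_mul]; congr 1; ring] at *
    have hev : Even (j + j) := ⟨j, rfl⟩
    simp only [hev, if_true, show (j + j) / 2 = j by omega]
    rw [phiR_mul_phiD h0 h1 hj, inv_cRatio_eq h0 h1 hj, hIj, neg_pow (h ^ (2 * 9)),
      neg_pow (h ^ (2 * 5)), show (-1 : ℂ) ^ (j + j) = 1 by rw [← two_mul, pow_mul]; norm_num]
    simp only [hp2j, hpj]
    generalize h ^ j = y at *
    generalize (-1 : ℂ) ^ j = e at *
    generalize (ε : ℂ) ^ (j + j) = t at *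
    have h24 : 1 - y ^ 24 = (1 - y ^ 12) * (1 + y ^ 12) := by ring
    have h24' : 1 + y ^ 12 ≠ 0 := by
      rw [← pow_mul, h24] at h12; exact right_ne_zero_of_mul h12
    push_cast
    simp only [← pow_mul, Nat.reduceMul, h24]
    field_simp
    ring
  · simp only [if_neg he]
    rw [Nat.not_even_iff_odd] at he
    simp only [he.neg_one_pow]
    generalize h ^ m = x at *
    generalize (ε : ℂ) ^ m = t at *
    generalize Complex.I ^ m = t' at *
    field_simp
    ring

end

end IzerginKorepin

namespace IzerginKorepin
open Metric Set

/-! ### Two product identities -/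

section
variable {h : ℂ} (h0 : h ≠ 0) (h1 : ‖h‖ < 1) (ε : SignType)
include h0 h1

/-- At coinciding points the contraction arguments `Z₂ / Z₁` equal `-q³`; this identity, with
`gConst_eq`, explains the value of the constant `g`. -/
theorem kappa_one_mul_kappa : kappa h 1 * kappa h (-h ^ 6) = (1 - h ^ 4) * (1 + h ^ 6) := by
  have hlt : ∀ k : ℕ, k ≠ 0 → ‖h ^ k * 1‖ < 1 := fun k hk => by
    rw [mul_one, norm_pow]; exact pow_lt_one₀ (norm_nonneg _) h1 hk
  have n2 : ‖h ^ 4 * (-h ^ 6 * 1)‖ < 1 := by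
    have := hlt 10 (by norm_num)
    rwa [show h ^ 4 * (-h ^ 6 * 1) = -(h ^ 10 * 1) by ring, norm_neg]
  have e1 := (expSum_phi_phi h0 h1 (hlt 4 (by norm_num))).mul (expSum_phi_phi h0 h1 n2).scale
  have e2 := (expSum_one_sub (hlt 4 (by norm_num))).mul (expSum_one_add (hlt 6 (by norm_num)))
  rw [mul_one] at e1
  rw [mul_one, mul_one] at e2
  refine e1.unique (e2.congr fun m => ?_)
  rcases Nat.eq_zero_or_pos m with rfl | hm
  · simp [phiR_zero]
  have a3 : (m : ℂ) ≠ 0 := by exact_mod_cast hm.ne'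
  have h6 : 1 - (h ^ m) ^ 12 ≠ 0 := by
    rw [← pow_mul]; exact one_sub_pow_ne_zero h1 (by omega)
  have hsq : ((-1 : ℂ) ^ m) ^ 2 = 1 := by rw [← pow_mul, mul_comm, pow_mul]; norm_num
  have hp2 : ∀ k : ℕ, (h ^ 2) ^ (k * m) = (h ^ m) ^ (2 * k) := fun k => by
    rw [← pow_mul, ← pow_mul]; congr 1; ring
  have hpw : ∀ k : ℕ, (h ^ k) ^ m = (h ^ m) ^ k := fun k => by rw [← pow_mul, mul_comm, pow_mul]
  rw [phiR_mul_phiD h0 h1 hm.ne', inv_cRatio_eq h0 h1 hm.ne', neg_pow (h ^ 6)]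
  simp only [hp2, hpw]
  generalize h ^ m = x at *
  generalize (-1 : ℂ) ^ m = e at *
  have h6' : 1 - x ^ (2 * 6) ≠ 0 := h6
  field_simp
  linear_combination (x ^ 12 * (1 - x ^ 4)) * hsq

/-- The boundary factors at `Z₁` and at `Z₂ = -q³ Z₁`, combined with the contraction at `Z₁ Z₂`,
collapse to a rational function. It cancels the rational function produced by the double residue. -/
theorem phi_mul_phi {z : ℂ} (hz : ‖z‖ = 1) :
    phi h ε z * phi h ε (-(h ^ 6 * z)) * kappa h (-(h ^ 6 * z ^ 2)) *
      ((1 - ε * Complex.I * h * z) * (1 + ε * Complex.I * h ^ 3 * z)) = 1 - h ^ 12 * z ^ 2 := by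
  have hlt : ∀ k : ℕ, k ≠ 0 → ‖h ^ k * z‖ < 1 := fun k hk => by
    rw [norm_mul, norm_pow, hz, mul_one]; exact pow_lt_one₀ (norm_nonneg _) h1 hk
  have n1 : ‖h * z‖ < 1 := by simpa using hlt 1 one_ne_zero
  have n7 : ‖h * (-h ^ 6 * z)‖ < 1 := by
    have := hlt 7 (by norm_num)
    rwa [show h * (-h ^ 6 * z) = -(h ^ 7 * z) by ring, norm_neg]
  have n10 : ‖h ^ 4 * (-h ^ 6 * z ^ 2)‖ < 1 := by
    have := hlt 5 (by norm_num)
    rw [show h ^ 4 * (-h ^ 6 * z ^ 2) = -((h ^ 5 * z) ^ 2) by ring, norm_neg, norm_pow]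
    exact pow_lt_one₀ (norm_nonneg _) this (by norm_num)
  have n12 : ‖h ^ 12 * z ^ 2‖ < 1 := by
    have := hlt 6 (by norm_num)
    rw [show h ^ 12 * z ^ 2 = ((h ^ 6 * z) ^ 2) by ring, norm_pow]
    exact pow_lt_one₀ (norm_nonneg _) this (by norm_num)
  have m1 : ‖(ε : ℂ) * Complex.I * h * z‖ < 1 := by
    have := (norm_signType_mul_pow_lt h0 h1 ε (hlt 1 one_ne_zero)).1
    rwa [pow_one] at this
  have m3 := (norm_signType_mul_pow_lt h0 h1 ε (hlt 3 (by norm_num))).1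
  have e1 := (((expSum_phi h0 h1 ε n1).mul (expSum_phi h0 h1 ε n7).scale).mul
    (expSum_phi_phi h0 h1 n10).scale.even).mul ((expSum_one_sub m1).mul (expSum_one_add m3))
  have e2 := (expSum_one_sub n12).even
  rw [neg_mul, neg_mul] at e1
  refine e1.unique (e2.congr fun m => ?_)
  rcases Nat.eq_zero_or_pos m with rfl | hm
  · simp [phiR_zero, phiNumLog, phiDenLog]
  have a3 : (m : ℂ) ≠ 0 := by exact_mod_cast hm.ne'
  have hpw : ∀ k : ℕ, (h ^ k) ^ m = (h ^ m) ^ k := fun k => by rw [← pow_mul, mul_comm, pow_mul]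
  have h12 : 1 - (h ^ m) ^ 12 ≠ 0 := by
    rw [← pow_mul]; exact one_sub_pow_ne_zero h1 (by omega)
  have hneg : -(ε : ℂ) * Complex.I = -1 * (ε * Complex.I) := by ring
  have hneg3 : -((ε : ℂ) * Complex.I * h ^ 3) = -1 * (ε * Complex.I) * h ^ 3 := by ring
  have hsq : ((-1 : ℂ) ^ m) ^ 2 = 1 := by rw [← pow_mul, mul_comm, pow_mul]; norm_num
  rw [phiNumLog, phiDenLog, hneg, hneg3, neg_pow (h ^ 6) m]
  simp only [mul_pow, ← pow_mul h 2]
  simp only [hpw, Nat.reduceMul]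
  by_cases he : Even m
  · obtain ⟨j, rfl⟩ := he
    have hj : j ≠ 0 := by omega
    have b3 : (j : ℂ) ≠ 0 := by exact_mod_cast hj
    have h12' : 1 - (h ^ j) ^ 12 ≠ 0 := by
      rw [← pow_mul]; exact one_sub_pow_ne_zero h1 (by omega)
    have hsqj : ((-1 : ℂ) ^ j) ^ 2 = 1 := by rw [← pow_mul, mul_comm, pow_mul]; norm_num
    have hpj : ∀ k : ℕ, (h ^ k) ^ j = (h ^ j) ^ k := fun k => by rw [← pow_mul, mul_comm, pow_mul]
    have hp2j : ∀ k : ℕ, (h ^ 2) ^ (k * j) = (h ^ j) ^ (2 * k) := fun k => by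
      rw [← pow_mul, ← pow_mul]; congr 1; ring
    rw [show (h : ℂ) ^ (j + j) = (h ^ j) ^ 2 by rw [← pow_mul]; congr 1; ring] at *
    have hev : Even (j + j) := ⟨j, rfl⟩
    simp only [hev, if_true, show (j + j) / 2 = j by omega]
    rw [phiR_mul_phiD h0 h1 hj, inv_cRatio_eq h0 h1 hj, neg_pow (h ^ 18), neg_pow (h ^ 10),
      neg_pow (h ^ 6) j, show (-1 : ℂ) ^ (j + j) = 1 by rw [← two_mul, pow_mul]; norm_num]
    simp only [hp2j, hpj]
    generalize h ^ j = y at *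
    generalize (-1 : ℂ) ^ j = e at *
    generalize (ε : ℂ) ^ (j + j) = t at *
    generalize Complex.I ^ (j + j) = t' at *
    have h24 : 1 - y ^ 24 = (1 - y ^ 12) * (1 + y ^ 12) := by ring
    have h24' : 1 + y ^ 12 ≠ 0 := by
      rw [← pow_mul, h24] at h12; exact right_ne_zero_of_mul h12
    push_cast
    simp only [← pow_mul, Nat.reduceMul, h24]
    field_simp
    linear_combination (2 * y ^ 12 * (1 - y ^ 4)) * hsqj
  · simp only [if_neg he]
    rw [Nat.not_even_iff_odd] at he
    simp only [he.neg_one_pow]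
    generalize h ^ m = x at *
    generalize (ε : ℂ) ^ m = t at *
    generalize Complex.I ^ m = t' at *
    field_simp
    ring

end

/-! ### One vertex operator next to the dual ground state -/

theorem cis_add (x y) : cis (x + y) = cis x * cis y := by
  rw [cis, cis, cis, AddCircle.toCircle_add, Circle.coe_mul]

theorem avg_comp_mul {c : ℂ} (hc : c ≠ 0) (ρ : ℝ) (f : ℂ → ℂ) :
    avg ρ (fun w => f (c * w)) = avg (‖c‖ * ρ) f := by
  obtain ⟨θ, hθ⟩ := exists_eq_mul_cis (norm_pos_iff.mpr hc) rfl
  have e : ∀ x, c * (ρ * cis x) = ((‖c‖ * ρ : ℝ) : ℂ) * cis (x + θ) := fun x => by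
    rw [cis_add]
    nth_rw 1 [hθ]
    push_cast; ring
  simp only [avg, e]
  exact MeasureTheory.integral_add_right_eq_self
    (fun x => f (((‖c‖ * ρ : ℝ) : ℂ) * cis x)) θ

/-- The shift of the mean by a vertex operator with coefficients `D` at the point `Z`. -/
def shift (D : ℕ → ℂ) (Z : ℂ) (m : ℕ) : ℂ := D m * (Z ^ m + Z⁻¹ ^ m)

/-- The substitution `Z = c ζ` in `gauss_polyMode`. In the rescaled variable creation and
annihilation shifts have equal coefficients and combine to `shift D Z`, which is invariant under `Z
→ 1/Z`. -/
theorem gauss_polyMode_scaled {a b r t R D : ℕ → ℂ} {c : ℂ} (hc : c ≠ 0)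
    (hr : ∀ m, r m = R m * c ^ m) (ht : ∀ m, t m = D m * c⁻¹ ^ m) (ha : ∀ m, a m * R m = D m)
    (hR : R 0 = 0) {ρ : ℝ} (hρ : 0 < ρ) (h1 : Summable fun m => ‖R m * D m * ((ρ : ℂ) ^ 2) ^ m‖)
    (h2 : Summable fun m => ‖R m * b m * (ρ : ℂ) ^ m‖) (k : ℤ) (f : Poly) :
    gauss a b (polyMode r t k f) = c ^ k * avg ρ fun Z => Z ^ (-k) *
      (gaussGen a b R Z * gauss a (b + shift D Z) f) := by
  have hcn : 0 < ‖c‖ := norm_pos_iff.mpr hc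
  have hcn' : ‖c‖ * (ρ / ‖c‖) = ρ := by field_simp
  have hnp : ‖((ρ / ‖c‖ : ℝ) : ℂ)‖ = ρ / ‖c‖ := Complex.norm_of_nonneg (by positivity)
  rw [gauss_polyMode (ρ := ρ / ‖c‖) (by rw [hr, hR, zero_mul]) (by positivity), ← hcn',
    ← avg_comp_mul hc, hcn', ← avg_const_mul]
  · refine avg_congr (by positivity) fun w hw => ?_
    have hg : gaussGen a b r w = gaussGen a b R (c * w) := by
      have e1 : ∀ m, r m * b m * w ^ m = R m * b m * (c * w) ^ m := fun m => by
        rw [hr, mul_pow]; ring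
      have e2 : ∀ m, a m * r m ^ 2 * w ^ (2 * m) = a m * R m ^ 2 * (c * w) ^ (2 * m) :=
        fun m => by rw [hr, mul_pow c]; ring
      rw [gaussGen, gaussGen, tsum_congr e1, tsum_congr e2]
    have hb : (fun m => b m + (a m * r m * w ^ m + t m * w⁻¹ ^ m)) = b + shift D (c * w) := by
      funext m
      rw [Pi.add_apply, shift, hr, ht, mul_inv, mul_pow, mul_pow, ← mul_assoc (a m), ha]; ring
    rw [hg, hb, mul_zpow]
    have : c ^ k * c ^ (-k) = 1 := by rw [← zpow_add₀ hc, add_neg_cancel, zpow_zero]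
    linear_combination (-(w ^ (-k) * (gaussGen a b R (c * w) * gauss a (b + shift D (c * w)) f))) *
      this
  · refine h1.congr fun m => ?_
    rw [hr, ← ha]
    simp only [norm_mul, norm_pow, hnp, div_pow, Complex.norm_of_nonneg hρ.le]
    field_simp
    ring
  · refine h2.congr fun m => ?_
    rw [hr]
    simp only [norm_mul, norm_pow, hnp, div_pow, Complex.norm_of_nonneg hρ.le]
    field_simp

/-- An operator at `Z` sees an earlier one at `Z'` and also its mirror image at `1/Z'`: the scalar
acquires one contraction at `Z Z'` and one at `Z / Z'`. -/
theorem gaussGen_add_shift {a b R D : ℕ → ℂ} {Z Z' E E' : ℂ}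
    (hb : Summable fun m => ‖R m * b m * Z ^ m‖)
    (h1 : ExpSum (fun m => R m * D m) (Z * Z') E) (h2 : ExpSum (fun m => R m * D m) (Z / Z') E') :
    gaussGen a (b + shift D Z') R Z = gaussGen a b R Z * (E * E') ∧
      Summable fun m => ‖R m * (b + shift D Z') m * Z ^ m‖ := by
  have e : ∀ m, R m * (b + shift D Z') m * Z ^ m =
      R m * b m * Z ^ m + (R m * D m * (Z * Z') ^ m + R m * D m * (Z / Z') ^ m) := fun m => by
    rw [Pi.add_apply, shift, mul_pow, div_eq_mul_inv, mul_pow]; ring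
  have hs1 := h1.summable.of_norm
  have hs2 := h2.summable.of_norm
  refine ⟨?_, ?_⟩
  · rw [h1.eq_exp, h2.eq_exp, gaussGen, gaussGen, ← Complex.exp_add, ← Complex.exp_add]
    congr 1
    rw [tsum_congr e, hb.of_norm.tsum_add (hs1.add hs2), hs1.tsum_add hs2]
    ring
  · rw [summable_norm_iff]
    exact (hb.of_norm.add (hs1.add hs2)).congr fun m => (e m).symm

theorem continuousOn_gaussGen {a b R D : ℕ → ℂ} (ha : ∀ m, a m * R m = D m) {ρ : ℝ} (hρ : 0 ≤ ρ)
    (h1 : Summable fun m => ‖R m * D m * ((ρ : ℂ) ^ 2) ^ m‖)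
    (h2 : Summable fun m => ‖R m * b m * (ρ : ℂ) ^ m‖) :
    ContinuousOn (gaussGen a b R) (sphere 0 ρ) := by
  have hn : ∀ Z ∈ sphere (0 : ℂ) ρ, ‖Z‖ = ‖(ρ : ℂ)‖ := fun Z hZ => by
    rw [mem_sphere_zero_iff_norm.mp hZ, Complex.norm_of_nonneg hρ]
  refine Complex.continuous_exp.comp_continuousOn ((continuousOn_tsum (fun m => by fun_prop) h2
    fun m Z hZ => ?_).add (continuousOn_const.mul (continuousOn_tsum (fun m => by fun_prop) h1
      fun m Z hZ => ?_)))
  · rw [norm_mul, norm_mul (_ * _), norm_pow, norm_pow, hn Z hZ]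
  · refine le_of_eq ?_
    rw [← ha, ← pow_mul]
    simp only [norm_mul, norm_pow, hn Z hZ]
    ring

/-- By integration by parts the value at `f` is a polynomial in the means, so it inherits their
regularity; the next lemma is the holomorphic version. -/
theorem continuousOn_gauss {X : Type*} [TopologicalSpace X] {S : Set X} (a : ℕ → ℂ)
    {b : X → ℕ → ℂ} (hb : ∀ m, ContinuousOn (fun x => b x m) S) (f : Poly) :
    ContinuousOn (fun x => gauss a (b x) f) S := by
  induction f using poly_induction_pderiv with
  | h1 => simpa only [gauss_one] using continuousOn_const
  | hadd f g hf hg => simpa only [map_add] using hf.fun_add hg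
  | hsmul c f hf => simpa only [map_smul] using hf.fun_const_smul c
  | hX j f hf hd =>
    simpa only [gauss_X_mul] using (continuousOn_const.fun_mul hd).fun_add ((hb j).fun_mul hf)

theorem differentiableAt_gauss {E : Type*} [NormedAddCommGroup E] [NormedSpace ℂ E] (a : ℕ → ℂ)
    {b : E → ℕ → ℂ} {x : E} (hb : ∀ m, DifferentiableAt ℂ (fun x => b x m) x) (f : Poly) :
    DifferentiableAt ℂ (fun x => gauss a (b x) f) x := by
  induction f using poly_induction_pderiv with
  | h1 => simpa only [gauss_one] using differentiableAt_const _
  | hadd f g hf hg => simpa only [map_add] using hf.fun_add hg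
  | hsmul c f hf => simpa only [map_smul] using hf.fun_const_smul c
  | hX j f hf hd =>
    simpa only [gauss_X_mul] using ((differentiableAt_const _).fun_mul hd).fun_add ((hb j).fun_mul hf)

end IzerginKorepin

namespace IzerginKorepin
open Metric Set

/-! ### Iterated averages -/

theorem continuousOn_slice {X Y : Type*} [TopologicalSpace X] [TopologicalSpace Y] {S : Set X}
    {T : Set Y} {F : X → Y → ℂ} (hF : ContinuousOn (Function.uncurry F) (S ×ˢ T)) {x : X}
    (hx : x ∈ S) : ContinuousOn (F x) T :=
  hF.comp (f := fun y => (x, y)) (by fun_prop) fun _ hy => ⟨hx, hy⟩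

theorem continuousOn_avg_sphere {X : Type*} [TopologicalSpace X] [T2Space X]
    [FirstCountableTopology X] {S : Set X} (hS : IsCompact S) {ρ : ℝ} (hρ : 0 ≤ ρ)
    {F : X × ℂ → ℂ} (hF : ContinuousOn F (S ×ˢ sphere 0 ρ)) :
    ContinuousOn (fun x => avg ρ fun w => F (x, w)) S :=
  continuousOn_avg hS hρ (f := fun x w => F (x, w)) hF

theorem avg_add_two {ρ σ : ℝ} (hρ : 0 ≤ ρ) (hσ : 0 ≤ σ) {f g : ℂ → ℂ → ℂ}
    (hf : ContinuousOn (Function.uncurry f) (sphere 0 ρ ×ˢ sphere 0 σ))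
    (hg : ContinuousOn (Function.uncurry g) (sphere 0 ρ ×ˢ sphere 0 σ)) :
    avg ρ (fun a => avg σ fun b => f a b + g a b) =
      avg ρ (fun a => avg σ fun b => f a b) + avg ρ (fun a => avg σ fun b => g a b) := by
  rw [← avg_add hρ (continuousOn_avg (isCompact_sphere _ _) hσ hf)
    (continuousOn_avg (isCompact_sphere _ _) hσ hg)]
  refine avg_congr hρ fun a ha => ?_
  rw [← mem_sphere_zero_iff_norm] at ha
  exact avg_add hσ (continuousOn_slice hf ha) (continuousOn_slice hg ha)

theorem continuousOn_avg_last {ρ σ τ : ℝ} (hτ : 0 ≤ τ) {f : ℂ → ℂ → ℂ → ℂ}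
    (hf : ContinuousOn (fun x : (ℂ × ℂ) × ℂ => f x.1.1 x.1.2 x.2)
      ((sphere 0 ρ ×ˢ sphere 0 σ) ×ˢ sphere 0 τ)) :
    ContinuousOn (Function.uncurry fun a b => avg τ fun c => f a b c)
      (sphere 0 ρ ×ˢ sphere 0 σ) :=
  continuousOn_avg (X := ℂ × ℂ) ((isCompact_sphere _ _).prod (isCompact_sphere _ _)) hτ
    (f := fun x c => f x.1 x.2 c) hf

theorem avg_add_three {ρ σ τ : ℝ} (hρ : 0 ≤ ρ) (hσ : 0 ≤ σ) (hτ : 0 ≤ τ) {f g : ℂ → ℂ → ℂ → ℂ}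
    (hf : ContinuousOn (fun x : (ℂ × ℂ) × ℂ => f x.1.1 x.1.2 x.2)
      ((sphere 0 ρ ×ˢ sphere 0 σ) ×ˢ sphere 0 τ))
    (hg : ContinuousOn (fun x : (ℂ × ℂ) × ℂ => g x.1.1 x.1.2 x.2)
      ((sphere 0 ρ ×ˢ sphere 0 σ) ×ˢ sphere 0 τ)) :
    avg ρ (fun a => avg σ fun b => avg τ fun c => f a b c + g a b c) =
      avg ρ (fun a => avg σ fun b => avg τ fun c => f a b c) +
        avg ρ (fun a => avg σ fun b => avg τ fun c => g a b c) := by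
  rw [← avg_add_two hρ hσ (continuousOn_avg_last hτ hf) (continuousOn_avg_last hτ hg)]
  refine avg_congr hρ fun a ha => avg_congr hσ fun b hb => ?_
  rw [← mem_sphere_zero_iff_norm] at ha hb
  exact avg_add hτ
    (continuousOn_slice (X := ℂ × ℂ) (F := fun x c => f x.1 x.2 c) hf (x := (a, b)) ⟨ha, hb⟩)
    (continuousOn_slice (X := ℂ × ℂ) (F := fun x c => g x.1 x.2 c) hg (x := (a, b)) ⟨ha, hb⟩)

theorem continuousOn_zpow_sphere {ρ : ℝ} (hρ : 0 < ρ) (k : ℤ) :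
    ContinuousOn (fun w : ℂ => w ^ k) (sphere 0 ρ) := fun w hw =>
  (continuousAt_zpow₀ w _ (Or.inl (by rintro rfl; simp at hw; linarith))).continuousWithinAt

theorem continuousOn_shift {X : Type*} [TopologicalSpace X] {S : Set X} {D : ℕ → ℂ} {f : X → ℂ}
    (hf : ContinuousOn f S) (hf0 : ∀ x ∈ S, f x ≠ 0) (m : ℕ) :
    ContinuousOn (fun x => shift D (f x) m) S :=
  continuousOn_const.fun_mul ((hf.fun_pow m).fun_add ((hf.inv₀ hf0).fun_pow m))

theorem ne_zero_of_norm_eq {ρ : ℝ} (hρ : 0 < ρ) {Z : ℂ} (hZ : ‖Z‖ = ρ) : Z ≠ 0 := by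
  rintro rfl; simp at hZ; linarith

theorem sub_ne_zero_of_norm_lt {x y : ℂ} (h : ‖y‖ < ‖x‖) : x - y ≠ 0 := by
  intro h0
  rw [sub_eq_zero] at h0
  rw [h0] at h
  exact lt_irrefl _ h

theorem one_sub_ne_zero_of_norm_lt {y : ℂ} (h : ‖y‖ < 1) : 1 - y ≠ 0 :=
  sub_ne_zero_of_norm_lt (by rwa [norm_one])

theorem one_add_ne_zero_of_norm_lt {y : ℂ} (h : ‖y‖ < 1) : 1 + y ≠ 0 := by
  rw [← sub_neg_eq_add]
  exact one_sub_ne_zero_of_norm_lt (by rwa [norm_neg])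

/-! ### Vertex operators next to the dual ground state -/

/-- The mean `b` is admissible for creation coefficients `R` at radius `ρ`. -/
def SumAt (R b : ℕ → ℂ) (ρ : ℝ) : Prop := Summable fun m => ‖R m * b m * (ρ : ℂ) ^ m‖

theorem SumAt.summable {R b : ℕ → ℂ} {ρ : ℝ} (h : SumAt R b ρ) {Z : ℂ} (hZ : ‖Z‖ = ρ) :
    Summable fun m => ‖R m * b m * Z ^ m‖ := by
  refine Summable.congr h fun m => ?_
  rw [norm_mul, norm_mul _ (Z ^ m), norm_pow, norm_pow, hZ,
    Complex.norm_of_nonneg (hZ ▸ norm_nonneg Z)]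

theorem sumAt_of_summable {R b : ℕ → ℂ} {ρ : ℝ} {Z : ℂ} (hZ : ‖Z‖ = ρ)
    (h : Summable fun m => ‖R m * b m * Z ^ m‖) : SumAt R b ρ := by
  refine h.congr fun m => ?_
  rw [norm_mul, norm_mul _ ((ρ : ℂ) ^ m), norm_pow, norm_pow, hZ,
    Complex.norm_of_nonneg (hZ ▸ norm_nonneg Z)]

section
variable {h : ℂ} (h0 : h ≠ 0) (h1 : ‖h‖ < 1)
include h0 h1

/-- Every matrix element considered contains two operators `Φ_-` and two currents `x^-`, so the
powers of `ε(q)` cancel and only its nonvanishing matters. -/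
theorem epsQ_ne_zero : epsQ h ≠ 0 := by
  rw [epsQ, Complex.cpow_ne_zero_iff_of_exponent_ne_zero (by norm_num)]
  intro h2
  field_simp at h2
  have : h ^ 2 = -1 := by linear_combination h2
  have h3 : ‖h ^ 2‖ = 1 := by rw [this, norm_neg, norm_one]
  rw [norm_pow] at h3
  have := pow_lt_one₀ (norm_nonneg h) h1 two_ne_zero
  linarith

theorem summable_phi_phi_sq {ρ : ℝ} (hρ : 0 < ρ) (hh : ‖h‖ ^ 2 * ρ < 1) :
    Summable fun m => ‖phiR h m * phiD h m * ((ρ : ℂ) ^ 2) ^ m‖ := by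
  refine (expSum_phi_phi h0 h1 ?_).summable
  rw [norm_mul, norm_pow, norm_pow, Complex.norm_of_nonneg hρ.le,
    show ‖h‖ ^ 4 * ρ ^ 2 = (‖h‖ ^ 2 * ρ) ^ 2 by ring]
  exact pow_lt_one₀ (by positivity) hh two_ne_zero

theorem summable_x_x_sq {ρ : ℝ} (hρ : 0 < ρ) (hh : ρ < 1) :
    Summable fun m => ‖xR h m * xD h m * ((ρ : ℂ) ^ 2) ^ m‖ := by
  refine (expSum_x_x h0 h1 ?_).summable
  rw [norm_pow, Complex.norm_of_nonneg hρ.le]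
  exact pow_lt_one₀ (by positivity) hh two_ne_zero

theorem gauss_xMinus {b : ℕ → ℂ} {r : ℝ} (hr : 0 < r) (hr1 : r < 1) (hb : SumAt (xR h) b r)
    (v : FockSpace) (n : ℤ) : gauss (bdVar h) b (xMinus h 0 v n) =
      epsQ h * ((h ^ 2)⁻¹ ^ (n + 1) * avg r fun W => W ^ (-(n + 1)) *
        (gaussGen (bdVar h) b (xR h) W *
          gauss (bdVar h) (b + shift (xD h) W) (v (n + 1)))) := by
  rw [xMinus_apply, map_smul, smul_eq_mul,
    gauss_polyMode_scaled (c := (h ^ 2)⁻¹) (inv_ne_zero (pow_ne_zero _ h0)) (xCre_eq h0 h1)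
      (D := xD h) (fun m => by rw [inv_inv]; exact xAnn_eq h0 h1 m) (bdVar_mul_xR h0 h1)
      (xR_zero h) hr (summable_x_x_sq h0 h1 hr hr1) hb]

/-- The mean `b` is arbitrary, because the lemma is applied repeatedly: each operator is moved onto
the functional in turn and leaves a shifted mean for the next one. -/
theorem gauss_vertexMinus {b : ℕ → ℂ} {ρ : ℝ} (hρ : 0 < ρ) (hρ1 : ‖h‖ ^ 2 * ρ < 1)
    (hb : SumAt (phiR h) b ρ) (k : ℤ) (v : FockSpace) (n : ℤ) :
    gauss (bdVar h) b (vertexMinus h k v n) =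
      (epsQ h)⁻¹ * ((-h ^ 2) ^ n * (h ^ 6) ^ k) * avg ρ fun Z => Z ^ (n - k) *
        (gaussGen (bdVar h) b (phiR h) Z *
          gauss (bdVar h) (b + shift (phiD h) Z) (v (n - 1))) := by
  rw [vertexMinus_apply, map_smul, smul_eq_mul,
    gauss_polyMode_scaled (c := h ^ 6) (pow_ne_zero _ h0) (phiCre_eq h0 h1)
      (D := phiD h) (phiAnn_eq h0 h1) (bdVar_mul_phiR h0 h1)
      (phiR_zero h) hρ (summable_phi_phi_sq h0 h1 hρ hρ1) hb, neg_sub, ← mul_assoc]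
  congr 1
  have h6 : h ^ 6 ≠ 0 := pow_ne_zero _ h0
  rw [zpow_sub₀ h6, show -(h ^ 2) ^ 4 = -h ^ 2 * h ^ 6 by ring, mul_zpow]
  have : (h ^ 6) ^ n ≠ 0 := zpow_ne_zero _ h6
  field_simp

theorem gaussGen_phi_phi {b : ℕ → ℂ} {Z Z' : ℂ}
    (hb : Summable fun m => ‖phiR h m * b m * Z ^ m‖) (hn1 : ‖h ^ 4 * (Z * Z')‖ < 1)
    (hn2 : ‖h ^ 4 * (Z / Z')‖ < 1) :
    gaussGen (bdVar h) (b + shift (phiD h) Z') (phiR h) Z =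
        gaussGen (bdVar h) b (phiR h) Z * (kappa h (Z * Z') * kappa h (Z / Z')) ∧
      Summable fun m => ‖phiR h m * (b + shift (phiD h) Z') m * Z ^ m‖ :=
  gaussGen_add_shift hb (expSum_phi_phi h0 h1 hn1) (expSum_phi_phi h0 h1 hn2)

theorem gaussGen_x_phi {b : ℕ → ℂ} {W Z : ℂ}
    (hb : Summable fun m => ‖xR h m * b m * W ^ m‖) (hn1 : ‖h ^ 2 * (W * Z)‖ < 1)
    (hn2 : ‖h ^ 2 * (W / Z)‖ < 1) :
    gaussGen (bdVar h) (b + shift (phiD h) Z) (xR h) W =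
        gaussGen (bdVar h) b (xR h) W * ((1 - h ^ 2 * (W * Z))⁻¹ * (1 - h ^ 2 * (W / Z))⁻¹) ∧
      Summable fun m => ‖xR h m * (b + shift (phiD h) Z) m * W ^ m‖ :=
  gaussGen_add_shift hb (expSum_x_phi h0 h1 hn1) (expSum_x_phi h0 h1 hn2)

theorem gaussGen_phi_x {b : ℕ → ℂ} {Z W : ℂ}
    (hb : Summable fun m => ‖phiR h m * b m * Z ^ m‖) (hn1 : ‖h ^ 2 * (Z * W)‖ < 1)
    (hn2 : ‖h ^ 2 * (Z / W)‖ < 1) :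
    gaussGen (bdVar h) (b + shift (xD h) W) (phiR h) Z =
        gaussGen (bdVar h) b (phiR h) Z * ((1 - h ^ 2 * (Z * W))⁻¹ * (1 - h ^ 2 * (Z / W))⁻¹) ∧
      Summable fun m => ‖phiR h m * (b + shift (xD h) W) m * Z ^ m‖ :=
  gaussGen_add_shift hb (expSum_phi_x h0 h1 hn1) (expSum_phi_x h0 h1 hn2)

theorem gaussGen_x_x {b : ℕ → ℂ} {W W' : ℂ}
    (hb : Summable fun m => ‖xR h m * b m * W ^ m‖) (hn1 : ‖W * W'‖ < 1)
    (hn2 : ‖W / W'‖ < 1) :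
    gaussGen (bdVar h) (b + shift (xD h) W') (xR h) W =
        gaussGen (bdVar h) b (xR h) W *
          ((1 - W * W') * (1 - h ^ 4 * (W * W')) / (1 + h ^ 2 * (W * W')) *
            ((1 - W / W') * (1 - h ^ 4 * (W / W')) / (1 + h ^ 2 * (W / W')))) ∧
      Summable fun m => ‖xR h m * (b + shift (xD h) W') m * W ^ m‖ :=
  gaussGen_add_shift hb (expSum_x_x h0 h1 hn1) (expSum_x_x h0 h1 hn2)

theorem continuousOn_genPhi {b : ℕ → ℂ} {ρ : ℝ} (hρ : 0 < ρ) (hρ1 : ‖h‖ ^ 2 * ρ < 1)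
    (hb : SumAt (phiR h) b ρ) : ContinuousOn (gaussGen (bdVar h) b (phiR h)) (sphere 0 ρ) :=
  continuousOn_gaussGen (bdVar_mul_phiR h0 h1) hρ.le (summable_phi_phi_sq h0 h1 hρ hρ1) hb

theorem continuousOn_genX {b : ℕ → ℂ} {r : ℝ} (hr : 0 < r) (hr1 : r < 1)
    (hb : SumAt (xR h) b r) : ContinuousOn (gaussGen (bdVar h) b (xR h)) (sphere 0 r) :=
  continuousOn_gaussGen (bdVar_mul_xR h0 h1) hr.le (summable_x_x_sq h0 h1 hr hr1) hb

/-- The matrix element of the `Φ_0` next to a Gaussian functional. -/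
theorem gauss_vertexZero {b : ℕ → ℂ} {ρ r : ℝ} (hρ : 0 < ρ) (hr : 0 < r) (hρ1 : ‖h‖ ^ 2 * ρ < 1)
    (hr1 : r < 1) (c1 : ‖h‖ ^ 2 * r < ρ) (c2 : ‖h‖ ^ 2 * ρ < r)
    (hbP : SumAt (phiR h) b ρ) (hbX : SumAt (xR h) b r) (k : ℤ) (v : FockSpace) (n : ℤ) :
    gauss (bdVar h) b (vertexZero h k v n) =
      (-1) ^ n * (h ^ 6) ^ k * (1 - h ^ 4) * avg ρ fun Z => avg r fun W =>
        Z ^ (n + 1 - k) * W ^ (1 - n) * (gaussGen (bdVar h) b (phiR h) Z *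
          gaussGen (bdVar h) b (xR h) W) *
          ((1 - h ^ 2 * (Z * W)) * (Z - h ^ 2 * W) * (W - h ^ 2 * Z))⁻¹ *
          gauss (bdVar h) (b + shift (phiD h) Z + shift (xD h) W) (v n) := by
  set gP := gaussGen (bdVar h) b (phiR h) with hgP
  set gX := gaussGen (bdVar h) b (xR h) with hgX
  set L : ℂ → ℂ → ℂ := fun Z W =>
    gauss (bdVar h) (b + shift (phiD h) Z + shift (xD h) W) (v n) with hL
  have he := epsQ_ne_zero h0 h1
  have hh2 : h ^ 2 ≠ 0 := pow_ne_zero _ h0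
  have hnZ : ∀ Z : ℂ, ‖Z‖ = ρ → Z ≠ 0 := fun Z hZ => ne_zero_of_norm_eq hρ hZ
  have hnW : ∀ W : ℂ, ‖W‖ = r → W ≠ 0 := fun Z hZ => ne_zero_of_norm_eq hr hZ
  have m1 : ∀ Z W : ℂ, ‖Z‖ = ρ → ‖W‖ = r → ‖h ^ 2 * (Z * W)‖ < 1 := fun Z W hZ hW => by
    rw [norm_mul, norm_mul, norm_pow, hZ, hW, ← mul_assoc]
    exact mul_lt_one_of_nonneg_of_lt_one_left (by positivity) hρ1 hr1.le
  have m2 : ∀ Z W : ℂ, ‖Z‖ = ρ → ‖W‖ = r → ‖h ^ 2 * (W / Z)‖ < 1 := fun Z W hZ hW => by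
    rw [norm_mul, norm_div, norm_pow, hZ, hW, ← mul_div_assoc, div_lt_one hρ]; exact c1
  have m3 : ∀ Z W : ℂ, ‖Z‖ = ρ → ‖W‖ = r → ‖h ^ 2 * (Z / W)‖ < 1 := fun Z W hZ hW => by
    rw [norm_mul, norm_div, norm_pow, hZ, hW, ← mul_div_assoc, div_lt_one hr]; exact c2
  -- The two orders of `Φ_-` and `x^-` differ only in the contraction at `W / Z` versus `Z / W` and
  -- in a monomial. Both converge on the same torus, by `c1` and `c2`, so the integrands of the
  -- `q`-commutator can be added.
  set T1 : ℂ → ℂ → ℂ := fun Z W => Z ^ (n - k) * W ^ (-n) * (gP Z * gX W) *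
    ((1 - h ^ 2 * (W * Z))⁻¹ * (1 - h ^ 2 * (W / Z))⁻¹) * L Z W with hT1
  set T2 : ℂ → ℂ → ℂ := fun Z W => Z ^ (n + 1 - k) * W ^ (-(n + 1)) * (gP Z * gX W) *
    ((1 - h ^ 2 * (Z * W))⁻¹ * (1 - h ^ 2 * (Z / W))⁻¹) * L Z W with hT2
  have cZ : ∀ j : ℤ, ContinuousOn (fun x : ℂ × ℂ => x.1 ^ j) (sphere 0 ρ ×ˢ sphere 0 r) :=
    fun j => (continuousOn_zpow_sphere hρ j).comp continuousOn_fst fun x hx => hx.1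
  have cW : ∀ j : ℤ, ContinuousOn (fun x : ℂ × ℂ => x.2 ^ j) (sphere 0 ρ ×ˢ sphere 0 r) :=
    fun j => (continuousOn_zpow_sphere hr j).comp continuousOn_snd fun x hx => hx.2
  have cP : ContinuousOn (fun x : ℂ × ℂ => gP x.1) (sphere 0 ρ ×ˢ sphere 0 r) :=
    (continuousOn_genPhi h0 h1 hρ hρ1 hbP).comp continuousOn_fst fun x hx => hx.1
  have cX : ContinuousOn (fun x : ℂ × ℂ => gX x.2) (sphere 0 ρ ×ˢ sphere 0 r) :=
    (continuousOn_genX h0 h1 hr hr1 hbX).comp continuousOn_snd fun x hx => hx.2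
  have n1 : ∀ x ∈ sphere (0 : ℂ) ρ ×ˢ sphere (0 : ℂ) r, x.1 ≠ 0 := fun x hx =>
    hnZ _ (mem_sphere_zero_iff_norm.mp hx.1)
  have n2 : ∀ x ∈ sphere (0 : ℂ) ρ ×ˢ sphere (0 : ℂ) r, x.2 ≠ 0 := fun x hx =>
    hnW _ (mem_sphere_zero_iff_norm.mp hx.2)
  have cL : ContinuousOn (fun x : ℂ × ℂ => L x.1 x.2) (sphere 0 ρ ×ˢ sphere 0 r) :=
    continuousOn_gauss _ (fun m => (continuousOn_const.add
      (continuousOn_shift continuousOn_fst n1 m)).add (continuousOn_shift continuousOn_snd n2 m)) _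
  have cA : ContinuousOn (fun x : ℂ × ℂ => (1 - h ^ 2 * (x.2 * x.1))⁻¹ *
      (1 - h ^ 2 * (x.2 / x.1))⁻¹) (sphere 0 ρ ×ˢ sphere 0 r) := by
    refine (ContinuousOn.inv₀ (by fun_prop) fun x hx => ?_).mul
      (ContinuousOn.inv₀ (continuousOn_const.sub (continuousOn_const.mul
        (continuousOn_snd.div continuousOn_fst n1))) fun x hx => ?_)
    · rw [mul_comm x.2]
      exact one_sub_ne_zero_of_norm_lt (m1 _ _ (mem_sphere_zero_iff_norm.mp hx.1)
        (mem_sphere_zero_iff_norm.mp hx.2))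
    · exact one_sub_ne_zero_of_norm_lt (m2 _ _ (mem_sphere_zero_iff_norm.mp hx.1)
        (mem_sphere_zero_iff_norm.mp hx.2))
  have cB : ContinuousOn (fun x : ℂ × ℂ => (1 - h ^ 2 * (x.1 * x.2))⁻¹ *
      (1 - h ^ 2 * (x.1 / x.2))⁻¹) (sphere 0 ρ ×ˢ sphere 0 r) := by
    refine (ContinuousOn.inv₀ (by fun_prop) fun x hx => ?_).mul
      (ContinuousOn.inv₀ (continuousOn_const.sub (continuousOn_const.mul
        (continuousOn_fst.div continuousOn_snd n2))) fun x hx => ?_)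
    · exact one_sub_ne_zero_of_norm_lt (m1 _ _ (mem_sphere_zero_iff_norm.mp hx.1)
        (mem_sphere_zero_iff_norm.mp hx.2))
    · exact one_sub_ne_zero_of_norm_lt (m3 _ _ (mem_sphere_zero_iff_norm.mp hx.1)
        (mem_sphere_zero_iff_norm.mp hx.2))
  have cT1 : ContinuousOn (Function.uncurry T1) (sphere 0 ρ ×ˢ sphere 0 r) :=
    ((((cZ _).mul (cW _)).mul (cP.mul cX)).mul cA).mul cL
  have cT2 : ContinuousOn (Function.uncurry T2) (sphere 0 ρ ×ˢ sphere 0 r) :=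
    ((((cZ _).mul (cW _)).mul (cP.mul cX)).mul cB).mul cL
  -- `Φ_- x_0`
  have t1 : gauss (bdVar h) b (vertexMinus h k (xMinus h 0 v) n) =
      (-1) ^ n * (h ^ 6) ^ k * avg ρ fun Z => avg r fun W => T1 Z W := by
    rw [gauss_vertexMinus h0 h1 hρ hρ1 hbP, show (epsQ h)⁻¹ * ((-h ^ 2) ^ n * (h ^ 6) ^ k) =
      (-1) ^ n * (h ^ 6) ^ k * ((epsQ h)⁻¹ * (h ^ 2) ^ n) by
        rw [← neg_one_mul (h ^ 2), mul_zpow]; ring, mul_assoc]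
    congr 1
    rw [← avg_const_mul]
    refine avg_congr hρ.le fun Z hZ => ?_
    rw [gauss_xMinus h0 h1 hr hr1 (sumAt_of_summable (Z := (r : ℂ)) (Complex.norm_of_nonneg hr.le)
      (gaussGen_x_phi h0 h1 hbX (by rw [mul_comm (r : ℂ)]
                                    exact m1 Z r hZ (Complex.norm_of_nonneg hr.le))
        (m2 Z r hZ (Complex.norm_of_nonneg hr.le))).2), sub_add_cancel]
    rw [show (epsQ h)⁻¹ * (h ^ 2) ^ n * (Z ^ (n - k) * (gP Z * (epsQ h * ((h ^ 2)⁻¹ ^ n *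
      avg r fun W => W ^ (-n) * (gaussGen (bdVar h) (b + shift (phiD h) Z) (xR h) W *
        (gauss (bdVar h) (b + shift (phiD h) Z + shift (xD h) W)) (v n)))))) =
      (Z ^ (n - k) * gP Z) * avg r fun W => W ^ (-n) *
        (gaussGen (bdVar h) (b + shift (phiD h) Z) (xR h) W *
        (gauss (bdVar h) (b + shift (phiD h) Z + shift (xD h) W)) (v n)) by
        rw [inv_zpow]
        have : (h ^ 2) ^ n ≠ 0 := zpow_ne_zero _ hh2
        field_simp]
    rw [← avg_const_mul]
    refine avg_congr hr.le fun W hW => ?_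
    rw [(gaussGen_x_phi h0 h1 (hbX.summable hW) (by rw [mul_comm W]; exact m1 Z W hZ hW)
      (m2 Z W hZ hW)).1]
    simp only [hT1, hL, hgX]
    ring
  -- `x_0 Φ_-`
  have t2 : gauss (bdVar h) b (xMinus h 0 (vertexMinus h k v) n) =
      -((-1) ^ n * (h ^ 6) ^ k) * avg ρ fun Z => avg r fun W => T2 Z W := by
    rw [avg_swap hρ.le hr.le cT2, gauss_xMinus h0 h1 hr hr1 hbX, ← avg_const_mul, ← avg_const_mul,
      ← avg_const_mul]
    refine avg_congr hr.le fun W hW => ?_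
    rw [gauss_vertexMinus h0 h1 hρ hρ1 (sumAt_of_summable (Z := (ρ : ℂ))
      (Complex.norm_of_nonneg hρ.le)
      (gaussGen_phi_x h0 h1 hbP (m1 ρ W (Complex.norm_of_nonneg hρ.le) hW)
        (m3 ρ W (Complex.norm_of_nonneg hρ.le) hW)).2), add_sub_cancel_right]
    have hK : epsQ h * (h ^ 2)⁻¹ ^ (n + 1) * ((epsQ h)⁻¹ * ((-h ^ 2) ^ (n + 1) * (h ^ 6) ^ k)) =
        -((-1) ^ n * (h ^ 6) ^ k) := by
      rw [← neg_one_mul (h ^ 2), mul_zpow, inv_zpow, zpow_add_one₀ (a := (-1 : ℂ)) (by norm_num)]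
      have : (h ^ 2) ^ (n + 1) ≠ 0 := zpow_ne_zero _ hh2
      field_simp
    have hA : avg ρ (fun Z => T2 Z W) = W ^ (-(n + 1)) * gX W * avg ρ fun Z => Z ^ (n + 1 - k) *
        (gaussGen (bdVar h) (b + shift (xD h) W) (phiR h) Z *
          gauss (bdVar h) (b + shift (xD h) W + shift (phiD h) Z) (v n)) := by
      rw [← avg_const_mul]
      refine avg_congr hρ.le fun Z hZ => ?_
      rw [(gaussGen_phi_x h0 h1 (hbP.summable hZ) (m1 Z W hZ hW) (m3 Z W hZ hW)).1,
        add_right_comm b]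
      simp only [hT2, hL, hgP]
      ring
    rw [hA]
    linear_combination (W ^ (-(n + 1)) * gX W * avg ρ fun Z => Z ^ (n + 1 - k) *
        (gaussGen (bdVar h) (b + shift (xD h) W) (phiR h) Z *
          gauss (bdVar h) (b + shift (xD h) W + shift (phiD h) Z) (v n))) * hK
  rw [vertexZero, Finsupp.sub_apply, Finsupp.smul_apply, map_sub, map_smul, smul_eq_mul, t1, t2]
  rw [show ∀ x y : ℂ, (-1) ^ n * (h ^ 6) ^ k * x - h ^ 2 * (-((-1) ^ n * (h ^ 6) ^ k) * y) =
    (-1) ^ n * (h ^ 6) ^ k * (x + h ^ 2 * y) from fun x y => by ring, mul_assoc _ (1 - h ^ 4)]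
  congr 1
  rw [← avg_const_mul, ← avg_const_mul]
  simp only [← avg_const_mul]
  rw [← avg_add_two hρ.le hr.le cT1 (g := fun Z W => h ^ 2 * T2 Z W)
    (continuousOn_const.fun_mul cT2)]
  -- The addition is `(W - qZ) + q (Z - qW) = (1 - q²) W` over the common denominator.
  refine avg_congr hρ.le fun Z hZ => avg_congr hr.le fun W hW => ?_
  have d0 := hnZ Z hZ
  have d1 := hnW W hW
  have d2 := one_sub_ne_zero_of_norm_lt (m1 Z W hZ hW)
  have d3 := one_sub_ne_zero_of_norm_lt (m2 Z W hZ hW)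
  have d4 := one_sub_ne_zero_of_norm_lt (m3 Z W hZ hW)
  have d3' : 1 - h ^ 2 * (W / Z) = (Z - h ^ 2 * W) / Z := by field_simp
  have d4' : 1 - h ^ 2 * (Z / W) = (W - h ^ 2 * Z) / W := by field_simp
  rw [d3'] at d3
  rw [d4'] at d4
  have d5 : Z - h ^ 2 * W ≠ 0 := fun h => d3 (by rw [h, zero_div])
  have d6 : W - h ^ 2 * Z ≠ 0 := fun h => d4 (by rw [h, zero_div])
  simp only [hT1, hT2, mul_comm W Z, d3', d4']
  rw [show n + 1 - k = (n - k) + 1 by ring, zpow_add_one₀ d0, show 1 - n = -n + 1 by ring,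
    zpow_add_one₀ d1, neg_add, ← sub_eq_add_neg, zpow_sub_one₀ d1]
  generalize Z ^ (n - k) = zz
  generalize W ^ (-n) = ww
  generalize gP Z * gX W = gg
  rw [show gauss (bdVar h) (b + shift (phiD h) Z + shift (xD h) W) (v n) = L Z W from rfl]
  generalize L Z W = ll
  field_simp
  ring

end

end IzerginKorepin

/-! ### The matrix elements of `Φ_+`. -/

namespace IzerginKorepin
open Metric Set

/-- The kernels of the integral representations, for `q = h ^ 2`. -/
def xKer (h W₁ W₂ : ℂ) : ℂ := (W₁ - h ^ 4 * W₂) * (W₁ - W₂) / (W₁ + h ^ 2 * W₂)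

def yKer (h W₁ W₂ : ℂ) : ℂ :=
  (1 - W₁ * W₂) * (1 - h ^ 4 * (W₁ * W₂)) / (1 + h ^ 2 * (W₁ * W₂))

def nKer (h W₁ W₂ Z : ℂ) : ℂ := (1 - h ^ 2) * (W₁ * W₂) - h ^ 2 * Z * W₁ + Z * W₂

def dKer (h Z W : ℂ) : ℂ := (1 - h ^ 2 * (Z * W)) * (Z - h ^ 2 * W) * (W - h ^ 2 * Z)

/-- Separates the contraction of two currents into `yKer`, symmetric in its two arguments, and
`xKer`, which is not; later symmetrizations only have to deal with the latter. -/
theorem gaussGen_x_x' {h : ℂ} (h0 : h ≠ 0) (h1 : ‖h‖ < 1) {b : ℕ → ℂ} {W W' : ℂ} (hW' : W' ≠ 0)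
    (hb : Summable fun m => ‖xR h m * b m * W ^ m‖) (hn1 : ‖W * W'‖ < 1) (hn2 : ‖W / W'‖ < 1) :
    gaussGen (bdVar h) (b + shift (xD h) W') (xR h) W =
        gaussGen (bdVar h) b (xR h) W * (yKer h W' W * (xKer h W' W / W')) ∧
      Summable fun m => ‖xR h m * (b + shift (xD h) W') m * W ^ m‖ := by
  have hx := gaussGen_x_x h0 h1 hb hn1 hn2
  refine ⟨?_, hx.2⟩
  have hd : 1 + h ^ 2 * (W / W') ≠ 0 := one_add_ne_zero_of_norm_lt (by
    rw [norm_mul, norm_pow]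
    exact mul_lt_one_of_nonneg_of_lt_one_left (by positivity)
      (pow_lt_one₀ (norm_nonneg _) h1 two_ne_zero) hn2.le)
  have hd' : 1 + h ^ 2 * (W / W') = (W' + h ^ 2 * W) / W' := by field_simp
  rw [hd'] at hd
  have hd2 : W' + h ^ 2 * W ≠ 0 := fun h => hd (by rw [h, zero_div])
  rw [hx.1, yKer, xKer, mul_comm W W', hd']
  congr 2
  field_simp

section
variable {h : ℂ} (h0 : h ≠ 0) (h1 : ‖h‖ < 1)
include h0 h1

/-- The matrix element of the `Φ_+` next to a Gaussian functional. -/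
theorem gauss_vertexPlus {b : ℕ → ℂ} {ρ r₁ r₂ : ℝ} (hρ : 0 < ρ) (hr₂ : 0 < r₂)
    (hρ1 : ‖h‖ ^ 2 * ρ < 1) (hr : r₂ < r₁) (hr1 : r₁ < 1)
    (c1 : ‖h‖ ^ 2 * r₁ < ρ) (c2 : ‖h‖ ^ 2 * ρ < r₂)
    (hbP : SumAt (phiR h) b ρ) (hbX₁ : SumAt (xR h) b r₁) (hbX₂ : SumAt (xR h) b r₂)
    (k : ℤ) (v : FockSpace) (n : ℤ) :
    gauss (bdVar h) b (vertexPlus h k v n) =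
      h * ((-1) ^ n * (h ^ 6) ^ k * (1 - h ^ 4) * (epsQ h * (h ^ 2)⁻¹ ^ (n + 1))) *
      avg ρ fun Z => avg r₁ fun W₁ => avg r₂ fun W₂ =>
        Z ^ (n + 2 - k) * (W₁ * W₂) ^ (-(n + 1)) * (gaussGen (bdVar h) b (phiR h) Z *
          (gaussGen (bdVar h) b (xR h) W₁ * gaussGen (bdVar h) b (xR h) W₂)) *
          (xKer h W₁ W₂ * yKer h W₁ W₂ * nKer h W₁ W₂ Z) * (dKer h Z W₁ * dKer h Z W₂)⁻¹ *
          gauss (bdVar h) (b + shift (phiD h) Z + shift (xD h) W₁ + shift (xD h) W₂)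
            (v (n + 1)) := by
  have hr₁ : 0 < r₁ := hr₂.trans hr
  have hr2 : r₂ < 1 := hr.trans hr1
  set gP := gaussGen (bdVar h) b (phiR h) with hgP
  set gX := gaussGen (bdVar h) b (xR h) with hgX
  set L : ℂ → ℂ → ℂ → ℂ := fun Z W₁ W₂ =>
    gauss (bdVar h) (b + shift (phiD h) Z + shift (xD h) W₁ + shift (xD h) W₂) (v (n + 1)) with hL
  have hq : 0 ≤ ‖h‖ ^ 2 := by positivity
  have hq1 : ‖h‖ ^ 2 < 1 := pow_lt_one₀ (norm_nonneg _) h1 two_ne_zero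
  have hnr : ∀ r : ℝ, 0 < r → ‖(r : ℂ)‖ = r := fun r hr => Complex.norm_of_nonneg hr.le
  have m1 : ∀ {r : ℝ}, 0 < r → r < 1 → ∀ {Z W : ℂ}, ‖Z‖ = ρ → ‖W‖ = r →
      ‖h ^ 2 * (Z * W)‖ < 1 := fun {r} hr hr1 {Z W} hZ hW => by
    rw [norm_mul, norm_mul, norm_pow, hZ, hW, ← mul_assoc]
    exact mul_lt_one_of_nonneg_of_lt_one_left (by positivity) hρ1 hr1.le
  have m2 : ∀ {r : ℝ}, ‖h‖ ^ 2 * r < ρ → ∀ {Z W : ℂ}, ‖Z‖ = ρ → ‖W‖ = r →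
      ‖h ^ 2 * W‖ < ‖Z‖ := fun {r} hr {Z W} hZ hW => by
    rw [norm_mul, norm_pow, hZ, hW]; exact hr
  have m3 : ∀ {r : ℝ}, ‖h‖ ^ 2 * ρ < r → ∀ {Z W : ℂ}, ‖Z‖ = ρ → ‖W‖ = r →
      ‖h ^ 2 * Z‖ < ‖W‖ := fun {r} hr {Z W} hZ hW => by
    rw [norm_mul, norm_pow, hZ, hW]; exact hr
  have hdiv : ∀ {x y : ℂ}, ‖h ^ 2 * x‖ < ‖y‖ → ‖h ^ 2 * (x / y)‖ < 1 := fun {x y} hxy => by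
    rw [← mul_div_assoc, norm_div, div_lt_one ((norm_nonneg _).trans_lt hxy)]; exact hxy
  have c1' : ‖h‖ ^ 2 * r₂ < ρ := (mul_le_mul_of_nonneg_left hr.le hq).trans_lt c1
  have c2' : ‖h‖ ^ 2 * ρ < r₁ := c2.trans hr
  have mX1 : ∀ {W₁ W₂ : ℂ}, ‖W₁‖ = r₁ → ‖W₂‖ = r₂ → ‖W₂ * W₁‖ < 1 := fun {W₁ W₂} hW₁ hW₂ => by
    rw [norm_mul, hW₁, hW₂]
    exact mul_lt_one_of_nonneg_of_lt_one_left hr₂.le hr2 hr1.le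
  have mX2 : ∀ {W₁ W₂ : ℂ}, ‖W₁‖ = r₁ → ‖W₂‖ = r₂ → ‖W₂ / W₁‖ < 1 := fun {W₁ W₂} hW₁ hW₂ => by
    rw [norm_div, hW₁, hW₂, div_lt_one hr₁]; exact hr
  set S : Set ((ℂ × ℂ) × ℂ) := (sphere 0 ρ ×ˢ sphere 0 r₁) ×ˢ sphere 0 r₂
  have sZ : ∀ x ∈ S, ‖x.1.1‖ = ρ := fun x hx => mem_sphere_zero_iff_norm.mp hx.1.1
  have s1 : ∀ x ∈ S, ‖x.1.2‖ = r₁ := fun x hx => mem_sphere_zero_iff_norm.mp hx.1.2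
  have s2 : ∀ x ∈ S, ‖x.2‖ = r₂ := fun x hx => mem_sphere_zero_iff_norm.mp hx.2
  have pZ : ContinuousOn (fun x : (ℂ × ℂ) × ℂ => x.1.1) S := by fun_prop
  have p1 : ContinuousOn (fun x : (ℂ × ℂ) × ℂ => x.1.2) S := by fun_prop
  have p2 : ContinuousOn (fun x : (ℂ × ℂ) × ℂ => x.2) S := by fun_prop
  have nZ : ∀ x ∈ S, x.1.1 ≠ 0 := fun x hx => ne_zero_of_norm_eq hρ (sZ x hx)
  have n1 : ∀ x ∈ S, x.1.2 ≠ 0 := fun x hx => ne_zero_of_norm_eq hr₁ (s1 x hx)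
  have n2 : ∀ x ∈ S, x.2 ≠ 0 := fun x hx => ne_zero_of_norm_eq hr₂ (s2 x hx)
  have cZ : ∀ j : ℤ, ContinuousOn (fun x : (ℂ × ℂ) × ℂ => x.1.1 ^ j) S := fun j =>
    pZ.zpow₀ j fun x hx => Or.inl (nZ x hx)
  have cW1 : ∀ j : ℤ, ContinuousOn (fun x : (ℂ × ℂ) × ℂ => x.1.2 ^ j) S := fun j =>
    p1.zpow₀ j fun x hx => Or.inl (n1 x hx)
  have cW2 : ∀ j : ℤ, ContinuousOn (fun x : (ℂ × ℂ) × ℂ => x.2 ^ j) S := fun j =>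
    p2.zpow₀ j fun x hx => Or.inl (n2 x hx)
  have cP : ContinuousOn (fun x : (ℂ × ℂ) × ℂ => gP x.1.1) S :=
    (continuousOn_genPhi h0 h1 hρ hρ1 hbP).comp pZ fun x hx => hx.1.1
  have cX1 : ContinuousOn (fun x : (ℂ × ℂ) × ℂ => gX x.1.2) S :=
    (continuousOn_genX h0 h1 hr₁ hr1 hbX₁).comp p1 fun x hx => hx.1.2
  have cX2 : ContinuousOn (fun x : (ℂ × ℂ) × ℂ => gX x.2) S :=
    (continuousOn_genX h0 h1 hr₂ hr2 hbX₂).comp p2 fun x hx => hx.2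
  have cL : ContinuousOn (fun x : (ℂ × ℂ) × ℂ => L x.1.1 x.1.2 x.2) S :=
    continuousOn_gauss _ (fun m => ((continuousOn_const.add (continuousOn_shift pZ nZ m)).add
      (continuousOn_shift p1 n1 m)).add (continuousOn_shift p2 n2 m)) _
  have qW : ∀ x ∈ S, ‖h ^ 2 * x.2‖ < ‖x.1.2‖ := fun x hx => by
    rw [norm_mul, norm_pow, s1 x hx, s2 x hx]
    exact (mul_le_of_le_one_left hr₂.le hq1.le).trans_lt hr
  have cXX : ContinuousOn (fun x : (ℂ × ℂ) × ℂ => yKer h x.1.2 x.2 * (xKer h x.1.2 x.2 / x.1.2)) S := by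
    unfold yKer xKer
    refine (ContinuousOn.div (by fun_prop) (by fun_prop) fun x hx => ?_).mul
      ((ContinuousOn.div (by fun_prop) (by fun_prop) fun x hx => ?_).div p1 n1)
    · refine one_add_ne_zero_of_norm_lt ?_
      rw [norm_mul, norm_pow, mul_comm x.1.2]
      exact mul_lt_one_of_nonneg_of_lt_one_left hq hq1 (mX1 (s1 x hx) (s2 x hx)).le
    · rw [← sub_neg_eq_add]
      exact sub_ne_zero_of_norm_lt (by rw [norm_neg]; exact qW x hx)
  have cD1 : ContinuousOn (fun x : (ℂ × ℂ) × ℂ => (dKer h x.1.1 x.1.2)⁻¹) S := by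
    unfold dKer
    refine ContinuousOn.inv₀ (by fun_prop) fun x hx => ?_
    exact mul_ne_zero (mul_ne_zero
      (one_sub_ne_zero_of_norm_lt (m1 hr₁ hr1 (sZ x hx) (s1 x hx)))
      (sub_ne_zero_of_norm_lt (m2 c1 (sZ x hx) (s1 x hx))))
      (sub_ne_zero_of_norm_lt (m3 c2' (sZ x hx) (s1 x hx)))
  have cD2 : ContinuousOn (fun x : (ℂ × ℂ) × ℂ => (dKer h x.1.1 x.2)⁻¹) S := by
    unfold dKer
    refine ContinuousOn.inv₀ (by fun_prop) fun x hx => ?_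
    exact mul_ne_zero (mul_ne_zero
      (one_sub_ne_zero_of_norm_lt (m1 hr₂ hr2 (sZ x hx) (s2 x hx)))
      (sub_ne_zero_of_norm_lt (m2 c1' (sZ x hx) (s2 x hx))))
      (sub_ne_zero_of_norm_lt (m3 c2 (sZ x hx) (s2 x hx)))
  have cA : ContinuousOn (fun x : (ℂ × ℂ) × ℂ => (1 - h ^ 2 * (x.2 * x.1.1))⁻¹ *
      (1 - h ^ 2 * (x.2 / x.1.1))⁻¹) S := by
    refine (ContinuousOn.inv₀ (by fun_prop) fun x hx => ?_).mul
      (ContinuousOn.inv₀ (continuousOn_const.sub (continuousOn_const.mul (p2.div pZ nZ)))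
        fun x hx => ?_)
    · rw [mul_comm x.2]
      exact one_sub_ne_zero_of_norm_lt (m1 hr₂ hr2 (sZ x hx) (s2 x hx))
    · exact one_sub_ne_zero_of_norm_lt (hdiv (m2 c1' (sZ x hx) (s2 x hx)))
  have cB : ContinuousOn (fun x : (ℂ × ℂ) × ℂ => (1 - h ^ 2 * (x.1.1 * x.1.2))⁻¹ *
      (1 - h ^ 2 * (x.1.1 / x.1.2))⁻¹) S := by
    refine (ContinuousOn.inv₀ (by fun_prop) fun x hx => ?_).mul
      (ContinuousOn.inv₀ (continuousOn_const.sub (continuousOn_const.mul (pZ.div p1 n1)))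
        fun x hx => ?_)
    · exact one_sub_ne_zero_of_norm_lt (m1 hr₁ hr1 (sZ x hx) (s1 x hx))
    · exact one_sub_ne_zero_of_norm_lt (hdiv (m3 c2' (sZ x hx) (s1 x hx)))
  -- In `Φ_0 x_0` the current inside `Φ_0` gets the variable `W₁`; in `x_0 Φ_0` the outer current
  -- does. Thus the left current always carries the larger radius `r₁`, as the contraction of two
  -- currents requires, and both terms live on one torus.
  set T1 : ℂ → ℂ → ℂ → ℂ := fun Z W₁ W₂ => Z ^ (n + 1 - k) * W₁ ^ (1 - n) * W₂ ^ (-(n + 1)) *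
    (gP Z * (gX W₁ * gX W₂)) * (((1 - h ^ 2 * (W₂ * Z))⁻¹ * (1 - h ^ 2 * (W₂ / Z))⁻¹) *
      (yKer h W₁ W₂ * (xKer h W₁ W₂ / W₁)) * (dKer h Z W₁)⁻¹) * L Z W₁ W₂ with hT1
  set T2 : ℂ → ℂ → ℂ → ℂ := fun Z W₁ W₂ => Z ^ (n + 2 - k) * W₁ ^ (-(n + 1)) * W₂ ^ (-n) *
    (gP Z * (gX W₁ * gX W₂)) * (((1 - h ^ 2 * (Z * W₁))⁻¹ * (1 - h ^ 2 * (Z / W₁))⁻¹) *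
      (yKer h W₁ W₂ * (xKer h W₁ W₂ / W₁)) * (dKer h Z W₂)⁻¹) * L Z W₁ W₂ with hT2
  have cT1 : ContinuousOn (fun x : (ℂ × ℂ) × ℂ => T1 x.1.1 x.1.2 x.2) S :=
    (((((cZ _).mul (cW1 _)).mul (cW2 _)).mul (cP.mul (cX1.mul cX2))).mul
      ((cA.mul cXX).mul cD1)).mul cL
  have cT2 : ContinuousOn (fun x : (ℂ × ℂ) × ℂ => T2 x.1.1 x.1.2 x.2) S :=
    (((((cZ _).mul (cW1 _)).mul (cW2 _)).mul (cP.mul (cX1.mul cX2))).mul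
      ((cB.mul cXX).mul cD2)).mul cL
  -- summability of the shifted means
  have sPZ : ∀ {Z : ℂ}, ‖Z‖ = ρ → ∀ {r : ℝ}, 0 < r → r < 1 → ‖h‖ ^ 2 * r < ρ →
      SumAt (xR h) b r → SumAt (xR h) (b + shift (phiD h) Z) r :=
    fun {Z} hZ {r} hr hr1 hc hb => sumAt_of_summable (hnr r hr) (gaussGen_x_phi h0 h1 hb
      (by rw [mul_comm (r : ℂ)]; exact m1 hr hr1 hZ (hnr r hr)) (hdiv (m2 hc hZ (hnr r hr)))).2
  set C := (-1 : ℂ) ^ n * (h ^ 6) ^ k * (1 - h ^ 4) * (epsQ h * (h ^ 2)⁻¹ ^ (n + 1)) with hC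
  -- `Φ_0 x_0`
  have t1 : gauss (bdVar h) b (vertexZero h k (xMinus h 0 v) n) =
      C * avg ρ fun Z => avg r₁ fun W₁ => avg r₂ fun W₂ => T1 Z W₁ W₂ := by
    rw [gauss_vertexZero h0 h1 hρ hr₁ hρ1 hr1 c1 c2' hbP hbX₁, hC, mul_assoc _ (epsQ h * _)]
    congr 1
    simp only [← avg_const_mul]
    refine avg_congr hρ.le fun Z hZ => avg_congr hr₁.le fun W₁ hW₁ => ?_
    have hs := sumAt_of_summable (hnr r₂ hr₂) (gaussGen_x_x' h0 h1 (ne_zero_of_norm_eq hr₁ hW₁)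
      (sPZ hZ hr₂ hr2 c1' hbX₂) (mX1 hW₁ (hnr r₂ hr₂)) (mX2 hW₁ (hnr r₂ hr₂))).2
    rw [gauss_xMinus h0 h1 hr₂ hr2 hs]
    simp only [← avg_const_mul]
    refine avg_congr hr₂.le fun W₂ hW₂ => ?_
    rw [(gaussGen_x_x' h0 h1 (ne_zero_of_norm_eq hr₁ hW₁)
      ((sPZ hZ hr₂ hr2 c1' hbX₂).summable hW₂) (mX1 hW₁ hW₂) (mX2 hW₁ hW₂)).1,
      (gaussGen_x_phi h0 h1 (hbX₂.summable hW₂) (by rw [mul_comm W₂]; exact m1 hr₂ hr2 hZ hW₂)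
        (hdiv (m2 c1' hZ hW₂))).1]
    simp only [hT1, hL, hgX, dKer]
    ring
  -- `x_0 Φ_0`
  have t2 : gauss (bdVar h) b (xMinus h 0 (vertexZero h k v) n) =
      -C * avg ρ fun Z => avg r₁ fun W₁ => avg r₂ fun W₂ => T2 Z W₁ W₂ := by
    rw [avg_swap hρ.le hr₁.le (continuousOn_avg_last hr₂.le cT2), gauss_xMinus h0 h1 hr₁ hr1 hbX₁]
    simp only [← avg_const_mul]
    refine avg_congr hr₁.le fun W₁ hW₁ => ?_
    have hW0 := ne_zero_of_norm_eq hr₁ hW₁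
    have hs1 : SumAt (phiR h) (b + shift (xD h) W₁) ρ := sumAt_of_summable (hnr ρ hρ)
      (gaussGen_phi_x h0 h1 hbP (m1 hr₁ hr1 (hnr ρ hρ) hW₁) (hdiv (m3 c2' (hnr ρ hρ) hW₁))).2
    have hs2 : SumAt (xR h) (b + shift (xD h) W₁) r₂ := sumAt_of_summable (hnr r₂ hr₂)
      (gaussGen_x_x' h0 h1 hW0 hbX₂ (mX1 hW₁ (hnr r₂ hr₂)) (mX2 hW₁ (hnr r₂ hr₂))).2
    rw [gauss_vertexZero h0 h1 hρ hr₂ hρ1 hr2 c1' c2 hs1 hs2]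
    simp only [← avg_const_mul]
    refine avg_congr hρ.le fun Z hZ => avg_congr hr₂.le fun W₂ hW₂ => ?_
    rw [(gaussGen_x_x' h0 h1 hW0 (hbX₂.summable hW₂) (mX1 hW₁ hW₂) (mX2 hW₁ hW₂)).1,
      (gaussGen_phi_x h0 h1 (hbP.summable hZ) (m1 hr₁ hr1 hZ hW₁) (hdiv (m3 c2' hZ hW₁))).1,
      add_right_comm b (shift (xD h) W₁)]
    simp only [hT2, hL, hgX, hgP, dKer, hC]
    rw [show n + 1 + 1 - k = n + 2 - k by ring, show 1 - (n + 1) = -n by ring,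
      zpow_add_one₀ (a := (-1 : ℂ)) (by norm_num)]
    ring
  rw [vertexPlus, Finsupp.smul_apply, Finsupp.sub_apply, map_smul, map_sub, smul_eq_mul, t1, t2]
  rw [show ∀ x y : ℂ, h * (C * x - -C * y) = h * C * (x + y) from fun x y => by ring,
    ← avg_add_three hρ.le hr₁.le hr₂.le cT1 cT2]
  congr 1
  refine avg_congr hρ.le fun Z hZ => avg_congr hr₁.le fun W₁ hW₁ => avg_congr hr₂.le
    fun W₂ hW₂ => ?_
  have d0 := ne_zero_of_norm_eq hρ hZ
  have d1 := ne_zero_of_norm_eq hr₁ hW₁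
  have d2 := ne_zero_of_norm_eq hr₂ hW₂
  have e1 := one_sub_ne_zero_of_norm_lt (m1 hr₁ hr1 hZ hW₁)
  have e2 := one_sub_ne_zero_of_norm_lt (m1 hr₂ hr2 hZ hW₂)
  have e3 := sub_ne_zero_of_norm_lt (m2 c1 hZ hW₁)
  have e4 := sub_ne_zero_of_norm_lt (m2 c1' hZ hW₂)
  have e5 := sub_ne_zero_of_norm_lt (m3 c2' hZ hW₁)
  have e6 := sub_ne_zero_of_norm_lt (m3 c2 hZ hW₂)
  simp only [hT1, hT2, dKer, nKer, mul_comm W₂ Z,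
    show 1 - h ^ 2 * (W₂ / Z) = (Z - h ^ 2 * W₂) / Z by field_simp,
    show 1 - h ^ 2 * (Z / W₁) = (W₁ - h ^ 2 * Z) / W₁ by field_simp]
  rw [show gauss (bdVar h) (b + shift (phiD h) Z + shift (xD h) W₁ + shift (xD h) W₂) (v (n + 1)) =
    L Z W₁ W₂ from rfl]
  rw [show n + 2 - k = (n + 1 - k) + 1 by ring, zpow_add_one₀ d0, show 1 - n = -(n + 1) + 1 + 1 by ring,
    zpow_add_one₀ d1, zpow_add_one₀ d1, show -n = -(n + 1) + 1 by ring, zpow_add_one₀ d2, mul_zpow]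
  generalize 1 - h ^ 2 * (Z * W₁) = f1 at *
  generalize 1 - h ^ 2 * (Z * W₂) = f2 at *
  generalize Z ^ (n + 1 - k) = zz
  generalize W₁ ^ (-(n + 1)) = w1
  generalize W₂ ^ (-(n + 1)) = w2
  generalize gP Z * (gX W₁ * gX W₂) = gg
  generalize L Z W₁ W₂ = ll
  generalize xKer h W₁ W₂ = xx
  generalize yKer h W₁ W₂ = yy
  generalize g1 : Z - h ^ 2 * W₁ = a1 at *
  generalize g2 : Z - h ^ 2 * W₂ = a2 at *
  generalize g3 : W₁ - h ^ 2 * Z = a3 at *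
  generalize g4 : W₂ - h ^ 2 * Z = a4 at *
  field_simp
  -- What is left is `W₁ (W₂ - qZ) + W₂ (Z - qW₁)`, which is `nKer`.
  rw [← g1, ← g4]
  ring

end

end IzerginKorepin

namespace IzerginKorepin
open Metric Set

/-! ### The integrand of the four-point function -/

/-- The contraction of `x^-` with the boundary. -/
def chi (h : ℂ) (ε : SignType) (W : ℂ) : ℂ := (1 - W ^ 2) * (1 + (ε : ℂ) * Complex.I * h⁻¹ * W)

/-- The value at `v` of the Gaussian functional shifted by all four operators. -/
def shifted (h : ℂ) (ε : SignType) (v : FockSpace) (Z₁ Z₂ W₁ W₂ : ℂ) : ℂ :=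
  gauss (bdVar h) (bdMean h ε + shift (phiD h) Z₁ + shift (phiD h) Z₂ + shift (xD h) W₁ +
    shift (xD h) W₂) (v ((ε : ℤ) ^ 2))

/-- The part of the integrand that does not depend on the component and is symmetric in `W₁` and
`W₂`. -/
def symKer (h : ℂ) (ε : SignType) (v : FockSpace) (Z₁ Z₂ W₁ W₂ : ℂ) : ℂ :=
  yKer h W₁ W₂ * (chi h ε W₁ * chi h ε W₂) * (W₁ * W₂) ^ (-(ε : ℤ) ^ 2) *
    ((Z₁ - h ^ 2 * W₁) * (Z₁ - h ^ 2 * W₂) * ((W₁ - h ^ 2 * Z₂) * (W₂ - h ^ 2 * Z₂)) *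
      ((1 - h ^ 2 * (Z₁ * W₁)) * (1 - h ^ 2 * (Z₁ * W₂)) *
        ((1 - h ^ 2 * (Z₂ * W₁)) * (1 - h ^ 2 * (Z₂ * W₂)))))⁻¹ *
    shifted h ε v Z₁ Z₂ W₁ W₂

/-- The part of the integrand that depends on the component `j`. -/
def pKer (h : ℂ) (j : SignType) (Z₁ Z₂ W₁ W₂ : ℂ) : ℂ :=
  match j with
  | .pos => h ^ 2 * nKer h W₁ W₂ Z₂ / ((Z₂ - h ^ 2 * W₁) * (Z₂ - h ^ 2 * W₂))
  | .zero => (1 - h ^ 4) * (W₁ * W₂) / ((W₁ - h ^ 2 * Z₁) * (Z₂ - h ^ 2 * W₂))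
  | .neg => nKer h W₁ W₂ Z₁ / ((W₁ - h ^ 2 * Z₁) * (W₂ - h ^ 2 * Z₁))

/-- The factors that depend on `Z₁` and `Z₂` only. -/
def preKer (h : ℂ) (ε : SignType) (Z₁ Z₂ : ℂ) : ℂ :=
  phi h ε (-Z₁) * phi h ε (-Z₂) * (kappa h (Z₂ * Z₁) * kappa h (Z₂ / Z₁)) * (1 - h ^ 4) *
    (Z₁ ^ ((ε : ℤ) ^ 2 + 2) * Z₂ ^ ((ε : ℤ) ^ 2 + 1))

/-- The `W`-integrand. -/
def wKer (h : ℂ) (ε : SignType) (j : SignType) (v : FockSpace) (Z₁ Z₂ W₁ W₂ : ℂ) : ℂ :=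
  pKer h j Z₁ Z₂ W₁ W₂ * xKer h W₁ W₂ * symKer h ε v Z₁ Z₂ W₁ W₂

/-- The denominator of `pKer`. -/
def pDen (h : ℂ) (j : SignType) (Z₁ Z₂ W₁ W₂ : ℂ) : ℂ :=
  match j with
  | .pos => (Z₂ - h ^ 2 * W₁) * (Z₂ - h ^ 2 * W₂)
  | .zero => (W₁ - h ^ 2 * Z₁) * (Z₂ - h ^ 2 * W₂)
  | .neg => (W₁ - h ^ 2 * Z₁) * (W₂ - h ^ 2 * Z₁)

/-- The denominators of `wKer`, apart from `pDen`, do not vanish. -/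
structure RegularAt (h Z₁ Z₂ W₁ W₂ : ℂ) : Prop where
  z₁ : Z₁ ≠ 0
  z₂ : Z₂ ≠ 0
  w₁ : W₁ ≠ 0
  w₂ : W₂ ≠ 0
  xd : W₁ + h ^ 2 * W₂ ≠ 0
  yd : 1 + h ^ 2 * (W₁ * W₂) ≠ 0
  a₁ : Z₁ - h ^ 2 * W₁ ≠ 0
  a₂ : Z₁ - h ^ 2 * W₂ ≠ 0
  b₁ : W₁ - h ^ 2 * Z₂ ≠ 0
  b₂ : W₂ - h ^ 2 * Z₂ ≠ 0
  c₁ : 1 - h ^ 2 * (Z₁ * W₁) ≠ 0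
  c₂ : 1 - h ^ 2 * (Z₁ * W₂) ≠ 0
  d₁ : 1 - h ^ 2 * (Z₂ * W₁) ≠ 0
  d₂ : 1 - h ^ 2 * (Z₂ * W₂) ≠ 0

section
variable {E : Type*} [NormedAddCommGroup E] [NormedSpace ℂ E] {f g : E → ℂ} {x : E}

theorem differentiableAt_div (hf : DifferentiableAt ℂ f x) (hg : DifferentiableAt ℂ g x)
    (h0 : g x ≠ 0) : DifferentiableAt ℂ (fun x => f x / g x) x := by
  simpa only [div_eq_mul_inv] using hf.fun_mul (hg.fun_inv h0)

theorem differentiableAt_zpow_comp (hf : DifferentiableAt ℂ f x) (h0 : f x ≠ 0) (n : ℤ) :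
    DifferentiableAt ℂ (fun x => f x ^ n) x :=
  DifferentiableAt.comp x (g := fun z : ℂ => z ^ n) (differentiableAt_zpow.mpr (Or.inl h0)) hf

end

theorem differentiableAt_shift {E : Type*} [NormedAddCommGroup E] [NormedSpace ℂ E] {D : ℕ → ℂ}
    {f : E → ℂ} {x : E} (hf : DifferentiableAt ℂ f x) (hf0 : f x ≠ 0) (m : ℕ) :
    DifferentiableAt ℂ (fun x => shift D (f x) m) x := by
  unfold shift
  exact (differentiableAt_const _).fun_mul ((hf.fun_pow m).fun_add ((hf.fun_inv hf0).fun_pow m))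

section
variable {E : Type*} [NormedAddCommGroup E] [NormedSpace ℂ E] {h : ℂ}
  {z₁ z₂ w₁ w₂ : E → ℂ} {x : E}

theorem differentiableAt_shifted (ε : SignType) (v : FockSpace)
    (dz₁ : DifferentiableAt ℂ z₁ x) (dz₂ : DifferentiableAt ℂ z₂ x)
    (dw₁ : DifferentiableAt ℂ w₁ x) (dw₂ : DifferentiableAt ℂ w₂ x)
    (nz₁ : z₁ x ≠ 0) (nz₂ : z₂ x ≠ 0) (nw₁ : w₁ x ≠ 0) (nw₂ : w₂ x ≠ 0) :
    DifferentiableAt ℂ (fun x => shifted h ε v (z₁ x) (z₂ x) (w₁ x) (w₂ x)) x := by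
  unfold shifted
  exact differentiableAt_gauss _ (fun m => (((((differentiableAt_const _).fun_add
    (differentiableAt_shift dz₁ nz₁ m)).fun_add (differentiableAt_shift dz₂ nz₂ m)).fun_add
    (differentiableAt_shift dw₁ nw₁ m)).fun_add (differentiableAt_shift dw₂ nw₂ m))) _

theorem differentiableAt_symKer (ε : SignType) (v : FockSpace)
    (dz₁ : DifferentiableAt ℂ z₁ x) (dz₂ : DifferentiableAt ℂ z₂ x)
    (dw₁ : DifferentiableAt ℂ w₁ x) (dw₂ : DifferentiableAt ℂ w₂ x)
    (H : RegularAt h (z₁ x) (z₂ x) (w₁ x) (w₂ x)) :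
    DifferentiableAt ℂ (fun x => symKer h ε v (z₁ x) (z₂ x) (w₁ x) (w₂ x)) x := by
  unfold symKer
  refine (((DifferentiableAt.fun_mul ?_ ?_).fun_mul ?_).fun_mul ?_).fun_mul
    (differentiableAt_shifted ε v dz₁ dz₂ dw₁ dw₂ H.z₁ H.z₂ H.w₁ H.w₂)
  · unfold yKer
    refine differentiableAt_div ?_ ?_ H.yd <;> fun_prop
  · unfold chi; fun_prop
  · exact differentiableAt_zpow_comp (dw₁.fun_mul dw₂) (mul_ne_zero H.w₁ H.w₂) _
  · exact DifferentiableAt.fun_inv (by fun_prop) (mul_ne_zero (mul_ne_zero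
      (mul_ne_zero H.a₁ H.a₂) (mul_ne_zero H.b₁ H.b₂)) (mul_ne_zero (mul_ne_zero H.c₁ H.c₂)
        (mul_ne_zero H.d₁ H.d₂)))

theorem differentiableAt_pKer (j : SignType)
    (dz₁ : DifferentiableAt ℂ z₁ x) (dz₂ : DifferentiableAt ℂ z₂ x)
    (dw₁ : DifferentiableAt ℂ w₁ x) (dw₂ : DifferentiableAt ℂ w₂ x)
    (hj : pDen h j (z₁ x) (z₂ x) (w₁ x) (w₂ x) ≠ 0) :
    DifferentiableAt ℂ (fun x => pKer h j (z₁ x) (z₂ x) (w₁ x) (w₂ x)) x := by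
  cases j
  · refine differentiableAt_div ?_ ?_ hj <;> fun_prop
  · refine differentiableAt_div ?_ ?_ hj <;> (try unfold nKer) <;> fun_prop
  · refine differentiableAt_div ?_ ?_ hj <;> (try unfold nKer) <;> fun_prop

theorem differentiableAt_xKer (dw₁ : DifferentiableAt ℂ w₁ x) (dw₂ : DifferentiableAt ℂ w₂ x)
    (hd : w₁ x + h ^ 2 * w₂ x ≠ 0) : DifferentiableAt ℂ (fun x => xKer h (w₁ x) (w₂ x)) x := by
  unfold xKer
  refine differentiableAt_div ?_ ?_ hd <;> fun_prop

theorem differentiableAt_wKer (ε j : SignType) (v : FockSpace)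
    (dz₁ : DifferentiableAt ℂ z₁ x) (dz₂ : DifferentiableAt ℂ z₂ x)
    (dw₁ : DifferentiableAt ℂ w₁ x) (dw₂ : DifferentiableAt ℂ w₂ x)
    (H : RegularAt h (z₁ x) (z₂ x) (w₁ x) (w₂ x))
    (hj : pDen h j (z₁ x) (z₂ x) (w₁ x) (w₂ x) ≠ 0) :
    DifferentiableAt ℂ (fun x => wKer h ε j v (z₁ x) (z₂ x) (w₁ x) (w₂ x)) x :=
  ((differentiableAt_pKer j dz₁ dz₂ dw₁ dw₂ hj).fun_mul (differentiableAt_xKer dw₁ dw₂ H.xd)).fun_mul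
    (differentiableAt_symKer ε v dz₁ dz₂ dw₁ dw₂ H)

end

section
variable {h : ℂ} (h0 : h ≠ 0) (h1 : ‖h‖ < 1) (ε : SignType)
include h0 h1

theorem differentiable_phiNum : Differentiable ℂ (phiNum h ε) := by
  have p12 := differentiable_qPoch (norm_pow_pow_lt h0 h1 (k := 12) (by norm_num))
  have p6 := differentiable_qPoch (norm_pow_pow_lt h0 h1 (k := 6) (by norm_num))
  have e : phiNum h ε = fun z => phiNum h ε z := rfl
  rw [e]
  simp only [phiNum_eq]
  exact (((p12.comp (by fun_prop : Differentiable ℂ fun z : ℂ => (h ^ 2) ^ 8 * z ^ 2)).mul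
    (p12.comp (by fun_prop : Differentiable ℂ fun z : ℂ => -(h ^ 2) ^ 9 * z ^ 2))).mul
    ((p6.comp (by fun_prop : Differentiable ℂ fun z : ℂ => (ε : ℂ) * Complex.I * h ^ 9 * z)).mul
    (p6.comp (by fun_prop : Differentiable ℂ fun z : ℂ => -(ε : ℂ) * Complex.I * h ^ 7 * z))))

theorem differentiable_phiDen : Differentiable ℂ (phiDen h ε) := by
  have p12 := differentiable_qPoch (norm_pow_pow_lt h0 h1 (k := 12) (by norm_num))
  have p6 := differentiable_qPoch (norm_pow_pow_lt h0 h1 (k := 6) (by norm_num))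
  have e : phiDen h ε = fun z => phiDen h ε z := rfl
  rw [e]
  simp only [phiDen_eq]
  exact (((p12.comp (by fun_prop : Differentiable ℂ fun z : ℂ => (h ^ 2) ^ 12 * z ^ 2)).mul
    (p12.comp (by fun_prop : Differentiable ℂ fun z : ℂ => -(h ^ 2) ^ 5 * z ^ 2))).mul
    ((p6.comp (by fun_prop : Differentiable ℂ fun z : ℂ => (ε : ℂ) * Complex.I * h * z)).mul
    (p6.comp (by fun_prop : Differentiable ℂ fun z : ℂ => -(ε : ℂ) * Complex.I * h ^ 3 * z))))

theorem differentiableAt_phi {z : ℂ} (hz : phiDen h ε z ≠ 0) : DifferentiableAt ℂ (phi h ε) z :=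
  (differentiable_phiNum h0 h1 ε z).fun_div (differentiable_phiDen h0 h1 ε z) hz

theorem phiDen_ne_zero {z : ℂ} (hz : ‖h * z‖ < 1) : phiDen h ε z ≠ 0 :=
  (expSum_phiDen h0 h1 ε hz).ne_zero

theorem differentiableAt_kappa {u : ℂ} (hu : ‖h ^ 4 * u‖ < 1) : DifferentiableAt ℂ (kappa h) u := by
  have p6 := norm_pow_pow_lt h0 h1 (k := 6) (by norm_num)
  have d6 := differentiable_qPoch p6
  have n10 : ‖-h ^ 10 * u‖ < 1 := by
    rw [neg_mul, norm_neg]; exact norm_pow_mul_lt h1 (by norm_num) hu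
  have n12 : ‖h ^ 12 * u‖ < 1 := norm_pow_mul_lt h1 (by norm_num) hu
  exact (((d6.comp (by fun_prop : Differentiable ℂ fun z : ℂ => h ^ 4 * z)).mul
    (d6.comp (by fun_prop : Differentiable ℂ fun z : ℂ => -h ^ 6 * z))) u).fun_div
    (((d6.comp (by fun_prop : Differentiable ℂ fun z : ℂ => h ^ 12 * z)).mul
    (d6.comp (by fun_prop : Differentiable ℂ fun z : ℂ => -h ^ 10 * z))) u)
    (mul_ne_zero (expSum_qPoch p6 n12).ne_zero (expSum_qPoch p6 n10).ne_zero)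

theorem differentiableAt_preKer {E : Type*} [NormedAddCommGroup E] [NormedSpace ℂ E]
    {z₁ z₂ : E → ℂ} {x : E} (dz₁ : DifferentiableAt ℂ z₁ x) (dz₂ : DifferentiableAt ℂ z₂ x)
    (nz₁ : z₁ x ≠ 0) (nz₂ : z₂ x ≠ 0) (c₁ : ‖h * z₁ x‖ < 1) (c₂ : ‖h * z₂ x‖ < 1)
    (k₁ : ‖h ^ 4 * (z₂ x * z₁ x)‖ < 1) (k₂ : ‖h ^ 4 * (z₂ x / z₁ x)‖ < 1) :
    DifferentiableAt ℂ (fun x => preKer h ε (z₁ x) (z₂ x)) x := by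
  unfold preKer
  have e₁ : DifferentiableAt ℂ (phi h ε) (-z₁ x) := differentiableAt_phi h0 h1 ε
    (phiDen_ne_zero h0 h1 ε (by rwa [mul_neg, norm_neg]))
  have e₂ : DifferentiableAt ℂ (phi h ε) (-z₂ x) := differentiableAt_phi h0 h1 ε
    (phiDen_ne_zero h0 h1 ε (by rwa [mul_neg, norm_neg]))
  exact ((((e₁.comp x dz₁.neg).fun_mul (e₂.comp x dz₂.neg)).fun_mul
    (((differentiableAt_kappa h0 h1 k₁).comp x (dz₂.mul dz₁)).fun_mul
      ((differentiableAt_kappa h0 h1 k₂).comp x (differentiableAt_div dz₂ dz₁ nz₁)))).fun_mul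
    (differentiableAt_const _)).fun_mul ((differentiableAt_zpow_comp dz₁ nz₁ _).fun_mul
      (differentiableAt_zpow_comp dz₂ nz₂ _))

end

/-! ### Admissible radii -/

/-- Admissible radii of the contours. -/
structure Radii (h : ℂ) (j : SignType) (ρ₁ ρ₂ r₁ r₂ : ℝ) : Prop where
  ρ₂_pos : 0 < ρ₂
  r₂_pos : 0 < r₂
  r_lt : r₂ < r₁
  r₁_lt : r₁ < ‖h‖
  hρ₁ : ‖h‖ * ρ₁ < 1
  hρ₂ : ‖h‖ * ρ₂ < 1
  ar : ‖h‖ ^ 2 * r₁ < ρ₁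
  br : ‖h‖ ^ 2 * ρ₂ < r₂
  pos : j = 1 → ‖h‖ ^ 2 * r₁ < ρ₂
  zero : j = 0 → ‖h‖ ^ 2 * ρ₁ < r₁ ∧ ‖h‖ ^ 2 * r₂ < ρ₂
  neg : j = -1 → ‖h‖ ^ 2 * ρ₁ < r₂

section
variable {h : ℂ} {j : SignType} {ρ₁ ρ₂ r₁ r₂ : ℝ}

/-- The conditions on the radii are those under which the contractions converge: `ar` and `br` for a
current between the two vertex operators, and the component conditions for currents that stand on
both sides of their vertex operator. They keep every denominator away from zero. -/
theorem Radii.regularAt (R : Radii h j ρ₁ ρ₂ r₁ r₂) (h1 : ‖h‖ < 1) {Z₁ Z₂ W₁ W₂ : ℂ}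
    (hZ₁ : ‖Z₁‖ = ρ₁) (hZ₂ : ‖Z₂‖ = ρ₂) (hW₁ : ‖W₁‖ = r₁) (hW₂ : ‖W₂‖ = r₂) :
    RegularAt h Z₁ Z₂ W₁ W₂ ∧ pDen h j Z₁ Z₂ W₁ W₂ ≠ 0 := by
  obtain ⟨p2, q2, rl, r1, e1, e2, ar, br, jp, jz, jn⟩ := R
  have hn := norm_nonneg h
  have hq : 0 ≤ ‖h‖ ^ 2 := by positivity
  have hq1 : ‖h‖ ^ 2 < 1 := pow_lt_one₀ hn h1 two_ne_zero
  have q1 : 0 < r₁ := q2.trans rl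
  have p1 : 0 < ρ₁ := (by positivity : 0 ≤ ‖h‖ ^ 2 * r₁).trans_lt ar
  have sub : ∀ {x y : ℂ}, ‖h‖ ^ 2 * ‖y‖ < ‖x‖ → x - h ^ 2 * y ≠ 0 := fun {x y} hxy =>
    sub_ne_zero_of_norm_lt (by rwa [norm_mul, norm_pow])
  have one : ∀ {x y : ℂ}, ‖h‖ * ‖x‖ < 1 → ‖h‖ * ‖y‖ < 1 → ‖h ^ 2 * (x * y)‖ < 1 :=
    fun {x y} hx hy => by
      rw [norm_mul, norm_mul, norm_pow,
        show ‖h‖ ^ 2 * (‖x‖ * ‖y‖) = (‖h‖ * ‖x‖) * (‖h‖ * ‖y‖) by ring]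
      exact mul_lt_one_of_nonneg_of_lt_one_left (by positivity) hx hy.le
  have hr₁ : ‖h‖ * r₁ < 1 := by nlinarith
  have hr₂ : ‖h‖ * r₂ < 1 := by nlinarith
  have ar' : ‖h‖ ^ 2 * r₂ < ρ₁ := (mul_le_mul_of_nonneg_left rl.le hq).trans_lt ar
  refine ⟨⟨ne_zero_of_norm_eq p1 hZ₁, ne_zero_of_norm_eq p2 hZ₂, ne_zero_of_norm_eq q1 hW₁,
    ne_zero_of_norm_eq q2 hW₂, ?_, one_add_ne_zero_of_norm_lt (one (by rwa [hW₁]) (by rwa [hW₂])),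
    sub (by rwa [hZ₁, hW₁]), sub (by rwa [hZ₁, hW₂]), sub (by rw [hW₁, hZ₂]; exact br.trans rl),
    sub (by rwa [hW₂, hZ₂]), one_sub_ne_zero_of_norm_lt (one (by rwa [hZ₁]) (by rwa [hW₁])),
    one_sub_ne_zero_of_norm_lt (one (by rwa [hZ₁]) (by rwa [hW₂])),
    one_sub_ne_zero_of_norm_lt (one (by rwa [hZ₂]) (by rwa [hW₁])),
    one_sub_ne_zero_of_norm_lt (one (by rwa [hZ₂]) (by rwa [hW₂]))⟩, ?_⟩
  · rw [← sub_neg_eq_add]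
    refine sub_ne_zero_of_norm_lt ?_
    rw [norm_neg, norm_mul, norm_pow, hW₁, hW₂]
    exact (mul_le_of_le_one_left q2.le hq1.le).trans_lt rl
  · cases j
    · have := jz rfl
      exact mul_ne_zero (sub (by rw [hW₁, hZ₁]; exact this.1)) (sub (by rw [hW₂, hZ₂]; exact this.2))
    · have := jn rfl
      exact mul_ne_zero (sub (by rw [hW₁, hZ₁]; exact this.trans rl))
        (sub (by rw [hW₂, hZ₁]; exact this))
    · have := jp rfl
      exact mul_ne_zero (sub (by rw [hW₁, hZ₂]; exact this))
        (sub (by rw [hW₂, hZ₂]; exact (mul_le_mul_of_nonneg_left rl.le hq).trans_lt this))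

theorem Radii.kappa_bounds (R : Radii h j ρ₁ ρ₂ r₁ r₂) (h1 : ‖h‖ < 1) {Z₁ Z₂ : ℂ}
    (hZ₁ : ‖Z₁‖ = ρ₁) (hZ₂ : ‖Z₂‖ = ρ₂) :
    0 < ρ₁ ∧ ‖h * Z₁‖ < 1 ∧ ‖h * Z₂‖ < 1 ∧ ‖h ^ 4 * (Z₂ * Z₁)‖ < 1 ∧ ‖h ^ 4 * (Z₂ / Z₁)‖ < 1 := by
  obtain ⟨p2, q2, rl, r1, e1, e2, ar, br, jp, jz, jn⟩ := R
  have hn := norm_nonneg h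
  have hq : 0 ≤ ‖h‖ ^ 2 := by positivity
  have hq1 : ‖h‖ ^ 2 < 1 := pow_lt_one₀ hn h1 two_ne_zero
  have q1 : 0 < r₁ := q2.trans rl
  have p1 : 0 < ρ₁ := (by positivity : 0 ≤ ‖h‖ ^ 2 * r₁).trans_lt ar
  refine ⟨p1, by rwa [norm_mul, hZ₁], by rwa [norm_mul, hZ₂], ?_, ?_⟩
  · rw [norm_mul, norm_mul, norm_pow, hZ₁, hZ₂,
      show ‖h‖ ^ 4 * (ρ₂ * ρ₁) = (‖h‖ ^ 2) * ((‖h‖ * ρ₂) * (‖h‖ * ρ₁)) by ring]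
    exact mul_lt_one_of_nonneg_of_lt_one_left hq hq1
      (mul_le_one₀ e2.le (by positivity) e1.le)
  · rw [norm_mul, norm_div, norm_pow, hZ₁, hZ₂, ← mul_div_assoc, div_lt_one p1]
    nlinarith

end

end IzerginKorepin

/-! ### The fourfold integral for the component `+`. -/

namespace IzerginKorepin
open Metric Set

/-- The full integrand of the coefficient of `Z₁^k₁ Z₂^k₂`. -/
def fourKer (h : ℂ) (ε j : SignType) (v : FockSpace) (k₁ k₂ : ℤ) (Z₁ Z₂ W₁ W₂ : ℂ) : ℂ :=
  Z₁ ^ (-k₁) * Z₂ ^ (-k₂) * (preKer h ε Z₁ Z₂ * wKer h ε j v Z₁ Z₂ W₁ W₂)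

theorem avg_rotate {ρ σ τ : ℝ} (hρ : 0 ≤ ρ) (hσ : 0 ≤ σ) (hτ : 0 ≤ τ) {f : ℂ → ℂ → ℂ → ℂ}
    (hf : ContinuousOn (fun x : (ℂ × ℂ) × ℂ => f x.1.1 x.1.2 x.2)
      ((sphere 0 ρ ×ˢ sphere 0 σ) ×ˢ sphere 0 τ)) :
    avg ρ (fun a => avg σ fun b => avg τ fun c => f a b c) =
      avg τ fun c => avg ρ fun a => avg σ fun b => f a b c := by
  have e1 : avg ρ (fun a => avg σ fun b => avg τ fun c => f a b c) =
      avg ρ fun a => avg τ fun c => avg σ fun b => f a b c := by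
    refine avg_congr hρ fun a ha => avg_swap hσ hτ ?_
    rw [← mem_sphere_zero_iff_norm] at ha
    exact hf.comp (f := fun x : ℂ × ℂ => ((a, x.1), x.2)) (by fun_prop)
      fun x hx => ⟨⟨ha, hx.1⟩, hx.2⟩
  rw [e1, avg_swap hρ hτ]
  exact continuousOn_avg_last (f := fun a c b => f a b c) hσ
    (hf.comp (f := fun x : (ℂ × ℂ) × ℂ => ((x.1.1, x.2), x.1.2)) (by fun_prop)
      fun x hx => ⟨⟨hx.1.1, hx.2⟩, hx.1.2⟩)

/-- Pure bookkeeping with atoms: the two factors `1/Z` hidden in the contractions at `W / Z₁` absorb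
`(Z²)⁻¹`. Only `Z` has to be nonzero, since the other inverses occur identically on both sides. -/
theorem integrand_identity_pos {Z za zb zc zd ww ph1 ph2 kk ch1 ch2 xx yy nn ll a1 a2 a3 a4 a5 a6 a7
    a8 a9 a10 : ℂ} (hZ : Z ≠ 0) : za * zb * (Z ^ 2)⁻¹ * (ph1 * (zc * zd * ww * (ph2 * kk * (ch1 *
      (a1⁻¹ * (a5 / Z)⁻¹) * (ch2 * (a2⁻¹ * (a6 / Z)⁻¹)))) * (xx * yy * nn) *
      (a3 * a7 * a9 * (a4 * a8 * a10))⁻¹ * ll)) =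
      zb * zd * (ph1 * ph2 * kk * (za * zc) * (nn / (a7 * a8) * xx *
        (yy * (ch1 * ch2) * ww * (a5 * a6 * (a9 * a10) * (a1 * a2 * (a3 * a4)))⁻¹ * ll))) := by
  simp only [div_eq_mul_inv, mul_inv, inv_inv]
  have e : Z ^ 2 * (Z ^ 2)⁻¹ = 1 := mul_inv_cancel₀ (pow_ne_zero _ hZ)
  linear_combination (zb * zd * (ph1 * ph2 * kk * (za * zc) * (nn * (a7⁻¹ * a8⁻¹) * xx *
    (yy * (ch1 * ch2) * ww * (a5⁻¹ * a6⁻¹ * (a9⁻¹ * a10⁻¹) * (a1⁻¹ * a2⁻¹ * (a3⁻¹ * a4⁻¹))) *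
      ll)))) * e

section
variable {h : ℂ} (h0 : h ≠ 0) (h1 : ‖h‖ < 1) {ε j : SignType} {ρ₁ ρ₂ r₁ r₂ : ℝ}
include h0 h1

theorem Radii.differentiableAt_fourKer (R : Radii h j ρ₁ ρ₂ r₁ r₂) (v : FockSpace) (k₁ k₂ : ℤ)
    {x : (ℂ × ℂ) × (ℂ × ℂ)} (hx : x ∈ (sphere (0 : ℂ) ρ₁ ×ˢ sphere (0 : ℂ) ρ₂) ×ˢ
      (sphere (0 : ℂ) r₁ ×ˢ sphere (0 : ℂ) r₂)) :
    DifferentiableAt ℂ (fun x : (ℂ × ℂ) × (ℂ × ℂ) =>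
      fourKer h ε j v k₁ k₂ x.1.1 x.1.2 x.2.1 x.2.2) x := by
  obtain ⟨⟨hz1, hz2⟩, hw1, hw2⟩ := hx
  rw [mem_sphere_zero_iff_norm] at hz1 hz2 hw1 hw2
  obtain ⟨H, hj⟩ := R.regularAt h1 hz1 hz2 hw1 hw2
  obtain ⟨-, b1, b2, b3, b4⟩ := R.kappa_bounds h1 hz1 hz2
  have d1 : DifferentiableAt ℂ (fun x : (ℂ × ℂ) × (ℂ × ℂ) => x.1.1) x := by fun_prop
  have d2 : DifferentiableAt ℂ (fun x : (ℂ × ℂ) × (ℂ × ℂ) => x.1.2) x := by fun_prop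
  have d3 : DifferentiableAt ℂ (fun x : (ℂ × ℂ) × (ℂ × ℂ) => x.2.1) x := by fun_prop
  have d4 : DifferentiableAt ℂ (fun x : (ℂ × ℂ) × (ℂ × ℂ) => x.2.2) x := by fun_prop
  have e1 := differentiableAt_zpow_comp d1 H.z₁ (-k₁)
  have e2 := differentiableAt_zpow_comp d2 H.z₂ (-k₂)
  have e3 := differentiableAt_preKer h0 h1 ε d1 d2 H.z₁ H.z₂ b1 b2 b3 b4
  have e4 := differentiableAt_wKer ε j v d1 d2 d3 d4 H hj
  exact (e1.fun_mul e2).fun_mul (e3.fun_mul e4)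

theorem Radii.continuousOn_fourKer (R : Radii h j ρ₁ ρ₂ r₁ r₂) (v : FockSpace) (k₁ k₂ : ℤ) :
    ContinuousOn (fun x : (ℂ × ℂ) × (ℂ × ℂ) => fourKer h ε j v k₁ k₂ x.1.1 x.1.2 x.2.1 x.2.2)
      ((sphere (0 : ℂ) ρ₁ ×ˢ sphere (0 : ℂ) ρ₂) ×ˢ (sphere (0 : ℂ) r₁ ×ˢ sphere (0 : ℂ) r₂)) :=
  fun _ hx => (R.differentiableAt_fourKer h0 h1 v k₁ k₂ hx).continuousAt.continuousWithinAt

theorem sumAt_phiR_bdMean {ρ : ℝ} (hρ : 0 < ρ) (hh : ‖h‖ * ρ < 1) :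
    SumAt (phiR h) (bdMean h ε) ρ :=
  summable_phiR_mul_bdMean h0 h1 ε (by rwa [norm_mul, Complex.norm_of_nonneg hρ.le])

theorem sumAt_xR_bdMean {r : ℝ} (hr : 0 < r) (hh : r < ‖h‖) : SumAt (xR h) (bdMean h ε) r :=
  summable_xR_mul_bdMean h0 h1 ε (by rwa [Complex.norm_of_nonneg hr.le])

theorem sq_mul_lt_one {ρ : ℝ} (hh : ‖h‖ * ρ < 1) : ‖h‖ ^ 2 * ρ < 1 := by
  have := norm_pos_iff.mpr h0
  rw [sq, mul_assoc]
  exact mul_lt_one_of_nonneg_of_lt_one_left (norm_nonneg _) h1 hh.le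

set_option maxHeartbeats 1000000 in
theorem dualGroundState_vertex_pos (R : Radii h 1 ρ₁ ρ₂ r₁ r₂) (v : FockSpace) (k₁ k₂ : ℤ) :
    dualGroundState h ε (vertexDual h 1 k₁ (vertex h 1 k₂ v)) =
      (-1) ^ k₁ * (h ^ 6) ^ k₂ * avg ρ₁ fun Z₁ => avg ρ₂ fun Z₂ => avg r₁ fun W₁ => avg r₂ fun W₂ =>
        fourKer h ε 1 v k₁ k₂ Z₁ Z₂ W₁ W₂ := by
  obtain ⟨p2, q2, rl, r1, e1, e2, ar, br, jp, -, -⟩ := id R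
  have c := jp rfl
  have q1 : 0 < r₁ := q2.trans rl
  have p1 : 0 < ρ₁ := (by positivity : 0 ≤ ‖h‖ ^ 2 * r₁).trans_lt ar
  have hnr : ∀ {r : ℝ}, 0 < r → ‖(r : ℂ)‖ = r := fun {r} hr => Complex.norm_of_nonneg hr.le
  have hdiv : ∀ {x y : ℂ}, ‖h‖ ^ 2 * ‖x‖ < ‖y‖ → ‖h ^ 2 * (x / y)‖ < 1 := fun {x y} hxy => by
    rw [← mul_div_assoc, norm_div, norm_mul, norm_pow, div_lt_one (by
      exact (by positivity : 0 ≤ ‖h‖ ^ 2 * ‖x‖).trans_lt hxy)]; exact hxy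
  have one : ∀ {x y : ℂ}, ‖h‖ * ‖x‖ < 1 → ‖h‖ * ‖y‖ < 1 → ‖h ^ 2 * (x * y)‖ < 1 :=
    fun {x y} hx hy => by
      rw [norm_mul, norm_mul, norm_pow,
        show ‖h‖ ^ 2 * (‖x‖ * ‖y‖) = (‖h‖ * ‖x‖) * (‖h‖ * ‖y‖) by ring]
      exact mul_lt_one_of_nonneg_of_lt_one_left (by positivity) hx hy.le
  have hhr₁ : ‖h‖ * r₁ < 1 := by nlinarith [norm_nonneg h]
  have hhr₂ : ‖h‖ * r₂ < 1 := by nlinarith [norm_nonneg h]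
  have ar' : ‖h‖ ^ 2 * r₂ < ρ₁ := by nlinarith [sq_nonneg ‖h‖]
  have xz : ∀ {r : ℝ}, ‖h‖ * r < 1 → ‖h‖ ^ 2 * r < ρ₁ → ∀ {W Z : ℂ}, ‖W‖ = r → ‖Z‖ = ρ₁ →
      ‖h ^ 2 * (W * Z)‖ < 1 ∧ ‖h ^ 2 * (W / Z)‖ < 1 := fun {r} a b {W Z} hW hZ =>
    ⟨one (by rwa [hW]) (by rwa [hZ]), hdiv (by rwa [hW, hZ])⟩
  have b1 := sumAt_phiR_bdMean h0 h1 (ε := ε) p1 e1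
  have b2 := sumAt_phiR_bdMean h0 h1 (ε := ε) p2 e2
  have x1 := sumAt_xR_bdMean h0 h1 (ε := ε) q1 r1
  have x2 := sumAt_xR_bdMean h0 h1 (ε := ε) q2 (rl.trans r1)
  set n : ℤ := (ε : ℤ) ^ 2 with hn
  have he := epsQ_ne_zero h0 h1
  have hh2 : h ^ 2 ≠ 0 := pow_ne_zero _ h0
  rw [dualGroundState_eq, ← hn]
  change gauss (bdVar h) (bdMean h ε)
    ((((-h) ^ ((1 : SignType) : ℤ) * (-((h ^ 2) ^ 3)⁻¹) ^ k₁) •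
      vertexMinus h k₁ (vertexPlus h k₂ v)) n) = _
  rw [Finsupp.smul_apply, map_smul, smul_eq_mul,
    gauss_vertexMinus h0 h1 p1 (sq_mul_lt_one h0 h1 e1) b1]
  simp only [← avg_const_mul]
  refine avg_congr p1.le fun Z₁ hZ₁ => ?_
  have s2 : SumAt (phiR h) (bdMean h ε + shift (phiD h) Z₁) ρ₂ := by
    have := R.kappa_bounds h1 hZ₁ (hnr p2)
    exact sumAt_of_summable (hnr p2) (gaussGen_phi_phi h0 h1 b2 this.2.2.2.1 this.2.2.2.2).2
  have sx1 : SumAt (xR h) (bdMean h ε + shift (phiD h) Z₁) r₁ := by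
    have := xz hhr₁ ar (hnr q1) hZ₁
    exact sumAt_of_summable (hnr q1) (gaussGen_x_phi h0 h1 x1 this.1 this.2).2
  have sx2 : SumAt (xR h) (bdMean h ε + shift (phiD h) Z₁) r₂ := by
    have := xz hhr₂ ar' (hnr q2) hZ₁
    exact sumAt_of_summable (hnr q2) (gaussGen_x_phi h0 h1 x2 this.1 this.2).2
  rw [gauss_vertexPlus h0 h1 p2 q2 (sq_mul_lt_one h0 h1 e2) rl (r1.trans h1) c br s2 sx1 sx2]
  simp only [← avg_const_mul]
  refine avg_congr p2.le fun Z₂ hZ₂ => avg_congr q1.le fun W₁ hW₁ => avg_congr q2.le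
    fun W₂ hW₂ => ?_
  obtain ⟨H, hj⟩ := R.regularAt h1 hZ₁ hZ₂ hW₁ hW₂
  obtain ⟨-, bb1, bb2, bb3, bb4⟩ := R.kappa_bounds h1 hZ₁ hZ₂
  have m1 := xz hhr₁ ar hW₁ hZ₁
  have m2 := xz hhr₂ ar' hW₂ hZ₁
  rw [(gaussGen_phi_phi h0 h1 (b2.summable hZ₂) bb3 bb4).1,
    (gaussGen_x_phi h0 h1 (x1.summable hW₁) m1.1 m1.2).1,
    (gaussGen_x_phi h0 h1 (x2.summable hW₂) m2.1 m2.2).1, gaussGen_phi h0 h1 ε bb1,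
    gaussGen_phi h0 h1 ε bb2, gaussGen_x h0 h1 ε (by rw [hW₁]; exact r1),
    gaussGen_x h0 h1 ε (by rw [hW₂]; exact rl.trans r1), sub_add_cancel]
  -- All scalar prefactors: the rescaling `(h⁶)^{k₁}` of `Z₁` cancels the argument `-q⁻³z` of the
  -- dual operator up to `(-1)^{k₁}`, and the powers of `ε(q)` and of `q^n` cancel between the
  -- vertex operators and the currents.
  have hK : (-h) ^ ((1 : SignType) : ℤ) * (-((h ^ 2) ^ 3)⁻¹) ^ k₁ *
      ((epsQ h)⁻¹ * ((-h ^ 2) ^ n * (h ^ 6) ^ k₁)) *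
      (h * ((-1) ^ (n - 1) * (h ^ 6) ^ k₂ * (1 - h ^ 4) * (epsQ h * (h ^ 2)⁻¹ ^ n))) =
      (-1) ^ k₁ * (h ^ 6) ^ k₂ * (h ^ 2 * (1 - h ^ 4)) := by
    have hh6 : (h ^ 6) ^ k₁ ≠ 0 := zpow_ne_zero _ (pow_ne_zero _ h0)
    have hhn : (h ^ 2) ^ n ≠ 0 := zpow_ne_zero _ hh2
    rw [show (-((h ^ 2) ^ 3)⁻¹) = -1 * (h ^ 6)⁻¹ by rw [← pow_mul]; ring, mul_zpow, inv_zpow,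
      show (-h ^ 2) = -1 * h ^ 2 by ring, mul_zpow, inv_zpow, zpow_sub_one₀ (by norm_num)]
    have hs : ((-1 : ℂ) ^ n) * (-1) ^ n = 1 := by rw [← mul_zpow]; norm_num
    simp only [SignType.coe_one, zpow_one]
    field_simp
    linear_combination (1 - h ^ 4) * hs
  have hZ : Z₁ ^ (n - k₁) = Z₁ ^ (n + 2) * Z₁ ^ (-k₁) * (Z₁ ^ 2)⁻¹ := by
    rw [← zpow_natCast, ← zpow_neg, ← zpow_add₀ H.z₁, ← zpow_add₀ H.z₁]
    congr 1; push_cast; ring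
  have hZ' : Z₂ ^ (n - 1 + 2 - k₂) = Z₂ ^ (n + 1) * Z₂ ^ (-k₂) := by
    rw [← zpow_add₀ H.z₂]; congr 1; ring
  obtain ⟨z1, z2, w1, w2, -, -, f1, f2, g1, g2, u1, u2, u3, u4⟩ := H
  simp only [fourKer, preKer, wKer, symKer, shifted, dKer, chi, ← hn]
  change _ = (-1) ^ k₁ * (h ^ 6) ^ k₂ * (_ * (_ * (h ^ 2 * nKer h W₁ W₂ Z₂ /
    ((Z₂ - h ^ 2 * W₁) * (Z₂ - h ^ 2 * W₂)) * _ * _)))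
  have hj1 : Z₂ - h ^ 2 * W₁ ≠ 0 := left_ne_zero_of_mul hj
  have hj2 : Z₂ - h ^ 2 * W₂ ≠ 0 := right_ne_zero_of_mul hj
  rw [hZ, hZ', show 1 - h ^ 2 * (W₁ / Z₁) = (Z₁ - h ^ 2 * W₁) / Z₁ by field_simp,
    show 1 - h ^ 2 * (W₂ / Z₁) = (Z₁ - h ^ 2 * W₂) / Z₁ by field_simp, mul_comm W₁ Z₁,
    mul_comm W₂ Z₁]
  generalize gauss (bdVar h) (bdMean h ε + shift (phiD h) Z₁ + shift (phiD h) Z₂ +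
    shift (xD h) W₁ + shift (xD h) W₂) (v n) = ll
  generalize xKer h W₁ W₂ = xx
  generalize yKer h W₁ W₂ = yy
  generalize nKer h W₁ W₂ Z₂ = nn
  generalize (1 - W₁ ^ 2) * (1 + (ε : ℂ) * Complex.I * h⁻¹ * W₁) = ch1
  generalize (1 - W₂ ^ 2) * (1 + (ε : ℂ) * Complex.I * h⁻¹ * W₂) = ch2
  generalize Z₁ ^ (n + 2) = za
  generalize Z₁ ^ (-k₁) = zb
  generalize Z₂ ^ (n + 1) = zc
  generalize Z₂ ^ (-k₂) = zd
  generalize (W₁ * W₂) ^ (-n) = ww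
  generalize phi h ε (-Z₁) = ph1
  generalize phi h ε (-Z₂) = ph2
  generalize kappa h (Z₂ * Z₁) * kappa h (Z₂ / Z₁) = kk
  generalize 1 - h ^ 2 * (Z₁ * W₁) = a1 at *
  generalize 1 - h ^ 2 * (Z₁ * W₂) = a2 at *
  generalize 1 - h ^ 2 * (Z₂ * W₁) = a3 at *
  generalize 1 - h ^ 2 * (Z₂ * W₂) = a4 at *
  generalize Z₁ - h ^ 2 * W₁ = a5 at *
  generalize Z₁ - h ^ 2 * W₂ = a6 at *
  generalize Z₂ - h ^ 2 * W₁ = a7 at *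
  generalize Z₂ - h ^ 2 * W₂ = a8 at *
  generalize W₁ - h ^ 2 * Z₂ = a9 at *
  generalize W₂ - h ^ 2 * Z₂ = a10 at *
  generalize (-h) ^ ((1 : SignType) : ℤ) = k1 at *
  generalize (-((h ^ 2) ^ 3)⁻¹) ^ k₁ = k2 at *
  generalize (-h ^ 2) ^ n = k3 at *
  generalize (h ^ 6) ^ k₁ = k4 at *
  generalize (-1 : ℂ) ^ (n - 1) = k5 at *
  generalize (h ^ 6) ^ k₂ = k6 at *
  generalize (h ^ 2)⁻¹ ^ n = k7 at *
  generalize (-1 : ℂ) ^ k₁ = k8 at *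
  have hbody := integrand_identity_pos (za := za) (zb := zb) (zc := zc) (zd := zd) (ww := ww)
    (ph1 := ph1) (ph2 := ph2) (kk := kk) (ch1 := ch1) (ch2 := ch2) (xx := xx) (yy := yy) (nn := nn)
    (ll := ll) (a1 := a1) (a2 := a2) (a3 := a3) (a4 := a4) (a5 := a5) (a6 := a6) (a7 := a7)
    (a8 := a8) (a9 := a9) (a10 := a10) z1
  linear_combination (za * zb * (Z₁ ^ 2)⁻¹ * (ph1 * (zc * zd * ww * (ph2 * kk * (ch1 *
      (a1⁻¹ * (a5 / Z₁)⁻¹) * (ch2 * (a2⁻¹ * (a6 / Z₁)⁻¹)))) * (xx * yy * nn) *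
      (a3 * a7 * a9 * (a4 * a8 * a10))⁻¹ * ll))) * hK + k8 * k6 * (h ^ 2 * (1 - h ^ 4)) * hbody

end

end IzerginKorepin

/-! ### The fourfold integrals for the components `0` and `-`. -/

namespace IzerginKorepin
open Metric Set

theorem integrand_identity_zero {Z W z1 zb z2 zd ww wp ph1 ph2 kk ch1 ch2 xx yy ll q a1 a2 a3
    a4 a5 a6 a8 a9 a10 b1 : ℂ} (hW : W ≠ 0) :
    z1 * zb * wp * (ph1 * ch1) * (a1 * a5 * b1)⁻¹ *
      (z2 * zd * ww * (ph2 * kk * (a3⁻¹ * (a9 / W)⁻¹) *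
        (ch2 * (a2⁻¹ * (a6 / Z)⁻¹) * (yy * (xx / W)))) * (a4 * a8 * a10)⁻¹ * ll) * q =
    zb * zd * (ph1 * ph2 * kk * (z1 * Z * z2) * (q * (wp * ww) / (b1 * a8) * xx *
        (yy * (ch1 * ch2) * (a5 * a6 * (a9 * a10) * (a1 * a2 * (a3 * a4)))⁻¹ * ll))) := by
  simp only [div_eq_mul_inv, mul_inv, inv_inv]
  have e : W * W⁻¹ = 1 := mul_inv_cancel₀ hW
  linear_combination (zb * zd * (ph1 * ph2 * kk * (z1 * Z * z2) * (q * (wp * ww) * (b1⁻¹ * a8⁻¹) *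
    xx * (yy * (ch1 * ch2) * (a5⁻¹ * a6⁻¹ * (a9⁻¹ * a10⁻¹) * (a1⁻¹ * a2⁻¹ * (a3⁻¹ * a4⁻¹))) *
      ll)))) * e

theorem integrand_identity_neg {W V za zb zc zd ww ph1 ph2 kk ch1 ch2 xx yy nn ll a1 a2 a3 a4 a5 a6
    b1 b2 a9 a10 : ℂ} (hW : W ≠ 0) (hV : V ≠ 0) :
    za * zb * (ww * (W * V)⁻¹) * (ph1 * (ch1 * ch2)) * (xx * yy * nn) *
      (a1 * a5 * b1 * (a2 * a6 * b2))⁻¹ * (zc * zd * (ph2 * kk * (a3⁻¹ * (a9 / W)⁻¹) *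
        (a4⁻¹ * (a10 / V)⁻¹) * ll)) =
      zb * zd * (ph1 * ph2 * kk * (za * zc) * (nn / (b1 * b2) * xx *
        (yy * (ch1 * ch2) * ww * (a5 * a6 * (a9 * a10) * (a1 * a2 * (a3 * a4)))⁻¹ * ll))) := by
  simp only [div_eq_mul_inv, mul_inv, inv_inv]
  have e : (W * W⁻¹) * (V * V⁻¹) = 1 := by rw [mul_inv_cancel₀ hW, mul_inv_cancel₀ hV, one_mul]
  linear_combination (zb * zd * (ph1 * ph2 * kk * (za * zc) * (nn * (b1⁻¹ * b2⁻¹) * xx *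
    (yy * (ch1 * ch2) * ww * (a5⁻¹ * a6⁻¹ * (a9⁻¹ * a10⁻¹) * (a1⁻¹ * a2⁻¹ * (a3⁻¹ * a4⁻¹))) *
      ll)))) * e

section
variable {h : ℂ} (h0 : h ≠ 0) (h1 : ‖h‖ < 1) {ε j : SignType} {ρ₁ ρ₂ r₁ r₂ : ℝ}
include h0 h1

theorem norm_sq_mul_lt_one {x y : ℂ} (hx : ‖h‖ * ‖x‖ < 1) (hy : ‖h‖ * ‖y‖ < 1) :
    ‖h ^ 2 * (x * y)‖ < 1 := by
  rw [norm_mul, norm_mul, norm_pow,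
    show ‖h‖ ^ 2 * (‖x‖ * ‖y‖) = (‖h‖ * ‖x‖) * (‖h‖ * ‖y‖) by ring]
  exact mul_lt_one_of_nonneg_of_lt_one_left (by positivity) hx hy.le

theorem norm_sq_div_lt_one {x y : ℂ} (hxy : ‖h‖ ^ 2 * ‖x‖ < ‖y‖) : ‖h ^ 2 * (x / y)‖ < 1 := by
  rw [← mul_div_assoc, norm_div, norm_mul, norm_pow, div_lt_one (by
    exact (by positivity : 0 ≤ ‖h‖ ^ 2 * ‖x‖).trans_lt hxy)]; exact hxy

set_option maxHeartbeats 1000000 in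
theorem dualGroundState_vertex_zero (R : Radii h 0 ρ₁ ρ₂ r₁ r₂) (v : FockSpace) (k₁ k₂ : ℤ) :
    dualGroundState h ε (vertexDual h 0 k₁ (vertex h 0 k₂ v)) =
      (-1) ^ k₁ * (h ^ 6) ^ k₂ * avg ρ₁ fun Z₁ => avg ρ₂ fun Z₂ => avg r₁ fun W₁ => avg r₂ fun W₂ =>
        fourKer h ε 0 v k₁ k₂ Z₁ Z₂ W₁ W₂ := by
  have hc := R.continuousOn_fourKer h0 h1 (ε := ε) v k₁ k₂
  obtain ⟨p2, q2, rl, r1, e1, e2, ar, br, -, jz, -⟩ := id R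
  obtain ⟨c1, c2⟩ := jz rfl
  have q1 : 0 < r₁ := q2.trans rl
  have p1 : 0 < ρ₁ := (by positivity : 0 ≤ ‖h‖ ^ 2 * r₁).trans_lt ar
  -- The operators are peeled off from left to right, which produces `W₁` before `Z₂`; Fubini
  -- restores the common order of integration.
  have hswap : (avg ρ₁ fun Z₁ => avg ρ₂ fun Z₂ => avg r₁ fun W₁ => avg r₂ fun W₂ =>
        fourKer h ε 0 v k₁ k₂ Z₁ Z₂ W₁ W₂) = avg ρ₁ fun Z₁ => avg r₁ fun W₁ => avg ρ₂ fun Z₂ =>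
        avg r₂ fun W₂ => fourKer h ε 0 v k₁ k₂ Z₁ Z₂ W₁ W₂ := by
    refine avg_congr p1.le fun Z₁ hZ₁ => avg_swap p2.le q1.le ?_
    rw [← mem_sphere_zero_iff_norm] at hZ₁
    exact continuousOn_avg_last (f := fun Z₂ W₁ W₂ => fourKer h ε 0 v k₁ k₂ Z₁ Z₂ W₁ W₂) q2.le
      (hc.comp (f := fun x : (ℂ × ℂ) × ℂ => ((Z₁, x.1.1), (x.1.2, x.2))) (by fun_prop)
        fun x hx => ⟨⟨hZ₁, hx.1.1⟩, hx.1.2, hx.2⟩)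
  rw [hswap]
  have hnr : ∀ {r : ℝ}, 0 < r → ‖(r : ℂ)‖ = r := fun {r} hr => Complex.norm_of_nonneg hr.le
  have hhr₁ : ‖h‖ * r₁ < 1 := by nlinarith [norm_nonneg h]
  have hhr₂ : ‖h‖ * r₂ < 1 := by nlinarith [norm_nonneg h]
  have ar' : ‖h‖ ^ 2 * r₂ < ρ₁ := by nlinarith [sq_nonneg ‖h‖]
  have b1 := sumAt_phiR_bdMean h0 h1 (ε := ε) p1 e1
  have b2 := sumAt_phiR_bdMean h0 h1 (ε := ε) p2 e2
  have x1 := sumAt_xR_bdMean h0 h1 (ε := ε) q1 r1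
  have x2 := sumAt_xR_bdMean h0 h1 (ε := ε) q2 (rl.trans r1)
  set n : ℤ := (ε : ℤ) ^ 2 with hn
  have hh2 : h ^ 2 ≠ 0 := pow_ne_zero _ h0
  rw [dualGroundState_eq, ← hn]
  change gauss (bdVar h) (bdMean h ε)
    ((((-h) ^ ((0 : SignType) : ℤ) * (-((h ^ 2) ^ 3)⁻¹) ^ k₁) •
      vertexZero h k₁ (vertexZero h k₂ v)) n) = _
  rw [Finsupp.smul_apply, map_smul, smul_eq_mul,
    gauss_vertexZero h0 h1 p1 q1 (sq_mul_lt_one h0 h1 e1) (r1.trans h1) ar c1 b1 x1]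
  simp only [← avg_const_mul]
  refine avg_congr p1.le fun Z₁ hZ₁ => avg_congr q1.le fun W₁ hW₁ => ?_
  have n1 : W₁ ≠ 0 := ne_zero_of_norm_eq q1 hW₁
  have gP : ∀ Z₂ : ℂ, ‖Z₂‖ = ρ₂ → gaussGen (bdVar h)
      (bdMean h ε + shift (phiD h) Z₁ + shift (xD h) W₁) (phiR h) Z₂ = phi h ε (-Z₂) *
        (kappa h (Z₂ * Z₁) * kappa h (Z₂ / Z₁)) *
          ((1 - h ^ 2 * (Z₂ * W₁))⁻¹ * (1 - h ^ 2 * (Z₂ / W₁))⁻¹) ∧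
      Summable fun m => ‖phiR h m * (bdMean h ε + shift (phiD h) Z₁ + shift (xD h) W₁) m *
        Z₂ ^ m‖ := fun Z₂ hZ₂ => by
    obtain ⟨-, -, bb2, bb3, bb4⟩ := R.kappa_bounds h1 hZ₁ hZ₂
    have a := gaussGen_phi_phi h0 h1 (b2.summable hZ₂) bb3 bb4
    have b := gaussGen_phi_x h0 h1 a.2 (Z := Z₂) (W := W₁)
      (norm_sq_mul_lt_one h0 h1 (by rwa [hZ₂]) (by rwa [hW₁]))
      (norm_sq_div_lt_one h0 h1 (by rw [hZ₂, hW₁]; exact br.trans rl))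
    refine ⟨?_, b.2⟩
    rw [b.1, a.1, gaussGen_phi h0 h1 ε bb2]
  have gX : ∀ W₂ : ℂ, ‖W₂‖ = r₂ → gaussGen (bdVar h)
      (bdMean h ε + shift (phiD h) Z₁ + shift (xD h) W₁) (xR h) W₂ = chi h ε W₂ *
          ((1 - h ^ 2 * (W₂ * Z₁))⁻¹ * (1 - h ^ 2 * (W₂ / Z₁))⁻¹) *
          (yKer h W₁ W₂ * (xKer h W₁ W₂ / W₁)) ∧
      Summable fun m => ‖xR h m * (bdMean h ε + shift (phiD h) Z₁ + shift (xD h) W₁) m *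
        W₂ ^ m‖ := fun W₂ hW₂ => by
    have a := gaussGen_x_phi h0 h1 (x2.summable hW₂) (W := W₂) (Z := Z₁)
      (norm_sq_mul_lt_one h0 h1 (by rwa [hW₂]) (by rwa [hZ₁]))
      (norm_sq_div_lt_one h0 h1 (by rwa [hZ₁, hW₂]))
    have b := gaussGen_x_x' h0 h1 n1 a.2
      (by rw [norm_mul, hW₁, hW₂]; nlinarith) (by rw [norm_div, hW₁, hW₂]; rwa [div_lt_one q1])
    refine ⟨?_, b.2⟩
    rw [b.1, a.1, gaussGen_x h0 h1 ε (by rw [hW₂]; exact rl.trans r1), chi]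
  rw [gauss_vertexZero h0 h1 p2 q2 (sq_mul_lt_one h0 h1 e2) ((rl.trans r1).trans h1) c2 br
    (sumAt_of_summable (hnr p2) (gP _ (hnr p2)).2) (sumAt_of_summable (hnr q2) (gX _ (hnr q2)).2)]
  simp only [← avg_const_mul]
  refine avg_congr p2.le fun Z₂ hZ₂ => avg_congr q2.le fun W₂ hW₂ => ?_
  rw [(gP _ hZ₂).1, (gX _ hW₂).1]
  obtain ⟨H, hj⟩ := R.regularAt h1 hZ₁ hZ₂ hW₁ hW₂
  obtain ⟨-, bb1, bb2, bb3, bb4⟩ := R.kappa_bounds h1 hZ₁ hZ₂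
  rw [gaussGen_phi h0 h1 ε bb1, gaussGen_x h0 h1 ε (by rw [hW₁]; exact r1)]
  have hK : (-h) ^ ((0 : SignType) : ℤ) * (-((h ^ 2) ^ 3)⁻¹) ^ k₁ *
      ((-1) ^ n * (h ^ 6) ^ k₁ * (1 - h ^ 4)) * ((-1) ^ n * (h ^ 6) ^ k₂ * (1 - h ^ 4)) =
      (-1) ^ k₁ * (h ^ 6) ^ k₂ * (1 - h ^ 4) * (1 - h ^ 4) := by
    have hh6 : (h ^ 6) ^ k₁ ≠ 0 := zpow_ne_zero _ (pow_ne_zero _ h0)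
    rw [show (-((h ^ 2) ^ 3)⁻¹) = -1 * (h ^ 6)⁻¹ by rw [← pow_mul]; ring, mul_zpow, inv_zpow]
    have hs : ((-1 : ℂ) ^ n) * (-1) ^ n = 1 := by rw [← mul_zpow]; norm_num
    simp only [SignType.coe_zero, zpow_zero]
    field_simp
    linear_combination (1 - h ^ 4) ^ 2 * hs
  have hZ : Z₁ ^ (n + 1 - k₁) = Z₁ ^ (n + 1) * Z₁ ^ (-k₁) := by
    rw [← zpow_add₀ H.z₁]; congr 1
  have hZ2 : Z₁ ^ (n + 2) = Z₁ ^ (n + 1) * Z₁ := by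
    rw [← zpow_add_one₀ H.z₁]; congr 1; ring
  have hZ' : Z₂ ^ (n + 1 - k₂) = Z₂ ^ (n + 1) * Z₂ ^ (-k₂) := by
    rw [← zpow_add₀ H.z₂]; congr 1
  have hWW : (W₁ * W₂) ^ (-n) * (W₁ * W₂) = W₁ ^ (1 - n) * W₂ ^ (1 - n) := by
    rw [← mul_zpow, ← zpow_add_one₀ (mul_ne_zero H.w₁ H.w₂)]; congr 1; ring
  obtain ⟨z1, z2, w1, w2, -, -, f1, f2, g1, g2, u1, u2, u3, u4⟩ := H
  have hsh : shifted h ε v Z₁ Z₂ W₁ W₂ = gauss (bdVar h) (bdMean h ε + shift (phiD h) Z₁ +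
      shift (xD h) W₁ + shift (phiD h) Z₂ + shift (xD h) W₂) (v n) := by
    rw [shifted, add_right_comm (bdMean h ε + shift (phiD h) Z₁)]
  simp only [fourKer, preKer, wKer, symKer, hsh, ← hn]
  change _ = (-1) ^ k₁ * (h ^ 6) ^ k₂ * (_ * (_ * ((1 - h ^ 4) * (W₁ * W₂) /
    ((W₁ - h ^ 2 * Z₁) * (Z₂ - h ^ 2 * W₂)) * _ * _)))
  rw [hZ, hZ', hZ2, show 1 - h ^ 2 * (Z₂ / W₁) = (W₁ - h ^ 2 * Z₂) / W₁ by field_simp,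
    show 1 - h ^ 2 * (W₂ / Z₁) = (Z₁ - h ^ 2 * W₂) / Z₁ by field_simp, mul_comm W₂ Z₁]
  rw [show (1 - W₁ ^ 2) * (1 + (ε : ℂ) * Complex.I * h⁻¹ * W₁) = chi h ε W₁ from rfl]
  generalize gauss (bdVar h) _ (v n) = ll
  have hbody := integrand_identity_zero (Z := Z₁) (z1 := Z₁ ^ (n + 1)) (zb := Z₁ ^ (-k₁))
    (z2 := Z₂ ^ (n + 1)) (zd := Z₂ ^ (-k₂)) (ww := W₂ ^ (1 - n)) (wp := W₁ ^ (1 - n))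
    (ph1 := phi h ε (-Z₁)) (ph2 := phi h ε (-Z₂)) (kk := kappa h (Z₂ * Z₁) * kappa h (Z₂ / Z₁))
    (ch1 := chi h ε W₁) (ch2 := chi h ε W₂) (xx := xKer h W₁ W₂) (yy := yKer h W₁ W₂) (ll := ll)
    (q := 1 - h ^ 4) (a1 := 1 - h ^ 2 * (Z₁ * W₁)) (a2 := 1 - h ^ 2 * (Z₁ * W₂))
    (a3 := 1 - h ^ 2 * (Z₂ * W₁)) (a4 := 1 - h ^ 2 * (Z₂ * W₂)) (a5 := Z₁ - h ^ 2 * W₁)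
    (a6 := Z₁ - h ^ 2 * W₂) (a8 := Z₂ - h ^ 2 * W₂) (a9 := W₁ - h ^ 2 * Z₂)
    (a10 := W₂ - h ^ 2 * Z₂) (b1 := W₁ - h ^ 2 * Z₁) n1
  rw [← hWW] at hbody
  linear_combination (Z₁ ^ (n + 1) * Z₁ ^ (-k₁) * W₁ ^ (1 - n) * (phi h ε (-Z₁) *
    chi h ε W₁) * ((1 - h ^ 2 * (Z₁ * W₁)) * (Z₁ - h ^ 2 * W₁) * (W₁ - h ^ 2 * Z₁))⁻¹ *
      (Z₂ ^ (n + 1) * Z₂ ^ (-k₂) * W₂ ^ (1 - n) * (phi h ε (-Z₂) *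
        (kappa h (Z₂ * Z₁) * kappa h (Z₂ / Z₁)) * ((1 - h ^ 2 * (Z₂ * W₁))⁻¹ *
        ((W₁ - h ^ 2 * Z₂) / W₁)⁻¹) * (chi h ε W₂ * ((1 - h ^ 2 * (Z₁ * W₂))⁻¹ *
        ((Z₁ - h ^ 2 * W₂) / Z₁)⁻¹) * (yKer h W₁ W₂ * (xKer h W₁ W₂ / W₁)))) *
        ((1 - h ^ 2 * (Z₂ * W₂)) * (Z₂ - h ^ 2 * W₂) * (W₂ - h ^ 2 * Z₂))⁻¹ * ll)) * hK +
    (-1) ^ k₁ * (h ^ 6) ^ k₂ * (1 - h ^ 4) * hbody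

set_option maxHeartbeats 1000000 in
theorem dualGroundState_vertex_neg (R : Radii h (-1) ρ₁ ρ₂ r₁ r₂) (v : FockSpace) (k₁ k₂ : ℤ) :
    dualGroundState h ε (vertexDual h (-1) k₁ (vertex h (-1) k₂ v)) =
      (-1) ^ k₁ * (h ^ 6) ^ k₂ * avg ρ₁ fun Z₁ => avg ρ₂ fun Z₂ => avg r₁ fun W₁ => avg r₂ fun W₂ =>
        fourKer h ε (-1) v k₁ k₂ Z₁ Z₂ W₁ W₂ := by
  have hc := R.continuousOn_fourKer h0 h1 (ε := ε) v k₁ k₂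
  obtain ⟨p2, q2, rl, r1, e1, e2, ar, br, -, -, jn⟩ := id R
  have c1 := jn rfl
  have q1 : 0 < r₁ := q2.trans rl
  have p1 : 0 < ρ₁ := (by positivity : 0 ≤ ‖h‖ ^ 2 * r₁).trans_lt ar
  -- Here both currents belong to the left vertex operator, so `Z₂` comes last and the averages have
  -- to be rotated.
  have hswap : (avg ρ₁ fun Z₁ => avg ρ₂ fun Z₂ => avg r₁ fun W₁ => avg r₂ fun W₂ =>
        fourKer h ε (-1) v k₁ k₂ Z₁ Z₂ W₁ W₂) = avg ρ₁ fun Z₁ => avg r₁ fun W₁ => avg r₂ fun W₂ =>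
        avg ρ₂ fun Z₂ => fourKer h ε (-1) v k₁ k₂ Z₁ Z₂ W₁ W₂ := by
    refine avg_congr p1.le fun Z₁ hZ₁ => (avg_rotate q1.le q2.le p2.le
      (f := fun W₁ W₂ Z₂ => fourKer h ε (-1) v k₁ k₂ Z₁ Z₂ W₁ W₂) ?_).symm
    rw [← mem_sphere_zero_iff_norm] at hZ₁
    exact hc.comp (f := fun x : (ℂ × ℂ) × ℂ => ((Z₁, x.2), (x.1.1, x.1.2))) (by fun_prop)
        fun x hx => ⟨⟨hZ₁, hx.2⟩, hx.1.1, hx.1.2⟩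
  rw [hswap]
  have hnr : ∀ {r : ℝ}, 0 < r → ‖(r : ℂ)‖ = r := fun {r} hr => Complex.norm_of_nonneg hr.le
  have hhr₁ : ‖h‖ * r₁ < 1 := by nlinarith [norm_nonneg h]
  have hhr₂ : ‖h‖ * r₂ < 1 := by nlinarith [norm_nonneg h]
  have b1 := sumAt_phiR_bdMean h0 h1 (ε := ε) p1 e1
  have b2 := sumAt_phiR_bdMean h0 h1 (ε := ε) p2 e2
  have x1 := sumAt_xR_bdMean h0 h1 (ε := ε) q1 r1
  have x2 := sumAt_xR_bdMean h0 h1 (ε := ε) q2 (rl.trans r1)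
  set n : ℤ := (ε : ℤ) ^ 2 with hn
  have he := epsQ_ne_zero h0 h1
  have hh2 : h ^ 2 ≠ 0 := pow_ne_zero _ h0
  rw [dualGroundState_eq, ← hn]
  change gauss (bdVar h) (bdMean h ε)
    ((((-h) ^ ((-1 : SignType) : ℤ) * (-((h ^ 2) ^ 3)⁻¹) ^ k₁) •
      vertexPlus h k₁ (vertexMinus h k₂ v)) n) = _
  rw [Finsupp.smul_apply, map_smul, smul_eq_mul,
    gauss_vertexPlus h0 h1 p1 q2 (sq_mul_lt_one h0 h1 e1) rl (r1.trans h1) ar c1 b1 x1 x2]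
  simp only [← avg_const_mul]
  refine avg_congr p1.le fun Z₁ hZ₁ => avg_congr q1.le fun W₁ hW₁ => avg_congr q2.le
    fun W₂ hW₂ => ?_
  have n1 : W₁ ≠ 0 := ne_zero_of_norm_eq q1 hW₁
  have n2 : W₂ ≠ 0 := ne_zero_of_norm_eq q2 hW₂
  have gP : ∀ Z₂ : ℂ, ‖Z₂‖ = ρ₂ → gaussGen (bdVar h)
      (bdMean h ε + shift (phiD h) Z₁ + shift (xD h) W₁ + shift (xD h) W₂) (phiR h) Z₂ =
        phi h ε (-Z₂) * (kappa h (Z₂ * Z₁) * kappa h (Z₂ / Z₁)) *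
          ((1 - h ^ 2 * (Z₂ * W₁))⁻¹ * (1 - h ^ 2 * (Z₂ / W₁))⁻¹) *
          ((1 - h ^ 2 * (Z₂ * W₂))⁻¹ * (1 - h ^ 2 * (Z₂ / W₂))⁻¹) ∧
      Summable fun m => ‖phiR h m * (bdMean h ε + shift (phiD h) Z₁ + shift (xD h) W₁ +
        shift (xD h) W₂) m * Z₂ ^ m‖ := fun Z₂ hZ₂ => by
    obtain ⟨-, -, bb2, bb3, bb4⟩ := R.kappa_bounds h1 hZ₁ hZ₂
    have a := gaussGen_phi_phi h0 h1 (b2.summable hZ₂) bb3 bb4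
    have b := gaussGen_phi_x h0 h1 a.2 (Z := Z₂) (W := W₁)
      (norm_sq_mul_lt_one h0 h1 (by rwa [hZ₂]) (by rwa [hW₁]))
      (norm_sq_div_lt_one h0 h1 (by rw [hZ₂, hW₁]; exact br.trans rl))
    have c := gaussGen_phi_x h0 h1 b.2 (Z := Z₂) (W := W₂)
      (norm_sq_mul_lt_one h0 h1 (by rwa [hZ₂]) (by rwa [hW₂]))
      (norm_sq_div_lt_one h0 h1 (by rwa [hZ₂, hW₂]))
    refine ⟨?_, c.2⟩
    rw [c.1, b.1, a.1, gaussGen_phi h0 h1 ε bb2]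
  rw [gauss_vertexMinus h0 h1 p2 (sq_mul_lt_one h0 h1 e2)
    (sumAt_of_summable (hnr p2) (gP _ (hnr p2)).2), add_sub_cancel_right]
  simp only [← avg_const_mul]
  refine avg_congr p2.le fun Z₂ hZ₂ => ?_
  rw [(gP _ hZ₂).1]
  obtain ⟨H, hj⟩ := R.regularAt h1 hZ₁ hZ₂ hW₁ hW₂
  obtain ⟨-, bb1, bb2, bb3, bb4⟩ := R.kappa_bounds h1 hZ₁ hZ₂
  rw [gaussGen_phi h0 h1 ε bb1, gaussGen_x h0 h1 ε (by rw [hW₁]; exact r1),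
    gaussGen_x h0 h1 ε (by rw [hW₂]; exact rl.trans r1)]
  have hK : (-h) ^ ((-1 : SignType) : ℤ) * (-((h ^ 2) ^ 3)⁻¹) ^ k₁ *
      (h * ((-1) ^ n * (h ^ 6) ^ k₁ * (1 - h ^ 4) * (epsQ h * (h ^ 2)⁻¹ ^ (n + 1)))) *
      ((epsQ h)⁻¹ * ((-h ^ 2) ^ (n + 1) * (h ^ 6) ^ k₂)) =
      (-1) ^ k₁ * (h ^ 6) ^ k₂ * (1 - h ^ 4) := by
    have hh6 : (h ^ 6) ^ k₁ ≠ 0 := zpow_ne_zero _ (pow_ne_zero _ h0)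
    have hhn : (h ^ 2) ^ (n + 1) ≠ 0 := zpow_ne_zero _ hh2
    rw [show (-((h ^ 2) ^ 3)⁻¹) = -1 * (h ^ 6)⁻¹ by rw [← pow_mul]; ring, mul_zpow, inv_zpow,
      show (-h ^ 2) = -1 * h ^ 2 by ring, mul_zpow, inv_zpow,
      show (-h) = -1 * h by ring, mul_zpow]
    have hs : ((-1 : ℂ) ^ n) * (-1) ^ n = 1 := by rw [← mul_zpow]; norm_num
    have hs' : (-1 : ℂ) ^ (n + 1) = -(-1) ^ n := by rw [zpow_add_one₀ (by norm_num)]; ring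
    simp only [SignType.coe_neg_one, zpow_neg_one]
    field_simp
    linear_combination (1 - h ^ 4) * hs - (1 - h ^ 4) * (-1) ^ n * hs'
  have hZ : Z₁ ^ (n + 2 - k₁) = Z₁ ^ (n + 2) * Z₁ ^ (-k₁) := by
    rw [← zpow_add₀ H.z₁]; congr 1
  have hZ' : Z₂ ^ (n + 1 - k₂) = Z₂ ^ (n + 1) * Z₂ ^ (-k₂) := by
    rw [← zpow_add₀ H.z₂]; congr 1
  have hWW : (W₁ * W₂) ^ (-(n + 1)) = (W₁ * W₂) ^ (-n) * (W₁ * W₂)⁻¹ := by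
    rw [← zpow_sub_one₀ (mul_ne_zero H.w₁ H.w₂)]; congr 1; ring
  obtain ⟨z1, z2, w1, w2, -, -, f1, f2, g1, g2, u1, u2, u3, u4⟩ := H
  have hsh : shifted h ε v Z₁ Z₂ W₁ W₂ = gauss (bdVar h) (bdMean h ε + shift (phiD h) Z₁ +
      shift (xD h) W₁ + shift (xD h) W₂ + shift (phiD h) Z₂) (v n) := by
    rw [shifted, add_right_comm (bdMean h ε + shift (phiD h) Z₁),
      add_right_comm (bdMean h ε + shift (phiD h) Z₁ + shift (xD h) W₁)]
  simp only [fourKer, preKer, wKer, symKer, hsh, dKer, ← hn]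
  change _ = (-1) ^ k₁ * (h ^ 6) ^ k₂ * (_ * (_ * (nKer h W₁ W₂ Z₁ /
    ((W₁ - h ^ 2 * Z₁) * (W₂ - h ^ 2 * Z₁)) * _ * _)))
  rw [hZ, hZ', hWW, show 1 - h ^ 2 * (Z₂ / W₁) = (W₁ - h ^ 2 * Z₂) / W₁ by field_simp,
    show 1 - h ^ 2 * (Z₂ / W₂) = (W₂ - h ^ 2 * Z₂) / W₂ by field_simp]
  rw [show (1 - W₁ ^ 2) * (1 + (ε : ℂ) * Complex.I * h⁻¹ * W₁) = chi h ε W₁ from rfl,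
    show (1 - W₂ ^ 2) * (1 + (ε : ℂ) * Complex.I * h⁻¹ * W₂) = chi h ε W₂ from rfl]
  generalize gauss (bdVar h) _ (v n) = ll
  have hbody := integrand_identity_neg (za := Z₁ ^ (n + 2)) (zb := Z₁ ^ (-k₁))
    (zc := Z₂ ^ (n + 1)) (zd := Z₂ ^ (-k₂)) (ww := (W₁ * W₂) ^ (-n))
    (ph1 := phi h ε (-Z₁)) (ph2 := phi h ε (-Z₂)) (kk := kappa h (Z₂ * Z₁) * kappa h (Z₂ / Z₁))
    (ch1 := chi h ε W₁) (ch2 := chi h ε W₂) (xx := xKer h W₁ W₂) (yy := yKer h W₁ W₂) (ll := ll)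
    (nn := nKer h W₁ W₂ Z₁) (a1 := 1 - h ^ 2 * (Z₁ * W₁)) (a2 := 1 - h ^ 2 * (Z₁ * W₂))
    (a3 := 1 - h ^ 2 * (Z₂ * W₁)) (a4 := 1 - h ^ 2 * (Z₂ * W₂)) (a5 := Z₁ - h ^ 2 * W₁)
    (a6 := Z₁ - h ^ 2 * W₂) (b2 := W₂ - h ^ 2 * Z₁) (a9 := W₁ - h ^ 2 * Z₂)
    (a10 := W₂ - h ^ 2 * Z₂) (b1 := W₁ - h ^ 2 * Z₁) n1 n2
  linear_combination (Z₁ ^ (n + 2) * Z₁ ^ (-k₁) * ((W₁ * W₂) ^ (-n) * (W₁ * W₂)⁻¹) *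
    (phi h ε (-Z₁) * (chi h ε W₁ * chi h ε W₂)) *
    (xKer h W₁ W₂ * yKer h W₁ W₂ * nKer h W₁ W₂ Z₁) *
    ((1 - h ^ 2 * (Z₁ * W₁)) * (Z₁ - h ^ 2 * W₁) * (W₁ - h ^ 2 * Z₁) *
      ((1 - h ^ 2 * (Z₁ * W₂)) * (Z₁ - h ^ 2 * W₂) * (W₂ - h ^ 2 * Z₁)))⁻¹ *
    (Z₂ ^ (n + 1) * Z₂ ^ (-k₂) * (phi h ε (-Z₂) * (kappa h (Z₂ * Z₁) * kappa h (Z₂ / Z₁)) *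
      ((1 - h ^ 2 * (Z₂ * W₁))⁻¹ * ((W₁ - h ^ 2 * Z₂) / W₁)⁻¹) *
      ((1 - h ^ 2 * (Z₂ * W₂))⁻¹ * ((W₂ - h ^ 2 * Z₂) / W₂)⁻¹) * ll))) * hK +
    (-1) ^ k₁ * (h ^ 6) ^ k₂ * (1 - h ^ 4) * hbody

theorem dualGroundState_vertex (R : Radii h j ρ₁ ρ₂ r₁ r₂) (v : FockSpace) (k₁ k₂ : ℤ) :
    dualGroundState h ε (vertexDual h j k₁ (vertex h j k₂ v)) =
      (-1) ^ k₁ * (h ^ 6) ^ k₂ * avg ρ₁ fun Z₁ => avg ρ₂ fun Z₂ => avg r₁ fun W₁ => avg r₂ fun W₂ =>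
        fourKer h ε j v k₁ k₂ Z₁ Z₂ W₁ W₂ := by
  cases j
  · exact dualGroundState_vertex_zero h0 h1 R v k₁ k₂
  · exact dualGroundState_vertex_neg h0 h1 R v k₁ k₂
  · exact dualGroundState_vertex_pos h0 h1 R v k₁ k₂

end

end IzerginKorepin

namespace IzerginKorepin
open Metric Set

/-! ### Double Laurent series -/

/-- Absolute convergence of a double Laurent series on the torus of radii `ρ` and `σ`. -/
def AbsAt (c : ℤ → ℤ → ℂ) (ρ σ : ℝ) : Prop :=
  Summable fun p : ℤ × ℤ => ‖c p.1 p.2‖ * (ρ ^ p.1 * σ ^ p.2)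

/-- For `k ≥ 0` the term is at most `(ρ/b)^k`, and for `k = -n` at most `(a/ρ)^n`. -/
theorem summable_zpow_div_add {a b ρ : ℝ} (ha : 0 < a) (hρa : a < ρ) (hρb : ρ < b) :
    Summable fun k : ℤ => ρ ^ k / (a ^ k + b ^ k) := by
  have hρ := ha.trans hρa
  have hb := hρ.trans hρb
  refine Summable.of_nat_of_neg ?_ ?_
  · refine Summable.of_nonneg_of_le (fun n => by positivity) (fun n => ?_)
      (summable_geometric_of_lt_one (by positivity) ((div_lt_one hb).mpr hρb))
    rw [div_pow, zpow_natCast, zpow_natCast, zpow_natCast]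
    exact div_le_div_of_nonneg_left (by positivity) (by positivity)
      (le_add_of_nonneg_left (by positivity))
  · refine Summable.of_nonneg_of_le (fun n => by positivity) (fun n => ?_)
      (summable_geometric_of_lt_one (by positivity) ((div_lt_one hρ).mpr hρa))
    rw [div_pow, zpow_neg, zpow_neg, zpow_neg, zpow_natCast, zpow_natCast, zpow_natCast,
      div_le_div_iff₀ (by positivity) (by positivity)]
    have : (ρ ^ n)⁻¹ * ρ ^ n = 1 := inv_mul_cancel₀ (by positivity)
    have h2 : (a ^ n)⁻¹ * a ^ n = 1 := inv_mul_cancel₀ (by positivity)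
    rw [this, mul_add, mul_comm (a ^ n), h2]
    exact le_add_of_nonneg_right (by positivity)

/-- A Cauchy estimate: bounds on the four tori at the corners of a rectangle of radii give geometric
decay of the coefficients at every interior pair of radii. No holomorphy of a single function on the
whole region is needed, so the inner contours may differ from corner to corner. -/
theorem absAt_of_bounded {c : ℤ → ℤ → ℂ} {a b ρ a' b' σ : ℝ} (ha : 0 < a) (hρa : a < ρ)
    (hρb : ρ < b) (ha' : 0 < a') (hσa : a' < σ) (hσb : σ < b')
    (hC : ∀ s ∈ ({a, b} : Set ℝ), ∀ t ∈ ({a', b'} : Set ℝ),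
      ∃ C, ∀ k l, ‖c k l‖ * (s ^ k * t ^ l) ≤ C) : AbsAt c ρ σ := by
  obtain ⟨C₁, h₁⟩ := hC a (by simp) a' (by simp)
  obtain ⟨C₂, h₂⟩ := hC a (by simp) b' (by simp)
  obtain ⟨C₃, h₃⟩ := hC b (by simp) a' (by simp)
  obtain ⟨C₄, h₄⟩ := hC b (by simp) b' (by simp)
  have hρ := ha.trans hρa
  have hb := hρ.trans hρb
  have hσ := ha'.trans hσa
  have hb' := hσ.trans hσb
  have hs := ((summable_zpow_div_add ha hρa hρb).mul_of_nonneg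
    (summable_zpow_div_add ha' hσa hσb) (fun k => by dsimp only; positivity)
    (fun k => by dsimp only; positivity)).mul_left (C₁ + C₂ + C₃ + C₄)
  refine Summable.of_nonneg_of_le (fun p => by positivity) (fun p => ?_) hs
  obtain ⟨k, l⟩ := p
  dsimp only
  rw [div_mul_div_comm, ← mul_div_assoc, le_div_iff₀ (by positivity)]
  have e : ‖c k l‖ * (ρ ^ k * σ ^ l) * ((a ^ k + b ^ k) * (a' ^ l + b' ^ l)) =
      (‖c k l‖ * (a ^ k * a' ^ l) + ‖c k l‖ * (a ^ k * b' ^ l) + ‖c k l‖ * (b ^ k * a' ^ l) +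
        ‖c k l‖ * (b ^ k * b' ^ l)) * (ρ ^ k * σ ^ l) := by ring
  rw [e]
  exact mul_le_mul_of_nonneg_right
    (add_le_add (add_le_add (add_le_add (h₁ k l) (h₂ k l)) (h₃ k l)) (h₄ k l)) (by positivity)

/-- The coefficients of a double Laurent series are determined by its sum on a torus. -/
theorem coeff_eq_avg {c : ℤ → ℤ → ℂ} {ρ σ : ℝ} (hρ : 0 < ρ) (hσ : 0 < σ) (hc : AbsAt c ρ σ)
    {G : ℂ → ℂ → ℂ} (hG : ∀ a b, ‖a‖ = ρ → ‖b‖ = σ →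
      HasSum (fun p : ℤ × ℤ => c p.1 p.2 * (a ^ p.1 * b ^ p.2)) (G a b)) (k l : ℤ) :
    c k l = avg ρ fun a => avg σ fun b => a ^ (-k) * b ^ (-l) * G a b := by
  have hρ' := hρ.ne'
  have hσ' := hσ.ne'
  have key : ∀ a, ‖a‖ = ρ → HasSum (fun p : ℤ × ℤ => (c p.1 p.2 * if p.2 - l = 0 then 1 else 0) *
      a ^ (p.1 - k)) (avg σ fun b => a ^ (-k) * b ^ (-l) * G a b) := fun a ha => by
    have ha0 : a ≠ 0 := ne_zero_of_norm_eq hρ ha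
    have := hasSum_avg hσ (c := fun p : ℤ × ℤ => c p.1 p.2 * a ^ (p.1 - k)) (e := fun p => p.2 - l)
      (g := fun b => a ^ (-k) * b ^ (-l) * G a b) ?_ ?_
    · exact this.congr_fun fun p => by ring
    · refine (hc.mul_right (ρ ^ (-k) * σ ^ (-l))).congr fun p => ?_
      rw [norm_mul, norm_zpow, ha, sub_eq_add_neg, sub_eq_add_neg, zpow_add₀ hρ', zpow_add₀ hσ']
      ring
    · intro b hb
      have hb0 : b ≠ 0 := ne_zero_of_norm_eq hσ hb
      refine ((hG a b ha hb).mul_left (a ^ (-k) * b ^ (-l))).congr_fun fun p => ?_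
      rw [sub_eq_add_neg, sub_eq_add_neg, zpow_add₀ ha0, zpow_add₀ hb0]
      ring
  have h2 := hasSum_avg hρ (c := fun p : ℤ × ℤ => c p.1 p.2 * if p.2 - l = 0 then 1 else 0)
    (e := fun p => p.1 - k) (g := fun a => avg σ fun b => a ^ (-k) * b ^ (-l) * G a b) ?_ key
  · refine HasSum.unique ?_ h2
    refine (hasSum_ite_eq (k, l) (c k l)).congr_fun fun p => ?_
    obtain ⟨x, y⟩ := p
    by_cases h1 : x = k
    · by_cases h2 : y = l
      · simp [h1, h2]
      · simp [h1, h2, sub_eq_zero]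
    · simp [h1, sub_eq_zero]
  · refine Summable.of_nonneg_of_le (fun p => by positivity) (fun p => ?_)
      (hc.mul_right (ρ ^ (-k) * σ ^ (-l)))
    by_cases h : p.2 - l = 0
    · have e : σ ^ p.2 * σ ^ (-l) = 1 := by rw [← zpow_add₀ hσ', ← sub_eq_add_neg, h, zpow_zero]
      rw [if_pos h, mul_one, sub_eq_add_neg, zpow_add₀ hρ']
      refine le_of_eq ?_
      linear_combination -(‖c p.1 p.2‖ * (ρ ^ p.1 * ρ ^ (-k))) * e
    · rw [if_neg h, mul_zero, norm_zero, zero_mul]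
      positivity

/-- The coefficients of the product of a power series in the first variable and a double Laurent
series. -/
def conv (f : ℕ → ℂ) (c : ℤ → ℤ → ℂ) (k l : ℤ) : ℂ := ∑' i : ℕ, f i * c (k - i) l

/-- The reindexing behind the product of two series. -/
def convEquiv : (ℤ × ℤ) × ℕ ≃ ℕ × (ℤ × ℤ) where
  toFun x := (x.2, (x.1.1 - x.2, x.1.2))
  invFun y := ((y.2.1 + y.1, y.2.2), y.1)
  left_inv x := by simp
  right_inv y := by simp

/-- The Cauchy product of two absolutely convergent series, reindexed by the total exponent of the
first variable. -/
theorem conv_spec {f : ℕ → ℂ} {c : ℤ → ℤ → ℂ} {ρ σ : ℝ} (hρ : 0 < ρ)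
    (hf : Summable fun i => ‖f i‖ * ρ ^ i) (hc : AbsAt c ρ σ) {a b : ℂ} (ha : ‖a‖ = ρ)
    (hb : ‖b‖ = σ) : AbsAt (conv f c) ρ σ ∧
      HasSum (fun p : ℤ × ℤ => conv f c p.1 p.2 * (a ^ p.1 * b ^ p.2))
        ((∑' i, f i * a ^ i) * ∑' p : ℤ × ℤ, c p.1 p.2 * (a ^ p.1 * b ^ p.2)) := by
  have ha0 : a ≠ 0 := ne_zero_of_norm_eq hρ ha
  have hf' : Summable fun i => ‖f i * a ^ i‖ := hf.congr fun i => by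
    rw [norm_mul, norm_pow, ha]
  have hc' : Summable fun p : ℤ × ℤ => ‖c p.1 p.2 * (a ^ p.1 * b ^ p.2)‖ :=
    Summable.congr hc fun p => by rw [norm_mul, norm_mul, norm_zpow, norm_zpow, ha, hb]
  have hn := hf'.mul_norm hc'
  have hn' := (Equiv.summable_iff convEquiv).mpr hn
  have hterm : ∀ x : (ℤ × ℤ) × ℕ, (f x.2 * a ^ x.2) * (c (x.1.1 - x.2) x.1.2 *
      (a ^ (x.1.1 - x.2) * b ^ x.1.2)) = f x.2 * c (x.1.1 - x.2) x.1.2 *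
        (a ^ x.1.1 * b ^ x.1.2) := fun x => by
    have : a ^ (x.1.1 - x.2) * a ^ x.2 = a ^ x.1.1 := by
      rw [← zpow_natCast a x.2, ← zpow_add₀ ha0]; congr 1; ring
    linear_combination f x.2 * c (x.1.1 - x.2) x.1.2 * b ^ x.1.2 * this
  have hn2 : Summable fun x : (ℤ × ℤ) × ℕ => ‖f x.2 * c (x.1.1 - x.2) x.1.2 *
        (a ^ x.1.1 * b ^ x.1.2)‖ := hn'.congr fun x => by
    rw [← hterm]; rfl
  have hsum : HasSum (fun x : (ℤ × ℤ) × ℕ => f x.2 * c (x.1.1 - x.2) x.1.2 *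
        (a ^ x.1.1 * b ^ x.1.2))
      ((∑' i, f i * a ^ i) * ∑' p : ℤ × ℤ, c p.1 p.2 * (a ^ p.1 * b ^ p.2)) := by
    have h1 := hf'.of_norm.hasSum.mul hc'.of_norm.hasSum hn.of_norm
    refine ((Equiv.hasSum_iff convEquiv).mpr h1).congr_fun fun x => ?_
    rw [← hterm]; rfl
  have hfib : ∀ p : ℤ × ℤ, HasSum (fun i : ℕ => f i * c (p.1 - i) p.2 * (a ^ p.1 * b ^ p.2))
      (conv f c p.1 p.2 * (a ^ p.1 * b ^ p.2)) := fun p => by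
    have h1 := (hn2.of_norm.prod_factor p).hasSum
    dsimp only at h1
    rw [tsum_mul_right] at h1
    exact h1
  refine ⟨?_, hsum.prod_fiberwise hfib⟩
  refine Summable.of_nonneg_of_le (fun p => ?_) (fun p => ?_) hn2.prod
  · rw [← ha, ← hb]; positivity
  · dsimp only
    rw [← ha, ← hb, ← norm_zpow, ← norm_zpow, ← norm_mul, ← norm_mul, ← (hfib p).tsum_eq]
    exact norm_tsum_le_tsum_norm (hn2.prod_factor p)

end IzerginKorepin

namespace IzerginKorepin
open Metric Set

/-! ### The mode expansion of the two-point function -/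

/-- The coefficient of `Z₁^k₁ Z₂^k₂` in the matrix element, for `Z₁ = -z⁻¹` and `Z₂ = h⁶ z`. -/
def modeCoeff (h : ℂ) (ε j : SignType) (v : FockSpace) (k₁ k₂ : ℤ) : ℂ :=
  (-1) ^ k₁ * ((h ^ 6) ^ k₂)⁻¹ * dualGroundState h ε (vertexDual h j k₁ (vertex h j k₂ v))

/-- The integral representation of the sum of the mode expansion. -/
def twoPoint (h : ℂ) (ε j : SignType) (v : FockSpace) (r₁ r₂ : ℝ) (Z₁ Z₂ : ℂ) : ℂ :=
  preKer h ε Z₁ Z₂ * avg r₁ fun W₁ => avg r₂ fun W₂ => wKer h ε j v Z₁ Z₂ W₁ W₂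

/-- In each component the lower bounds for `r₁`, `r₂` lie below their upper bounds. The restriction
`‖h‖ * ρ₁ < 1` is essential here, through `u5`; it is removed afterwards by reflection. -/
theorem exists_radii {h : ℂ} (h0 : h ≠ 0) (h1 : ‖h‖ < 1) (j : SignType) {ρ₁ ρ₂ : ℝ}
    (a₁ : ‖h‖ ^ 4 < ρ₁) (b₁ : ‖h‖ * ρ₁ < 1) (a₂ : 0 < ρ₂) (b₂ : ρ₂ < ‖h‖ ^ 2) :
    ∃ r₁ r₂, Radii h j ρ₁ ρ₂ r₁ r₂ := by
  have hx : 0 < ‖h‖ := norm_pos_iff.mpr h0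
  set x := ‖h‖ with hxdef
  have hq : 0 < x ^ 2 := by positivity
  have hq1 : x ^ 2 < 1 := pow_lt_one₀ hx.le h1 two_ne_zero
  have p1 : 0 < ρ₁ := (by positivity : 0 < x ^ 4).trans a₁
  have e₂ : x * ρ₂ < 1 := by nlinarith
  have u1 : x ^ 2 * ρ₂ < ρ₂ / x ^ 2 := by
    rw [lt_div_iff₀ hq]; nlinarith [mul_pos hq a₂]
  have u2 : x ^ 2 * ρ₂ < ρ₁ / x ^ 2 := by
    rw [lt_div_iff₀ hq]; nlinarith [mul_pos hq a₂, mul_pos hq hq]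
  have u3 : x ^ 2 * ρ₂ < x := by nlinarith
  have u4 : x ^ 2 * ρ₁ < ρ₁ / x ^ 2 := by
    rw [lt_div_iff₀ hq]; nlinarith [mul_pos hq p1]
  have u5 : x ^ 2 * ρ₁ < x := by nlinarith
  have mulr : ∀ {r y : ℝ}, r < y / x ^ 2 → x ^ 2 * r < y := fun {r y} hr => by
    rw [lt_div_iff₀ hq] at hr; linarith
  have hL : 0 < x ^ 2 * ρ₂ := by positivity
  cases j
  · obtain ⟨r₁, l₁, g₁⟩ := exists_between
      (max_lt (lt_min u4 u5) (lt_min u2 u3) : max (x ^ 2 * ρ₁) (x ^ 2 * ρ₂) < min (ρ₁ / x ^ 2) x)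
    rw [max_lt_iff] at l₁
    rw [lt_min_iff] at g₁
    obtain ⟨r₂, l₂, g₂⟩ := exists_between (lt_min u1 l₁.2 : x ^ 2 * ρ₂ < min (ρ₂ / x ^ 2) r₁)
    rw [lt_min_iff] at g₂
    exact ⟨r₁, r₂, a₂, hL.trans l₂, g₂.2, g₁.2, b₁, e₂, mulr g₁.1, l₂, nofun,
      fun _ => ⟨l₁.1, mulr g₂.1⟩, nofun⟩
  · obtain ⟨r₁, l₁, g₁⟩ := exists_between
      (max_lt (lt_min u4 u5) (lt_min u2 u3) : max (x ^ 2 * ρ₁) (x ^ 2 * ρ₂) < min (ρ₁ / x ^ 2) x)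
    obtain ⟨r₂, l₂, g₂⟩ := exists_between l₁
    rw [max_lt_iff] at l₂
    rw [lt_min_iff] at g₁
    exact ⟨r₁, r₂, a₂, hL.trans l₂.2, g₂, g₁.2, b₁, e₂, mulr g₁.1, l₂.2, nofun,
      nofun, fun _ => l₂.1⟩
  · obtain ⟨r₁, l₁, g₁⟩ := exists_between
      (lt_min u1 (lt_min u2 u3) : x ^ 2 * ρ₂ < min (ρ₂ / x ^ 2) (min (ρ₁ / x ^ 2) x))
    obtain ⟨r₂, l₂, g₂⟩ := exists_between l₁
    rw [lt_min_iff, lt_min_iff] at g₁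
    exact ⟨r₁, r₂, a₂, hL.trans l₂, g₂, g₁.2.2, b₁, e₂, mulr g₁.2.1, l₂, fun _ => mulr g₁.1,
      nofun, nofun⟩

section
variable {h : ℂ} (h0 : h ≠ 0) (h1 : ‖h‖ < 1) {ε j : SignType} {ρ₁ ρ₂ r₁ r₂ : ℝ}
include h0

theorem dualGroundState_eq_modeCoeff (v : FockSpace) (k₁ k₂ : ℤ) :
    dualGroundState h ε (vertexDual h j k₁ (vertex h j k₂ v)) =
      (-1) ^ k₁ * (h ^ 6) ^ k₂ * modeCoeff h ε j v k₁ k₂ := by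
  have hs : ((-1 : ℂ) ^ k₁) * (-1) ^ k₁ = 1 := by rw [← mul_zpow]; norm_num
  have h6 : (h ^ 6) ^ k₂ * ((h ^ 6) ^ k₂)⁻¹ = 1 :=
    mul_inv_cancel₀ (zpow_ne_zero _ (pow_ne_zero _ h0))
  rw [modeCoeff]
  linear_combination (-dualGroundState h ε (vertexDual h j k₁ (vertex h j k₂ v))) *
    (h6 + (h ^ 6) ^ k₂ * ((h ^ 6) ^ k₂)⁻¹ * hs)

include h1

theorem modeCoeff_eq (R : Radii h j ρ₁ ρ₂ r₁ r₂) (v : FockSpace) (k₁ k₂ : ℤ) :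
    modeCoeff h ε j v k₁ k₂ = avg ρ₁ fun Z₁ => avg ρ₂ fun Z₂ => avg r₁ fun W₁ => avg r₂ fun W₂ =>
        fourKer h ε j v k₁ k₂ Z₁ Z₂ W₁ W₂ := by
  have hs : ((-1 : ℂ) ^ k₁) * (-1) ^ k₁ = 1 := by rw [← mul_zpow]; norm_num
  have h6 : (h ^ 6) ^ k₂ * ((h ^ 6) ^ k₂)⁻¹ = 1 :=
    mul_inv_cancel₀ (zpow_ne_zero _ (pow_ne_zero _ h0))
  rw [modeCoeff, dualGroundState_vertex h0 h1 R]
  generalize avg ρ₁ _ = A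
  linear_combination A * (h6 + (h ^ 6) ^ k₂ * ((h ^ 6) ^ k₂)⁻¹ * hs)

theorem modeCoeff_eq_twoPoint (R : Radii h j ρ₁ ρ₂ r₁ r₂) (v : FockSpace) (k₁ k₂ : ℤ) :
    modeCoeff h ε j v k₁ k₂ = avg ρ₁ fun Z₁ => avg ρ₂ fun Z₂ =>
      Z₁ ^ (-k₁) * Z₂ ^ (-k₂) * twoPoint h ε j v r₁ r₂ Z₁ Z₂ := by
  rw [modeCoeff_eq h0 h1 R]
  simp only [fourKer, twoPoint, avg_const_mul]

/-- The indices enter the integrand only through `Z₁^{-k₁} Z₂^{-k₂}`, so the maximum for indices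
zero on the compact torus bounds all coefficients. -/
theorem modeCoeff_bound (R : Radii h j ρ₁ ρ₂ r₁ r₂) (v : FockSpace) :
    ∃ C, ∀ k₁ k₂, ‖modeCoeff h ε j v k₁ k₂‖ * (ρ₁ ^ k₁ * ρ₂ ^ k₂) ≤ C := by
  have p2 := R.ρ₂_pos
  have q2 := R.r₂_pos
  have q1 := q2.trans R.r_lt
  have p1 : 0 < ρ₁ := (by have := q1; positivity : 0 ≤ ‖h‖ ^ 2 * r₁).trans_lt R.ar
  obtain ⟨C, hC⟩ := (((isCompact_sphere (0 : ℂ) ρ₁).prod (isCompact_sphere (0 : ℂ) ρ₂)).prod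
    ((isCompact_sphere (0 : ℂ) r₁).prod (isCompact_sphere (0 : ℂ) r₂))).exists_bound_of_continuousOn
    (R.continuousOn_fourKer h0 h1 (ε := ε) v 0 0)
  refine ⟨C, fun k₁ k₂ => ?_⟩
  have e : C = (ρ₁ ^ (-k₁) * ρ₂ ^ (-k₂) * C) * (ρ₁ ^ k₁ * ρ₂ ^ k₂) := by
    rw [zpow_neg, zpow_neg]
    field_simp
  rw [e]
  refine mul_le_mul_of_nonneg_right ?_ (by positivity)
  rw [modeCoeff_eq h0 h1 R]
  refine norm_avg_le p1.le fun Z₁ hZ₁ => norm_avg_le p2.le fun Z₂ hZ₂ =>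
    norm_avg_le q1.le fun W₁ hW₁ => norm_avg_le q2.le fun W₂ hW₂ => ?_
  have := hC ((Z₁, Z₂), (W₁, W₂)) ⟨⟨mem_sphere_zero_iff_norm.mpr hZ₁,
    mem_sphere_zero_iff_norm.mpr hZ₂⟩, mem_sphere_zero_iff_norm.mpr hW₁,
    mem_sphere_zero_iff_norm.mpr hW₂⟩
  simp only [fourKer, neg_zero, zpow_zero, one_mul] at this
  rw [fourKer, norm_mul, norm_mul, norm_zpow, norm_zpow, hZ₁, hZ₂]
  exact mul_le_mul_of_nonneg_left this (by positivity)

theorem absAt_modeCoeff (v : FockSpace) (a₁ : ‖h‖ ^ 4 < ρ₁) (b₁ : ‖h‖ * ρ₁ < 1) (a₂ : 0 < ρ₂)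
    (b₂ : ρ₂ < ‖h‖ ^ 2) : AbsAt (modeCoeff h ε j v) ρ₁ ρ₂ := by
  have hx : 0 < ‖h‖ := norm_pos_iff.mpr h0
  obtain ⟨a, l1, u1⟩ := exists_between a₁
  obtain ⟨b, l2, u2⟩ := exists_between ((lt_div_iff₀' hx).mpr b₁)
  obtain ⟨a', l3, u3⟩ := exists_between a₂
  obtain ⟨b', l4, u4⟩ := exists_between b₂
  rw [lt_div_iff₀' hx] at u2
  refine absAt_of_bounded ((by positivity : 0 ≤ ‖h‖ ^ 4).trans_lt l1) u1 l2 l3 u3 l4 ?_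
  -- All corner radii remain in the admissible range, so contours for the currents exist at each
  -- corner separately.
  have D1 : ∀ s ∈ ({a, b} : Set ℝ), ‖h‖ ^ 4 < s ∧ ‖h‖ * s < 1 := by
    rintro s (rfl | rfl)
    · exact ⟨l1, (mul_lt_mul_of_pos_left (u1.trans l2) hx).trans u2⟩
    · exact ⟨l1.trans (u1.trans l2), u2⟩
  have D2 : ∀ t ∈ ({a', b'} : Set ℝ), 0 < t ∧ t < ‖h‖ ^ 2 := by
    rintro t (rfl | rfl)
    · exact ⟨l3, (u3.trans l4).trans u4⟩
    · exact ⟨l3.trans (u3.trans l4), u4⟩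
  intro s hs t ht
  obtain ⟨r₁, r₂, R⟩ := exists_radii h0 h1 j (D1 s hs).1 (D1 s hs).2 (D2 t ht).1 (D2 t ht).2
  exact modeCoeff_bound h0 h1 R v

theorem Radii.continuousOn_twoPoint (R : Radii h j ρ₁ ρ₂ r₁ r₂) (v : FockSpace) :
    ContinuousOn (Function.uncurry (twoPoint h ε j v r₁ r₂)) (sphere 0 ρ₁ ×ˢ sphere 0 ρ₂) := by
  have hc := R.continuousOn_fourKer h0 h1 (ε := ε) v 0 0
  have q2 := R.r₂_pos
  have q1 := q2.trans R.r_lt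
  have e : Function.uncurry (twoPoint h ε j v r₁ r₂) = fun x : ℂ × ℂ => avg r₁ fun W₁ =>
      avg r₂ fun W₂ => fourKer h ε j v 0 0 x.1 x.2 W₁ W₂ := by
    funext x
    simp only [Function.uncurry, twoPoint, fourKer, avg_const_mul, neg_zero, zpow_zero, one_mul]
  rw [e]
  have hK := (isCompact_sphere (0 : ℂ) ρ₁).prod (isCompact_sphere (0 : ℂ) ρ₂)
  refine continuousOn_avg_sphere (F := fun y : (ℂ × ℂ) × ℂ => avg r₂ fun W₂ =>
    fourKer h ε j v 0 0 y.1.1 y.1.2 y.2 W₂) hK q1.le ?_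
  refine continuousOn_avg_sphere (F := fun y : ((ℂ × ℂ) × ℂ) × ℂ =>
    fourKer h ε j v 0 0 y.1.1.1 y.1.1.2 y.1.2 y.2) (hK.prod (isCompact_sphere _ _)) q2.le ?_
  exact hc.comp (f := fun y : ((ℂ × ℂ) × ℂ) × ℂ => (y.1.1, (y.1.2, y.2))) (by fun_prop)
    fun y hy => ⟨hy.1.1, hy.1.2, hy.2⟩

theorem hasSum_twoPoint (R : Radii h j ρ₁ ρ₂ r₁ r₂) (v : FockSpace)
    (hs : AbsAt (modeCoeff h ε j v) ρ₁ ρ₂) {Z₁ Z₂ : ℂ} (hZ₁ : ‖Z₁‖ = ρ₁) (hZ₂ : ‖Z₂‖ = ρ₂) :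
    HasSum (fun p : ℤ × ℤ => modeCoeff h ε j v p.1 p.2 * (Z₁ ^ p.1 * Z₂ ^ p.2))
      (twoPoint h ε j v r₁ r₂ Z₁ Z₂) :=
  hasSum_laurent_two (R.kappa_bounds h1 hZ₁ hZ₂).1 R.ρ₂_pos (R.continuousOn_twoPoint h0 h1 v)
    (modeCoeff_eq_twoPoint h0 h1 R v) hs hZ₁ hZ₂

end

end IzerginKorepin

namespace IzerginKorepin
open Metric Set

/-! ### Rational identities for the reflection of the contours -/


/-- The product over the orbit of `W - q Z` under inversion of `W` and `Z`. -/
def eKer (q Z W : ℂ) : ℂ := (W - q * Z) * (Z - q * W) * (1 - q * (Z * W)) * (Z * W - q)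

theorem eKer_inv_left {q Z W : ℂ} (hZ : Z ≠ 0) : eKer q Z⁻¹ W = (Z ^ 4)⁻¹ * eKer q Z W := by
  unfold eKer; field_simp

theorem eKer_inv_right {q Z W : ℂ} (hW : W ≠ 0) : eKer q Z W⁻¹ = (W ^ 4)⁻¹ * eKer q Z W := by
  unfold eKer; field_simp

/-- In this and the next three identities, summation over `W → 1/W` puts everything over the orbit
product `eKer`. That product changes by a monomial under inversion of `Z`, so the behaviour in `Z`
can be read off the numerator. -/
theorem flip_zero_of_zero {q Z W : ℂ} (hW : W ≠ 0) (h1 : W - q * Z ≠ 0)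
    (h2 : Z - q * W ≠ 0) (h3 : 1 - q * (Z * W) ≠ 0) (h4 : Z * W - q ≠ 0) :
    W * (1 - W ^ 2) / ((W - q * Z) * (Z - q * W) * (1 - q * (Z * W))) +
      W⁻¹ * (1 - W⁻¹ ^ 2) / ((W⁻¹ - q * Z) * (Z - q * W⁻¹) * (1 - q * (Z * W⁻¹))) =
      -(1 - W ^ 2) ^ 2 * Z / eKer q Z W := by
  have e1 : W⁻¹ - q * Z = (1 - q * (Z * W)) / W := by field_simp
  have e2 : Z - q * W⁻¹ = (Z * W - q) / W := by field_simp
  have e3 : 1 - q * (Z * W⁻¹) = (W - q * Z) / W := by field_simp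
  rw [e1, e2, e3, eKer]
  generalize g1 : W - q * Z = a1 at *
  generalize g2 : Z - q * W = a2 at *
  generalize g3 : 1 - q * (Z * W) = a3 at *
  generalize g4 : Z * W - q = a4 at *
  field_simp
  rw [← g2, ← g4]
  ring

theorem flip_zero_of_ne {q e Z W : ℂ} (hW : W ≠ 0) (h1 : W - q * Z ≠ 0)
    (h2 : Z - q * W ≠ 0) (h3 : 1 - q * (Z * W) ≠ 0) (h4 : Z * W - q ≠ 0) :
    (1 - W ^ 2) * (1 + e * W) / ((W - q * Z) * (Z - q * W) * (1 - q * (Z * W))) +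
      (1 - W⁻¹ ^ 2) * (1 + e * W⁻¹) / ((W⁻¹ - q * Z) * (Z - q * W⁻¹) * (1 - q * (Z * W⁻¹))) =
      -(1 - W ^ 2) ^ 2 * (q + e * Z) / eKer q Z W := by
  have e1 : W⁻¹ - q * Z = (1 - q * (Z * W)) / W := by field_simp
  have e2 : Z - q * W⁻¹ = (Z * W - q) / W := by field_simp
  have e3 : 1 - q * (Z * W⁻¹) = (W - q * Z) / W := by field_simp
  rw [e1, e2, e3, eKer]
  generalize g1 : W - q * Z = a1 at *
  generalize g2 : Z - q * W = a2 at *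
  generalize g3 : 1 - q * (Z * W) = a3 at *
  generalize g4 : Z * W - q = a4 at *
  field_simp
  rw [← g2, ← g4]
  ring

theorem flip_neg_of_zero {q Z V W : ℂ} (hW : W ≠ 0) (h1 : W - q * Z ≠ 0)
    (h2 : Z - q * W ≠ 0) (h3 : 1 - q * (Z * W) ≠ 0) (h4 : Z * W - q ≠ 0) :
    ((1 - q) * (W * V) - q * Z * W + Z * V) * (1 - W ^ 2) /
        ((W - q * Z) * (Z - q * W) * (1 - q * (Z * W))) +
      ((1 - q) * (W⁻¹ * V) - q * Z * W⁻¹ + Z * V) * (1 - W⁻¹ ^ 2) /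
        ((W⁻¹ - q * Z) * (Z - q * W⁻¹) * (1 - q * (Z * W⁻¹))) =
      -(1 - W ^ 2) ^ 2 * Z * (V - q * Z) / eKer q Z W := by
  have e1 : W⁻¹ - q * Z = (1 - q * (Z * W)) / W := by field_simp
  have e2 : Z - q * W⁻¹ = (Z * W - q) / W := by field_simp
  have e3 : 1 - q * (Z * W⁻¹) = (W - q * Z) / W := by field_simp
  rw [e1, e2, e3, eKer]
  generalize g1 : W - q * Z = a1 at *
  generalize g2 : Z - q * W = a2 at *
  generalize g3 : 1 - q * (Z * W) = a3 at *
  generalize g4 : Z * W - q = a4 at *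
  field_simp
  rw [← g2, ← g4]
  ring

/-- The numerator left by the sum over `W → 1/W` for the component `-` with `ε ≠ 0`. It still
depends on `s = W + 1/W`, and one inversion does not suffice to make it homogeneous in `Z`. -/
def flipBr (q e Z s V : ℂ) : ℂ :=
  -(q * Z * V * s) + (Z ^ 2 - q + q ^ 2) * V + q ^ 2 * Z - e * Z * (V - q * Z)

theorem flip_neg_of_ne {q e Z V W : ℂ} (hW : W ≠ 0) (h1 : W - q * Z ≠ 0)
    (h2 : Z - q * W ≠ 0) (h3 : 1 - q * (Z * W) ≠ 0) (h4 : Z * W - q ≠ 0) :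
    ((1 - q) * (W * V) - q * Z * W + Z * V) * ((1 - W ^ 2) * (1 + e * W)) * W⁻¹ /
        ((W - q * Z) * (Z - q * W) * (1 - q * (Z * W))) +
      ((1 - q) * (W⁻¹ * V) - q * Z * W⁻¹ + Z * V) * ((1 - W⁻¹ ^ 2) * (1 + e * W⁻¹)) * W /
        ((W⁻¹ - q * Z) * (Z - q * W⁻¹) * (1 - q * (Z * W⁻¹))) =
      (1 - W ^ 2) ^ 2 * flipBr q e Z (W + W⁻¹) V / eKer q Z W := by
  have e1 : W⁻¹ - q * Z = (1 - q * (Z * W)) / W := by field_simp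
  have e2 : Z - q * W⁻¹ = (Z * W - q) / W := by field_simp
  have e3 : 1 - q * (Z * W⁻¹) = (W - q * Z) / W := by field_simp
  rw [e1, e2, e3, eKer, flipBr]
  generalize g1 : W - q * Z = a1 at *
  generalize g2 : Z - q * W = a2 at *
  generalize g3 : 1 - q * (Z * W) = a3 at *
  generalize g4 : Z * W - q = a4 at *
  field_simp
  rw [← g2, ← g4]
  ring

/-- The numerator and the denominator of the sum over inversions of the second variable. -/
def flipNum (q e Z s t : ℂ) : ℂ :=
  -- `b` are the coefficients of `flipBr` in the remaining variable `W`, `c` those of its product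
  -- with `(1 + eW)(ZW - q)/W²`, from `W¹` down to `W⁻²`, and `d` those of `(W⁻¹ + q⁴W - q²s)(W +
  -- q²W⁻¹ + qs)`, from `W⁻²` to `W²`.
  let b0 := -(q * Z * s) + Z ^ 2 - q + q ^ 2 - e * Z
  let b1 := q * Z * (q + e * Z)
  let c1 := e * Z * b0
  let c0 := (Z - e * q) * b0 + e * Z * b1
  let cm := (Z - e * q) * b1 - q * b0
  let cn := -(q * b1)
  let dn := q ^ 2
  let dm := (q - q ^ 4) * s
  let d0 := 1 + q ^ 6 - q ^ 3 * s ^ 2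
  let d1 := (q ^ 5 - q ^ 2) * s
  let d2 := q ^ 4
  -- The antisymmetrization of the product `c d` divided by `W⁻¹ - W`: `(W⁻ⁿ - Wⁿ)/(W⁻¹ - W)` equals
  -- `1`, `t`, `t² - 1`, `t³ - 2t` for `n = 1, …, 4`, with `t = W + 1/W`.
  (cm * d0 + cn * d1 + c0 * dm + c1 * dn - (c1 * d0 + c0 * d1 + cm * d2)) +
    (cn * d0 + cm * dm + c0 * dn - (c1 * d1 + c0 * d2)) * t +
    (cn * dm + cm * dn - c1 * d2) * (t ^ 2 - 1) + cn * dn * (t ^ 3 - 2 * t)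

def flipDen (q s t : ℂ) : ℂ :=
  1 + q ^ 4 - 2 * q ^ 2 + q ^ 2 * t ^ 2 + q * (1 + q ^ 2) * (s * t) + q ^ 2 * s ^ 2

def flipM (q e Z s W : ℂ) : ℂ :=
  (W⁻¹ - W) * ((1 + e * W) * (Z * W - q) / W) * (flipBr q e Z s W / W) *
    ((W⁻¹ + q ^ 4 * W - q ^ 2 * s) / (W⁻¹ + q ^ 2 * W + q * s))

theorem flipDen_eq {q s W : ℂ} (hW : W ≠ 0) : flipDen q s (W + W⁻¹) =
    (W⁻¹ + q ^ 2 * W + q * s) * (W + q ^ 2 * W⁻¹ + q * s) := by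
  unfold flipDen; field_simp; ring

theorem flipM_add {q e Z s W : ℂ} (hW : W ≠ 0) (h1 : W⁻¹ + q ^ 2 * W + q * s ≠ 0)
    (h2 : W + q ^ 2 * W⁻¹ + q * s ≠ 0) :
    flipM q e Z s W + flipM q e Z s W⁻¹ =
      (W⁻¹ - W) ^ 2 * flipNum q e Z s (W + W⁻¹) / flipDen q s (W + W⁻¹) := by
  rw [flipDen_eq hW]
  unfold flipM
  rw [inv_inv]
  generalize g1 : W⁻¹ + q ^ 2 * W + q * s = a1 at *
  generalize g2 : W + q ^ 2 * W⁻¹ + q * s = a2 at *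
  rw [eq_div_iff (mul_ne_zero h1 h2), add_mul]
  have e1 : ∀ x y : ℂ, x * (y / a1) * (a1 * a2) = x * y * a2 := fun x y => by field_simp
  have e2 : ∀ x y : ℂ, x * (y / a2) * (a1 * a2) = x * y * a1 := fun x y => by field_simp
  rw [e1, e2, ← g1, ← g2]
  simp only [flipNum, flipBr]
  field_simp
  ring

/-- The decisive identity for the component `-`: after antisymmetrization in the two variables the
numerator becomes homogeneous under `Z → 1/Z`, when `q = -g²` and `e = 1/g`. This relation is the
special value of the boundary parameter in `K_±`. -/
theorem flipNum_inv {g Z s t : ℂ} (hg : g ≠ 0) (hZ : Z ≠ 0) :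
    flipNum (-g ^ 2) g⁻¹ Z⁻¹ s t - flipNum (-g ^ 2) g⁻¹ Z⁻¹ t s =
      (Z ^ 2)⁻¹ * (flipNum (-g ^ 2) g⁻¹ Z s t - flipNum (-g ^ 2) g⁻¹ Z t s) := by
  simp only [flipNum]
  field_simp
  ring

end IzerginKorepin

namespace IzerginKorepin
open Metric Set

/-! ### Symmetrization of averages over the unit torus -/

section
variable {f g : ℂ → ℂ → ℂ}

theorem mapsTo_inv_sphere : MapsTo (fun w : ℂ => w⁻¹) (sphere 0 1) (sphere 0 1) := fun w hw => by
  rw [mem_sphere_zero_iff_norm] at hw ⊢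
  rw [norm_inv, hw, inv_one]

/-- On the unit circle the average is invariant under `w → 1/w`, so it depends only on the
symmetrized integrand. -/
theorem avg_eq_of_flip {f g : ℂ → ℂ} (hf : ContinuousOn f (sphere 0 1))
    (hg : ContinuousOn g (sphere 0 1)) (H : ∀ w, ‖w‖ = 1 → f w + f w⁻¹ = g w + g w⁻¹) :
    avg 1 f = avg 1 g := by
  have hc : ContinuousOn (fun w : ℂ => w⁻¹) (sphere 0 1) := continuousOn_id.inv₀ fun w hw => by
    exact ne_zero_of_norm_eq one_pos (mem_sphere_zero_iff_norm.mp hw)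
  have key : ∀ {f : ℂ → ℂ}, ContinuousOn f (sphere 0 1) →
      avg 1 (fun w => f w + f w⁻¹) = 2 * avg 1 f := fun {f} hf => by
    rw [avg_add zero_le_one (g := fun w => f w⁻¹) hf (hf.comp hc mapsTo_inv_sphere), avg_inv]; ring
  have := avg_congr zero_le_one H
  rw [key hf, key hg] at this
  exact mul_left_cancel₀ two_ne_zero this

/-- The sum over inversions of the first variable. -/
def flipFst (f : ℂ → ℂ → ℂ) (a b : ℂ) : ℂ := f a b + f a⁻¹ b

/-- The sum over inversions of the second variable. -/
def flipSnd (f : ℂ → ℂ → ℂ) (a b : ℂ) : ℂ := f a b + f a b⁻¹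

/-- The sum over permutations of the variables. -/
def swapSum (f : ℂ → ℂ → ℂ) (a b : ℂ) : ℂ := f a b + f b a

theorem continuousOn_flipFst (hf : ContinuousOn (Function.uncurry f) (sphere 0 1 ×ˢ sphere 0 1)) :
    ContinuousOn (Function.uncurry fun a b => f a⁻¹ b) (sphere 0 1 ×ˢ sphere 0 1) := by
  refine hf.comp (f := fun x : ℂ × ℂ => (x.1⁻¹, x.2)) ?_ fun x hx =>
    ⟨mapsTo_inv_sphere hx.1, hx.2⟩
  refine ContinuousOn.prodMk (continuousOn_fst.inv₀ fun x hx => ?_) continuousOn_snd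
  exact ne_zero_of_norm_eq one_pos (mem_sphere_zero_iff_norm.mp hx.1)

theorem continuousOn_swap (hf : ContinuousOn (Function.uncurry f) (sphere 0 1 ×ˢ sphere 0 1)) :
    ContinuousOn (Function.uncurry fun a b => f b a) (sphere 0 1 ×ˢ sphere 0 1) :=
  hf.comp (f := fun x : ℂ × ℂ => (x.2, x.1)) (by fun_prop) fun x hx => ⟨hx.2, hx.1⟩

theorem continuousOn_flipSnd (hf : ContinuousOn (Function.uncurry f) (sphere 0 1 ×ˢ sphere 0 1)) :
    ContinuousOn (Function.uncurry fun a b => f a b⁻¹) (sphere 0 1 ×ˢ sphere 0 1) :=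
  continuousOn_swap (continuousOn_flipFst (continuousOn_swap hf))

theorem avg_swapSum (hf : ContinuousOn (Function.uncurry f) (sphere 0 1 ×ˢ sphere 0 1)) :
    avg 1 (fun a => avg 1 fun b => swapSum f a b) = 2 * avg 1 (fun a => avg 1 fun b => f a b) := by
  unfold swapSum
  rw [avg_add_two zero_le_one zero_le_one hf (continuousOn_swap hf),
    avg_swap zero_le_one zero_le_one (continuousOn_swap hf), two_mul]

/-- Each of the two inversions and the exchange of variables preserves the average over the unit
torus and contributes a factor `2`. -/
theorem avg_symm (hf : ContinuousOn (Function.uncurry f) (sphere 0 1 ×ˢ sphere 0 1)) :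
    avg 1 (fun a => avg 1 fun b => swapSum (flipSnd (flipFst f)) a b) =
      8 * avg 1 (fun a => avg 1 fun b => f a b) := by
  have c1 : ContinuousOn (Function.uncurry (flipFst f)) (sphere 0 1 ×ˢ sphere 0 1) :=
    hf.add (continuousOn_flipFst hf)
  have c2 : ContinuousOn (Function.uncurry (flipSnd (flipFst f))) (sphere 0 1 ×ˢ sphere 0 1) :=
    c1.add (continuousOn_flipSnd c1)
  have e1 : avg 1 (fun a => avg 1 fun b => flipFst f a b) =
      2 * avg 1 (fun a => avg 1 fun b => f a b) := by
    unfold flipFst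
    rw [avg_add_two zero_le_one zero_le_one hf (continuousOn_flipFst hf),
      avg_inv (fun a => avg 1 fun b => f a b), two_mul]
  have e2 : avg 1 (fun a => avg 1 fun b => flipSnd (flipFst f) a b) =
      2 * avg 1 (fun a => avg 1 fun b => flipFst f a b) := by
    unfold flipSnd
    rw [avg_add_two zero_le_one zero_le_one c1 (continuousOn_flipSnd c1), two_mul]
    congr 1
    exact avg_congr zero_le_one fun a _ => avg_inv (flipFst f a)
  rw [avg_swapSum c2, e2, e1]
  ring

theorem avg_eq_of_symm (hf : ContinuousOn (Function.uncurry f) (sphere 0 1 ×ˢ sphere 0 1))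
    (hg : ContinuousOn (Function.uncurry g) (sphere 0 1 ×ˢ sphere 0 1))
    (H : ∀ a b, ‖a‖ = 1 → ‖b‖ = 1 →
      swapSum (flipSnd (flipFst f)) a b = swapSum (flipSnd (flipFst g)) a b) :
    avg 1 (fun a => avg 1 fun b => f a b) = avg 1 fun a => avg 1 fun b => g a b := by
  have := avg_congr zero_le_one fun a ha => avg_congr zero_le_one fun b hb => H a b ha hb
  rw [avg_symm hf, avg_symm hg] at this
  exact mul_left_cancel₀ (by norm_num) this

theorem avg_move_fst {r R σ : ℝ} (hr : 0 < r) (hR : r ≤ R) (hσ : 0 ≤ σ)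
    (hd : ∀ a b, r ≤ ‖a‖ → ‖a‖ ≤ R → ‖b‖ = σ →
      DifferentiableAt ℂ (Function.uncurry f) (a, b)) :
    avg r (fun a => avg σ fun b => f a b) = avg R fun a => avg σ fun b => f a b := by
  rw [avg_swap hr.le hσ fun x hx => ?_, avg_swap (hr.le.trans hR) hσ fun x hx => ?_]
  · refine avg_congr hσ fun b hb => (avg_radius_eq hr hR fun a ha ha' => ?_).symm
    have h1 : DifferentiableAt ℂ (fun a : ℂ => (a, b)) a := by fun_prop
    exact DifferentiableAt.comp a (g := Function.uncurry f) (hd a b ha ha' hb) h1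
  · obtain ⟨h1, h2⟩ := hx
    rw [mem_sphere_zero_iff_norm] at h1 h2
    exact (hd x.1 x.2 (by rw [h1]; exact hR) h1.le h2).continuousAt.continuousWithinAt
  · obtain ⟨h1, h2⟩ := hx
    rw [mem_sphere_zero_iff_norm] at h1 h2
    exact (hd x.1 x.2 h1.ge (h1.le.trans hR) h2).continuousAt.continuousWithinAt

theorem avg_move_snd {r R σ : ℝ} (hr : 0 < r) (hR : r ≤ R) (hσ : 0 ≤ σ)
    (hd : ∀ a b, ‖a‖ = σ → r ≤ ‖b‖ → ‖b‖ ≤ R →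
      DifferentiableAt ℂ (Function.uncurry f) (a, b)) :
    avg σ (fun a => avg r fun b => f a b) = avg σ fun a => avg R fun b => f a b := by
  refine avg_congr hσ fun a ha => (avg_radius_eq hr hR fun b hb hb' => ?_).symm
  have h1 : DifferentiableAt ℂ (fun b : ℂ => (a, b)) b := by fun_prop
  exact DifferentiableAt.comp b (g := Function.uncurry f) (hd a b ha hb hb') h1

end

/-! ### Symmetries of the integrand -/

theorem shift_inv (D : ℕ → ℂ) (Z : ℂ) : shift D Z⁻¹ = shift D Z := by
  funext m; rw [shift, shift, inv_inv, add_comm]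

theorem shifted_inv_z₁ (h : ℂ) (ε : SignType) (v : FockSpace) (Z₁ Z₂ W₁ W₂ : ℂ) :
    shifted h ε v Z₁⁻¹ Z₂ W₁ W₂ = shifted h ε v Z₁ Z₂ W₁ W₂ := by rw [shifted, shift_inv, shifted]

theorem shifted_inv_w₁ (h : ℂ) (ε : SignType) (v : FockSpace) (Z₁ Z₂ W₁ W₂ : ℂ) :
    shifted h ε v Z₁ Z₂ W₁⁻¹ W₂ = shifted h ε v Z₁ Z₂ W₁ W₂ := by rw [shifted, shift_inv, shifted]

theorem shifted_inv_w₂ (h : ℂ) (ε : SignType) (v : FockSpace) (Z₁ Z₂ W₁ W₂ : ℂ) :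
    shifted h ε v Z₁ Z₂ W₁ W₂⁻¹ = shifted h ε v Z₁ Z₂ W₁ W₂ := by rw [shifted, shift_inv, shifted]

theorem shifted_swap (h : ℂ) (ε : SignType) (v : FockSpace) (Z₁ Z₂ W₁ W₂ : ℂ) :
    shifted h ε v Z₁ Z₂ W₂ W₁ = shifted h ε v Z₁ Z₂ W₁ W₂ := by
  rw [shifted, shifted, add_right_comm]

theorem symKer_inv_z₁ {h : ℂ} (ε : SignType) (v : FockSpace) {Z₁ : ℂ} (hZ : Z₁ ≠ 0)
    (Z₂ W₁ W₂ : ℂ) : symKer h ε v Z₁⁻¹ Z₂ W₁ W₂ = Z₁ ^ 4 * symKer h ε v Z₁ Z₂ W₁ W₂ := by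
  rw [symKer, symKer, shifted_inv_z₁]
  have e : (Z₁⁻¹ - h ^ 2 * W₁) * (Z₁⁻¹ - h ^ 2 * W₂) * ((W₁ - h ^ 2 * Z₂) * (W₂ - h ^ 2 * Z₂)) *
      ((1 - h ^ 2 * (Z₁⁻¹ * W₁)) * (1 - h ^ 2 * (Z₁⁻¹ * W₂)) *
        ((1 - h ^ 2 * (Z₂ * W₁)) * (1 - h ^ 2 * (Z₂ * W₂)))) = (Z₁ ^ 4)⁻¹ *
      ((Z₁ - h ^ 2 * W₁) * (Z₁ - h ^ 2 * W₂) * ((W₁ - h ^ 2 * Z₂) * (W₂ - h ^ 2 * Z₂)) *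
      ((1 - h ^ 2 * (Z₁ * W₁)) * (1 - h ^ 2 * (Z₁ * W₂)) *
        ((1 - h ^ 2 * (Z₂ * W₁)) * (1 - h ^ 2 * (Z₂ * W₂))))) := by
    field_simp
  rw [e, mul_inv (Z₁ ^ 4)⁻¹, inv_inv]
  ring

theorem symKer_swap (h : ℂ) (ε : SignType) (v : FockSpace) (Z₁ Z₂ W₁ W₂ : ℂ) :
    symKer h ε v Z₁ Z₂ W₂ W₁ = symKer h ε v Z₁ Z₂ W₁ W₂ := by
  rw [symKer, symKer, shifted_swap, yKer, yKer, mul_comm W₂ W₁, mul_comm (chi h ε W₂),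
    mul_comm (Z₁ - h ^ 2 * W₂), mul_comm (W₂ - h ^ 2 * Z₂), mul_comm (1 - h ^ 2 * (Z₁ * W₂)),
    mul_comm (1 - h ^ 2 * (Z₂ * W₂))]

/-- The invariant factors of the integrand. -/
def aKer (h Z W : ℂ) : ℂ := (W - h ^ 2 * Z) * (1 - h ^ 2 * (Z * W)) / W

theorem aKer_inv {h Z W : ℂ} (hW : W ≠ 0) : aKer h Z W⁻¹ = aKer h Z W := by
  unfold aKer; field_simp

/-- Inversion of `W` exchanges the roles of the two kernels, up to powers of `W`: the contraction
with a current is carried to the contraction with its mirror image. -/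
theorem xKer_mul_yKer_inv {h W V : ℂ} (hW : W ≠ 0) :
    xKer h W⁻¹ V * yKer h W⁻¹ V / W⁻¹ = xKer h W V * yKer h W V / W := by
  have e1 : xKer h W⁻¹ V = (1 - h ^ 4 * (W * V)) * (1 - W * V) / (1 + h ^ 2 * (W * V)) / W := by
    rw [xKer, show W⁻¹ + h ^ 2 * V = (1 + h ^ 2 * (W * V)) / W by field_simp,
      show (W⁻¹ - h ^ 4 * V) * (W⁻¹ - V) = (1 - h ^ 4 * (W * V)) * (1 - W * V) / W / W by
        field_simp]
    rw [div_div_eq_mul_div, div_mul_cancel₀ _ hW, div_right_comm]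
  have e2 : yKer h W⁻¹ V = (W - V) * (W - h ^ 4 * V) / (W + h ^ 2 * V) / W := by
    rw [yKer, show 1 + h ^ 2 * (W⁻¹ * V) = (W + h ^ 2 * V) / W by field_simp,
      show (1 - W⁻¹ * V) * (1 - h ^ 4 * (W⁻¹ * V)) = (W - V) * (W - h ^ 4 * V) / W / W by
        field_simp]
    rw [div_div_eq_mul_div, div_mul_cancel₀ _ hW, div_right_comm]
  rw [e1, e2, xKer, yKer]
  simp only [div_eq_mul_inv, inv_inv]
  have e : W * W⁻¹ = 1 := mul_inv_cancel₀ hW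
  linear_combination ((W - h ^ 4 * V) * (W - V) * (W + h ^ 2 * V)⁻¹ * ((1 - W * V) *
    (1 - h ^ 4 * (W * V)) * (1 + h ^ 2 * (W * V))⁻¹) * W⁻¹) * e

/-- All factors except the last are invariant under `W → 1/W`; the last one is the subject of
`flip_zero_of_zero` and `flip_zero_of_ne`. `wKer_neg_eq` is the analogue for the component `-`. -/
theorem wKer_zero_eq {h : ℂ} (ε : SignType) (v : FockSpace) {Z Z₂ W V : ℂ} (hW : W ≠ 0) :
    wKer h ε 0 v Z Z₂ W V = (1 - h ^ 4) * V * chi h ε V * V ^ (-(ε : ℤ) ^ 2) /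
        ((Z₂ - h ^ 2 * V) * ((V - h ^ 2 * Z₂) * (1 - h ^ 2 * (Z₂ * V)))) *
      ((xKer h W V * yKer h W V / W) / aKer h Z₂ W) * shifted h ε v Z Z₂ W V *
      ((Z - h ^ 2 * V) * (1 - h ^ 2 * (Z * V)))⁻¹ * (W * chi h ε W * W ^ (-(ε : ℤ) ^ 2) /
        ((W - h ^ 2 * Z) * (Z - h ^ 2 * W) * (1 - h ^ 2 * (Z * W)))) := by
  change (1 - h ^ 4) * (W * V) / ((W - h ^ 2 * Z) * (Z₂ - h ^ 2 * V)) * _ * _ = _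
  rw [symKer, aKer, mul_zpow]
  simp only [div_eq_mul_inv, mul_inv, inv_inv]
  have e : W * W⁻¹ = 1 := mul_inv_cancel₀ hW
  linear_combination (-((1 - h ^ 4) * V * chi h ε V * V ^ (-(ε : ℤ) ^ 2) *
        ((Z₂ - h ^ 2 * V)⁻¹ * ((V - h ^ 2 * Z₂)⁻¹ * (1 - h ^ 2 * (Z₂ * V))⁻¹)) *
      ((xKer h W V * yKer h W V) * ((W - h ^ 2 * Z₂)⁻¹ * (1 - h ^ 2 * (Z₂ * W))⁻¹)) *
      shifted h ε v Z Z₂ W V *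
      ((Z - h ^ 2 * V)⁻¹ * (1 - h ^ 2 * (Z * V))⁻¹) * (W * chi h ε W * W ^ (-(ε : ℤ) ^ 2) *
        ((W - h ^ 2 * Z)⁻¹ * (Z - h ^ 2 * W)⁻¹ * (1 - h ^ 2 * (Z * W))⁻¹)))) * e

theorem wKer_neg_eq {h : ℂ} (ε : SignType) (v : FockSpace) {Z Z₂ W V : ℂ} (hW : W ≠ 0) :
    wKer h ε (-1) v Z Z₂ W V = chi h ε V * V ^ (-(ε : ℤ) ^ 2) /
        ((V - h ^ 2 * Z₂) * (1 - h ^ 2 * (Z₂ * V))) *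
      ((xKer h W V * yKer h W V / W) / aKer h Z₂ W) * shifted h ε v Z Z₂ W V *
      ((V - h ^ 2 * Z) * ((Z - h ^ 2 * V) * (1 - h ^ 2 * (Z * V))))⁻¹ *
      (nKer h W V Z * chi h ε W * W ^ (-(ε : ℤ) ^ 2) /
        ((W - h ^ 2 * Z) * (Z - h ^ 2 * W) * (1 - h ^ 2 * (Z * W)))) := by
  change nKer h W V Z / ((W - h ^ 2 * Z) * (V - h ^ 2 * Z)) * _ * _ = _
  rw [symKer, aKer, mul_zpow]
  simp only [div_eq_mul_inv, mul_inv, inv_inv]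
  have e : W * W⁻¹ = 1 := mul_inv_cancel₀ hW
  linear_combination (-(chi h ε V * V ^ (-(ε : ℤ) ^ 2) *
        ((V - h ^ 2 * Z₂)⁻¹ * (1 - h ^ 2 * (Z₂ * V))⁻¹) *
      ((xKer h W V * yKer h W V) * ((W - h ^ 2 * Z₂)⁻¹ * (1 - h ^ 2 * (Z₂ * W))⁻¹)) *
      shifted h ε v Z Z₂ W V *
      ((V - h ^ 2 * Z)⁻¹ * ((Z - h ^ 2 * V)⁻¹ * (1 - h ^ 2 * (Z * V))⁻¹)) *
      (nKer h W V Z * chi h ε W * W ^ (-(ε : ℤ) ^ 2) *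
        ((W - h ^ 2 * Z)⁻¹ * (Z - h ^ 2 * W)⁻¹ * (1 - h ^ 2 * (Z * W))⁻¹)))) * e

end IzerginKorepin

namespace IzerginKorepin
open Metric Set

/-! ### Reflection of the integrals over `W₁` and `W₂` -/

/-- The witness is `g = -εi h`; it expresses `q`, the root of the boundary factor `χ` and the
constant `εi q^{3/2}` of `K_ε` through one free parameter, so that the remaining identities become
polynomial. -/
theorem exists_boundary_parameter {h : ℂ} (h0 : h ≠ 0) {ε : SignType} (hε : ε ≠ 0) :
    ∃ g : ℂ, g ≠ 0 ∧ h ^ 2 = -g ^ 2 ∧ (ε : ℂ) * Complex.I * h⁻¹ = g⁻¹ ∧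
      (ε : ℂ) * Complex.I * h ^ 3 = g ^ 3 := by
  have e2 : (ε : ℂ) ^ 2 = 1 := by cases ε <;> simp_all
  have I2 := Complex.I_sq
  have en : (ε : ℂ) ≠ 0 := fun h => by rw [h] at e2; norm_num at e2
  refine ⟨-((ε : ℂ) * Complex.I * h), neg_ne_zero.mpr (mul_ne_zero (mul_ne_zero en
    Complex.I_ne_zero) h0), ?_, ?_, ?_⟩
  · linear_combination (h ^ 2 * Complex.I ^ 2) * e2 + h ^ 2 * I2
  · have hI := Complex.I_ne_zero
    rw [inv_neg, eq_neg_iff_add_eq_zero]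
    field_simp
    linear_combination Complex.I ^ 2 * e2 + I2
  · linear_combination (h ^ 3 * (ε : ℂ) * Complex.I ^ 3) * e2 + h ^ 3 * (ε : ℂ) * Complex.I * I2

section
variable {h : ℂ} (h0 : h ≠ 0) (h1 : ‖h‖ < 1) {ε : SignType} {r₁ r₂ : ℝ}

include h0 h1 in
theorem regularAt_of_norm {Z₁ Z₂ W₁ W₂ : ℂ} (hZ₁ : ‖Z₁‖ = 1) (hZ₂ : ‖Z₂‖ = ‖h‖ ^ 6)
    (l₁ : ‖h‖ ^ 8 < ‖W₁‖) (u₁ : ‖W₁‖ ≤ 1) (l₂ : ‖h‖ ^ 8 < ‖W₂‖) (u₂ : ‖W₂‖ ≤ 1)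
    (hx : W₁ + h ^ 2 * W₂ ≠ 0) : RegularAt h Z₁ Z₂ W₁ W₂ := by
  have hp : 0 < ‖h‖ := norm_pos_iff.mpr h0
  have hq : 0 < ‖h‖ ^ 2 := by positivity
  have hq1 : ‖h‖ ^ 2 < 1 := pow_lt_one₀ hp.le h1 two_ne_zero
  have h6 : ‖h‖ ^ 6 ≤ 1 := pow_le_one₀ hp.le h1.le
  have pos : ∀ {W : ℂ}, ‖h‖ ^ 8 < ‖W‖ → W ≠ 0 := fun {W} hW =>
    norm_pos_iff.mp ((by positivity : 0 ≤ ‖h‖ ^ 8).trans_lt hW)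
  have one : ∀ {x y : ℂ}, ‖x‖ ≤ 1 → ‖y‖ ≤ 1 → ‖h ^ 2 * (x * y)‖ < 1 := fun {x y} hx hy => by
    rw [norm_mul, norm_mul, norm_pow]
    exact (mul_le_of_le_one_right hq.le (mul_le_one₀ hx (norm_nonneg _) hy)).trans_lt hq1
  have sub : ∀ {x y : ℂ}, ‖h‖ ^ 2 * ‖y‖ < ‖x‖ → x - h ^ 2 * y ≠ 0 := fun {x y} hxy =>
    sub_ne_zero_of_norm_lt (by rwa [norm_mul, norm_pow])
  have za : ∀ {W : ℂ}, ‖W‖ ≤ 1 → Z₁ - h ^ 2 * W ≠ 0 := fun {W} hW => sub (by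
    rw [hZ₁]; exact (mul_le_of_le_one_right hq.le hW).trans_lt hq1)
  have zb : ∀ {W : ℂ}, ‖h‖ ^ 8 < ‖W‖ → W - h ^ 2 * Z₂ ≠ 0 := fun {W} hW => sub (by
    rw [hZ₂, ← pow_add]; exact hW)
  have z2 : ‖Z₂‖ ≤ 1 := by rw [hZ₂]; exact h6
  exact ⟨ne_zero_of_norm_eq one_pos hZ₁, ne_zero_of_norm_eq (by positivity) hZ₂, pos l₁, pos l₂, hx,
    one_add_ne_zero_of_norm_lt (one u₁ u₂), za u₁, za u₂, zb l₁, zb l₂,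
    one_sub_ne_zero_of_norm_lt (one hZ₁.le u₁), one_sub_ne_zero_of_norm_lt (one hZ₁.le u₂),
    one_sub_ne_zero_of_norm_lt (one z2 u₁), one_sub_ne_zero_of_norm_lt (one z2 u₂)⟩

theorem differentiableAt_wKer_pair (ε j : SignType) (v : FockSpace) {Z₁ Z₂ W₁ W₂ : ℂ}
    (H : RegularAt h Z₁ Z₂ W₁ W₂) (hj : pDen h j Z₁ Z₂ W₁ W₂ ≠ 0) :
    DifferentiableAt ℂ (Function.uncurry fun W₁ W₂ => wKer h ε j v Z₁ Z₂ W₁ W₂) (W₁, W₂) := by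
  have d1 : DifferentiableAt ℂ (fun x : ℂ × ℂ => x.1) (W₁, W₂) := by fun_prop
  have d2 : DifferentiableAt ℂ (fun x : ℂ × ℂ => x.2) (W₁, W₂) := by fun_prop
  exact differentiableAt_wKer (z₁ := fun _ => Z₁) (z₂ := fun _ => Z₂) ε j v
    (differentiableAt_const _) (differentiableAt_const _) d1 d2 H hj

/-- The component factor does not contain `Z₁`, so the symmetry holds for the integrand itself and
no contour has to be moved. -/
theorem avg_wKer_pos_inv (v : FockSpace) {Z₁ : ℂ} (hZ : Z₁ ≠ 0) (Z₂ : ℂ) (r₁ r₂ : ℝ) :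
    (avg r₁ fun W₁ => avg r₂ fun W₂ => wKer h ε 1 v Z₁⁻¹ Z₂ W₁ W₂) =
      Z₁ ^ 4 * avg r₁ fun W₁ => avg r₂ fun W₂ => wKer h ε 1 v Z₁ Z₂ W₁ W₂ := by
  simp only [← avg_const_mul]
  congr 1; funext W₁; congr 1; funext W₂
  rw [wKer, wKer, symKer_inv_z₁ ε v hZ]
  change pKer h 1 Z₁ Z₂ W₁ W₂ * _ * _ = _
  ring

include h0 h1

theorem norm_sq_lt_one : ‖h‖ ^ 2 < 1 := pow_lt_one₀ (norm_nonneg _) h1 two_ne_zero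

theorem unit_ne_zero {Z W : ℂ} (hZ : ‖Z‖ = 1) (hW : ‖W‖ = 1) :
    W - h ^ 2 * Z ≠ 0 ∧ Z - h ^ 2 * W ≠ 0 ∧ 1 - h ^ 2 * (Z * W) ≠ 0 ∧ Z * W - h ^ 2 ≠ 0 := by
  have hq1 := norm_sq_lt_one h0 h1
  refine ⟨sub_ne_zero_of_norm_lt ?_, sub_ne_zero_of_norm_lt ?_, sub_ne_zero_of_norm_lt ?_,
    sub_ne_zero_of_norm_lt ?_⟩ <;>
  simpa [norm_mul, norm_pow, hZ, hW] using hq1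

theorem norm_pow_eight_lt {j : SignType} (R : Radii h j 1 (‖h‖ ^ 6) r₁ r₂) : ‖h‖ ^ 8 < r₂ := by
  have := R.br
  rwa [← pow_add] at this

/-- The contour of `W₁` can be moved to the unit circle. -/
theorem avg_wKer_move_fst {j : SignType} (hj : j ≠ 1) (R : Radii h j 1 (‖h‖ ^ 6) r₁ r₂)
    (v : FockSpace) {Z₁ Z₂ : ℂ} (hZ₁ : ‖Z₁‖ = 1) (hZ₂ : ‖Z₂‖ = ‖h‖ ^ 6) :
    (∀ W₁ W₂, r₁ ≤ ‖W₁‖ → ‖W₁‖ ≤ 1 → ‖W₂‖ = r₂ → DifferentiableAt ℂ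
      (Function.uncurry fun W₁ W₂ => wKer h ε j v Z₁ Z₂ W₁ W₂) (W₁, W₂)) ∧
    (avg r₁ fun W₁ => avg r₂ fun W₂ => wKer h ε j v Z₁ Z₂ W₁ W₂) =
      avg 1 fun W₁ => avg r₂ fun W₂ => wKer h ε j v Z₁ Z₂ W₁ W₂ := by
  have hq1 := norm_sq_lt_one h0 h1
  have q1 := R.r₂_pos.trans R.r_lt
  have l8 := norm_pow_eight_lt h0 h1 R
  have r11 : r₁ < 1 := R.r₁_lt.trans h1
  have key : ∀ W₁ W₂, r₁ ≤ ‖W₁‖ → ‖W₁‖ ≤ 1 → ‖W₂‖ = r₂ → DifferentiableAt ℂ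
      (Function.uncurry fun W₁ W₂ => wKer h ε j v Z₁ Z₂ W₁ W₂) (W₁, W₂) := by
    intro W₁ W₂ hl hu hW₂
    have hx : W₁ + h ^ 2 * W₂ ≠ 0 := by
      rw [← sub_neg_eq_add]
      refine sub_ne_zero_of_norm_lt ?_
      rw [norm_neg, norm_mul, norm_pow, hW₂]
      exact (mul_le_of_le_one_left R.r₂_pos.le hq1.le).trans_lt (R.r_lt.trans_le hl)
    refine differentiableAt_wKer_pair ε j v (regularAt_of_norm h0 h1 hZ₁ hZ₂
      ((l8.trans R.r_lt).trans_le hl) hu (by rwa [hW₂])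
      (by rw [hW₂]; exact (R.r_lt.trans r11).le) hx) ?_
    have sub : ∀ {x y : ℂ}, ‖h‖ ^ 2 * ‖y‖ < ‖x‖ → x - h ^ 2 * y ≠ 0 := fun {x y} hxy =>
      sub_ne_zero_of_norm_lt (by rwa [norm_mul, norm_pow])
    -- For the components `0` and `-` the pole at `W₁ = q Z₁` lies inside the initial contour. For
    -- the component `+` a pole at `W₁ = Z₂ / q` would be crossed.
    cases j
    · have := R.zero rfl
      exact mul_ne_zero (sub (by rw [hZ₁]; exact this.1.trans_le hl))
        (sub (by rw [hW₂, hZ₂]; exact this.2))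
    · have := R.neg rfl
      exact mul_ne_zero (sub (by rw [hZ₁]; exact (this.trans R.r_lt).trans_le hl))
        (sub (by rw [hW₂, hZ₁]; exact this))
    · exact absurd rfl hj
  exact ⟨key, avg_move_fst q1 r11.le R.r₂_pos.le key⟩

/-- Reflection by inversion of `W₁` on the unit circle. -/
theorem avg_wKer_inv_of_flip {j : SignType} (hj : j ≠ 1) (R : Radii h j 1 (‖h‖ ^ 6) r₁ r₂)
    (v : FockSpace) {Z₁ Z₂ c c' : ℂ} (hZ₁ : ‖Z₁‖ = 1) (hZ₂ : ‖Z₂‖ = ‖h‖ ^ 6)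
    (H : ∀ W₁ W₂, ‖W₁‖ = 1 → ‖W₂‖ = r₂ →
      c * (wKer h ε j v Z₁⁻¹ Z₂ W₁ W₂ + wKer h ε j v Z₁⁻¹ Z₂ W₁⁻¹ W₂) =
        c' * (wKer h ε j v Z₁ Z₂ W₁ W₂ + wKer h ε j v Z₁ Z₂ W₁⁻¹ W₂)) :
    (c * avg r₁ fun W₁ => avg r₂ fun W₂ => wKer h ε j v Z₁⁻¹ Z₂ W₁ W₂) =
      c' * avg r₁ fun W₁ => avg r₂ fun W₂ => wKer h ε j v Z₁ Z₂ W₁ W₂ := by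
  have hZi : ‖Z₁⁻¹‖ = 1 := by rw [norm_inv, hZ₁, inv_one]
  have r11 : r₁ < 1 := R.r₁_lt.trans h1
  have A := avg_wKer_move_fst h0 h1 hj R (ε := ε) v hZi hZ₂
  have B := avg_wKer_move_fst h0 h1 hj R (ε := ε) v hZ₁ hZ₂
  have cont : ∀ {F : ℂ → ℂ → ℂ}, (∀ W₁ W₂, r₁ ≤ ‖W₁‖ → ‖W₁‖ ≤ 1 → ‖W₂‖ = r₂ →
      DifferentiableAt ℂ (Function.uncurry F) (W₁, W₂)) →
      ContinuousOn (Function.uncurry F) (sphere 0 1 ×ˢ sphere 0 r₂) := fun {F} hF x hx => by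
    obtain ⟨a, b⟩ := hx
    rw [mem_sphere_zero_iff_norm] at a b
    exact (hF x.1 x.2 (by rw [a]; exact r11.le) a.le b).continuousAt.continuousWithinAt
  have cA := cont A.1
  have cB := cont B.1
  rw [A.2, B.2, avg_swap zero_le_one R.r₂_pos.le cA, avg_swap zero_le_one R.r₂_pos.le cB,
    ← avg_const_mul, ← avg_const_mul]
  refine avg_congr R.r₂_pos.le fun W₂ hW₂ => ?_
  rw [← avg_const_mul, ← avg_const_mul]
  have sl : ∀ {F : ℂ → ℂ → ℂ}, ContinuousOn (Function.uncurry F) (sphere 0 1 ×ˢ sphere 0 r₂) →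
      ContinuousOn (fun W₁ => F W₁ W₂) (sphere 0 1) := fun {F} hF =>
    hF.comp (f := fun W₁ => (W₁, W₂)) (by fun_prop) fun x hx =>
      ⟨hx, mem_sphere_zero_iff_norm.mpr hW₂⟩
  refine avg_eq_of_flip (continuousOn_const.mul (sl cA)) (continuousOn_const.mul (sl cB))
    fun W₁ hW₁ => ?_
  rw [← mul_add, ← mul_add]
  exact H W₁ W₂ hW₁ hW₂

theorem wKer_zero_flip (v : FockSpace) {Z Z₂ W V : ℂ} (hZ : ‖Z‖ = 1) (hW : ‖W‖ = 1) :
    wKer h ε 0 v Z Z₂ W V + wKer h ε 0 v Z Z₂ W⁻¹ V =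
      (1 - h ^ 4) * V * chi h ε V * V ^ (-(ε : ℤ) ^ 2) /
        ((Z₂ - h ^ 2 * V) * ((V - h ^ 2 * Z₂) * (1 - h ^ 2 * (Z₂ * V)))) *
      ((xKer h W V * yKer h W V / W) / aKer h Z₂ W) * shifted h ε v Z Z₂ W V *
      (((Z - h ^ 2 * V) * (1 - h ^ 2 * (Z * V)))⁻¹ * (-(1 - W ^ 2) ^ 2 *
        (if ε = 0 then Z else h ^ 2 + (ε : ℂ) * Complex.I * h⁻¹ * Z) / eKer (h ^ 2) Z W)) := by
  have hW0 := ne_zero_of_norm_eq one_pos hW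
  obtain ⟨n1, n2, n3, n4⟩ := unit_ne_zero h0 h1 hZ hW
  rw [wKer_zero_eq ε v hW0, wKer_zero_eq ε v (inv_ne_zero hW0), xKer_mul_yKer_inv hW0,
    aKer_inv hW0, shifted_inv_w₁, ← mul_add, mul_assoc]
  congr 2
  by_cases hε : ε = 0
  · subst hε
    have := flip_zero_of_zero hW0 n1 n2 n3 n4
    simp only [chi, SignType.coe_zero, zero_mul, add_zero, mul_one, if_true]
    simpa using this
  · have := flip_zero_of_ne (e := (ε : ℂ) * Complex.I * h⁻¹) hW0 n1 n2 n3 n4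
    rw [if_neg hε, ← this]
    have e2 : (ε : ℤ) ^ 2 = 1 := by cases ε <;> simp_all
    rw [e2, zpow_neg_one, zpow_neg_one, inv_inv]
    have c1 : W * chi h ε W * W⁻¹ = (1 - W ^ 2) * (1 + (ε : ℂ) * Complex.I * h⁻¹ * W) := by
      rw [chi]; field_simp
    have c2 : W⁻¹ * chi h ε W⁻¹ * W = (1 - W⁻¹ ^ 2) * (1 + (ε : ℂ) * Complex.I * h⁻¹ * W⁻¹) := by
      rw [chi]; field_simp
    rw [c1, c2]

theorem inv_mul_pair {Z V : ℂ} (hZ : Z ≠ 0) : ((Z⁻¹ - h ^ 2 * V) * (1 - h ^ 2 * (Z⁻¹ * V)))⁻¹ =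
    Z ^ 2 * ((Z - h ^ 2 * V) * (1 - h ^ 2 * (Z * V)))⁻¹ := by
  rw [show (Z⁻¹ - h ^ 2 * V) * (1 - h ^ 2 * (Z⁻¹ * V)) =
    (Z ^ 2)⁻¹ * ((Z - h ^ 2 * V) * (1 - h ^ 2 * (Z * V))) by field_simp, mul_inv, inv_inv]

/-- For `ε ≠ 0` the symmetrized integrand contains `q + eZ = (Z - g³)/g`, whose reflection is
proportional to `1 - g³Z`; the factor `1 - εi q^{3/2} Z` compensates this, since `εi q^{3/2} = g³`.
-/
theorem avg_wKer_zero_inv (R : Radii h 0 1 (‖h‖ ^ 6) r₁ r₂) (v : FockSpace) {Z₁ Z₂ : ℂ}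
    (hZ₁ : ‖Z₁‖ = 1) (hZ₂ : ‖Z₂‖ = ‖h‖ ^ 6) :
    ((1 - (ε : ℂ) * Complex.I * h ^ 3 * Z₁⁻¹) *
      avg r₁ fun W₁ => avg r₂ fun W₂ => wKer h ε 0 v Z₁⁻¹ Z₂ W₁ W₂) =
      Z₁ ^ 4 * (1 - (ε : ℂ) * Complex.I * h ^ 3 * Z₁) *
        avg r₁ fun W₁ => avg r₂ fun W₂ => wKer h ε 0 v Z₁ Z₂ W₁ W₂ := by
  refine avg_wKer_inv_of_flip h0 h1 (by decide) R v hZ₁ hZ₂ fun W V hW hV => ?_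
  have hZi : ‖Z₁⁻¹‖ = 1 := by rw [norm_inv, hZ₁, inv_one]
  have hz := ne_zero_of_norm_eq one_pos hZ₁
  rw [wKer_zero_flip h0 h1 v hZi hW, wKer_zero_flip h0 h1 v hZ₁ hW, inv_mul_pair h0 h1 hz,
    eKer_inv_left hz, shifted_inv_z₁]
  generalize (1 - h ^ 4) * V * chi h ε V * V ^ (-(ε : ℤ) ^ 2) /
        ((Z₂ - h ^ 2 * V) * ((V - h ^ 2 * Z₂) * (1 - h ^ 2 * (Z₂ * V)))) *
      ((xKer h W V * yKer h W V / W) / aKer h Z₂ W) * shifted h ε v Z₁ Z₂ W V = A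
  generalize ((Z₁ - h ^ 2 * V) * (1 - h ^ 2 * (Z₁ * V)))⁻¹ = B
  generalize eKer (h ^ 2) Z₁ W = E
  rw [div_eq_mul_inv, div_eq_mul_inv, mul_inv, inv_inv]
  by_cases hε : ε = 0
  · simp only [hε, if_true, SignType.coe_zero, zero_mul, sub_zero]
    field_simp
  · obtain ⟨g, hg, e1, e2, e3⟩ := exists_boundary_parameter h0 hε
    rw [if_neg hε, if_neg hε, e2, e3, e1]
    field_simp
    ring

end

end IzerginKorepin

/-! ### Reflection of the component `-`. -/

namespace IzerginKorepin
open Metric Set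

theorem flip_identity_neg {W V pW pV e br num den dd sh aW aV eW b1 b2 b3 b4 : ℂ} (hW : W ≠ 0)
    (hV : V ≠ 0) (hb : b4 ≠ 0) : pV * V * (1 + e * V) * V⁻¹ / aV *
      (W * V * dd * (num / den) / W / aW) * sh * (b1 * (b2 * b3))⁻¹ * (pW * W ^ 2 * br / eW) =
      dd / (aW * (aV / V)) * sh / (eW / W ^ 2 * (b1 * b2 * b3 * b4 / V ^ 2)) * pW *
        (pV * ((1 + e * V) * b4 / V) * (br / V) * (num / den)) := by
  simp only [div_eq_mul_inv, mul_inv, inv_inv]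
  have e1 : V * V⁻¹ * (W * W⁻¹) = 1 := by rw [mul_inv_cancel₀ hV, mul_inv_cancel₀ hW, one_mul]
  have e2 : b4 * b4⁻¹ * (V * V⁻¹) ^ 2 = 1 := by
    rw [mul_inv_cancel₀ hV, mul_inv_cancel₀ hb, one_mul, one_pow]
  linear_combination (pV * (1 + e * V) * aV⁻¹ * (dd * (num * den⁻¹) * aW⁻¹) * sh *
    (b1⁻¹ * (b2⁻¹ * b3⁻¹)) * (pW * br * eW⁻¹) * V * W ^ 2) * (e1 - e2)

section
variable {h : ℂ} (h0 : h ≠ 0) (h1 : ‖h‖ < 1) {ε : SignType} {r₁ r₂ : ℝ}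
include h0 h1

/-- For `ε = 0` the sum over inversions of `W₁` alone produces the factor `W₂ - q Z₁`, which cancels
the only factor of the other variable that is not covariant under `Z₁ → 1/Z₁`. -/
theorem avg_wKer_neg_inv_of_zero (R : Radii h (-1) 1 (‖h‖ ^ 6) r₁ r₂) (v : FockSpace) {Z₁ Z₂ : ℂ}
    (hZ₁ : ‖Z₁‖ = 1) (hZ₂ : ‖Z₂‖ = ‖h‖ ^ 6) :
    (avg r₁ fun W₁ => avg r₂ fun W₂ => wKer h 0 (-1) v Z₁⁻¹ Z₂ W₁ W₂) =
      Z₁ ^ 4 * avg r₁ fun W₁ => avg r₂ fun W₂ => wKer h 0 (-1) v Z₁ Z₂ W₁ W₂ := by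
  have main := avg_wKer_inv_of_flip h0 h1 (ε := 0) (c := 1) (c' := Z₁ ^ 4) (by decide) R v hZ₁ hZ₂
    fun W V hW hV => ?_
  · rwa [one_mul] at main
  have hZi : ‖Z₁⁻¹‖ = 1 := by rw [norm_inv, hZ₁, inv_one]
  have hz := ne_zero_of_norm_eq one_pos hZ₁
  have hW0 := ne_zero_of_norm_eq one_pos hW
  have key : ∀ {Z : ℂ}, ‖Z‖ = 1 → wKer h 0 (-1) v Z Z₂ W V + wKer h 0 (-1) v Z Z₂ W⁻¹ V =
      chi h 0 V / ((V - h ^ 2 * Z₂) * (1 - h ^ 2 * (Z₂ * V))) *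
      ((xKer h W V * yKer h W V / W) / aKer h Z₂ W) * shifted h 0 v Z Z₂ W V *
      (((Z - h ^ 2 * V) * (1 - h ^ 2 * (Z * V)))⁻¹ * (-(1 - W ^ 2) ^ 2 * Z / eKer (h ^ 2) Z W)) :=
      fun {Z} hZ => by
    obtain ⟨n1, n2, n3, n4⟩ := unit_ne_zero h0 h1 hZ hW
    have nV : V - h ^ 2 * Z ≠ 0 := sub_ne_zero_of_norm_lt (by
      rw [norm_mul, norm_pow, hZ, hV]; exact R.neg rfl)
    have e := flip_neg_of_zero (V := V) hW0 n1 n2 n3 n4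
    have chi0 : ∀ w, chi h 0 w = 1 - w ^ 2 := fun w => by simp [chi]
    rw [wKer_neg_eq 0 v hW0, wKer_neg_eq 0 v (inv_ne_zero hW0), xKer_mul_yKer_inv hW0,
      aKer_inv hW0, shifted_inv_w₁, ← mul_add]
    simp only [SignType.coe_zero, ne_eq, OfNat.ofNat_ne_zero, not_false_eq_true, zero_pow, neg_zero,
      zpow_zero, mul_one, nKer]
    rw [chi0 W, chi0 W⁻¹, e, mul_inv]
    have ec : (V - h ^ 2 * Z)⁻¹ * (V - h ^ 2 * Z) = 1 := inv_mul_cancel₀ nV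
    simp only [div_eq_mul_inv]
    linear_combination (chi h 0 V * ((V - h ^ 2 * Z₂) * (1 - h ^ 2 * (Z₂ * V)))⁻¹ *
      ((xKer h W V * yKer h W V * W⁻¹) * (aKer h Z₂ W)⁻¹) * shifted h 0 v Z Z₂ W V *
      (((Z - h ^ 2 * V) * (1 - h ^ 2 * (Z * V)))⁻¹ *
        (-(1 - W ^ 2) ^ 2 * Z * (eKer (h ^ 2) Z W)⁻¹))) * ec
  rw [key hZi, key hZ₁, inv_mul_pair h0 h1 hz, eKer_inv_left hz, shifted_inv_z₁]
  generalize chi h 0 V / ((V - h ^ 2 * Z₂) * (1 - h ^ 2 * (Z₂ * V))) *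
      ((xKer h W V * yKer h W V / W) / aKer h Z₂ W) * shifted h 0 v Z₁ Z₂ W V = A
  generalize ((Z₁ - h ^ 2 * V) * (1 - h ^ 2 * (Z₁ * V)))⁻¹ = B
  generalize eKer (h ^ 2) Z₁ W = E
  rw [div_eq_mul_inv, div_eq_mul_inv, mul_inv, inv_inv]
  field_simp

theorem unit_add_ne_zero {W V : ℂ} (hW : ‖W‖ = 1) (hV : ‖V‖ = 1) :
    W + h ^ 2 * V ≠ 0 ∧ 1 + h ^ 2 * (W * V) ≠ 0 := by
  have hq1 := norm_sq_lt_one h0 h1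
  constructor
  · rw [← sub_neg_eq_add]
    refine sub_ne_zero_of_norm_lt ?_
    simpa [norm_mul, norm_pow, hW, hV] using hq1
  · refine one_add_ne_zero_of_norm_lt ?_
    simpa [norm_mul, norm_pow, hW, hV] using hq1

/-- The invariant factor of the symmetrized integrand. -/
def invKer (h : ℂ) (ε : SignType) (v : FockSpace) (Z Z₂ W V : ℂ) : ℂ :=
  (V + V⁻¹ - (W + W⁻¹)) / (aKer h Z₂ W * aKer h Z₂ V) * shifted h ε v Z Z₂ W V /
    (eKer (h ^ 2) Z W / W ^ 2 * (eKer (h ^ 2) Z V / V ^ 2))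

/-- Written in `s = W + 1/W`, the product shows an antisymmetric factor `t - s`, with `t = V + 1/V`,
which goes into `invKer`, and the quotient that enters `flipM`. -/
theorem xKer_mul_yKer_eq {W V : ℂ} (hW : ‖W‖ = 1) (hV : ‖V‖ = 1) :
    xKer h W V * yKer h W V = W * V * (V + V⁻¹ - (W + W⁻¹)) *
      ((V⁻¹ + (h ^ 2) ^ 4 * V - (h ^ 2) ^ 2 * (W + W⁻¹)) /
        (V⁻¹ + (h ^ 2) ^ 2 * V + h ^ 2 * (W + W⁻¹))) := by
  have hW0 := ne_zero_of_norm_eq one_pos hW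
  have hV0 := ne_zero_of_norm_eq one_pos hV
  obtain ⟨n1, n2⟩ := unit_add_ne_zero h0 h1 hW hV
  have e : V⁻¹ + (h ^ 2) ^ 2 * V + h ^ 2 * (W + W⁻¹) =
      (W + h ^ 2 * V) * (1 + h ^ 2 * (W * V)) / (W * V) := by field_simp; ring
  rw [e, xKer, yKer]
  generalize W + h ^ 2 * V = a at *
  generalize 1 + h ^ 2 * (W * V) = b at *
  field_simp
  ring

theorem wKer_neg_flipFst (hε : ε ≠ 0) (v : FockSpace) {Z Z₂ W V : ℂ} (hZ : ‖Z‖ = 1) (hW : ‖W‖ = 1)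
    (hV : ‖V‖ = 1) : flipFst (fun W V => wKer h ε (-1) v Z Z₂ W V) W V =
      invKer h ε v Z Z₂ W V * (W⁻¹ - W) ^ 2 *
        flipM (h ^ 2) ((ε : ℂ) * Complex.I * h⁻¹) Z (W + W⁻¹) V := by
  have hW0 := ne_zero_of_norm_eq one_pos hW
  have hV0 := ne_zero_of_norm_eq one_pos hV
  obtain ⟨n1, n2, n3, n4⟩ := unit_ne_zero h0 h1 hZ hW
  obtain ⟨m1, m2, m3, m4⟩ := unit_ne_zero h0 h1 hZ hV
  have e := flip_neg_of_ne (e := (ε : ℂ) * Complex.I * h⁻¹) (V := V) hW0 n1 n2 n3 n4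
  have e2 : (ε : ℤ) ^ 2 = 1 := by cases ε <;> simp_all
  unfold flipFst
  dsimp only
  rw [wKer_neg_eq ε v hW0, wKer_neg_eq ε v (inv_ne_zero hW0), xKer_mul_yKer_inv hW0,
    aKer_inv hW0, shifted_inv_w₁, ← mul_add, e2]
  simp only [zpow_neg_one, inv_inv]
  rw [show nKer h W V Z * chi h ε W * W⁻¹ = ((1 - h ^ 2) * (W * V) - h ^ 2 * Z * W + Z * V) *
      ((1 - W ^ 2) * (1 + (ε : ℂ) * Complex.I * h⁻¹ * W)) * W⁻¹ from rfl,
    show nKer h W⁻¹ V Z * chi h ε W⁻¹ * W = ((1 - h ^ 2) * (W⁻¹ * V) - h ^ 2 * Z * W⁻¹ + Z * V) *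
      ((1 - W⁻¹ ^ 2) * (1 + (ε : ℂ) * Complex.I * h⁻¹ * W⁻¹)) * W from rfl, e,
    xKer_mul_yKer_eq h0 h1 hW hV, invKer, flipM, chi]
  generalize (ε : ℂ) * Complex.I * h⁻¹ = e
  generalize V⁻¹ + (h ^ 2) ^ 4 * V - (h ^ 2) ^ 2 * (W + W⁻¹) = num
  generalize V⁻¹ + (h ^ 2) ^ 2 * V + h ^ 2 * (W + W⁻¹) = den
  generalize flipBr (h ^ 2) e Z (W + W⁻¹) V = br
  generalize V + V⁻¹ - (W + W⁻¹) = dd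
  generalize shifted h ε v Z Z₂ W V = sh
  rw [show aKer h Z₂ V = (V - h ^ 2 * Z₂) * (1 - h ^ 2 * (Z₂ * V)) / V from rfl,
    show eKer (h ^ 2) Z V = (V - h ^ 2 * Z) * (Z - h ^ 2 * V) * (1 - h ^ 2 * (Z * V)) *
      (Z * V - h ^ 2) from rfl]
  generalize aKer h Z₂ W = aW
  generalize eKer (h ^ 2) Z W = eW
  generalize (V - h ^ 2 * Z₂) * (1 - h ^ 2 * (Z₂ * V)) = aV
  generalize V - h ^ 2 * Z = b1 at *
  generalize Z - h ^ 2 * V = b2 at *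
  generalize 1 - h ^ 2 * (Z * V) = b3 at *
  generalize Z * V - h ^ 2 = b4 at *
  have p1 : (1 - W ^ 2) ^ 2 = (W⁻¹ - W) ^ 2 * W ^ 2 := by field_simp
  have p2 : 1 - V ^ 2 = (V⁻¹ - V) * V := by field_simp
  rw [p1, p2]
  exact flip_identity_neg hW0 hV0 m4

theorem invKer_inv_snd (v : FockSpace) {Z Z₂ W V : ℂ} (hV : V ≠ 0) :
    invKer h ε v Z Z₂ W V⁻¹ = invKer h ε v Z Z₂ W V := by
  have : eKer (h ^ 2) Z V⁻¹ / V⁻¹ ^ 2 = eKer (h ^ 2) Z V / V ^ 2 := by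
    rw [eKer_inv_right hV]; field_simp
  rw [invKer, invKer, aKer_inv hV, shifted_inv_w₂, this, inv_inv, add_comm V⁻¹]

theorem invKer_swap (v : FockSpace) {Z Z₂ W V : ℂ} :
    invKer h ε v Z Z₂ V W = -invKer h ε v Z Z₂ W V := by
  rw [invKer, invKer, shifted_swap, mul_comm (aKer h Z₂ V),
    mul_comm (eKer (h ^ 2) Z V / V ^ 2), ← neg_sub (V + V⁻¹)]
  ring

/-- `invKer` is invariant under inversion of the second variable but changes sign under exchange, so
the final sum over the exchange turns into the antisymmetrization of `flipNum`. -/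
theorem wKer_neg_symm (hε : ε ≠ 0) (v : FockSpace) {Z Z₂ W V : ℂ} (hZ : ‖Z‖ = 1) (hW : ‖W‖ = 1)
    (hV : ‖V‖ = 1) : swapSum (flipSnd (flipFst fun W V => wKer h ε (-1) v Z Z₂ W V)) W V =
      invKer h ε v Z Z₂ W V * ((W⁻¹ - W) ^ 2 * (V⁻¹ - V) ^ 2 /
        flipDen (h ^ 2) (W + W⁻¹) (V + V⁻¹)) *
        (flipNum (h ^ 2) ((ε : ℂ) * Complex.I * h⁻¹) Z (W + W⁻¹) (V + V⁻¹) -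
          flipNum (h ^ 2) ((ε : ℂ) * Complex.I * h⁻¹) Z (V + V⁻¹) (W + W⁻¹)) := by
  have key : ∀ {W V : ℂ}, ‖W‖ = 1 → ‖V‖ = 1 →
      flipSnd (flipFst fun W V => wKer h ε (-1) v Z Z₂ W V) W V = invKer h ε v Z Z₂ W V *
        ((W⁻¹ - W) ^ 2 * (V⁻¹ - V) ^ 2 / flipDen (h ^ 2) (W + W⁻¹) (V + V⁻¹)) *
        flipNum (h ^ 2) ((ε : ℂ) * Complex.I * h⁻¹) Z (W + W⁻¹) (V + V⁻¹) := fun {W V} hW hV => by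
    have hW0 := ne_zero_of_norm_eq one_pos hW
    have hV0 := ne_zero_of_norm_eq one_pos hV
    have hVi : ‖V⁻¹‖ = 1 := by rw [norm_inv, hV, inv_one]
    have den : ∀ {V : ℂ}, ‖V‖ = 1 → V⁻¹ + (h ^ 2) ^ 2 * V + h ^ 2 * (W + W⁻¹) ≠ 0 := fun {V} hV => by
      have hV0 := ne_zero_of_norm_eq one_pos hV
      obtain ⟨n1, n2⟩ := unit_add_ne_zero h0 h1 hW hV
      have e : V⁻¹ + (h ^ 2) ^ 2 * V + h ^ 2 * (W + W⁻¹) =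
        (W + h ^ 2 * V) * (1 + h ^ 2 * (W * V)) / (W * V) := by field_simp; ring
      rw [e]
      exact div_ne_zero (mul_ne_zero n1 n2) (mul_ne_zero hW0 hV0)
    have d2 := den hVi
    rw [inv_inv] at d2
    unfold flipSnd
    rw [wKer_neg_flipFst h0 h1 hε v hZ hW hV, wKer_neg_flipFst h0 h1 hε v hZ hW hVi,
      invKer_inv_snd h0 h1 v hV0, ← mul_add, flipM_add hV0 (den hV) d2]
    ring
  unfold swapSum
  rw [key hW hV, key hV hW, invKer_swap h0 h1, show flipDen (h ^ 2) (V + V⁻¹) (W + W⁻¹) =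
    flipDen (h ^ 2) (W + W⁻¹) (V + V⁻¹) by unfold flipDen; ring]
  ring

theorem invKer_inv_fst (v : FockSpace) {Z Z₂ W V : ℂ} (hZ : Z ≠ 0) :
    invKer h ε v Z⁻¹ Z₂ W V = Z ^ 8 * invKer h ε v Z Z₂ W V := by
  rw [invKer, invKer, shifted_inv_z₁, eKer_inv_left hZ, eKer_inv_left hZ]
  simp only [div_eq_mul_inv, mul_inv, inv_inv]
  ring

theorem avg_wKer_neg_unit (R : Radii h (-1) 1 (‖h‖ ^ 6) r₁ r₂) (v : FockSpace) {Z₁ Z₂ : ℂ}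
    (hZ₁ : ‖Z₁‖ = 1) (hZ₂ : ‖Z₂‖ = ‖h‖ ^ 6) :
    ContinuousOn (Function.uncurry fun W₁ W₂ => wKer h ε (-1) v Z₁ Z₂ W₁ W₂)
      (sphere 0 1 ×ˢ sphere 0 1) ∧
    (avg r₁ fun W₁ => avg r₂ fun W₂ => wKer h ε (-1) v Z₁ Z₂ W₁ W₂) =
      avg 1 fun W₁ => avg 1 fun W₂ => wKer h ε (-1) v Z₁ Z₂ W₁ W₂ := by
  have hq1 := norm_sq_lt_one h0 h1
  have l8 := norm_pow_eight_lt h0 h1 R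
  have l81 : ‖h‖ ^ 8 < 1 := pow_lt_one₀ (norm_nonneg _) h1 (by norm_num)
  have r21 : r₂ < 1 := (R.r_lt.trans R.r₁_lt).trans h1
  have key : ∀ W₁ W₂, ‖W₁‖ = 1 → r₂ ≤ ‖W₂‖ → ‖W₂‖ ≤ 1 → DifferentiableAt ℂ
      (Function.uncurry fun W₁ W₂ => wKer h ε (-1) v Z₁ Z₂ W₁ W₂) (W₁, W₂) := by
    intro W₁ W₂ hW₁ hl hu
    have hx : W₁ + h ^ 2 * W₂ ≠ 0 := by
      rw [← sub_neg_eq_add]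
      refine sub_ne_zero_of_norm_lt ?_
      rw [norm_neg, norm_mul, norm_pow, hW₁]
      exact (mul_le_of_le_one_right (by positivity) hu).trans_lt hq1
    refine differentiableAt_wKer_pair ε (-1) v (regularAt_of_norm h0 h1 hZ₁ hZ₂
      (by rw [hW₁]; exact l81) hW₁.le (l8.trans_le hl) hu hx) ?_
    have sub : ∀ {x y : ℂ}, ‖h‖ ^ 2 * ‖y‖ < ‖x‖ → x - h ^ 2 * y ≠ 0 := fun {x y} hxy =>
      sub_ne_zero_of_norm_lt (by rwa [norm_mul, norm_pow])
    exact mul_ne_zero (sub (by rw [hZ₁, hW₁, mul_one]; exact hq1))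
      (sub (by rw [hZ₁]; exact (R.neg rfl).trans_le hl))
  refine ⟨fun x hx => ?_, ?_⟩
  · obtain ⟨a, b⟩ := hx
    rw [mem_sphere_zero_iff_norm] at a b
    exact (key x.1 x.2 a (by rw [b]; exact r21.le) b.le).continuousAt.continuousWithinAt
  · rw [(avg_wKer_move_fst h0 h1 (by decide) R v hZ₁ hZ₂).2]
    exact avg_move_snd R.r₂_pos r21.le zero_le_one key

/-- The exponent `6` is `8` from `invKer_inv_fst` minus `2` from `flipNum_inv`. -/
theorem avg_wKer_neg_inv_of_ne (hε : ε ≠ 0) (R : Radii h (-1) 1 (‖h‖ ^ 6) r₁ r₂) (v : FockSpace)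
    {Z₁ Z₂ : ℂ} (hZ₁ : ‖Z₁‖ = 1) (hZ₂ : ‖Z₂‖ = ‖h‖ ^ 6) :
    (avg r₁ fun W₁ => avg r₂ fun W₂ => wKer h ε (-1) v Z₁⁻¹ Z₂ W₁ W₂) =
      Z₁ ^ 6 * avg r₁ fun W₁ => avg r₂ fun W₂ => wKer h ε (-1) v Z₁ Z₂ W₁ W₂ := by
  have hZi : ‖Z₁⁻¹‖ = 1 := by rw [norm_inv, hZ₁, inv_one]
  have hz := ne_zero_of_norm_eq one_pos hZ₁
  have A := avg_wKer_neg_unit h0 h1 R (ε := ε) v hZi hZ₂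
  have B := avg_wKer_neg_unit h0 h1 R (ε := ε) v hZ₁ hZ₂
  rw [A.2, B.2]
  simp only [← avg_const_mul]
  refine avg_eq_of_symm A.1 (continuousOn_const.mul B.1) fun W V hW hV => ?_
  have e : swapSum (flipSnd (flipFst fun W V => Z₁ ^ 6 * wKer h ε (-1) v Z₁ Z₂ W V)) W V =
      Z₁ ^ 6 * swapSum (flipSnd (flipFst fun W V => wKer h ε (-1) v Z₁ Z₂ W V)) W V := by
    unfold swapSum flipSnd flipFst; ring
  rw [e, wKer_neg_symm h0 h1 hε v hZi hW hV, wKer_neg_symm h0 h1 hε v hZ₁ hW hV,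
    invKer_inv_fst h0 h1 v hz]
  obtain ⟨g, hg, e1, e2, -⟩ := exists_boundary_parameter h0 hε
  rw [e2, e1, flipNum_inv hg hz]
  field_simp

end

end IzerginKorepin

namespace IzerginKorepin
open Metric Set

/-! ### Reflection of the coefficients -/

/-- The factor `1 - εi q^{3/2} Z` for the component `0`, and `1` for the components `±`. -/
def cutoff (h : ℂ) (ε j : SignType) (Z : ℂ) : ℂ :=
  if j = 0 then 1 - (ε : ℂ) * Complex.I * h ^ 3 * Z else 1

/-- The degree of the reflection. -/
def reflDeg (ε j : SignType) : ℤ := if j = -1 then 0 else 2 * (ε : ℤ) ^ 2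

/-- The factor of the matrix element that carries its poles. -/
def poleFactor (h : ℂ) (ε j : SignType) (Z : ℂ) : ℂ := phi h ε (-Z) / cutoff h ε j Z

/-- The quotient of the two-point function by its pole factor. -/
def coreFun (h : ℂ) (ε j : SignType) (v : FockSpace) (r₁ r₂ : ℝ) (Z₁ Z₂ : ℂ) : ℂ :=
  cutoff h ε j Z₁ * (phi h ε (-Z₂) * (kappa h (Z₂ * Z₁) * kappa h (Z₂ / Z₁)) * (1 - h ^ 4) *
    (Z₁ ^ ((ε : ℤ) ^ 2 + 2) * Z₂ ^ ((ε : ℤ) ^ 2 + 1)) *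
      avg r₁ fun W₁ => avg r₂ fun W₂ => wKer h ε j v Z₁ Z₂ W₁ W₂)

theorem exists_taylor {F : ℂ → ℂ} {R : ℝ} (hR : 0 < R) (hF : DifferentiableOn ℂ F (ball 0 R)) :
    ∃ f : ℕ → ℂ, (∀ ρ, 0 < ρ → ρ < R → Summable fun i => ‖f i‖ * ρ ^ i) ∧
      ∀ z, ‖z‖ < R → HasSum (fun i => f i * z ^ i) (F z) := by
  have key : ∀ z : ℂ, ‖z‖ < R →
      HasSum (fun i => ((i.factorial : ℂ)⁻¹ * iteratedDeriv i F 0) * z ^ i) (F z) := fun z hz => by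
    have := Complex.hasSum_taylorSeries_on_ball (c := 0) (r := R.toNNReal) (f := F)
      (by rwa [Real.coe_toNNReal _ hR.le]) (z := z)
      (by rwa [Real.coe_toNNReal _ hR.le, mem_ball_zero_iff])
    refine this.congr_fun fun i => ?_
    simp only [sub_zero, smul_eq_mul]; ring
  refine ⟨_, fun ρ h0 h1 => ?_, key⟩
  have h2 := (key ρ (by rwa [Complex.norm_of_nonneg h0.le])).summable.norm
  refine h2.congr fun i => ?_
  rw [norm_mul _ ((ρ : ℂ) ^ i), norm_pow, Complex.norm_of_nonneg h0.le]

section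
variable {h : ℂ} (h0 : h ≠ 0) (h1 : ‖h‖ < 1) {ε j : SignType} {r₁ r₂ : ℝ}
include h0 h1

/-- The contractions at `Z₂ Z₁` and `Z₂ / Z₁` are exchanged by `Z₁ → 1/Z₁`, and `φ_ε(-Z₁)` has been
split off into `poleFactor`; what remains are the monomials and the three reflection formulas for
the integrals. -/
theorem coreFun_inv (R : Radii h j 1 (‖h‖ ^ 6) r₁ r₂) (v : FockSpace) {Z₁ Z₂ : ℂ}
    (hZ₁ : ‖Z₁‖ = 1) (hZ₂ : ‖Z₂‖ = ‖h‖ ^ 6) :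
    coreFun h ε j v r₁ r₂ Z₁⁻¹ Z₂ = Z₁ ^ (-reflDeg ε j) * coreFun h ε j v r₁ r₂ Z₁ Z₂ := by
  have hz := ne_zero_of_norm_eq one_pos hZ₁
  have key : (cutoff h ε j Z₁⁻¹ * avg r₁ fun W₁ => avg r₂ fun W₂ => wKer h ε j v Z₁⁻¹ Z₂ W₁ W₂) =
      Z₁ ^ (2 * (ε : ℤ) ^ 2 + 4 - reflDeg ε j) *
        (cutoff h ε j Z₁ * avg r₁ fun W₁ => avg r₂ fun W₂ => wKer h ε j v Z₁ Z₂ W₁ W₂) := by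
    have z4 : Z₁ ^ (2 * (ε : ℤ) ^ 2 + 4 - 2 * (ε : ℤ) ^ 2) = Z₁ ^ 4 := by
      rw [add_sub_cancel_left]; norm_cast
    cases j
    · have := avg_wKer_zero_inv h0 h1 R (ε := ε) v hZ₁ hZ₂
      rw [show cutoff h ε .zero Z₁⁻¹ = 1 - (ε : ℂ) * Complex.I * h ^ 3 * Z₁⁻¹ from rfl,
        show cutoff h ε .zero Z₁ = 1 - (ε : ℂ) * Complex.I * h ^ 3 * Z₁ from rfl,
        show reflDeg ε .zero = 2 * (ε : ℤ) ^ 2 from rfl, z4, ← mul_assoc]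
      exact this
    · rw [show ∀ Z, cutoff h ε .neg Z = 1 from fun _ => rfl, show cutoff h ε .neg Z₁ = 1 from rfl,
        show reflDeg ε .neg = 0 from rfl, one_mul, one_mul, sub_zero]
      by_cases hε : ε = 0
      · subst hε
        rw [SignType.coe_zero, show (2 * (0 : ℤ) ^ 2 + 4) = ((4 : ℕ) : ℤ) by norm_num, zpow_natCast]
        exact avg_wKer_neg_inv_of_zero h0 h1 R v hZ₁ hZ₂
      · have e2 : (ε : ℤ) ^ 2 = 1 := by cases ε <;> simp_all
        rw [e2, show (2 * (1 : ℤ) + 4) = ((6 : ℕ) : ℤ) by norm_num, zpow_natCast]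
        exact avg_wKer_neg_inv_of_ne h0 h1 hε R v hZ₁ hZ₂
    · rw [show ∀ Z, cutoff h ε .pos Z = 1 from fun _ => rfl, show cutoff h ε .pos Z₁ = 1 from rfl,
        show reflDeg ε .pos = 2 * (ε : ℤ) ^ 2 from rfl, one_mul, one_mul, z4]
      exact avg_wKer_pos_inv v hz Z₂ r₁ r₂
  have hpow : Z₁⁻¹ ^ ((ε : ℤ) ^ 2 + 2) * Z₁ ^ (2 * (ε : ℤ) ^ 2 + 4 - reflDeg ε j) =
      Z₁ ^ (-reflDeg ε j) * Z₁ ^ ((ε : ℤ) ^ 2 + 2) := by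
    rw [inv_zpow', ← zpow_add₀ hz, ← zpow_add₀ hz]; congr 1; ring
  rw [coreFun, coreFun, div_inv_eq_mul, ← div_eq_mul_inv, mul_comm (kappa h (Z₂ / Z₁))]
  generalize kappa h (Z₂ * Z₁) * kappa h (Z₂ / Z₁) = k at *
  linear_combination (phi h ε (-Z₂) * k * (1 - h ^ 4) *
    (Z₁⁻¹ ^ ((ε : ℤ) ^ 2 + 2) * Z₂ ^ ((ε : ℤ) ^ 2 + 1))) * key + (phi h ε (-Z₂) * k * (1 - h ^ 4) *
      Z₂ ^ ((ε : ℤ) ^ 2 + 1) * (cutoff h ε j Z₁ *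
        avg r₁ fun W₁ => avg r₂ fun W₂ => wKer h ε j v Z₁ Z₂ W₁ W₂)) * hpow

theorem phiNum_ne_zero {z : ℂ} (hz : ‖h ^ 7 * z‖ < 1) : phiNum h ε z ≠ 0 :=
  (expSum_phiNum h0 h1 ε hz).ne_zero

theorem phiDen_zero_ne_zero {z : ℂ} (hz : ‖h ^ 4 * z‖ < 1) : phiDen h 0 z ≠ 0 := by
  have p12 := norm_pow_pow_lt h0 h1 (k := 12) (by norm_num)
  have key : ∀ k : ℕ, 8 ≤ k → ‖h ^ k * z ^ 2‖ < 1 := fun k hk => by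
    refine norm_pow_mul_lt h1 hk ?_
    rw [show h ^ 8 * z ^ 2 = (h ^ 4 * z) ^ 2 by ring, norm_pow]
    exact pow_lt_one₀ (norm_nonneg _) hz two_ne_zero
  rw [phiDen, if_pos rfl, mul_one]
  refine mul_ne_zero (expSum_qPoch p12 ?_).ne_zero (expSum_qPoch p12 ?_).ne_zero
  · rw [← pow_mul]; exact key _ (by norm_num)
  · rw [neg_mul, norm_neg, ← pow_mul]; exact key _ (by norm_num)

theorem cutoff_ne_zero {Z : ℂ} (hZ : ‖h * Z‖ < 1) : cutoff h ε j Z ≠ 0 := by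
  unfold cutoff
  split_ifs
  · refine one_sub_ne_zero_of_norm_lt ?_
    have := norm_pow_mul_lt (k := 1) (l := 3) h1 (by norm_num) (u := Z) (by rwa [pow_one])
    rw [mul_assoc, norm_mul, norm_mul, Complex.norm_I, mul_one]
    refine (mul_le_of_le_one_left (norm_nonneg _) ?_).trans_lt this
    cases ε <;> simp
  · exact one_ne_zero

theorem differentiable_cutoff (ε j : SignType) : Differentiable ℂ (cutoff h ε j) := by
  unfold cutoff
  split_ifs <;> fun_prop

end

end IzerginKorepin

/-! ### Division by the pole factor, and the mode expansion on the larger domain. -/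

namespace IzerginKorepin
open Metric Set

theorem mul_lt_one_of_lt_inv {a b : ℝ} (ha : 0 < a) (hb : b < a⁻¹) : a * b < 1 := by
  have := mul_lt_mul_of_pos_left hb ha
  rwa [mul_inv_cancel₀ ha.ne'] at this

/-- The reflection of the sum of a double Laurent series. -/
theorem tsum_reflect {c : ℤ → ℤ → ℂ} {s : ℤ} (hc : ∀ k l, c (s - k) l = c k l) {a : ℂ}
    (ha : a ≠ 0) (b : ℂ) : ∑' p : ℤ × ℤ, c p.1 p.2 * (a⁻¹ ^ p.1 * b ^ p.2) =
      a ^ (-s) * ∑' p : ℤ × ℤ, c p.1 p.2 * (a ^ p.1 * b ^ p.2) := by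
  rw [← ((Equiv.subLeft s).prodCongr (Equiv.refl ℤ)).tsum_eq, ← tsum_mul_left]
  refine tsum_congr fun p => ?_
  simp only [Equiv.prodCongr_apply, Prod.map, Equiv.subLeft_apply, Equiv.refl_apply, hc]
  rw [inv_zpow', neg_sub, sub_eq_add_neg, zpow_add₀ ha]
  ring

theorem AbsAt.reflect {c : ℤ → ℤ → ℂ} {s : ℤ} (hc : ∀ k l, c (s - k) l = c k l) {ρ σ : ℝ}
    (hρ : 0 < ρ) (H : AbsAt c ρ⁻¹ σ) : AbsAt c ρ σ := by
  have := (((Equiv.subLeft s).prodCongr (Equiv.refl ℤ)).summable_iff.mpr H).mul_left (ρ ^ s)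
  refine this.congr fun p => ?_
  simp only [Function.comp, Equiv.prodCongr_apply, Prod.map, Equiv.subLeft_apply, Equiv.refl_apply,
    hc]
  rw [inv_zpow', neg_sub, sub_eq_add_neg, zpow_add₀ hρ.ne', zpow_neg]
  have : ρ ^ s ≠ 0 := zpow_ne_zero _ hρ.ne'
  field_simp

section
variable {h : ℂ} (h0 : h ≠ 0) (h1 : ‖h‖ < 1) {ε j : SignType} {r₁ r₂ : ℝ}
include h0 h1

theorem phi_neg_ne_zero {Z : ℂ} (hZ : ‖h * Z‖ < 1) : phi h ε (-Z) ≠ 0 := by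
  refine div_ne_zero (phiNum_ne_zero h0 h1 ?_) (phiDen_ne_zero h0 h1 ε (by rwa [mul_neg, norm_neg]))
  rw [mul_neg, norm_neg]
  exact norm_pow_mul_lt (k := 1) h1 (by norm_num) (by rwa [pow_one])

theorem twoPoint_eq (v : FockSpace) {Z₁ Z₂ : ℂ} (hZ₁ : ‖h * Z₁‖ < 1) :
    twoPoint h ε j v r₁ r₂ Z₁ Z₂ = poleFactor h ε j Z₁ * coreFun h ε j v r₁ r₂ Z₁ Z₂ := by
  have := cutoff_ne_zero h0 h1 (ε := ε) (j := j) hZ₁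
  rw [twoPoint, poleFactor, coreFun, preKer, div_mul_eq_mul_div, mul_left_comm (phi h ε (-Z₁)),
    mul_div_cancel_left₀ _ this]
  ring

/-- The radius of the disc on which the pole factor is holomorphic. -/
def poleRadius (h : ℂ) (ε : SignType) : ℝ := if ε = 0 then (‖h‖ ^ 4)⁻¹ else ‖h‖⁻¹

theorem one_lt_poleRadius : 1 < poleRadius h ε := by
  have hp : 0 < ‖h‖ := norm_pos_iff.mpr h0
  unfold poleRadius
  split_ifs
  · exact (one_lt_inv₀ (by positivity)).mpr (pow_lt_one₀ hp.le h1 (by norm_num))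
  · exact (one_lt_inv₀ hp).mpr h1

theorem differentiableOn_poleFactor :
    DifferentiableOn ℂ (poleFactor h ε j) (ball 0 (poleRadius h ε)) := by
  intro Z hZ
  rw [mem_ball_zero_iff] at hZ
  have hp : 0 < ‖h‖ := norm_pos_iff.mpr h0
  have hh : phiDen h ε (-Z) ≠ 0 ∧ cutoff h ε j Z ≠ 0 := by
    unfold poleRadius at hZ
    split_ifs at hZ with hε
    · subst hε
      refine ⟨phiDen_zero_ne_zero h0 h1 ?_, ?_⟩
      · rw [mul_neg, norm_neg, norm_mul, norm_pow]
        exact mul_lt_one_of_lt_inv (by positivity) hZ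
      · unfold cutoff; split_ifs <;> simp
    · have : ‖h * Z‖ < 1 := by
        rw [norm_mul]; exact mul_lt_one_of_lt_inv hp hZ
      exact ⟨phiDen_ne_zero h0 h1 ε (by rwa [mul_neg, norm_neg]), cutoff_ne_zero h0 h1 this⟩
  refine DifferentiableAt.differentiableWithinAt ?_
  unfold poleFactor
  exact DifferentiableAt.fun_div (DifferentiableAt.comp Z (differentiableAt_phi h0 h1 ε hh.1)
    differentiableAt_id.neg) (differentiable_cutoff h0 h1 ε j Z) hh.2

/-- The pole factor is also free of zeros in the disc of radius `1/|h|`, so dividing by it is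
multiplication by another power series. -/
theorem differentiableOn_poleFactor_inv :
    DifferentiableOn ℂ (fun Z => (poleFactor h ε j Z)⁻¹) (ball 0 ‖h‖⁻¹) := by
  intro Z hZ
  rw [mem_ball_zero_iff] at hZ
  have hp : 0 < ‖h‖ := norm_pos_iff.mpr h0
  have this : ‖h * Z‖ < 1 := by
    rw [norm_mul]; exact mul_lt_one_of_lt_inv hp hZ
  have d := phiDen_ne_zero h0 h1 ε (z := -Z) (by rwa [mul_neg, norm_neg])
  have c := cutoff_ne_zero h0 h1 (ε := ε) (j := j) this
  refine DifferentiableAt.differentiableWithinAt (DifferentiableAt.fun_inv ?_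
    (div_ne_zero (phi_neg_ne_zero h0 h1 this) c))
  unfold poleFactor
  exact DifferentiableAt.fun_div (DifferentiableAt.comp Z (differentiableAt_phi h0 h1 ε d)
    differentiableAt_id.neg) (differentiable_cutoff h0 h1 ε j Z) c

/-- The coefficients of the two-point function divided by its pole factor. -/
theorem exists_quotient (j : SignType) (v : FockSpace) : ∃ c : ℤ → ℤ → ℂ,
    (∀ ρ₁ ρ₂, ‖h‖ ^ 4 < ρ₁ → ‖h‖ * ρ₁ < 1 → 0 < ρ₂ → ρ₂ < ‖h‖ ^ 2 → AbsAt c ρ₁ ρ₂) ∧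
    (∀ k l, c (reflDeg ε j - k) l = c k l) ∧
    (∀ r₁ r₂ Z₁ Z₂, Radii h j 1 (‖h‖ ^ 6) r₁ r₂ → ‖Z₁‖ = 1 → ‖Z₂‖ = ‖h‖ ^ 6 →
      HasSum (fun p : ℤ × ℤ => c p.1 p.2 * (Z₁ ^ p.1 * Z₂ ^ p.2)) (coreFun h ε j v r₁ r₂ Z₁ Z₂)) ∧
    ∀ Z₁ Z₂, Z₁ ≠ 0 → ‖Z₁‖ < poleRadius h ε → AbsAt c ‖Z₁‖ ‖Z₂‖ →
      HasSum (fun p : ℤ × ℤ => modeCoeff h ε j v p.1 p.2 * (Z₁ ^ p.1 * Z₂ ^ p.2))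
        (poleFactor h ε j Z₁ * ∑' p : ℤ × ℤ, c p.1 p.2 * (Z₁ ^ p.1 * Z₂ ^ p.2)) := by
  have hp : 0 < ‖h‖ := norm_pos_iff.mpr h0
  have h6 : 0 < ‖h‖ ^ 6 := by positivity
  have h41 : ‖h‖ ^ 4 < 1 := pow_lt_one₀ hp.le h1 (by norm_num)
  have h62 : ‖h‖ ^ 6 < ‖h‖ ^ 2 := pow_lt_pow_right_of_lt_one₀ hp h1 (by norm_num)
  obtain ⟨g, hgs, hg⟩ := exists_taylor (inv_pos.mpr hp)
    (differentiableOn_poleFactor_inv h0 h1 (ε := ε) (j := j))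
  obtain ⟨f, hfs, hf⟩ := exists_taylor (zero_lt_one.trans (one_lt_poleRadius h0 h1 (ε := ε)))
    (differentiableOn_poleFactor h0 h1 (ε := ε) (j := j))
  have hmul : ∀ {ρ : ℝ}, ‖h‖ * ρ < 1 → ρ < ‖h‖⁻¹ := fun {ρ} hρ => by
    rw [← one_div, lt_div_iff₀ hp]; linarith
  set m := modeCoeff h ε j v with hm
  have absm : ∀ ρ₁ ρ₂, ‖h‖ ^ 4 < ρ₁ → ‖h‖ * ρ₁ < 1 → 0 < ρ₂ → ρ₂ < ‖h‖ ^ 2 → AbsAt m ρ₁ ρ₂ :=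
    fun ρ₁ ρ₂ a b c d => absAt_modeCoeff h0 h1 v a b c d
  have absc : ∀ ρ₁ ρ₂, ‖h‖ ^ 4 < ρ₁ → ‖h‖ * ρ₁ < 1 → 0 < ρ₂ → ρ₂ < ‖h‖ ^ 2 →
      AbsAt (conv g m) ρ₁ ρ₂ := fun ρ₁ ρ₂ a b c d => by
    have p1 : 0 < ρ₁ := (by positivity : 0 < ‖h‖ ^ 4).trans a
    exact (conv_spec p1 (hgs ρ₁ p1 (hmul b)) (absm ρ₁ ρ₂ a b c d)
      (Complex.norm_of_nonneg p1.le) (Complex.norm_of_nonneg c.le)).1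
  have absref := absc 1 (‖h‖ ^ 6) h41 (by rwa [mul_one]) h6 h62
  have sumref : ∀ r₁ r₂ Z₁ Z₂, Radii h j 1 (‖h‖ ^ 6) r₁ r₂ → ‖Z₁‖ = 1 → ‖Z₂‖ = ‖h‖ ^ 6 →
      HasSum (fun p : ℤ × ℤ => conv g m p.1 p.2 * (Z₁ ^ p.1 * Z₂ ^ p.2))
        (coreFun h ε j v r₁ r₂ Z₁ Z₂) := fun r₁ r₂ Z₁ Z₂ R hZ₁ hZ₂ => by
    have hn : ‖h * Z₁‖ < 1 := by rwa [norm_mul, hZ₁, mul_one]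
    have am := absm 1 (‖h‖ ^ 6) h41 (by rwa [mul_one]) h6 h62
    have := (conv_spec one_pos (hgs 1 one_pos (hmul (by rwa [mul_one]))) am hZ₁ hZ₂).2
    rw [(hg Z₁ (by rw [hZ₁]; exact hmul (by rwa [mul_one]))).tsum_eq,
      (hasSum_twoPoint h0 h1 R v am hZ₁ hZ₂).tsum_eq, twoPoint_eq h0 h1 v hn,
      inv_mul_cancel_left₀ (show poleFactor h ε j Z₁ ≠ 0 from
        div_ne_zero (phi_neg_ne_zero h0 h1 hn) (cutoff_ne_zero h0 h1 hn))] at this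
    exact this
  obtain ⟨r₁, r₂, R⟩ := exists_radii h0 h1 j h41 (by rwa [mul_one]) h6 h62
  -- Both coefficients are averages of `coreFun` over the torus with `|Z₁| = 1`; the substitution
  -- `Z₁ → 1/Z₁` in one of them and `coreFun_inv` identify the two.
  have refl : ∀ k l, conv g m (reflDeg ε j - k) l = conv g m k l := fun k l => by
    have hG : ∀ a b, ‖a‖ = 1 → ‖b‖ = ‖h‖ ^ 6 → HasSum
        (fun p : ℤ × ℤ => conv g m p.1 p.2 * (a ^ p.1 * b ^ p.2)) (coreFun h ε j v r₁ r₂ a b) :=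
      fun a b ha hb => sumref r₁ r₂ a b R ha hb
    rw [coeff_eq_avg one_pos h6 absref hG, coeff_eq_avg one_pos h6 absref hG,
      ← avg_inv (fun a => avg (‖h‖ ^ 6) fun b => a ^ (-(reflDeg ε j - k)) * b ^ (-l) *
        coreFun h ε j v r₁ r₂ a b)]
    refine avg_congr zero_le_one fun a ha => avg_congr h6.le fun b hb => ?_
    have ha0 := ne_zero_of_norm_eq one_pos ha
    rw [coreFun_inv h0 h1 R v ha hb, inv_zpow', neg_neg]
    have : a ^ (reflDeg ε j - k) * a ^ (-reflDeg ε j) = a ^ (-k) := by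
      rw [← zpow_add₀ ha0]; congr 1; ring
    linear_combination (b ^ (-l) * coreFun h ε j v r₁ r₂ a b) * this
  refine ⟨conv g m, absc, refl, sumref, fun Z₁ Z₂ hZ0 hZ habs => ?_⟩
  have hn0 : 0 < ‖Z₁‖ := norm_pos_iff.mpr hZ0
  -- Multiplying back by `poleFactor` gives series with the same sum on the reference torus, hence
  -- the same coefficients. The equality of coefficients then allows summation at radii where no
  -- integral representation is available.
  have hconv : conv f (conv g m) = m := by
    have hr := one_lt_poleRadius h0 h1 (ε := ε)
    have am := absm 1 (‖h‖ ^ 6) h41 (by rwa [mul_one]) h6 h62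
    have A : ∀ a b, ‖a‖ = 1 → ‖b‖ = ‖h‖ ^ 6 → HasSum
        (fun p : ℤ × ℤ => conv f (conv g m) p.1 p.2 * (a ^ p.1 * b ^ p.2))
        (twoPoint h ε j v r₁ r₂ a b) := fun a b ha hb => by
      have hn : ‖h * a‖ < 1 := by rwa [norm_mul, ha, mul_one]
      have := (conv_spec one_pos (hfs 1 one_pos hr) absref ha hb).2
      rwa [(hf a (by rwa [ha])).tsum_eq, (sumref r₁ r₂ a b R ha hb).tsum_eq,
        ← twoPoint_eq h0 h1 v hn] at this
    have absf := (conv_spec one_pos (hfs 1 one_pos hr) absref norm_one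
      (b := ((‖h‖ ^ 6 : ℝ) : ℂ)) (Complex.norm_of_nonneg h6.le)).1
    funext k l
    rw [coeff_eq_avg one_pos h6 absf A, coeff_eq_avg one_pos h6 am
      fun a b ha hb => hasSum_twoPoint h0 h1 R v am ha hb]
  have := (conv_spec hn0 (hfs _ hn0 hZ) habs rfl rfl).2
  rwa [hconv, (hf Z₁ hZ).tsum_eq] at this

end

end IzerginKorepin

namespace IzerginKorepin
open Metric Set

/-! ### Evaluation on the unit circle -/

section
variable {f g : ℂ → ℂ → ℂ} {r R σ : ℝ} {c : ℂ}

/-- The integrand `f` is required to be `g / (b - c)` only off the pole, because its value at `c` is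
a junk value of division by zero. -/
theorem avg_residue_snd (hr : 0 < r) (hc : r < ‖c‖) (hR : ‖c‖ < R) (hσ : 0 ≤ σ)
    (hd : ∀ a b, ‖a‖ = σ → r ≤ ‖b‖ → ‖b‖ ≤ R → DifferentiableAt ℂ (Function.uncurry g) (a, b))
    (hf : ∀ a b, ‖a‖ = σ → b ≠ c → r ≤ ‖b‖ → f a b = g a b / (b - c)) :
    avg σ (fun a => avg r fun b => f a b) =
      (avg σ fun a => avg R fun b => f a b) - (avg σ fun a => g a c) / c := by
  have hR0 : 0 < R := (hr.trans hc).trans hR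
  have ne : ∀ {b : ℂ}, ‖b‖ ≠ ‖c‖ → b ≠ c := fun hb h => hb (by rw [h])
  have ct : ∀ a b, ‖a‖ = σ → r ≤ ‖b‖ → ‖b‖ ≤ R → ContinuousAt (Function.uncurry g) (a, b) :=
    fun a b h1 h2 h3 => (hd a b h1 h2 h3).continuousAt
  have cg : ContinuousOn (fun a => g a c) (sphere 0 σ) := fun a ha =>
    (ContinuousAt.comp (f := fun a : ℂ => (a, c)) (g := Function.uncurry g)
      (ct a c (mem_sphere_zero_iff_norm.mp ha) hc.le hR.le) (by fun_prop)).continuousWithinAt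
  have cf : ContinuousOn (Function.uncurry fun a b => g a b / (b - c)) (sphere 0 σ ×ˢ sphere 0 R) :=
    fun x hx => by
      obtain ⟨h1, h2⟩ := hx
      rw [mem_sphere_zero_iff_norm] at h1 h2
      exact ((ct x.1 x.2 h1 (by rw [h2]; exact (hc.trans hR).le) h2.le).div
        (f := Function.uncurry g) (g := fun x : ℂ × ℂ => x.2 - c) (by fun_prop)
        (sub_ne_zero.mpr (ne (by rw [h2]; exact hR.ne')))).continuousWithinAt
  have e1 : avg σ (fun a => avg R fun b => f a b) = avg σ fun a => avg R fun b => g a b / (b - c) :=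
    avg_congr hσ fun a ha => avg_congr hR0.le fun b hb =>
      hf a b ha (ne (by rw [hb]; exact hR.ne')) (by rw [hb]; exact (hc.trans hR).le)
  rw [e1, div_eq_inv_mul, ← avg_const_mul, ← avg_sub hσ (continuousOn_avg (isCompact_sphere _ _)
    hR0.le cf) (g := fun a => c⁻¹ * g a c) (continuousOn_const.mul cg)]
  refine avg_congr hσ fun a ha => ?_
  rw [avg_congr hr.le fun b hb => hf a b ha (ne (by rw [hb]; exact hc.ne)) hb.ge,
    avg_residue (g := g a) hr hc hR fun b hb hb' => DifferentiableAt.comp b (f := fun b : ℂ => (a, b))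
      (g := Function.uncurry g) (hd a b ha hb hb') (by fun_prop), div_eq_inv_mul (g a c)]

theorem avg_residue_fst (hr : 0 < r) (hc : r < ‖c‖) (hR : ‖c‖ < R) (hσ : 0 ≤ σ)
    (hd : ∀ a b, ‖b‖ = σ → r ≤ ‖a‖ → ‖a‖ ≤ R → DifferentiableAt ℂ (Function.uncurry g) (a, b))
    (hf : ∀ a b, ‖b‖ = σ → a ≠ c → r ≤ ‖a‖ → f a b = g a b / (a - c)) :
    avg r (fun a => avg σ fun b => f a b) =
      (avg R fun a => avg σ fun b => f a b) - (avg σ fun b => g c b) / c := by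
  have ne : ∀ {b : ℂ}, ‖b‖ ≠ ‖c‖ → b ≠ c := fun hb h => hb (by rw [h])
  have sw : ∀ {t : ℝ}, r ≤ t → t ≤ R → t ≠ ‖c‖ →
      avg t (fun a => avg σ fun b => f a b) = avg σ fun b => avg t fun a => f a b :=
    fun {t} h1 h2 h3 => by
      have t0 : 0 ≤ t := hr.le.trans h1
      have e : ∀ a b, ‖a‖ = t → ‖b‖ = σ → f a b = g a b / (a - c) := fun a b ha hb =>
        hf a b hb (ne (by rwa [ha])) (by rwa [ha])
      rw [avg_congr t0 fun a ha => avg_congr hσ fun b hb => e a b ha hb, avg_swap t0 hσ fun x hx => ?_]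
      · exact avg_congr hσ fun b hb => avg_congr t0 fun a ha => (e a b ha hb).symm
      · obtain ⟨ha, hb⟩ := hx
        rw [mem_sphere_zero_iff_norm] at ha hb
        exact ((hd x.1 x.2 hb (by rwa [ha]) (by rwa [ha])).continuousAt.div
          (f := Function.uncurry g) (g := fun x : ℂ × ℂ => x.1 - c) (by fun_prop)
          (sub_ne_zero.mpr (ne (by rwa [ha])))).continuousWithinAt
  rw [sw le_rfl (hc.trans hR).le hc.ne, sw (hc.trans hR).le le_rfl hR.ne']
  exact avg_residue_snd (g := fun b a => g a b) hr hc hR hσ (fun b a h1 h2 h3 =>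
    DifferentiableAt.comp (b, a) (f := fun x : ℂ × ℂ => (x.2, x.1)) (g := Function.uncurry g)
      (hd a b h1 h2 h3) (by fun_prop)) fun b a h1 h2 h3 => hf a b h1 h2 h3

end

theorem sub_mul_eq (h Z a : ℂ) : -h ^ 6 * Z - h ^ 2 * a = -(h ^ 2 * (a + h ^ 4 * Z)) := by ring

theorem pKer_pos_eq (h Z a b : ℂ) : pKer h 1 Z (-h ^ 6 * Z) a b =
    h ^ 2 * nKer h a b (-h ^ 6 * Z) / (h ^ 2 * (a + h ^ 4 * Z) * (h ^ 2 * (b + h ^ 4 * Z))) := by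
  change h ^ 2 * nKer h a b (-h ^ 6 * Z) / ((-h ^ 6 * Z - h ^ 2 * a) * (-h ^ 6 * Z - h ^ 2 * b)) = _
  rw [sub_mul_eq, sub_mul_eq, neg_mul_neg]

theorem pKer_zero_eq (h Z a b : ℂ) : pKer h 0 Z (-h ^ 6 * Z) a b =
    -((1 - h ^ 4) * (a * b)) / ((a - h ^ 2 * Z) * (h ^ 2 * (b + h ^ 4 * Z))) := by
  change (1 - h ^ 4) * (a * b) / ((a - h ^ 2 * Z) * (-h ^ 6 * Z - h ^ 2 * b)) = _
  rw [sub_mul_eq, mul_neg, div_neg, neg_div]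

theorem pKer_neg_eq (h Z Z₂ a b : ℂ) : pKer h (-1) Z Z₂ a b =
    nKer h a b Z / ((a - h ^ 2 * Z) * (b - h ^ 2 * Z)) := rfl

/-- The integrands cancel after symmetrization in `W₁` and `W₂`. -/
theorem pKer_mul_xKer_symm {h Z a b : ℂ} (h0 : h ≠ 0) (ha : a - h ^ 2 * Z ≠ 0)
    (hb : b - h ^ 2 * Z ≠ 0) (ha' : a + h ^ 4 * Z ≠ 0) (hb' : b + h ^ 4 * Z ≠ 0)
    (hab : a + h ^ 2 * b ≠ 0) (hba : b + h ^ 2 * a ≠ 0) :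
    (pKer h (-1) Z (-h ^ 6 * Z) a b + pKer h 0 Z (-h ^ 6 * Z) a b +
        pKer h 1 Z (-h ^ 6 * Z) a b) * xKer h a b +
      (pKer h (-1) Z (-h ^ 6 * Z) b a + pKer h 0 Z (-h ^ 6 * Z) b a +
        pKer h 1 Z (-h ^ 6 * Z) b a) * xKer h b a = 0 := by
  simp only [pKer_pos_eq, pKer_zero_eq, pKer_neg_eq, xKer, nKer]
  field_simp
  ring

/-- On the first residue the kernel has a zero at `a = -q²Z`, which removes the pole of the
remaining integrand there, and a new pole at `a = qZ`, the source of the double residue. -/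
theorem xKer_residue {h Z a : ℂ} (h0 : h ≠ 0) (ha : a - h ^ 2 * Z ≠ 0) : xKer h (-h ^ 4 * Z) a =
    h ^ 2 * (Z + a) * (a + h ^ 4 * Z) / (a - h ^ 2 * Z) := by
  rw [xKer, show -h ^ 4 * Z + h ^ 2 * a = h ^ 2 * (a - h ^ 2 * Z) by ring]
  field_simp
  ring

/-- The single residues cancel. -/
theorem residue_cancel {h Z a : ℂ} (h0 : h ≠ 0) (ha : a - h ^ 2 * Z ≠ 0)
    (ha' : a + h ^ 4 * Z ≠ 0) (hx : a - h ^ 6 * Z ≠ 0) :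
    -((1 - h ^ 4) * (a * (-h ^ 4 * Z)) / ((a - h ^ 2 * Z) * h ^ 2)) * xKer h a (-h ^ 4 * Z) +
      nKer h a (-h ^ 4 * Z) (-h ^ 6 * Z) / (h ^ 2 * (a + h ^ 4 * Z)) * xKer h a (-h ^ 4 * Z) +
      nKer h (-h ^ 4 * Z) a (-h ^ 6 * Z) / (h ^ 2 * (a + h ^ 4 * Z)) * xKer h (-h ^ 4 * Z) a = 0 := by
  have e1 : xKer h a (-h ^ 4 * Z) = (a + h ^ 8 * Z) * (a + h ^ 4 * Z) / (a - h ^ 6 * Z) := by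
    rw [xKer]; ring
  rw [e1, xKer_residue h0 ha, nKer, nKer]
  field_simp
  ring

end IzerginKorepin

/-! ### Residues of the integrals at coinciding points. -/

namespace IzerginKorepin
open Metric Set

section
variable {h : ℂ} (h0 : h ≠ 0) (h1 : ‖h‖ < 1) {ε : SignType} {r₁ r₂ : ℝ}

theorem differentiableAt_xKer_mul_symKer (ε : SignType) (v : FockSpace) {Z₁ Z₂ W₁ W₂ : ℂ}
    (H : RegularAt h Z₁ Z₂ W₁ W₂) : DifferentiableAt ℂ
      (fun x : ℂ × ℂ => xKer h x.1 x.2 * symKer h ε v Z₁ Z₂ x.1 x.2) (W₁, W₂) := by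
  have d1 : DifferentiableAt ℂ (fun x : ℂ × ℂ => x.1) (W₁, W₂) := by fun_prop
  have d2 : DifferentiableAt ℂ (fun x : ℂ × ℂ => x.2) (W₁, W₂) := by fun_prop
  exact (differentiableAt_xKer d1 d2 H.xd).fun_mul
    (differentiableAt_symKer (z₁ := fun _ => Z₁) (z₂ := fun _ => Z₂) ε v
    (differentiableAt_const _) (differentiableAt_const _) d1 d2 H)

include h0 h1

theorem norm_h_pow {Z : ℂ} (hZ : ‖Z‖ = 1) (k : ℕ) : ‖-h ^ k * Z‖ = ‖h‖ ^ k := by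
  rw [norm_mul, norm_neg, norm_pow, hZ, mul_one]

theorem norm_pow_lt_pow {k l : ℕ} (hkl : l < k) : ‖h‖ ^ k < ‖h‖ ^ l :=
  pow_lt_pow_right_of_lt_one₀ (norm_pos_iff.mpr h0) h1 hkl

theorem add_mul_ne_zero {a b : ℂ} (hab : ‖h‖ ^ 2 * ‖b‖ < ‖a‖) : a + h ^ 2 * b ≠ 0 := by
  rw [← sub_neg_eq_add]
  exact sub_ne_zero_of_norm_lt (by rwa [norm_neg, norm_mul, norm_pow])

theorem continuousOn_wKer_unit (j : SignType) (v : FockSpace) {Z : ℂ} (hZ : ‖Z‖ = 1) :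
    ContinuousOn (Function.uncurry fun W₁ W₂ => wKer h ε j v Z (-h ^ 6 * Z) W₁ W₂)
      (sphere 0 1 ×ˢ sphere 0 1) := by
  rintro ⟨a, b⟩ ⟨ha, hb⟩
  rw [mem_sphere_zero_iff_norm] at ha hb
  have hq1 := norm_sq_lt_one h0 h1
  have l8 : ‖h‖ ^ 8 < 1 := pow_lt_one₀ (norm_nonneg _) h1 (by norm_num)
  refine (differentiableAt_wKer_pair ε j v (regularAt_of_norm h0 h1 hZ (norm_h_pow h0 h1 hZ 6)
    (by rwa [ha]) ha.le (by rwa [hb]) hb.le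
    (unit_add_ne_zero h0 h1 ha hb).1) ?_).continuousAt.continuousWithinAt
  have z : ∀ {W : ℂ}, ‖W‖ = 1 → -h ^ 6 * Z - h ^ 2 * W ≠ 0 := fun {W} hW => by
    rw [← neg_ne_zero, neg_sub]
    refine sub_ne_zero_of_norm_lt ?_
    rw [norm_h_pow h0 h1 hZ, norm_mul, norm_pow, hW, mul_one]
    exact norm_pow_lt_pow h0 h1 (by norm_num)
  have na := (unit_ne_zero h0 h1 hZ ha).1
  have nb := (unit_ne_zero h0 h1 hZ hb).1
  cases j
  · exact mul_ne_zero na (z hb)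
  · exact mul_ne_zero na nb
  · exact mul_ne_zero (z ha) (z hb)

/-- The contour of `W₂` in the component `0`. -/
theorem avg_wKer_zero_residue (R : Radii h 0 1 (‖h‖ ^ 6) r₁ r₂) (v : FockSpace) {Z : ℂ}
    (hZ : ‖Z‖ = 1) :
    (avg r₁ fun W₁ => avg r₂ fun W₂ => wKer h ε 0 v Z (-h ^ 6 * Z) W₁ W₂) =
      (avg 1 fun W₁ => avg 1 fun W₂ => wKer h ε 0 v Z (-h ^ 6 * Z) W₁ W₂) -
        (avg 1 fun a => -((1 - h ^ 4) * (a * (-h ^ 4 * Z)) / ((a - h ^ 2 * Z) * h ^ 2)) *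
          (xKer h a (-h ^ 4 * Z) * symKer h ε v Z (-h ^ 6 * Z) a (-h ^ 4 * Z))) / (-h ^ 4 * Z) := by
  have hZ₂ := norm_h_pow h0 h1 hZ 6
  have hp : 0 < ‖h‖ := norm_pos_iff.mpr h0
  have l8 := norm_pow_eight_lt h0 h1 R
  have l81 : ‖h‖ ^ 8 < 1 := pow_lt_one₀ (norm_nonneg _) h1 (by norm_num)
  have l41 : ‖h‖ ^ 4 < 1 := pow_lt_one₀ (norm_nonneg _) h1 (by norm_num)
  rw [(avg_wKer_move_fst h0 h1 (by decide) R v hZ hZ₂).2]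
  -- With `Z₂ = -q³Z` the factor `Z₂ - q W₂` vanishes at `W₂ = -q²Z`; the condition `Radii.zero`
  -- says precisely that the initial circle is smaller than this.
  refine avg_residue_snd (c := -h ^ 4 * Z) (g := fun a b =>
    -((1 - h ^ 4) * (a * b) / ((a - h ^ 2 * Z) * h ^ 2)) *
      (xKer h a b * symKer h ε v Z (-h ^ 6 * Z) a b))
    R.r₂_pos ?_ ?_ zero_le_one (fun a b ha hb hb' => ?_) (fun a b ha hb hb' => ?_)
  · rw [norm_h_pow h0 h1 hZ]
    have := (R.zero rfl).2
    rw [show ‖h‖ ^ 6 = ‖h‖ ^ 2 * ‖h‖ ^ 4 by ring] at this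
    exact lt_of_mul_lt_mul_left this (by positivity)
  · rwa [norm_h_pow h0 h1 hZ]
  · have H : RegularAt h Z (-h ^ 6 * Z) a b := regularAt_of_norm h0 h1 hZ hZ₂ (by rwa [ha]) ha.le
      (l8.trans_le hb) hb' (add_mul_ne_zero h0 h1 (by
        rw [ha]; exact (mul_le_of_le_one_right (by positivity) hb').trans_lt
          (norm_sq_lt_one h0 h1)))
    have na := mul_ne_zero (unit_ne_zero h0 h1 hZ ha).1 (pow_ne_zero 2 h0)
    exact (DifferentiableAt.fun_neg (differentiableAt_div (g := fun x : ℂ × ℂ =>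
      (x.1 - h ^ 2 * Z) * h ^ 2) (by fun_prop) (by fun_prop) na)).fun_mul
      (differentiableAt_xKer_mul_symKer ε v H)
  · rw [wKer, pKer_zero_eq, show b - -h ^ 4 * Z = b + h ^ 4 * Z by ring]
    have nb : b + h ^ 4 * Z ≠ 0 := fun e => hb (by linear_combination e)
    have na := (unit_ne_zero h0 h1 hZ ha).1
    generalize xKer h a b = x
    generalize symKer h ε v Z (-h ^ 6 * Z) a b = s
    field_simp

/-- The contours of `W₁` and `W₂` in the component `+`. -/
theorem avg_wKer_pos_residue (R : Radii h 1 1 (‖h‖ ^ 6) r₁ r₂) (v : FockSpace) {Z : ℂ}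
    (hZ : ‖Z‖ = 1) :
    (avg r₁ fun W₁ => avg r₂ fun W₂ => wKer h ε 1 v Z (-h ^ 6 * Z) W₁ W₂) =
      (avg 1 fun W₁ => avg 1 fun W₂ => wKer h ε 1 v Z (-h ^ 6 * Z) W₁ W₂) -
        (avg 1 fun a => nKer h a (-h ^ 4 * Z) (-h ^ 6 * Z) / (h ^ 2 * (a + h ^ 4 * Z)) *
          (xKer h a (-h ^ 4 * Z) * symKer h ε v Z (-h ^ 6 * Z) a (-h ^ 4 * Z))) / (-h ^ 4 * Z) -
        (avg r₂ fun a => nKer h (-h ^ 4 * Z) a (-h ^ 6 * Z) / (h ^ 2 * (a + h ^ 4 * Z)) *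
          (xKer h (-h ^ 4 * Z) a * symKer h ε v Z (-h ^ 6 * Z) (-h ^ 4 * Z) a)) / (-h ^ 4 * Z) := by
  have hZ₂ := norm_h_pow h0 h1 hZ 6
  have hc := norm_h_pow h0 h1 hZ 4
  have hp : 0 < ‖h‖ := norm_pos_iff.mpr h0
  have hq1 := norm_sq_lt_one h0 h1
  have l8 := norm_pow_eight_lt h0 h1 R
  have l81 : ‖h‖ ^ 8 < 1 := pow_lt_one₀ (norm_nonneg _) h1 (by norm_num)
  have l41 : ‖h‖ ^ 4 < 1 := pow_lt_one₀ (norm_nonneg _) h1 (by norm_num)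
  have r14 : r₁ < ‖h‖ ^ 4 := by
    have := R.pos rfl
    rw [show ‖h‖ ^ 6 = ‖h‖ ^ 2 * ‖h‖ ^ 4 by ring] at this
    exact lt_of_mul_lt_mul_left this (by positivity)
  have r24 := R.r_lt.trans r14
  have dn : ∀ (x : ℂ × ℂ), DifferentiableAt ℂ (fun x : ℂ × ℂ => nKer h x.1 x.2 (-h ^ 6 * Z)) x :=
    fun x => by unfold nKer; fun_prop
  have ne : ∀ {b : ℂ}, ‖b‖ ≠ ‖h‖ ^ 4 → b + h ^ 4 * Z ≠ 0 := fun {b} hb e =>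
    hb (by rw [← hc]; congr 1; linear_combination e)
  have ne' : ∀ {b : ℂ}, b ≠ -h ^ 4 * Z → b + h ^ 4 * Z ≠ 0 := fun {b} hb e =>
    hb (by linear_combination e)
  have q0 := pow_ne_zero 2 h0
  -- Both circles start inside `|W| = |q|²`. The outer variable is moved first, so that `W₁ + q W₂`
  -- never vanishes; `W₂` is then moved in the double integral, while the residue in `W₁` keeps `W₂`
  -- on the small circle for the moment.
  rw [avg_residue_fst (c := -h ^ 4 * Z) (R := 1) (g := fun a b =>
    nKer h a b (-h ^ 6 * Z) / (h ^ 2 * (b + h ^ 4 * Z)) *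
      (xKer h a b * symKer h ε v Z (-h ^ 6 * Z) a b))
    (R.r₂_pos.trans R.r_lt) (by rwa [hc]) (by rwa [hc]) R.r₂_pos.le (fun a b hb ha ha' => ?_)
    (fun a b hb ha ha' => ?_),
    avg_residue_snd (c := -h ^ 4 * Z) (R := 1) (g := fun a b =>
    nKer h a b (-h ^ 6 * Z) / (h ^ 2 * (a + h ^ 4 * Z)) *
      (xKer h a b * symKer h ε v Z (-h ^ 6 * Z) a b))
    R.r₂_pos (by rwa [hc]) (by rwa [hc]) zero_le_one (fun a b ha hb hb' => ?_)
    (fun a b ha hb hb' => ?_)]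
  · have H : RegularAt h Z (-h ^ 6 * Z) a b := regularAt_of_norm h0 h1 hZ hZ₂ (by rwa [ha]) ha.le
      (l8.trans_le hb) hb' (add_mul_ne_zero h0 h1 (by
        rw [ha]; exact (mul_le_of_le_one_right (by positivity) hb').trans_lt hq1))
    exact (differentiableAt_div (g := fun x : ℂ × ℂ => h ^ 2 * (x.1 + h ^ 4 * Z)) (dn _)
      (by fun_prop) (mul_ne_zero q0 (ne (by rw [ha]; exact l41.ne')))).fun_mul
      (differentiableAt_xKer_mul_symKer ε v H)
  · rw [wKer, pKer_pos_eq, show b - -h ^ 4 * Z = b + h ^ 4 * Z by ring]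
    have nb := ne' hb
    have na := ne (b := a) (by rw [ha]; exact l41.ne')
    generalize xKer h a b = x
    generalize symKer h ε v Z (-h ^ 6 * Z) a b = s
    generalize nKer h a b (-h ^ 6 * Z) = n
    field_simp
  · have H : RegularAt h Z (-h ^ 6 * Z) a b := regularAt_of_norm h0 h1 hZ hZ₂
      ((l8.trans R.r_lt).trans_le ha) ha' (by rwa [hb]) (by rw [hb]; exact (r24.trans l41).le)
      (add_mul_ne_zero h0 h1 (by
        rw [hb]; exact (mul_le_of_le_one_left R.r₂_pos.le hq1.le).trans_lt (R.r_lt.trans_le ha)))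
    exact (differentiableAt_div (g := fun x : ℂ × ℂ => h ^ 2 * (x.2 + h ^ 4 * Z)) (dn _)
      (by fun_prop) (mul_ne_zero q0 (ne (by rw [hb]; exact r24.ne)))).fun_mul
      (differentiableAt_xKer_mul_symKer ε v H)
  · rw [wKer, pKer_pos_eq, show a - -h ^ 4 * Z = a + h ^ 4 * Z by ring]
    have na := ne' ha
    have nb := ne (b := b) (by rw [hb]; exact r24.ne)
    generalize xKer h a b = x
    generalize symKer h ε v Z (-h ^ 6 * Z) a b = s
    generalize nKer h a b (-h ^ 6 * Z) = n
    field_simp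

/-- The double residue. -/
theorem avg_double_residue (v : FockSpace) {Z : ℂ} (hZ : ‖Z‖ = 1) (l : ‖h‖ ^ 8 < r₂)
    (u : r₂ < ‖h‖ ^ 4) :
    (avg r₂ fun a => nKer h (-h ^ 4 * Z) a (-h ^ 6 * Z) / (h ^ 2 * (a + h ^ 4 * Z)) *
        (xKer h (-h ^ 4 * Z) a * symKer h ε v Z (-h ^ 6 * Z) (-h ^ 4 * Z) a)) =
      (avg 1 fun a => nKer h (-h ^ 4 * Z) a (-h ^ 6 * Z) / (h ^ 2 * (a + h ^ 4 * Z)) *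
        (xKer h (-h ^ 4 * Z) a * symKer h ε v Z (-h ^ 6 * Z) (-h ^ 4 * Z) a)) +
      h ^ 4 * (1 + h ^ 2) * (1 + h ^ 6) * Z ^ 2 *
        symKer h ε v Z (-h ^ 6 * Z) (-h ^ 4 * Z) (h ^ 2 * Z) := by
  have hZ₂ := norm_h_pow h0 h1 hZ 6
  have hc := norm_h_pow h0 h1 hZ 4
  have hd : ‖h ^ 2 * Z‖ = ‖h‖ ^ 2 := by rw [norm_mul, norm_pow, hZ, mul_one]
  have hp : 0 < ‖h‖ := norm_pos_iff.mpr h0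
  have hq1 := norm_sq_lt_one h0 h1
  have l41 : ‖h‖ ^ 4 < 1 := pow_lt_one₀ (norm_nonneg _) h1 (by norm_num)
  have l84 : ‖h‖ ^ 8 < ‖h‖ ^ 4 := norm_pow_lt_pow h0 h1 (by norm_num)
  have u2 : r₂ < ‖h‖ ^ 2 := u.trans (norm_pow_lt_pow h0 h1 (by norm_num))
  have hr : 0 < r₂ := (by positivity : 0 < ‖h‖ ^ 8).trans l
  have z0 := ne_zero_of_norm_eq one_pos hZ
  have key : ∀ a : ℂ, ‖a‖ ≠ ‖h‖ ^ 4 → ‖a‖ ≠ ‖h‖ ^ 2 →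
      nKer h (-h ^ 4 * Z) a (-h ^ 6 * Z) / (h ^ 2 * (a + h ^ 4 * Z)) *
        (xKer h (-h ^ 4 * Z) a * symKer h ε v Z (-h ^ 6 * Z) (-h ^ 4 * Z) a) =
      -(h ^ 4 * Z * (Z + a) * (a + h ^ 8 * Z)) *
        symKer h ε v Z (-h ^ 6 * Z) (-h ^ 4 * Z) a / (a - h ^ 2 * Z) := fun a n4 n2 => by
    have na : a + h ^ 4 * Z ≠ 0 := fun e => n4 (by rw [← hc]; congr 1; linear_combination e)
    have nd : a - h ^ 2 * Z ≠ 0 := fun e => n2 (by rw [← hd]; congr 1; linear_combination e)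
    rw [xKer_residue h0 nd, nKer]
    generalize symKer h ε v Z (-h ^ 6 * Z) (-h ^ 4 * Z) a = s
    field_simp
    ring
  rw [avg_congr hr.le fun a ha => key a (by rw [ha]; exact u.ne) (by rw [ha]; exact u2.ne),
    avg_congr zero_le_one fun a ha => key a (by rw [ha]; exact l41.ne') (by rw [ha]; exact hq1.ne'),
    avg_residue (R := 1) (g := fun a => -(h ^ 4 * Z * (Z + a) * (a + h ^ 8 * Z)) *
        symKer h ε v Z (-h ^ 6 * Z) (-h ^ 4 * Z) a) hr (by rwa [hd]) (by rwa [hd])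
      fun a ha ha' => ?_]
  · generalize symKer h ε v Z (-h ^ 6 * Z) (-h ^ 4 * Z) (h ^ 2 * Z) = s
    rw [sub_eq_add_neg]
    congr 1
    field_simp
  · refine DifferentiableAt.fun_mul (by fun_prop) ?_
    have da : DifferentiableAt ℂ (fun a : ℂ => a) a := by fun_prop
    -- `symKer` itself has no pole where `W₁ + q W₂ = 0`, but `RegularAt` excludes such points. At
    -- `a = qZ` the symmetry of `symKer` is used to exchange the arguments, after which the sum is
    -- nonzero.
    by_cases e : -h ^ 4 * Z + h ^ 2 * a = 0
    · have e' : a = h ^ 2 * Z := by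
        have : h ^ 2 * (a - h ^ 2 * Z) = 0 := by linear_combination e
        exact sub_eq_zero.mp ((mul_eq_zero.mp this).resolve_left (pow_ne_zero 2 h0))
      have na : ‖a‖ = ‖h‖ ^ 2 := by rw [e', hd]
      rw [show symKer h ε v Z (-h ^ 6 * Z) (-h ^ 4 * Z) = fun a =>
        symKer h ε v Z (-h ^ 6 * Z) a (-h ^ 4 * Z) from funext fun a => symKer_swap h ε v Z _ a _]
      exact differentiableAt_symKer (z₁ := fun _ => Z) (z₂ := fun _ => -h ^ 6 * Z)
        (w₂ := fun _ => -h ^ 4 * Z) ε v (differentiableAt_const _) (differentiableAt_const _) da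
        (differentiableAt_const _) (regularAt_of_norm h0 h1 hZ hZ₂ (l.trans_le ha) ha'
          (by rwa [hc]) (by rw [hc]; exact l41.le) (add_mul_ne_zero h0 h1 (by
            rw [na, hc]; exact mul_lt_of_lt_one_right (by positivity) l41)))
    · exact differentiableAt_symKer (z₁ := fun _ => Z) (z₂ := fun _ => -h ^ 6 * Z)
        (w₁ := fun _ => -h ^ 4 * Z) ε v (differentiableAt_const _) (differentiableAt_const _)
        (differentiableAt_const _) da (regularAt_of_norm h0 h1 hZ hZ₂
          (by rwa [hc]) (by rw [hc]; exact l41.le) (l.trans_le ha) ha' e)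

end

end IzerginKorepin

/-! ### The sum over the components on the unit circle. -/

namespace IzerginKorepin
open Metric Set

theorem sum_signType (f : SignType → ℂ) : ∑ j, f j = f (-1) + f 0 + f 1 := by
  rw [show (Finset.univ : Finset SignType) = {-1, 0, 1} by decide,
    Finset.sum_insert (by decide), Finset.sum_insert (by decide), Finset.sum_singleton, add_assoc]

section
variable {h : ℂ} (h0 : h ≠ 0) (h1 : ‖h‖ < 1) {ε : SignType}
include h0 h1

/-- `symKer` is symmetric in the two currents, so the sum over their exchange vanishes pointwise by
`pKer_mul_xKer_symm`. -/
theorem avg_wKer_unit_sum (v : FockSpace) {Z : ℂ} (hZ : ‖Z‖ = 1) :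
    (avg 1 fun a => avg 1 fun b => wKer h ε (-1) v Z (-h ^ 6 * Z) a b) +
      (avg 1 fun a => avg 1 fun b => wKer h ε 0 v Z (-h ^ 6 * Z) a b) +
      (avg 1 fun a => avg 1 fun b => wKer h ε 1 v Z (-h ^ 6 * Z) a b) = 0 := by
  have c := fun j => continuousOn_wKer_unit h0 h1 (ε := ε) j v hZ
  have c2 : ContinuousOn (Function.uncurry fun a b => wKer h ε (-1) v Z (-h ^ 6 * Z) a b +
    wKer h ε 0 v Z (-h ^ 6 * Z) a b) (sphere 0 1 ×ˢ sphere 0 1) := (c (-1)).add (c 0)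
  have c3 : ContinuousOn (Function.uncurry fun a b => wKer h ε (-1) v Z (-h ^ 6 * Z) a b +
    wKer h ε 0 v Z (-h ^ 6 * Z) a b + wKer h ε 1 v Z (-h ^ 6 * Z) a b)
    (sphere 0 1 ×ˢ sphere 0 1) := c2.add (c 1)
  rw [← avg_add_two zero_le_one zero_le_one (c (-1)) (c 0),
    ← avg_add_two zero_le_one zero_le_one c2 (c 1)]
  have := avg_swapSum c3
  refine (mul_eq_zero.mp (this.symm.trans ?_)).resolve_left two_ne_zero
  rw [avg_congr zero_le_one (g := fun _ => 0) fun a ha => ?_, avg_const]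
  rw [avg_congr zero_le_one (g := fun _ => 0) fun b hb => ?_, avg_const]
  have hc := norm_h_pow h0 h1 hZ 4
  have l41 : ‖h‖ ^ 4 < 1 := pow_lt_one₀ (norm_nonneg _) h1 (by norm_num)
  have ne : ∀ {b : ℂ}, ‖b‖ = 1 → b + h ^ 4 * Z ≠ 0 := fun {b} hb e =>
    l41.ne' (by rw [← hc, ← hb]; congr 1; linear_combination e)
  have := pKer_mul_xKer_symm h0 (unit_ne_zero h0 h1 hZ ha).1 (unit_ne_zero h0 h1 hZ hb).1 (ne ha)
    (ne hb) (unit_add_ne_zero h0 h1 ha hb).1 (unit_add_ne_zero h0 h1 hb ha).1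
  simp only [swapSum, wKer]
  rw [symKer_swap h ε v Z _ a b]
  linear_combination symKer h ε v Z (-h ^ 6 * Z) a b * this

theorem avg_single_residue_sum (v : FockSpace) {Z : ℂ} (hZ : ‖Z‖ = 1) :
    (avg 1 fun a => -((1 - h ^ 4) * (a * (-h ^ 4 * Z)) / ((a - h ^ 2 * Z) * h ^ 2)) *
        (xKer h a (-h ^ 4 * Z) * symKer h ε v Z (-h ^ 6 * Z) a (-h ^ 4 * Z))) +
      (avg 1 fun a => nKer h a (-h ^ 4 * Z) (-h ^ 6 * Z) / (h ^ 2 * (a + h ^ 4 * Z)) *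
        (xKer h a (-h ^ 4 * Z) * symKer h ε v Z (-h ^ 6 * Z) a (-h ^ 4 * Z))) +
      (avg 1 fun a => nKer h (-h ^ 4 * Z) a (-h ^ 6 * Z) / (h ^ 2 * (a + h ^ 4 * Z)) *
        (xKer h (-h ^ 4 * Z) a * symKer h ε v Z (-h ^ 6 * Z) (-h ^ 4 * Z) a)) = 0 := by
  have hZ₂ := norm_h_pow h0 h1 hZ 6
  have hc := norm_h_pow h0 h1 hZ 4
  have hq1 := norm_sq_lt_one h0 h1
  have q0 := pow_ne_zero 2 h0
  have l41 : ‖h‖ ^ 4 < 1 := pow_lt_one₀ (norm_nonneg _) h1 (by norm_num)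
  have l61 : ‖h‖ ^ 6 < 1 := pow_lt_one₀ (norm_nonneg _) h1 (by norm_num)
  have l81 : ‖h‖ ^ 8 < 1 := pow_lt_one₀ (norm_nonneg _) h1 (by norm_num)
  have l84 : ‖h‖ ^ 8 < ‖h‖ ^ 4 := norm_pow_lt_pow h0 h1 (by norm_num)
  have ne : ∀ {b : ℂ}, ‖b‖ = 1 → b + h ^ 4 * Z ≠ 0 := fun {b} hb e =>
    l41.ne' (by rw [← hc, ← hb]; congr 1; linear_combination e)
  have ne6 : ∀ {b : ℂ}, ‖b‖ = 1 → b - h ^ 6 * Z ≠ 0 := fun {b} hb => sub_ne_zero_of_norm_lt (by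
    rw [hb, norm_mul, norm_pow, hZ, mul_one]; exact l61)
  have cK : ContinuousOn (fun a => xKer h a (-h ^ 4 * Z) *
      symKer h ε v Z (-h ^ 6 * Z) a (-h ^ 4 * Z)) (sphere 0 1) := fun a ha => by
    rw [mem_sphere_zero_iff_norm] at ha
    have H : RegularAt h Z (-h ^ 6 * Z) a (-h ^ 4 * Z) := regularAt_of_norm h0 h1 hZ hZ₂
      (by rwa [ha]) ha.le (by rwa [hc]) (by rw [hc]; exact l41.le) (by
        have := ne6 ha
        rwa [show a + h ^ 2 * (-h ^ 4 * Z) = a - h ^ 6 * Z by ring])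
    exact (ContinuousAt.comp (f := fun a : ℂ => (a, -h ^ 4 * Z))
      (g := fun x : ℂ × ℂ => xKer h x.1 x.2 * symKer h ε v Z (-h ^ 6 * Z) x.1 x.2)
      (differentiableAt_xKer_mul_symKer ε v H).continuousAt (by fun_prop)).continuousWithinAt
  have c1 : ContinuousOn (fun a => -((1 - h ^ 4) * (a * (-h ^ 4 * Z)) / ((a - h ^ 2 * Z) * h ^ 2)) *
        (xKer h a (-h ^ 4 * Z) * symKer h ε v Z (-h ^ 6 * Z) a (-h ^ 4 * Z))) (sphere 0 1) :=
    (ContinuousOn.div (by fun_prop) (by fun_prop) fun a ha => mul_ne_zero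
      (unit_ne_zero h0 h1 hZ (mem_sphere_zero_iff_norm.mp ha)).1 q0).neg.mul cK
  have c2 : ContinuousOn (fun a => nKer h a (-h ^ 4 * Z) (-h ^ 6 * Z) / (h ^ 2 * (a + h ^ 4 * Z)) *
        (xKer h a (-h ^ 4 * Z) * symKer h ε v Z (-h ^ 6 * Z) a (-h ^ 4 * Z))) (sphere 0 1) :=
    (ContinuousOn.div (by unfold nKer; fun_prop) (by fun_prop) fun a ha => mul_ne_zero q0
      (ne (mem_sphere_zero_iff_norm.mp ha))).mul cK
  have e : ∀ a, ‖a‖ = 1 → nKer h (-h ^ 4 * Z) a (-h ^ 6 * Z) / (h ^ 2 * (a + h ^ 4 * Z)) *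
      (xKer h (-h ^ 4 * Z) a * symKer h ε v Z (-h ^ 6 * Z) (-h ^ 4 * Z) a) =
      (-1) * (-((1 - h ^ 4) * (a * (-h ^ 4 * Z)) / ((a - h ^ 2 * Z) * h ^ 2)) *
        (xKer h a (-h ^ 4 * Z) * symKer h ε v Z (-h ^ 6 * Z) a (-h ^ 4 * Z)) +
      nKer h a (-h ^ 4 * Z) (-h ^ 6 * Z) / (h ^ 2 * (a + h ^ 4 * Z)) *
        (xKer h a (-h ^ 4 * Z) * symKer h ε v Z (-h ^ 6 * Z) a (-h ^ 4 * Z))) := fun a ha => by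
    have := residue_cancel h0 (unit_ne_zero h0 h1 hZ ha).1 (ne ha) (ne6 ha)
    rw [symKer_swap h ε v Z _ a]
    linear_combination symKer h ε v Z (-h ^ 6 * Z) a (-h ^ 4 * Z) * this
  rw [avg_congr zero_le_one e, avg_const_mul, avg_add zero_le_one c1 c2]
  ring

/-- The sum over the components of the integrals is a single double residue. -/
theorem sum_avg_wKer {r₁ r₂ : SignType → ℝ} (R : ∀ j, Radii h j 1 (‖h‖ ^ 6) (r₁ j) (r₂ j))
    (v : FockSpace) {Z : ℂ} (hZ : ‖Z‖ = 1) :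
    (∑ j, avg (r₁ j) fun a => avg (r₂ j) fun b => wKer h ε j v Z (-h ^ 6 * Z) a b) =
      (1 + h ^ 2) * (1 + h ^ 6) * Z *
        symKer h ε v Z (-h ^ 6 * Z) (-h ^ 4 * Z) (h ^ 2 * Z) := by
  have z0 := ne_zero_of_norm_eq one_pos hZ
  have r14 : r₂ 1 < ‖h‖ ^ 4 := by
    have := (R 1).pos rfl
    rw [show ‖h‖ ^ 6 = ‖h‖ ^ 2 * ‖h‖ ^ 4 by ring] at this
    exact (R 1).r_lt.trans (lt_of_mul_lt_mul_left this (by positivity))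
  have A := avg_wKer_unit_sum h0 h1 (ε := ε) v hZ
  have B := avg_single_residue_sum h0 h1 (ε := ε) v hZ
  rw [sum_signType, avg_wKer_zero_residue h0 h1 (R 0) v hZ, avg_wKer_pos_residue h0 h1 (R 1) v hZ,
    avg_double_residue h0 h1 v hZ (norm_pow_eight_lt h0 h1 (R 1)) r14,
    (avg_wKer_neg_unit h0 h1 (R (-1)) v hZ (norm_h_pow h0 h1 hZ 6)).2]
  have e : (-h ^ 4 * Z)⁻¹ * (h ^ 4 * Z) = -1 := by field_simp
  linear_combination A - (-h ^ 4 * Z)⁻¹ * B - (1 + h ^ 2) * (1 + h ^ 6) * Z *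
    symKer h ε v Z (-h ^ 6 * Z) (-h ^ 4 * Z) (h ^ 2 * Z) * e

/-- At the double residue the four shifts cancel. -/
theorem shifted_residue (v : FockSpace) {Z : ℂ} (hZ : Z ≠ 0) :
    shifted h ε v Z (-h ^ 6 * Z) (-h ^ 4 * Z) (h ^ 2 * Z) = dualGroundState h ε v := by
  rw [shifted, dualGroundState_eq]
  congr 2
  funext m
  -- With `x = h^m` and `u = (-1)^m` the cancellation is `(x² + x⁻² - u)(u x⁴ + x²) = 1 + u x⁶`,
  -- where `u² = 1`, together with its counterpart for inverse powers.
  simp only [Pi.add_apply, shift, phiD, xD, cInt_eq h0 h1, cRatio]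
  have hm := pow_ne_zero m h0
  have zm := pow_ne_zero m hZ
  have sm : ((-1 : ℂ) ^ m) ^ 2 = 1 := by rw [← pow_mul, mul_comm, pow_mul, neg_one_sq, one_pow]
  have e6 : (-h ^ 6 * Z) ^ m = (-1) ^ m * (h ^ m) ^ 6 * Z ^ m := by
    rw [neg_mul, neg_pow, mul_pow]; ring
  have e4 : (-h ^ 4 * Z) ^ m = (-1) ^ m * (h ^ m) ^ 4 * Z ^ m := by
    rw [neg_mul, neg_pow, mul_pow]; ring
  have e2 : (h ^ 2 * Z) ^ m = (h ^ m) ^ 2 * Z ^ m := by rw [mul_pow]; ring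
  simp only [inv_pow]
  rw [e6, e4, e2, ← pow_mul h 2 m, mul_comm 2 m, pow_mul h m 2, mul_inv ((-1 : ℂ) ^ m * _),
    mul_inv ((-1 : ℂ) ^ m), mul_inv ((-1 : ℂ) ^ m * (h ^ m) ^ 4), mul_inv ((-1 : ℂ) ^ m),
    mul_inv ((h ^ m) ^ 2), inv_eq_of_mul_eq_one_left ((sq _).symm.trans sm)]
  generalize h ^ m = x at *
  generalize Z ^ m = y at *
  generalize (-1 : ℂ) ^ m = u at *
  generalize qInt h m = Q
  simp only [div_eq_mul_inv]
  generalize (m : ℂ)⁻¹ = n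
  field_simp
  linear_combination -(x ^ 2 * Q * n + x ^ 10 * y ^ 2 * Q * n) * sm

/-- At the double residue `yKer`, the quadratic parts of `χ` and the denominators nearly cancel; the
linear parts of `χ` remain and are exactly those in `phi_mul_phi` at `-Z`. -/
theorem symKer_residue (v : FockSpace) {Z : ℂ} (hZ : ‖Z‖ = 1) :
    symKer h ε v Z (-h ^ 6 * Z) (-h ^ 4 * Z) (h ^ 2 * Z) *
        (h ^ 6 * Z ^ 4 * ((1 + h ^ 6) ^ 2 * (1 - h ^ 4) ^ 2 * (1 - h ^ 12 * Z ^ 2))) =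
      -((1 - (ε : ℂ) * Complex.I * h ^ 3 * Z) * (1 + (ε : ℂ) * Complex.I * h * Z)) *
        (-h ^ 6 * Z ^ 2) ^ (-(ε : ℤ) ^ 2) * dualGroundState h ε v := by
  have z0 := ne_zero_of_norm_eq one_pos hZ
  have one : ∀ {k : ℕ}, k ≠ 0 → 1 - h ^ k * Z ^ 2 ≠ 0 := fun {k} hk =>
    one_sub_ne_zero_of_norm_lt (by
      rw [norm_mul, norm_pow, norm_pow, hZ, one_pow, mul_one]
      exact pow_lt_one₀ (norm_nonneg _) h1 hk)
  have one' : ∀ {k : ℕ}, k ≠ 0 → 1 + h ^ k * Z ^ 2 ≠ 0 := fun {k} hk =>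
    one_add_ne_zero_of_norm_lt (by
      rw [norm_mul, norm_pow, norm_pow, hZ, one_pow, mul_one]
      exact pow_lt_one₀ (norm_nonneg _) h1 hk)
  have k4 : 1 - h ^ 4 ≠ 0 := one_sub_ne_zero_of_norm_lt (by
    rw [norm_pow]; exact pow_lt_one₀ (norm_nonneg _) h1 (by norm_num))
  have k6 : 1 + h ^ 6 ≠ 0 := one_add_ne_zero_of_norm_lt (by
    rw [norm_pow]; exact pow_lt_one₀ (norm_nonneg _) h1 (by norm_num))
  rw [symKer, shifted_residue h0 h1 v z0]
  generalize dualGroundState h ε v = B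
  rw [show -h ^ 4 * Z * (h ^ 2 * Z) = -h ^ 6 * Z ^ 2 by ring]
  generalize (-h ^ 6 * Z ^ 2) ^ (-(ε : ℤ) ^ 2) = P
  have eY : yKer h (-h ^ 4 * Z) (h ^ 2 * Z) =
      (1 + h ^ 6 * Z ^ 2) * (1 + h ^ 10 * Z ^ 2) / (1 - h ^ 8 * Z ^ 2) := by rw [yKer]; ring
  have eC : chi h ε (-h ^ 4 * Z) * chi h ε (h ^ 2 * Z) = (1 - h ^ 8 * Z ^ 2) * (1 - h ^ 4 * Z ^ 2) *
      ((1 - (ε : ℂ) * Complex.I * h ^ 3 * Z) * (1 + (ε : ℂ) * Complex.I * h * Z)) := by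
    rw [chi, chi]; field_simp; ring
  have eD : (Z - h ^ 2 * (-h ^ 4 * Z)) * (Z - h ^ 2 * (h ^ 2 * Z)) *
      ((-h ^ 4 * Z - h ^ 2 * (-h ^ 6 * Z)) * (h ^ 2 * Z - h ^ 2 * (-h ^ 6 * Z))) *
      ((1 - h ^ 2 * (Z * (-h ^ 4 * Z))) * (1 - h ^ 2 * (Z * (h ^ 2 * Z))) *
        ((1 - h ^ 2 * (-h ^ 6 * Z * (-h ^ 4 * Z))) * (1 - h ^ 2 * (-h ^ 6 * Z * (h ^ 2 * Z))))) =
      -(h ^ 6 * Z ^ 4) * ((1 + h ^ 6) ^ 2 * (1 - h ^ 4) ^ 2 * ((1 + h ^ 6 * Z ^ 2) *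
        (1 - h ^ 4 * Z ^ 2) * (1 - h ^ 12 * Z ^ 2) * (1 + h ^ 10 * Z ^ 2))) := by ring
  rw [eY, eC, eD]
  have m4 := one (k := 4) (by norm_num)
  have m8 := one (k := 8) (by norm_num)
  have m12 := one (k := 12) (by norm_num)
  have p6 := one' (k := 6) (by norm_num)
  have p10 := one' (k := 10) (by norm_num)
  generalize (1 - (ε : ℂ) * Complex.I * h ^ 3 * Z) * (1 + (ε : ℂ) * Complex.I * h * Z) = E
  generalize 1 - h ^ 4 * Z ^ 2 = x4 at *
  generalize 1 - h ^ 8 * Z ^ 2 = x8 at *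
  generalize 1 - h ^ 12 * Z ^ 2 = x12 at *
  generalize 1 + h ^ 6 * Z ^ 2 = y6 at *
  generalize 1 + h ^ 10 * Z ^ 2 = y10 at *
  generalize 1 - h ^ 4 = k at *
  generalize 1 + h ^ 6 = l at *
  field_simp

/-- The transfer matrix identity on the unit circle. -/
theorem sum_twoPoint {r₁ r₂ : SignType → ℝ} (R : ∀ j, Radii h j 1 (‖h‖ ^ 6) (r₁ j) (r₂ j))
    (v : FockSpace) {Z : ℂ} (hZ : ‖Z‖ = 1) :
    gConst h * ∑ j, twoPoint h ε j v (r₁ j) (r₂ j) Z (-h ^ 6 * Z) = dualGroundState h ε v := by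
  have z0 := ne_zero_of_norm_eq one_pos hZ
  simp only [twoPoint]
  rw [← Finset.mul_sum, sum_avg_wKer h0 h1 R v hZ]
  have S := symKer_residue h0 h1 (ε := ε) v hZ
  have K := kappa_one_mul_kappa h0 h1
  have P := phi_mul_phi h0 h1 ε (z := -Z) (by rwa [norm_neg])
  have k2 : 1 + h ^ 2 ≠ 0 := one_add_ne_zero_of_norm_lt (by
    rw [norm_pow]; exact pow_lt_one₀ (norm_nonneg _) h1 (by norm_num))
  have k4 : 1 - h ^ 4 ≠ 0 := one_sub_ne_zero_of_norm_lt (by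
    rw [norm_pow]; exact pow_lt_one₀ (norm_nonneg _) h1 (by norm_num))
  have k6 : 1 + h ^ 6 ≠ 0 := one_add_ne_zero_of_norm_lt (by
    rw [norm_pow]; exact pow_lt_one₀ (norm_nonneg _) h1 (by norm_num))
  have m12 : 1 - h ^ 12 * Z ^ 2 ≠ 0 := one_sub_ne_zero_of_norm_lt (by
      rw [norm_mul, norm_pow, norm_pow, hZ, one_pow, mul_one]
      exact pow_lt_one₀ (norm_nonneg _) h1 (by norm_num))
  have w0 : -h ^ 6 * Z ^ 2 ≠ 0 := mul_ne_zero (neg_ne_zero.mpr (pow_ne_zero 6 h0)) (pow_ne_zero 2 z0)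
  have ez : Z ^ ((ε : ℤ) ^ 2 + 2) * (-h ^ 6 * Z) ^ ((ε : ℤ) ^ 2 + 1) =
      (-h ^ 6 * Z ^ 2) ^ ((ε : ℤ) ^ 2) * (-h ^ 6 * Z ^ 3) := by
    have w1 : -h ^ 6 * Z ≠ 0 := mul_ne_zero (neg_ne_zero.mpr (pow_ne_zero 6 h0)) z0
    rw [zpow_add₀ z0, zpow_add₀ w1, zpow_one, show -h ^ 6 * Z ^ 2 = Z * (-h ^ 6 * Z) by ring,
      mul_zpow Z]
    norm_cast
    ring
  rw [gConst_eq, preKer, ez, show -(-h ^ 6 * Z) = -(h ^ 6 * -Z) by ring,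
    show -h ^ 6 * Z * Z = -(h ^ 6 * (-Z) ^ 2) by ring, mul_div_cancel_right₀ _ z0]
  rw [zpow_neg] at S
  have pp := mul_inv_cancel₀ (zpow_ne_zero ((ε : ℤ) ^ 2) w0)
  rw [neg_sq] at P ⊢
  generalize (-h ^ 6 * Z ^ 2) ^ (ε : ℤ) ^ 2 = p at *
  generalize symKer h ε v Z (-h ^ 6 * Z) (-h ^ 4 * Z) (h ^ 2 * Z) = s at *
  generalize dualGroundState h ε v = B at *
  generalize kappa h 1 = κ₁ at *
  generalize kappa h (-h ^ 6) = κ₂ at *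
  generalize kappa h (-(h ^ 6 * Z ^ 2)) = κ₃ at *
  generalize phi h ε (-Z) = φ₁ at *
  generalize phi h ε (-(h ^ 6 * -Z)) = φ₂ at *
  have key : κ₁ / (1 + h ^ 2) * (φ₁ * φ₂ * (κ₃ * κ₂) * (1 - h ^ 4) * (p * (-h ^ 6 * Z ^ 3)) *
      ((1 + h ^ 2) * (1 + h ^ 6) * Z * s)) = -(κ₁ * κ₂) * (φ₁ * φ₂ * κ₃) * p * (1 - h ^ 4) *
        (1 + h ^ 6) * (s * (h ^ 6 * Z ^ 4)) := by field_simp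
  rw [key, K]
  -- The factor `1 - q⁶Z²` appears both in the residue and in `phi_mul_phi`; it is kept on both
  -- sides and cancelled at the end.
  have big : (1 - h ^ 12 * Z ^ 2) * ((1 - h ^ 4) ^ 2 * (1 + h ^ 6) ^ 2 * (s * (h ^ 6 * Z ^ 4)) *
      (-(φ₁ * φ₂ * κ₃) * p)) = (1 - h ^ 12 * Z ^ 2) * B := by
    linear_combination (-(φ₁ * φ₂ * κ₃) * p) * S + B * P +
      (B * (φ₁ * φ₂ * κ₃) * ((1 - (ε : ℂ) * Complex.I * h ^ 3 * Z) *
        (1 + (ε : ℂ) * Complex.I * h * Z))) * pp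
  linear_combination mul_left_cancel₀ m12 big

end

end IzerginKorepin

namespace IzerginKorepin
open Metric Set Filter Topology

/-! ### Continuation to the annulus -/

theorem isPreconnected_norm_Ioo {a b : ℝ} (ha : 0 ≤ a) :
    IsPreconnected {z : ℂ | a < ‖z‖ ∧ ‖z‖ < b} := by
  have e : {z : ℂ | a < ‖z‖ ∧ ‖z‖ < b} =
      (fun x : ℝ × ℝ => (x.1 : ℂ) * Complex.exp (x.2 * Complex.I)) '' (Ioo a b ×ˢ univ) := by
    ext z
    constructor
    · rintro ⟨h1, h2⟩
      exact ⟨(‖z‖, z.arg), ⟨⟨h1, h2⟩, trivial⟩, Complex.norm_mul_exp_arg_mul_I z⟩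
    · rintro ⟨⟨r, θ⟩, ⟨⟨h1, h2⟩, -⟩, rfl⟩
      have : ‖(r : ℂ) * Complex.exp (θ * Complex.I)‖ = r := by
        rw [norm_mul, Complex.norm_exp_ofReal_mul_I, mul_one,
          Complex.norm_of_nonneg (ha.trans h1.le)]
      exact ⟨by rwa [this], by rwa [this]⟩
  rw [e]
  exact (isPreconnected_Ioo.prod isPreconnected_univ).image _ (by fun_prop)

theorem isOpen_norm_Ioo (a b : ℝ) : IsOpen {z : ℂ | a < ‖z‖ ∧ ‖z‖ < b} :=
  (isOpen_lt continuous_const continuous_norm).inter (isOpen_lt continuous_norm continuous_const)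

/-- The identity theorem for functions that agree on the unit circle. -/
theorem eqOn_of_eq_on_circle {a b : ℝ} (ha : 0 ≤ a) (ha1 : a < 1) (hb : 1 < b) {F G : ℂ → ℂ}
    (hF : DifferentiableOn ℂ F {z | a < ‖z‖ ∧ ‖z‖ < b})
    (hG : DifferentiableOn ℂ G {z | a < ‖z‖ ∧ ‖z‖ < b}) (h : ∀ z, ‖z‖ = 1 → F z = G z) :
    EqOn F G {z | a < ‖z‖ ∧ ‖z‖ < b} := by
  have ho := isOpen_norm_Ioo a b
  refine (hF.analyticOnNhd ho).eqOn_of_preconnected_of_frequently_eq (hG.analyticOnNhd ho)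
    (isPreconnected_norm_Ioo ha) (z₀ := 1) (by simpa using ⟨ha1, hb⟩) ?_
  -- The curve `e^{it}` has nonzero derivative at `t = 0`, hence avoids `1` for small `t ≠ 0`: the
  -- points of the circle accumulate at `1`.
  have hd : HasDerivAt (fun t : ℝ => Complex.exp (t * Complex.I)) Complex.I 0 := by
    have := (((hasDerivAt_id (0 : ℝ)).ofReal_comp).mul_const Complex.I).cexp
    simpa using this
  have ht := hd.tendsto_nhdsNE Complex.I_ne_zero
  simp only [Complex.ofReal_zero, zero_mul, Complex.exp_zero] at ht
  exact ht.frequently (Eventually.frequently (Eventually.of_forall fun t =>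
    h _ (Complex.norm_exp_ofReal_mul_I t)))

theorem zpow_le_add {a b t : ℝ} (ha : 0 < a) (hat : a ≤ t) (htb : t ≤ b) (n : ℤ) :
    t ^ n ≤ a ^ n + b ^ n := by
  have ht := ha.trans_le hat
  have hb := ht.trans_le htb
  rcases le_total 0 n with hn | hn
  · exact (zpow_le_zpow_left₀ hn ht.le htb).trans (le_add_of_nonneg_left (by positivity))
  · refine le_trans ?_ (le_add_of_nonneg_right (by positivity))
    obtain ⟨m, rfl⟩ : ∃ m : ℕ, n = -m := ⟨n.natAbs, by omega⟩
    rw [zpow_neg, zpow_neg, zpow_natCast, zpow_natCast]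
    gcongr

/-- Along the line `(uz, wz)` each term is a monomial of degree `p.1 + p.2`. On a smaller annulus it
is dominated by the sum of its values at the two boundary radii, by `zpow_le_add`. -/
theorem differentiableOn_laurent {c : ℤ → ℤ → ℂ} {A B σ : ℝ} (hA : 0 ≤ A) {u w : ℂ} (hu : ‖u‖ = 1)
    (hw : ‖w‖ = σ) (hσ : 0 < σ) (H : ∀ ρ, A < ρ → ρ < B → AbsAt c ρ (σ * ρ)) :
    DifferentiableOn ℂ (fun z => ∑' p : ℤ × ℤ, c p.1 p.2 * ((u * z) ^ p.1 * (w * z) ^ p.2))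
      {z | A < ‖z‖ ∧ ‖z‖ < B} := by
  intro z₀ hz₀
  obtain ⟨a, ha1, ha2⟩ := exists_between hz₀.1
  obtain ⟨b, hb1, hb2⟩ := exists_between hz₀.2
  have a0 : 0 < a := hA.trans_lt ha1
  have u0 := ne_zero_of_norm_eq one_pos hu
  have w0 := ne_zero_of_norm_eq hσ hw
  have key := Complex.differentiableOn_tsum_of_summable_norm (F := fun (p : ℤ × ℤ) z =>
    c p.1 p.2 * ((u * z) ^ p.1 * (w * z) ^ p.2)) (U := {z | a < ‖z‖ ∧ ‖z‖ < b})
    ((H a ha1 ((ha2.trans hb1).trans hb2)).add (H b (ha1.trans (ha2.trans hb1)) hb2)) ?_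
    (isOpen_norm_Ioo a b) ?_
  · exact (key.differentiableAt ((isOpen_norm_Ioo a b).mem_nhds ⟨ha2, hb1⟩)).differentiableWithinAt
  · intro p z hz
    have z0 : z ≠ 0 := norm_pos_iff.mp (a0.trans hz.1)
    have e1 := differentiableAt_zpow_comp (f := fun z : ℂ => u * z) (x := z) (by fun_prop)
      (mul_ne_zero u0 z0) p.1
    have e2 := differentiableAt_zpow_comp (f := fun z : ℂ => w * z) (x := z) (by fun_prop)
      (mul_ne_zero w0 z0) p.2
    exact ((e1.fun_mul e2).const_mul _).differentiableWithinAt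
  · intro p z hz
    have z0 : 0 < ‖z‖ := a0.trans hz.1
    have b0 : 0 < b := z0.trans hz.2
    have := zpow_le_add a0 hz.1.le hz.2.le (p.1 + p.2)
    rw [zpow_add₀ z0.ne', zpow_add₀ a0.ne', zpow_add₀ b0.ne'] at this
    rw [norm_mul, norm_mul, norm_zpow, norm_zpow, norm_mul, norm_mul, hu, hw, one_mul, mul_zpow,
      mul_zpow, mul_zpow]
    calc _ = ‖c p.1 p.2‖ * σ ^ p.2 * (‖z‖ ^ p.1 * ‖z‖ ^ p.2) := by ring
      _ ≤ ‖c p.1 p.2‖ * σ ^ p.2 * (a ^ p.1 * a ^ p.2 + b ^ p.1 * b ^ p.2) := by gcongr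
      _ = _ := by ring

section
variable {h : ℂ} (h0 : h ≠ 0) (h1 : ‖h‖ < 1) {ε : SignType}

theorem annulus_eq (h : ℂ) : annulus h = {z | ‖h‖ ^ 4 < ‖z‖ ∧ ‖z‖ < (‖h‖ ^ 4)⁻¹} := by
  simp only [annulus, norm_inv, norm_pow, ← pow_mul]

include h0

/-- The symmetry of the coefficients makes the set of admissible `ρ₁` invariant under inversion, so
the range up to `1/|h|` extends to the range up to `1/|h|⁴`. -/
theorem absAt_of_reflect {c : ℤ → ℤ → ℂ} {s : ℤ}
    (habs : ∀ ρ₁ ρ₂, ‖h‖ ^ 4 < ρ₁ → ‖h‖ * ρ₁ < 1 → 0 < ρ₂ → ρ₂ < ‖h‖ ^ 2 → AbsAt c ρ₁ ρ₂)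
    (hc : ∀ k l, c (s - k) l = c k l) (h1 : ‖h‖ < 1) {ρ₁ ρ₂ : ℝ} (a₁ : ‖h‖ ^ 4 < ρ₁)
    (b₁ : ρ₁ < (‖h‖ ^ 4)⁻¹) (a₂ : 0 < ρ₂) (b₂ : ρ₂ < ‖h‖ ^ 2) : AbsAt c ρ₁ ρ₂ := by
  have hp : 0 < ‖h‖ := norm_pos_iff.mpr h0
  have hρ : 0 < ρ₁ := (by positivity : 0 < ‖h‖ ^ 4).trans a₁
  rcases lt_or_ge (‖h‖ * ρ₁) 1 with hlt | hge
  · exact habs ρ₁ ρ₂ a₁ hlt a₂ b₂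
  · refine AbsAt.reflect hc hρ (habs _ _ ?_ ?_ a₂ b₂)
    · rwa [lt_inv_comm₀ (by positivity) hρ]
    · rw [← div_eq_mul_inv, div_lt_one hρ]
      nlinarith

theorem norm_inv_mem {z : ℂ} (hz : z ∈ annulus h) : z ≠ 0 ∧ ‖h‖ ^ 4 < ‖z⁻¹‖ ∧
    ‖z⁻¹‖ < (‖h‖ ^ 4)⁻¹ ∧ 0 < ‖h ^ 6 * z‖ ∧ ‖h ^ 6 * z‖ < ‖h‖ ^ 2 := by
  have hp : 0 < ‖h‖ := norm_pos_iff.mpr h0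
  rw [annulus_eq] at hz
  have h4 : 0 < ‖h‖ ^ 4 := by positivity
  have zp : 0 < ‖z‖ := h4.trans hz.1
  have z0 := norm_pos_iff.mp zp
  refine ⟨z0, ?_, ?_, norm_pos_iff.mpr (mul_ne_zero (pow_ne_zero _ h0) z0), ?_⟩
  · rw [norm_inv, lt_inv_comm₀ h4 zp]; exact hz.2
  · rw [norm_inv, inv_lt_inv₀ zp h4]; exact hz.1
  · rw [norm_mul, norm_pow, show ‖h‖ ^ 2 = ‖h‖ ^ 6 * (‖h‖ ^ 4)⁻¹ by field_simp]
    exact mul_lt_mul_of_pos_left hz.2 (by positivity)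

/-- The reason for the form of the `K`-matrix: the quotient of `φ` functions exchanges the boundary
factors at `Z₁ = -1/z` and `-z`, and the diagonal entries compensate the monomial of the reflection
and, for the component `0`, the two values of `cutoff`. -/
theorem kMatrix_mul_poleFactor {z : ℂ} (hz : IsRegularPoint h ε z) (hn : phiNum h ε z⁻¹ ≠ 0)
    (j : SignType) : kMatrix h ε z j j * (poleFactor h ε j (-z⁻¹) * (-z) ^ (-reflDeg ε j)) =
      poleFactor h ε j (-z) := by
  obtain ⟨z0, d1, d2, hr⟩ := hz
  have p0 : phi h ε z⁻¹ ≠ 0 := div_ne_zero hn d2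
  simp only [kMatrix, Matrix.smul_apply, Matrix.diagonal_apply_eq, smul_eq_mul, poleFactor, neg_neg]
  generalize phi h ε z⁻¹ = p at *
  generalize phi h ε z = p'
  by_cases hε : ε = 0
  · subst hε
    have e1 : ∀ Z, cutoff h 0 j Z = 1 := fun Z => by unfold cutoff; split_ifs <;> simp
    have e2 : reflDeg 0 j = 0 := by unfold reflDeg; split_ifs <;> simp
    rw [e1, e1, e2, if_pos rfl, neg_zero, zpow_zero]
    field_simp
  · have e2 : (ε : ℤ) ^ 2 = 1 := by cases ε <;> simp_all
    have hr := hr hε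
    have z2 : (-z) ^ (-(2 * 1) : ℤ) = (z ^ 2)⁻¹ := by
      rw [mul_one, zpow_neg]; norm_cast; rw [neg_sq]
    rw [if_neg hε]
    cases j
    · rw [show ∀ Z, cutoff h ε .zero Z = 1 - (ε : ℂ) * Complex.I * h ^ 3 * Z from fun _ => rfl,
        show cutoff h ε .zero (-z) = 1 - (ε : ℂ) * Complex.I * h ^ 3 * -z from rfl,
        show reflDeg ε .zero = 2 * (ε : ℤ) ^ 2 from rfl, e2, z2]
      generalize (ε : ℂ) * Complex.I * h ^ 3 = e at *
      have c1 : 1 - e * -z⁻¹ = (e + z) / z := by field_simp; ring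
      have c2 : 1 - e * -z = (e + z⁻¹) * z := by field_simp; ring
      rw [c1, c2]
      obtain ⟨r1, r2⟩ := hr
      dsimp only
      generalize e + z⁻¹ = x at *
      generalize e + z = y at *
      field_simp
    · rw [show ∀ Z, cutoff h ε .neg Z = 1 from fun _ => rfl, show cutoff h ε .neg (-z) = 1 from rfl,
        show reflDeg ε .neg = 0 from rfl, neg_zero, zpow_zero]
      field_simp
    · rw [show ∀ Z, cutoff h ε .pos Z = 1 from fun _ => rfl, show cutoff h ε .pos (-z) = 1 from rfl,
        show reflDeg ε .pos = 2 * (ε : ℤ) ^ 2 from rfl, e2, z2]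
      dsimp only
      field_simp

include h1

/-- The identity of the transfer matrix, continued from the unit circle to the annulus. -/
theorem sum_poleFactor_mul (v : FockSpace) {D : SignType → ℂ → ℂ}
    (hD : ∀ j, DifferentiableOn ℂ (D j) (annulus h))
    (hD1 : ∀ j r₁ r₂ z, Radii h j 1 (‖h‖ ^ 6) r₁ r₂ → ‖z‖ = 1 →
      D j z = coreFun h ε j v r₁ r₂ (-z) (h ^ 6 * z)) {z : ℂ} (hz : z ∈ annulus h)
    (hd : phiDen h ε z ≠ 0) (hc : cutoff h ε 0 (-z) ≠ 0) :
    gConst h * ∑ j, poleFactor h ε j (-z) * D j z = dualGroundState h ε v := by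
  have hp : 0 < ‖h‖ := norm_pos_iff.mpr h0
  have h41 : ‖h‖ ^ 4 < 1 := pow_lt_one₀ hp.le h1 (by norm_num)
  have e1 : ∀ z, cutoff h ε 1 z = 1 := fun _ => rfl
  have e2 : ∀ z, cutoff h ε (-1) z = 1 := fun _ => rfl
  -- Clearing denominators makes both sides of the identity holomorphic on the whole annulus, poles
  -- included, so the identity theorem applies directly.
  have expand : ∀ {z}, phiDen h ε z ≠ 0 → cutoff h ε 0 (-z) ≠ 0 →
      (∑ j, poleFactor h ε j (-z) * D j z) * (phiDen h ε z * cutoff h ε 0 (-z)) =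
        phiNum h ε z * (D (-1) z * cutoff h ε 0 (-z) + D 0 z + D 1 z * cutoff h ε 0 (-z)) :=
    fun {z} hd hc => by
      rw [sum_signType]
      simp only [poleFactor, neg_neg, e1, e2, phi]
      field_simp
  have key := eqOn_of_eq_on_circle (a := ‖h‖ ^ 4) (b := (‖h‖ ^ 4)⁻¹)
    (F := fun z => gConst h * (phiNum h ε z *
      (D (-1) z * cutoff h ε 0 (-z) + D 0 z + D 1 z * cutoff h ε 0 (-z))))
    (G := fun z => dualGroundState h ε v * (phiDen h ε z * cutoff h ε 0 (-z)))
    (by positivity) h41 ((one_lt_inv₀ (by positivity)).mpr h41) ?_ ?_ ?_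
  · rw [annulus_eq] at hz
    have := key hz
    simp only at this
    rw [← expand hd hc, ← mul_assoc] at this
    exact mul_right_cancel₀ (mul_ne_zero hd hc) this
  · rw [← annulus_eq]
    have dc : DifferentiableOn ℂ (fun z => cutoff h ε 0 (-z)) (annulus h) :=
      ((differentiable_cutoff h0 h1 ε 0).comp differentiable_neg).differentiableOn
    exact (((differentiable_phiNum h0 h1 ε).differentiableOn).fun_mul
      ((((hD (-1)).fun_mul dc).fun_add (hD 0)).fun_add ((hD 1).fun_mul dc))).const_mul _
  · exact (((differentiable_phiDen h0 h1 ε).fun_mul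
      ((differentiable_cutoff h0 h1 ε 0).comp differentiable_neg)).const_mul _).differentiableOn
  · intro z hz
    have hlt : ‖h * -z‖ < 1 := by rwa [norm_mul, norm_neg, hz, mul_one]
    have hd : phiDen h ε z ≠ 0 := phiDen_ne_zero h0 h1 ε (by rwa [mul_neg, norm_neg] at hlt)
    have hc : cutoff h ε 0 (-z) ≠ 0 := cutoff_ne_zero h0 h1 hlt
    choose r₁ r₂ R using fun j => exists_radii h0 h1 j (ρ₁ := 1) (ρ₂ := ‖h‖ ^ 6) h41
      (by rwa [mul_one]) (by positivity) (norm_pow_lt_pow h0 h1 (by norm_num))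
    have := sum_twoPoint h0 h1 R (ε := ε) v (Z := -z) (by rwa [norm_neg])
    simp only [twoPoint_eq h0 h1 v hlt, show -h ^ 6 * -z = h ^ 6 * z by ring] at this
    rw [← expand hd hc, ← mul_assoc, ← this]
    congr 2
    exact Finset.sum_congr rfl fun j _ => by rw [hD1 j _ _ z (R j) hz]

theorem hasSum_matrixElement {j : SignType} {v : FockSpace} {z S : ℂ}
    (H : HasSum (fun p : ℤ × ℤ => modeCoeff h ε j v p.1 p.2 * ((-z⁻¹) ^ p.1 * (h ^ 6 * z) ^ p.2)) S) :
    HasSum (fun p : ℤ × ℤ => dualGroundState h ε (vertexDual h j p.2 (vertex h j p.1 v)) *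
      z⁻¹ ^ p.2 * z ^ p.1) S := by
  rw [← (Equiv.prodComm ℤ ℤ).hasSum_iff] at H
  refine H.congr_fun fun p => ?_
  simp only [Function.comp, Equiv.prodComm_apply, Prod.fst_swap, Prod.snd_swap]
  rw [dualGroundState_eq_modeCoeff h0 v, mul_zpow, neg_eq_neg_one_mul z⁻¹, mul_zpow]
  ring

theorem transferMatrix_dualGroundState (v : FockSpace) : ∃ M : SignType → ℂ → ℂ,
    (∀ j, ∀ z ∈ convergenceAnnulus h ε, HasSum (fun p : ℤ × ℤ =>
      dualGroundState h ε (vertexDual h j p.2 (vertex h j p.1 v)) * z⁻¹ ^ p.2 * z ^ p.1) (M j z)) ∧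
    (∀ j, MeromorphicOn (M j) (annulus h)) ∧
    (∀ j, DifferentiableOn ℂ (M j) {z ∈ annulus h | IsRegularPoint h ε z}) ∧
    ∀ z ∈ annulus h, IsRegularPoint h ε z →
      gConst h * ∑ j, kMatrix h ε z j j * M j z = dualGroundState h ε v := by
  have hp : 0 < ‖h‖ := norm_pos_iff.mpr h0
  choose c habs hrefl hcore hmode using fun j => exists_quotient h0 h1 (ε := ε) j v
  have hao : IsOpen (annulus h) := by rw [annulus_eq]; exact isOpen_norm_Ioo _ _
  -- The quotient series evaluated at the reflected point `Z₁ = -z` instead of `-1/z`; there it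
  -- meets the unit circle identity at `Z₂ = -q³ Z₁`.
  set D : SignType → ℂ → ℂ := fun j z =>
    ∑' p : ℤ × ℤ, c j p.1 p.2 * ((-1 * z) ^ p.1 * (h ^ 6 * z) ^ p.2) with hDdef
  have hD : ∀ j, DifferentiableOn ℂ (D j) (annulus h) := fun j => by
    rw [annulus_eq]
    refine differentiableOn_laurent (σ := ‖h‖ ^ 6) (by positivity) (by simp) (norm_pow h 6)
      (by positivity) fun ρ h2 h3 => ?_
    refine absAt_of_reflect h0 (habs j) (hrefl j) h1 h2 h3 (mul_pos (by positivity)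
      ((by positivity : 0 < ‖h‖ ^ 4).trans h2)) ?_
    rw [show ‖h‖ ^ 2 = ‖h‖ ^ 6 * (‖h‖ ^ 4)⁻¹ by field_simp]
    exact mul_lt_mul_of_pos_left h3 (by positivity)
  have hM : ∀ j {z : ℂ}, z ≠ 0 → (-z) ^ (-reflDeg ε j) * D j z =
      ∑' p : ℤ × ℤ, c j p.1 p.2 * ((-z⁻¹) ^ p.1 * (h ^ 6 * z) ^ p.2) := fun j z hz => by
    rw [← inv_neg, tsum_reflect (hrefl j) (neg_ne_zero.mpr hz)]
    simp only [hDdef, neg_one_mul]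
  -- By `hM` the second factor is the quotient series at `Z₁ = -1/z`, holomorphic on the annulus. So
  -- every singularity of the continued matrix element comes from `poleFactor`.
  refine ⟨fun j z => poleFactor h ε j (-z⁻¹) * ((-z) ^ (-reflDeg ε j) * D j z), ?_, ?_, ?_, ?_⟩
  · intro j z hz
    obtain ⟨z0, n1, n2, n3, n4⟩ := norm_inv_mem h0 hz.1
    dsimp only
    rw [hM j z0]
    refine hasSum_matrixElement h0 h1 (hmode j _ _ (neg_ne_zero.mpr (inv_ne_zero z0)) ?_ ?_)
    -- The domain of convergence of the modes is where `-1/z` lies in the disc of holomorphy of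
    -- `poleFactor`: no restriction on the annulus for `ε = 0`, and `|h| < |z|` for `ε = ±`.
    · rw [norm_neg, poleRadius]
      split_ifs with hε
      · exact n2
      · rw [norm_inv, inv_lt_inv₀ (norm_pos_iff.mpr z0) hp]
        exact hz.2 hε
    · rw [norm_neg]
      exact absAt_of_reflect h0 (habs j) (hrefl j) h1 n1 n2 n3 n4
  · intro j z hz
    obtain ⟨z0, -⟩ := norm_inv_mem h0 hz
    have ai : AnalyticAt ℂ (fun z : ℂ => z⁻¹) z := analyticAt_inv z0
    have an : AnalyticAt ℂ (fun z : ℂ => -z⁻¹) z := ai.neg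
    have a1 := ((differentiable_phiNum h0 h1 ε).analyticAt _).fun_comp ai
    have a2 := ((differentiable_phiDen h0 h1 ε).analyticAt _).fun_comp ai
    have a3 := ((differentiable_cutoff h0 h1 ε j).analyticAt _).fun_comp an
    have a4 : AnalyticAt ℂ (fun z : ℂ => -z) z := analyticAt_id.neg
    have a5 := (hD j).analyticAt (hao.mem_nhds hz)
    have := (((a1.meromorphicAt.div a2.meromorphicAt).div a3.meromorphicAt).mul
      ((a4.meromorphicAt.zpow (-reflDeg ε j)).mul a5.meromorphicAt))
    refine this.congr (Eventually.of_forall fun w => ?_)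
    simp [poleFactor, phi]
  · rintro j z ⟨hz, z0, d1, d2, hr⟩
    have dD := (hD j).differentiableAt (hao.mem_nhds hz)
    have di : DifferentiableAt ℂ (fun z : ℂ => z⁻¹) z := differentiableAt_inv z0
    have dn : DifferentiableAt ℂ (fun z : ℂ => -z⁻¹) z := di.fun_neg
    have dphi : DifferentiableAt ℂ (fun z : ℂ => phi h ε (- -z⁻¹)) z := by
      simp only [neg_neg]
      exact (differentiableAt_phi h0 h1 ε d2).comp z di
    have dc : DifferentiableAt ℂ (fun z : ℂ => cutoff h ε j (-z⁻¹)) z :=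
      (differentiable_cutoff h0 h1 ε j _).comp z dn
    have dz := differentiableAt_zpow_comp (f := fun z : ℂ => -z) (x := z) (by fun_prop)
      (neg_ne_zero.mpr z0) (-reflDeg ε j)
    refine ((differentiableAt_div dphi dc ?_).fun_mul (dz.fun_mul dD)).differentiableWithinAt
    unfold cutoff
    split_ifs
    · by_cases hε : ε = 0
      · simp [hε]
      · intro e
        refine (hr hε).1 ?_
        have : z * (1 - (ε : ℂ) * Complex.I * h ^ 3 * -z⁻¹) = 0 := by rw [e, mul_zero]
        rw [← this]
        field_simp
        ring
    · exact one_ne_zero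
  · intro z hz hreg
    obtain ⟨z0, n1, n2, n3, n4⟩ := norm_inv_mem h0 hz
    have hn : phiNum h ε z⁻¹ ≠ 0 := phiNum_ne_zero h0 h1 (by
      rw [norm_mul, norm_pow]
      calc ‖h‖ ^ 7 * ‖z⁻¹‖ < ‖h‖ ^ 7 * (‖h‖ ^ 4)⁻¹ := by gcongr
        _ = ‖h‖ ^ 3 := by field_simp
        _ < 1 := pow_lt_one₀ hp.le h1 (by norm_num))
    have e : ∀ j, kMatrix h ε z j j * (poleFactor h ε j (-z⁻¹) * ((-z) ^ (-reflDeg ε j) * D j z)) =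
        poleFactor h ε j (-z) * D j z := fun j => by
      rw [← kMatrix_mul_poleFactor h0 hreg hn j]; ring
    simp only [e]
    refine sum_poleFactor_mul h0 h1 v hD (fun j r₁ r₂ z R hz => ?_) hz hreg.2.1 ?_
    · have := (hcore j r₁ r₂ (-z) (h ^ 6 * z) R (by rwa [norm_neg])
        (by rw [norm_mul, hz, mul_one, norm_pow])).tsum_eq
      rw [← this]
      simp only [hDdef, neg_one_mul]
    · rw [show cutoff h ε 0 (-z) = 1 - (ε : ℂ) * Complex.I * h ^ 3 * -z from rfl]
      by_cases hε : ε = 0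
      · simp [hε]
      · intro e
        refine (hreg.2.2.2 hε).2 ?_
        have : z⁻¹ * (1 - (ε : ℂ) * Complex.I * h ^ 3 * -z) = 0 := by rw [e, mul_zero]
        rw [← this]
        field_simp
        ring

end

end IzerginKorepin

end

theorem mainTheorem2 (s : ℝ) (hs : -1 < s) (hs0 : s < 0) (ε : SignType) :
    IsLinearMap ℂ (dualGroundState (s : ℂ) ε) ∧
    ∀ v : FockSpace, ∃ M : SignType → ℂ → ℂ,
      -- `M j z` is the matrix element of `Φ_j^*(z⁻¹) Φ_j(z)` between the dual ground state and `v`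
      (∀ j, ∀ z ∈ convergenceAnnulus (s : ℂ) ε,
        HasSum (fun p : ℤ × ℤ =>
          dualGroundState (s : ℂ) ε (vertexDual (s : ℂ) j p.2 (vertex (s : ℂ) j p.1 v)) *
            z⁻¹ ^ p.2 * z ^ p.1) (M j z)) ∧
      -- continued meromorphically to the whole annulus
      (∀ j, MeromorphicOn (M j) (annulus (s : ℂ))) ∧
      (∀ j, DifferentiableOn ℂ (M j) {z ∈ annulus (s : ℂ) | IsRegularPoint (s : ℂ) ε z}) ∧
      -- the matrix element of `T_ε(z)` equals the value of the dual ground state at `v`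
      ∀ z ∈ annulus (s : ℂ), IsRegularPoint (s : ℂ) ε z →
        gConst (s : ℂ) * ∑ j : SignType, kMatrix (s : ℂ) ε z j j * M j z =
          dualGroundState (s : ℂ) ε v := by
  have h0 : (s : ℂ) ≠ 0 := Complex.ofReal_ne_zero.mpr hs0.ne
  -- The sign and the reality of `q^{1/2}` play no further role: only `h ≠ 0` and `‖h‖ < 1` enter.
  have h1 : ‖(s : ℂ)‖ < 1 := by
    rw [Complex.norm_real, Real.norm_eq_abs, abs_lt]
    exact ⟨hs, hs0.trans one_pos⟩
  exact ⟨isLinearMap_dualGroundState _ ε, transferMatrix_dualGroundState h0 h1⟩
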